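/- **Setting.** Let $m_e,m_Z>0$, $g_V'\in\mathbb R$, let $f\in C_0^\infty([0,\infty))$ be real valued, and put $\omega(p)=(m_e^2+p^2)^{1/2}$, $\omega_3(k)=(|k|^2+m_Z^2)^{1/2}$. Let $\Gamma$ be the set of triples $\gamma=(j,m_j,\kappa_j)$ with $j\in\mathbb N+\tfrac12$ (that is, $j=\tfrac12,\tfrac32,\dots$), $m_j\in\{-j,\dots,j\}$, $\kappa_j\in\{\pm(j+\tfrac12)\}$, and put $\gamma_j=|\kappa_j|=j+\tfrac12$. Let $\Sigma=\mathbb R_+\times\Gamma\ni\xi=(p,\gamma)$ with $\int d\xi=\sum_\gamma\int_{\mathbb R_+}dp$, and $\Sigma_3=\mathbb R^3\times\{-1,0,1\}\ni\xi_3=(k,\lambda)$ with $\int d\xi_3=\sum_\lambda\int_{\mathbb R^3} dk$. Let $\mathcal H=\mathfrak F_a(L^2(\Sigma))\otimes\mathfrak F_a(L^2(\Sigma))\otimes\mathfrak F_s(L^2(\Sigma_3))$ (electrons, positrons, $Z^0$ bosons; $\mathfrak F_a,\mathfrak F_s$ are the antisymmetric and symmetric Fock spaces), with annihilation operators $b_+(\xi)=b(\xi)\otimes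 1\otimes1$, $b_-(\xi)=(-1)^{N}\otimes b(\xi)\otimes1$, $a(\xi_3)$ and their adjoints, $N$ being the number operator of the first factor. The free Hamiltonian $$H_0=\int\omega(p)\,b_+^*(\xi)b_+(\xi)\,d\xi+\int\omega(p)\,b_-^*(\xi)b_-(\xi)\,d\xi+\int\omega_3(k)\,a^*(\xi_3)a(\xi_3)\,d\xi_3$$ is the self-adjoint operator of multiplication by the total energy in each particle-number sector. **Eigenfunctions.** Let $\psi_\pm(\xi,x)\in\mathbb C^4$ be the generalized eigenfunctions, with eigenvalues $\pm\omega(p)$, of the free Dirac operator of mass $m_e$ in the standard representation: for $r=|x|$, $$\psi_\pm=\begin{pmatrix} i\,g_{\kappa_j,\pm}(p,r)\,\Phi_{m_j,\kappa_j}\\ -f_{\kappa_j,\pm}(p,r)\,\Phi_{m_j,-\kappa_j}\end{pmatrix},$$ $$g_{\kappa_j,\pm}=\frac{C_1^\pm}{\omega(p)^{1/2}}\,\frac{(2pr)^{\gamma_j}}{r}\,\frac1{2\sqrt\pi}\,\frac{\Gamma(\gamma_j)}{\Gamma(2\gamma_j+1)}\,(Z+\overline Z),\qquad f_{\kappa_j,\pm}=\frac{i\,C_2^\pm}{\omega(p)^{1/2}}\,\frac{(2pr)^{\gamma_j}}{r}\,\frac1{2\sqrt\pi}\,\frac{\Gamma(\gamma_j)}{\Gamma(2\gamma_j+1)}\,(Z-\overline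 Z),$$ where $Z=e^{-ipr}e^{i\eta_j}\gamma_j\,{}_1F_1(\gamma_j+1,2\gamma_j+1,2ipr)$, $\eta_j=\pi/2$ if $\kappa_j>0$ and $\eta_j=0$ if $\kappa_j<0$, $C_1^\pm=\sqrt{\omega(p)\pm m_e}$, $C_2^\pm=\pm\sqrt{\omega(p)\mp m_e}$. With orthonormal spherical harmonics $Y_{l,m}$ (Condon–Shortley phases, $Y_{l,m}=0$ for $|m|>l$), for $\kappa=\pm(j+\frac12)$, $$\Phi_{m_j,j+\frac12}=\begin{pmatrix}-\sqrt{\tfrac{j-m_j+1}{2j+2}}\,Y_{j+\frac12,m_j-\frac12}\\ \sqrt{\tfrac{j+m_j+1}{2j+2}}\,Y_{j+\frac12,m_j+\frac12}\end{pmatrix},\qquad \Phi_{m_j,-(j+\frac12)}=\begin{pmatrix}\sqrt{\tfrac{j+m_j}{2j}}\,Y_{j-\frac12,m_j-\frac12}\\ \sqrt{\tfrac{j-m_j}{2j}}\,Y_{j-\frac12,m_j+\frac12}\end{pmatrix}.$$ Put $\tilde\psi_-((p,(j,m_j,\kappa_j)),x)=\psi_-((p,(j,-m_j,-\kappa_j)),x)$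 and $\overline\psi=\psi^\dagger\gamma^0$. **Interaction.** Let $\gamma^\mu$, $\gamma_5$ be the Dirac matrices in the standard representation, and $\epsilon_\mu(\xi_3)$ the covariant components (signature $+---$) of the polarization vectors of a massive spin-one boson, i.e. of $\epsilon^0=k\cdot e_\lambda/m_Z$, $\vec\epsilon=e_\lambda+\frac{(k\cdot e_\lambda)\,k}{m_Z(\omega_3(k)+m_Z)}$ with $e_0=(0,0,1)$, $e_{\pm1}=\mp\frac1{\sqrt2}(1,\pm i,0)$. Let $C_{m_Z}$ be a constant with $$\Big|\frac{\epsilon_\mu(\xi_3)}{\sqrt{2\omega_3(k)}}\Big|\le C_{m_Z}(1+|k|^2)^{1/4}\quad\text{for all }\mu,\xi_3,$$ and $C_Z=156\,C_{m_Z}$. For measurable kernels $G^{(1)},G^{(2)}:\Sigma\times\Sigma\times\Sigma_3\to\mathbb C$ let $F^{(\alpha)}=h^{(\alpha)}G^{(\alpha)}$, where $$h^{(1)}=\int_{\mathbb R^3} f(|x|)\,\overline{\psi_+(\xi_1,x)}\,\gamma^\mu(g_V'-\gamma_5)\,\tilde\psi_-(\xi_2,x)\,\frac{\epsilon_\mu(\xi_3)}{\sqrt{2\omega_3(k)}}\,e^{ik\cdot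 x}\,dx,$$ $h^{(2)}$ is the same with $\epsilon_\mu^*$ and $e^{-ik\cdot x}$ instead of $\epsilon_\mu$ and $e^{ik\cdot x}$, and let $$H_I=H_I^{(1)}+(H_I^{(1)})^*+H_I^{(2)}+(H_I^{(2)})^*,$$ $$H_I^{(1)}=\int F^{(1)}b_+^*(\xi_1)b_-^*(\xi_2)a(\xi_3)\,d\xi_1d\xi_2d\xi_3,\qquad (H_I^{(1)})^*=\int \overline{F^{(1)}}\,a^*(\xi_3)b_-(\xi_2)b_+(\xi_1)\,d\xi_1d\xi_2d\xi_3,$$ $$H_I^{(2)}=\int F^{(2)}b_+^*(\xi_1)b_-^*(\xi_2)a^*(\xi_3)\,d\xi_1d\xi_2d\xi_3,\qquad (H_I^{(2)})^*=\int \overline{F^{(2)}}\,a(\xi_3)b_-(\xi_2)b_+(\xi_1)\,d\xi_1d\xi_2d\xi_3,$$ each of the four terms being given by its explicit action in the particle-number sectors on its natural maximal domain in $\mathcal H$. Finally, with Euler's Gamma function, let $$A(p,\gamma)=\frac{(2p)^{\gamma_j+1}}{\Gamma(\gamma_j)}\Big(\frac{\omega(p)+m_e}{\omega(p)}\Big)^{1/2}\Big(\int_0^\infty|f(r)|\,r^{2\gamma_j}(1+r^2)\,dr\Big)^{1/2},$$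 $$K_1(G^{(\alpha)})^2=C_Z^2\int A(\xi_1)^2A(\xi_2)^2\,|G^{(\alpha)}(\xi_1,\xi_2,\xi_3)|^2\,d\xi_1d\xi_2d\xi_3 .$$ **Theorem (Self-adjointness).** Assume that, for $\alpha=1,2$, $G^{(\alpha)}$ is square integrable and $$\int A(\xi_1)^2A(\xi_2)^2\,(|k|^2+m_Z^2)^{1/2}\,|G^{(\alpha)}(\xi_1,\xi_2,\xi_3)|^2\,d\xi_1d\xi_2d\xi_3<\infty .$$ Let $g_0>0$ be such that $$g_0^2\Big(\sum_{\alpha=1,2}K_1(G^{(\alpha)})^2\Big)\Big(\frac1{m_e^2}+1\Big)<1 .$$ Then for every real $g$ with $|g|\le g_0$, the operator $H=H_0+gH_I$, defined on $\mathfrak D(H_0)\cap\mathfrak D(H_I)$, is self-adjoint with domain $\mathfrak D(H_0)$ (in particular $\mathfrak D(H_0)\cap\mathfrak D(H_I)=\mathfrak D(H_0)$). Moreover, any core for $H_0$ is a core for $H$. -/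

import Mathlib

open MeasureTheory Set
open scoped ENNReal ComplexConjugate ContDiff

noncomputable section

namespace ZDecay

/-! ## One-particle spaces -/

/-- The set `Γ` of angular quantum numbers `(j, m_j, κ_j)` with `j ∈ ℕ + 1/2`,
`m_j ∈ {-j, …, j}` and `κ_j ∈ {j + 1/2, -(j + 1/2)}`.  A triple `⟨n, i, b⟩` encodes
`j = n + 1/2`, `m_j = -j + i` (with `0 ≤ i ≤ 2j = 2n + 1`), and `κ_j = n + 1` if `b = true`,
`κ_j = -(n + 1)` if `b = false`. -/
def QNum : Type := (n : ℕ) × Fin (2 * n + 2) × Bool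

instance : Countable QNum := inferInstanceAs (Countable ((n : ℕ) × Fin (2 * n + 2) × Bool))
instance : MeasurableSpace QNum := ⊤
instance : DiscreteMeasurableSpace QNum := ⟨fun _ => trivial⟩

namespace QNum

/-- Total angular momentum `j`. -/
def j (γ : QNum) : ℝ := γ.1 + 1 / 2

/-- The magnetic quantum number `m_j`. -/
def mj (γ : QNum) : ℝ := -γ.j + ((γ.2.1 : ℕ) : ℝ)

/-- `γ_j = |κ_j| = j + 1/2`, a positive integer. -/
def gam (γ : QNum) : ℕ := γ.1 + 1

/-- `κ_j = ± (j + 1/2)`. -/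
def kappa (γ : QNum) : ℤ := if γ.2.2 then (γ.gam : ℤ) else -(γ.gam : ℤ)

/-- `(j, m_j, κ_j) ↦ (j, -m_j, -κ_j)`. -/
def flip (γ : QNum) : QNum := ⟨γ.1, Fin.rev γ.2.1, !γ.2.2⟩

end QNum

/-- `Σ = ℝ₊ × Γ`, the variables `ξ = (p, γ)` of an electron or a positron.  (The half line
`p > 0` is encoded in the measure `muF`.) -/
abbrev Fermion : Type := ℝ × QNum

/-- `∫ dξ = ∑_γ ∫_{ℝ₊} dp`. -/
def muF : Measure Fermion := (volume.restrict (Ioi (0 : ℝ))).prod Measure.count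

instance : SigmaFinite muF := by unfold muF; infer_instance

/-- Euclidean three-space. -/
abbrev R3 : Type := EuclideanSpace ℝ (Fin 3)

/-- `Σ₃ = ℝ³ × {-1, 0, 1}`, the variables `ξ₃ = (k, λ)` of a boson; `λ = -1, 0, 1` are
the indices `0, 1, 2` of `Fin 3`. -/
abbrev Boson : Type := R3 × Fin 3

/-- `∫ dξ₃ = ∑_λ ∫_{ℝ³} dk`. -/
def muB : Measure Boson := (volume : Measure R3).prod Measure.count

instance : SigmaFinite muB := by unfold muB; infer_instance

/-- Relativistic energy `(m² + p²)^{1/2}` of a fermion. -/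
def omega (me p : ℝ) : ℝ := Real.sqrt (me ^ 2 + p ^ 2)

/-- Relativistic energy `ω₃(k) = (|k|² + m_Z²)^{1/2}` of a boson. -/
def omega3 (mZ : ℝ) (k : R3) : ℝ := Real.sqrt (‖k‖ ^ 2 + mZ ^ 2)

/-! ## Generalized eigenfunctions of the free Dirac operator -/

/-- The confluent hypergeometric function `₁F₁(γ + 1, 2γ + 1, z)` for a positive integer `γ`,
through Euler's integral. -/
def confluentF (γ : ℕ) (z : ℂ) : ℂ :=
  ((Real.Gamma (2 * γ + 1) / (Real.Gamma (γ + 1) * Real.Gamma γ) : ℝ) : ℂ) *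
    ∫ u in (0 : ℝ)..1, Complex.exp (z * u) * (u : ℂ) ^ γ * ((1 - u : ℝ) : ℂ) ^ (γ - 1)

/-- The phase `η_j` for vanishing external potential: `exp (2 i η_j) = -κ_j / γ_j`. -/
def eta (γ : QNum) : ℝ := if 0 < γ.kappa then Real.pi / 2 else 0

/-- The two terms `e^{∓ipr} e^{±iη_j} γ_j F(γ_j + 1, 2γ_j + 1, ± 2ipr)` of the radial functions;
`s = 1` for the upper sign and `s = -1` for the lower one. -/
def radialTerm (s : ℝ) (γ : QNum) (p r : ℝ) : ℂ :=
  Complex.exp (-(s * p * r : ℝ) * Complex.I) * Complex.exp ((s * eta γ : ℝ) * Complex.I) *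
    (γ.gam : ℂ) * confluentF γ.gam ((2 * s * p * r : ℝ) * Complex.I)

/-- The common prefactor
`ω(p)^{-1/2} (2pr)^{γ_j} r^{-1} (2√π)^{-1} Γ(γ_j) / Γ(2γ_j + 1)`. -/
def radialPrefactor (me : ℝ) (γ : QNum) (p r : ℝ) : ℝ :=
  1 / Real.sqrt (omega me p) * ((2 * p * r) ^ γ.gam / r) * (1 / (2 * Real.sqrt Real.pi)) *
    (Real.Gamma γ.gam / Real.Gamma (2 * γ.gam + 1))

/-- The radial function `g_{κ_j, ±}(p, r)`; `pos = true` for positive energies. -/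
def gRadial (me : ℝ) (pos : Bool) (γ : QNum) (p r : ℝ) : ℂ :=
  ((if pos then Real.sqrt (omega me p + me) else Real.sqrt (omega me p - me) : ℝ) : ℂ) *
    (radialPrefactor me γ p r : ℂ) * (radialTerm 1 γ p r + radialTerm (-1) γ p r)

/-- The radial function `f_{κ_j, ±}(p, r)`; `pos = true` for positive energies. -/
def fRadial (me : ℝ) (pos : Bool) (γ : QNum) (p r : ℝ) : ℂ :=
  Complex.I *
    ((if pos then Real.sqrt (omega me p - me) else -Real.sqrt (omega me p + me) : ℝ) : ℂ) *
    (radialPrefactor me γ p r : ℂ) * (radialTerm 1 γ p r - radialTerm (-1) γ p r)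

/-- The spherical harmonic `Y_{l,m}` (orthonormal on the sphere, Condon–Shortley phase) at the
direction of `x ≠ 0`.  Here `x 2 / ‖x‖ = cos θ`, `√(x₁² + x₂²) / ‖x‖ = sin θ` and
`arg (x₁ + i x₂) = φ`; it is `0` for `|m| > l`. -/
def sphY (l : ℕ) (m : ℤ) (x : R3) : ℂ :=
  (((if 0 ≤ m then (-1) ^ m.natAbs else 1) *
      Real.sqrt ((2 * l + 1) / (4 * Real.pi) *
        ((l - m.natAbs).factorial / (l + m.natAbs).factorial)) *
      (Real.sqrt (x 0 ^ 2 + x 1 ^ 2) / ‖x‖) ^ m.natAbs *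
      (1 / (2 ^ l * l.factorial) *
        (Polynomial.derivative^[l + m.natAbs]
          ((Polynomial.X ^ 2 - 1 : Polynomial ℝ) ^ l)).eval (x 2 / ‖x‖)) : ℝ) : ℂ) *
    Complex.exp ((m : ℂ) * (Complex.arg ⟨x 0, x 1⟩ : ℂ) * Complex.I)

/-- The spinor spherical harmonic with total angular momentum `j`, magnetic quantum number `m_j`
and orbital angular momentum `l = j + 1/2` (`up = true`) or `l = j - 1/2` (`up = false`).  Its
entries involve `Y_{l, m_j - 1/2}` and `Y_{l, m_j + 1/2}`; with the encoding of `QNum`,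
`m_j - 1/2 = i - n - 1` and `m_j + 1/2 = i - n`. -/
def spinorY (up : Bool) (γ : QNum) (x : R3) : Fin 2 → ℂ :=
  let mLow : ℤ := (γ.2.1 : ℕ) - (γ.1 : ℤ) - 1
  let mUpp : ℤ := (γ.2.1 : ℕ) - (γ.1 : ℤ)
  if up then
    ![-(Real.sqrt ((γ.j - γ.mj + 1) / (2 * γ.j + 2)) : ℂ) * sphY (γ.1 + 1) mLow x,
      (Real.sqrt ((γ.j + γ.mj + 1) / (2 * γ.j + 2)) : ℂ) * sphY (γ.1 + 1) mUpp x]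
  else
    ![(Real.sqrt ((γ.j + γ.mj) / (2 * γ.j)) : ℂ) * sphY γ.1 mLow x,
      (Real.sqrt ((γ.j - γ.mj) / (2 * γ.j)) : ℂ) * sphY γ.1 mUpp x]

/-- Dirac spinors `ℂ⁴ = ℂ² ⊕ ℂ²`. -/
abbrev Spinor : Type := Fin 2 ⊕ Fin 2 → ℂ

/-- The generalized eigenfunction `ψ_±(ξ, x)` of the free Dirac operator, with upper component
`i g Φ⁽¹⁾` and lower component `-f Φ⁽²⁾`; `pos = true` for `ψ_+`. -/
def psi (me : ℝ) (pos : Bool) (ξ : Fermion) (x : R3) : Spinor :=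
  Sum.elim
    (fun a => Complex.I * gRadial me pos ξ.2 ξ.1 ‖x‖ * spinorY ξ.2.2.2 ξ.2 x a)
    (fun a => -fRadial me pos ξ.2 ξ.1 ‖x‖ * spinorY (!ξ.2.2.2) ξ.2 x a)

/-- `ψ̃_-((p, (j, m_j, κ_j)), x) = ψ_-((p, (j, -m_j, -κ_j)), x)`. -/
def psiTilde (me : ℝ) (ξ : Fermion) (x : R3) : Spinor := psi me false (ξ.1, ξ.2.flip) x

/-! ## Dirac matrices and polarization vectors -/

/-- The Pauli matrices. -/
def pauli : Fin 3 → Matrix (Fin 2) (Fin 2) ℂ :=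
  ![!![0, 1; 1, 0], !![0, -Complex.I; Complex.I, 0], !![1, 0; 0, -1]]

/-- The Dirac matrices `γ^0 = β`, `γ^i = β α_i` in the standard representation. -/
def diracGamma : Fin 4 → Matrix (Fin 2 ⊕ Fin 2) (Fin 2 ⊕ Fin 2) ℂ :=
  Fin.cons (Matrix.fromBlocks 1 0 0 (-1))
    (fun i : Fin 3 => Matrix.fromBlocks 0 (pauli i) (-pauli i) 0)

/-- `γ_5 = i γ^0 γ^1 γ^2 γ^3`. -/
def diracGamma5 : Matrix (Fin 2 ⊕ Fin 2) (Fin 2 ⊕ Fin 2) ℂ :=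
  Complex.I • (diracGamma 0 * diracGamma 1 * diracGamma 2 * diracGamma 3)

/-- The bilinear expression `ψ̄ γ^μ (g'_V - γ_5) χ`, where `ψ̄ = ψ† γ^0`. -/
def current (gV : ℝ) (μ : Fin 4) (ψ χ : Spinor) : ℂ :=
  star ψ ⬝ᵥ Matrix.mulVec
    (diracGamma 0 * (diracGamma μ * ((gV : ℂ) • (1 : Matrix _ _ ℂ) - diracGamma5))) χ

/-- The polarization vectors at rest, for `λ = -1, 0, 1`. -/
def restPol : Fin 3 → Fin 3 → ℂ :=
  ![![1 / Real.sqrt 2, -Complex.I / Real.sqrt 2, 0],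
    ![0, 0, 1],
    ![-1 / Real.sqrt 2, -Complex.I / Real.sqrt 2, 0]]

/-- The covariant components `ε_μ(k, λ)` (signature `+ - - -`) of the polarization vectors of a
massive spin one boson: the image of the vector at rest `(0, e)` under the standard boost, that
is, `ε^0 = k·e / m_Z` and `ε^i = e_i + (k·e) k_i / (m_Z (ω₃(k) + m_Z))`. -/
def polVec (mZ : ℝ) (μ : Fin 4) (ξ : Boson) : ℂ :=
  let ke : ℂ := ∑ i, (ξ.1 i : ℂ) * restPol ξ.2 i
  (Fin.cons (ke / mZ)
    (fun i : Fin 3 =>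
      -(restPol ξ.2 i + ke * (ξ.1 i : ℂ) / ((mZ * (omega3 mZ ξ.1 + mZ) : ℝ) : ℂ))) :
    Fin 4 → ℂ) μ

/-! ## Coupling functions -/

/-- `h⁽¹⁾(ξ₁, ξ₂, ξ₃) = ∫ f(|x|) ψ̄_+(ξ₁,x) γ^μ (g'_V - γ_5) ψ̃_-(ξ₂,x)
  ε_μ(ξ₃) (2 ω₃(k))^{-1/2} e^{ik·x} dx`. -/
def hOne (me mZ gV : ℝ) (f : ℝ → ℝ) (ξ₁ ξ₂ : Fermion) (ξ₃ : Boson) : ℂ :=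
  ∫ x : R3, (f ‖x‖ : ℂ) *
    (∑ μ : Fin 4, current gV μ (psi me true ξ₁ x) (psiTilde me ξ₂ x) *
      (polVec mZ μ ξ₃ / (Real.sqrt (2 * omega3 mZ ξ₃.1) : ℂ))) *
    Complex.exp (((inner ℝ ξ₃.1 x : ℝ) : ℂ) * Complex.I)

/-- `h⁽²⁾(ξ₁, ξ₂, ξ₃) = ∫ f(|x|) ψ̄_+(ξ₁,x) γ^μ (g'_V - γ_5) ψ̃_-(ξ₂,x)
  ε_μ^*(ξ₃) (2 ω₃(k))^{-1/2} e^{-ik·x} dx`. -/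
def hTwo (me mZ gV : ℝ) (f : ℝ → ℝ) (ξ₁ ξ₂ : Fermion) (ξ₃ : Boson) : ℂ :=
  ∫ x : R3, (f ‖x‖ : ℂ) *
    (∑ μ : Fin 4, current gV μ (psi me true ξ₁ x) (psiTilde me ξ₂ x) *
      (conj (polVec mZ μ ξ₃) / (Real.sqrt (2 * omega3 mZ ξ₃.1) : ℂ))) *
    Complex.exp (-((inner ℝ ξ₃.1 x : ℝ) : ℂ) * Complex.I)

/-- A kernel `(ξ₁, ξ₂, ξ₃) ↦ F(ξ₁, ξ₂, ξ₃)`. -/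
abbrev Kernel3 : Type := Fermion → Fermion → Boson → ℂ

/-- The measure `dξ₁ dξ₂ dξ₃`. -/
def muFFB : Measure (Fermion × Fermion × Boson) := muF.prod (muF.prod muB)

instance : SigmaFinite muFFB := by unfold muFFB; infer_instance

/-- The weight `A(ξ)`. -/
def weightA (me : ℝ) (f : ℝ → ℝ) (ξ : Fermion) : ℝ :=
  (2 * ξ.1) ^ (ξ.2.gam + 1) / Real.Gamma ξ.2.gam *
    Real.sqrt ((omega me ξ.1 + me) / omega me ξ.1) *
    Real.sqrt (∫ r in Ioi (0 : ℝ), |f r| * r ^ (2 * ξ.2.gam) * (1 + r ^ 2))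

/-- `K₁(G)² = C_Z² ∫ A(ξ₁)² A(ξ₂)² |G(ξ₁, ξ₂, ξ₃)|² dξ₁ dξ₂ dξ₃`, with `C_Z = 156 C`. -/
def K1sq (me : ℝ) (f : ℝ → ℝ) (C : ℝ) (G : Kernel3) : ℝ :=
  (156 * C) ^ 2 *
    ∫ ξ, weightA me f ξ.1 ^ 2 * weightA me f ξ.2.1 ^ 2 * ‖G ξ.1 ξ.2.1 ξ.2.2‖ ^ 2 ∂muFFB

/-! ## The Fock space -/

/-- Configurations of `r` electrons, `s` positrons and `n` bosons. -/
abbrev Sector (r s n : ℕ) : Type := (Fin r → Fermion) × (Fin s → Fermion) × (Fin n → Boson)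

def muS (r s n : ℕ) : Measure (Sector r s n) :=
  (Measure.pi fun _ => muF).prod ((Measure.pi fun _ => muF).prod (Measure.pi fun _ => muB))

instance (r s n : ℕ) : SigmaFinite (muS r s n) := by unfold muS; infer_instance

/-- Relabelling of the particles of each species. -/
def relabel {r s n : ℕ} (σ : Equiv.Perm (Fin r)) (τ : Equiv.Perm (Fin s))
    (π : Equiv.Perm (Fin n)) (w : Sector r s n) : Sector r s n :=
  (w.1 ∘ σ, w.2.1 ∘ τ, w.2.2 ∘ π)

theorem measurePreserving_comp_perm {α : Type*} [MeasurableSpace α] (μ : Measure α)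
    [SigmaFinite μ] {r : ℕ} (σ : Equiv.Perm (Fin r)) :
    MeasurePreserving (fun x : Fin r → α => x ∘ σ)
      (Measure.pi fun _ => μ) (Measure.pi fun _ => μ) := by
  have h := (measurePreserving_piCongrLeft (fun _ : Fin r => μ) σ.symm)
  convert h using 1
  funext x i
  simp [MeasurableEquiv.coe_piCongrLeft, Equiv.piCongrLeft_apply]

theorem measurePreserving_relabel {r s n : ℕ} (σ : Equiv.Perm (Fin r)) (τ : Equiv.Perm (Fin s))
    (π : Equiv.Perm (Fin n)) : MeasurePreserving (relabel σ τ π) (muS r s n) (muS r s n) :=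
  (measurePreserving_comp_perm muF σ).prod
    ((measurePreserving_comp_perm muF τ).prod (measurePreserving_comp_perm muB π))

/-- The sector `(⊗_a^r L²(Σ)) ⊗ (⊗_a^s L²(Σ)) ⊗ (⊗_s^n L²(Σ₃))` of Fock space: the square
integrable functions of `r + s + n` variables that are antisymmetric in the electron variables,
antisymmetric in the positron variables and symmetric in the boson variables. -/
def FockSector (r s n : ℕ) : Submodule ℂ (Lp ℂ 2 (muS r s n)) where
  carrier := {Φ | ∀ σ τ π, ∀ᵐ w ∂muS r s n,
    Φ (relabel σ τ π w) = ((Equiv.Perm.sign σ * Equiv.Perm.sign τ : ℤˣ) : ℂ) * Φ w}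
  zero_mem' := by
    intro σ τ π
    have h0 := Lp.coeFn_zero ℂ 2 (muS r s n)
    filter_upwards [h0, (measurePreserving_relabel σ τ π).quasiMeasurePreserving.ae h0]
      with w h1 h2
    rw [h1, h2, Pi.zero_apply, Pi.zero_apply, mul_zero]
  add_mem' := by
    intro Φ Ψ hΦ hΨ σ τ π
    have h0 := Lp.coeFn_add Φ Ψ
    filter_upwards [h0, (measurePreserving_relabel σ τ π).quasiMeasurePreserving.ae h0,
      hΦ σ τ π, hΨ σ τ π] with w h1 h2 h3 h4
    rw [h1, h2, Pi.add_apply, Pi.add_apply, h3, h4, mul_add]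
  smul_mem' := by
    intro c Φ hΦ σ τ π
    have h0 := Lp.coeFn_smul c Φ
    filter_upwards [h0, (measurePreserving_relabel σ τ π).quasiMeasurePreserving.ae h0,
      hΦ σ τ π] with w h1 h2 h3
    rw [h1, h2, Pi.smul_apply, Pi.smul_apply, h3, smul_eq_mul, smul_eq_mul]
    ring

theorem isClosed_fockSector (r s n : ℕ) :
    IsClosed (FockSector r s n : Set (Lp ℂ 2 (muS r s n))) := by
  have : (FockSector r s n : Set (Lp ℂ 2 (muS r s n))) =
      ⋂ (σ : Equiv.Perm (Fin r)) (τ : Equiv.Perm (Fin s)) (π : Equiv.Perm (Fin n)),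
        {Φ | Lp.compMeasurePreservingₗᵢ ℂ (relabel σ τ π) (measurePreserving_relabel σ τ π) Φ =
          ((Equiv.Perm.sign σ * Equiv.Perm.sign τ : ℤˣ) : ℂ) • Φ} := by
    ext Φ
    simp only [mem_iInter, mem_ofPred_eq]
    refine forall_congr' fun σ => forall_congr' fun τ => forall_congr' fun π => ?_
    have h1 := Lp.coeFn_compMeasurePreserving Φ (measurePreserving_relabel σ τ π)
    have h2 := Lp.coeFn_smul ((Equiv.Perm.sign σ * Equiv.Perm.sign τ : ℤˣ) : ℂ) Φ
    constructor
    · intro h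
      apply Lp.ext
      filter_upwards [h1, h2, h] with w e1 e2 e3
      exact e1.trans (e3.trans e2.symm)
    · intro h
      have h3 : (Lp.compMeasurePreserving (relabel σ τ π) (measurePreserving_relabel σ τ π) Φ :
          Lp ℂ 2 (muS r s n)) =
          ((Equiv.Perm.sign σ * Equiv.Perm.sign τ : ℤˣ) : ℂ) • Φ := h
      rw [h3] at h1
      filter_upwards [h1, h2] with w e1 e2
      exact e1.symm.trans e2
  rw [this]
  exact isClosed_iInter fun σ => isClosed_iInter fun τ => isClosed_iInter fun π =>
    isClosed_eq (LinearIsometry.continuous _) (continuous_const_smul _)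

instance (r s n : ℕ) : CompleteSpace (FockSector r s n) :=
  (isClosed_fockSector r s n).completeSpace_coe

/-- The Hilbert space `𝓗 = 𝔉_a ⊗ 𝔉_a ⊗ 𝔉_s`, as the direct sum of its sectors. -/
abbrev Fock : Type := lp (fun i : ℕ × ℕ × ℕ => FockSector i.1 i.2.1 i.2.2) 2

/-- Families of functions of the particle variables, one for each sector. -/
abbrev FockFun : Type := ∀ r s n : ℕ, Sector r s n → ℂ

/-- The components `Φ^{(r,s,n)}` of a vector of Fock space, as functions. -/
def Fock.toFun (Φ : Fock) : FockFun := fun r s n w =>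
  ((Φ (r, s, n) : FockSector r s n) : Lp ℂ 2 (muS r s n)) w

theorem Fock.toFun_add (Φ Ψ : Fock) (r s n : ℕ) :
    (Φ + Ψ).toFun r s n =ᵐ[muS r s n] (Φ.toFun + Ψ.toFun) r s n :=
  Lp.coeFn_add ((Φ (r, s, n) : FockSector r s n) : Lp ℂ 2 (muS r s n))
    ((Ψ (r, s, n) : FockSector r s n) : Lp ℂ 2 (muS r s n))

theorem Fock.toFun_smul (c : ℂ) (Φ : Fock) (r s n : ℕ) :
    (c • Φ).toFun r s n =ᵐ[muS r s n] (c • Φ.toFun) r s n :=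
  Lp.coeFn_smul c ((Φ (r, s, n) : FockSector r s n) : Lp ℂ 2 (muS r s n))

theorem Fock.toFun_zero (r s n : ℕ) :
    (0 : Fock).toFun r s n =ᵐ[muS r s n] (0 : FockFun) r s n :=
  Lp.coeFn_zero ℂ 2 (muS r s n)

theorem Fock.ext_ae {Φ Ψ : Fock} (h : ∀ r s n, Φ.toFun r s n =ᵐ[muS r s n] Ψ.toFun r s n) :
    Φ = Ψ := by
  apply lp.ext
  funext ⟨r, s, n⟩
  exact Subtype.ext (Lp.ext (h r s n))

/-! ## Operators given by pointwise formulas -/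

/-- A linear operation on families of functions which is given by a formula `app φ` that makes
sense at the configurations where `conv φ` holds (absolute convergence of the integrals that
occur in the formula), and which respects equality almost everywhere. -/
structure FormalOp where
  conv : FockFun → ∀ r s n : ℕ, Sector r s n → Prop
  app : FockFun → FockFun
  congr : ∀ φ ψ : FockFun, (∀ r s n, φ r s n =ᵐ[muS r s n] ψ r s n) →
    ∀ r s n, ∀ᵐ w ∂muS r s n, conv φ r s n w → conv ψ r s n w ∧ app ψ r s n w = app φ r s n w
  zero : ∀ r s n w, conv 0 r s n w ∧ app 0 r s n w = 0
  add : ∀ φ ψ : FockFun, ∀ r s n w, conv φ r s n w → conv ψ r s n w →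
    conv (φ + ψ) r s n w ∧ app (φ + ψ) r s n w = app φ r s n w + app ψ r s n w
  smul : ∀ (c : ℂ) (φ : FockFun), ∀ r s n w, conv φ r s n w →
    conv (c • φ) r s n w ∧ app (c • φ) r s n w = c * app φ r s n w

/-- The graph of the operator in Fock space with its natural maximal domain: the pairs `(Φ, Ψ)`
such that, almost everywhere in every sector, the formula converges at `Φ` and gives `Ψ`. -/
def FormalOp.graph (T : FormalOp) : Submodule ℂ (Fock × Fock) where
  carrier := {P | ∀ r s n, ∀ᵐ w ∂muS r s n,
    T.conv P.1.toFun r s n w ∧ P.2.toFun r s n w = T.app P.1.toFun r s n w}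
  zero_mem' := by
    intro r s n
    filter_upwards [Fock.toFun_zero r s n,
      T.congr 0 (0 : Fock).toFun (fun r s n => (Fock.toFun_zero r s n).symm) r s n] with w h1 h2
    obtain ⟨h3, h4⟩ := T.zero r s n w
    obtain ⟨h5, h6⟩ := h2 h3
    exact ⟨h5, h1.trans (h4.symm.trans h6.symm)⟩
  add_mem' := by
    intro P Q hP hQ r s n
    filter_upwards [hP r s n, hQ r s n, Fock.toFun_add P.2 Q.2 r s n,
      T.congr (P.1.toFun + Q.1.toFun) (P.1 + Q.1).toFun
        (fun r s n => (Fock.toFun_add P.1 Q.1 r s n).symm) r s n] with w h1 h2 h3 h4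
    obtain ⟨h5, h6⟩ := T.add _ _ r s n w h1.1 h2.1
    obtain ⟨h7, h8⟩ := h4 h5
    refine ⟨h7, h3.trans ?_⟩
    exact (congrArg₂ (· + ·) h1.2 h2.2).trans (h8.trans h6).symm
  smul_mem' := by
    intro c P hP r s n
    filter_upwards [hP r s n, Fock.toFun_smul c P.2 r s n,
      T.congr (c • P.1.toFun) (c • P.1).toFun
        (fun r s n => (Fock.toFun_smul c P.1 r s n).symm) r s n] with w h1 h3 h4
    obtain ⟨h5, h6⟩ := T.smul c _ r s n w h1.1
    obtain ⟨h7, h8⟩ := h4 h5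
    refine ⟨h7, h3.trans ?_⟩
    exact (congrArg (c * ·) h1.2).trans (h8.trans h6).symm

/-- The operator in Fock space defined by a formula, on its natural maximal domain. -/
def FormalOp.op (T : FormalOp) : Fock →ₗ.[ℂ] Fock := T.graph.toLinearPMap

/-- The graph of `T.op` is `T.graph`. -/
theorem FormalOp.graph_op (T : FormalOp) : T.op.graph = T.graph := by
  refine Submodule.toLinearPMap_graph_eq _ ?_
  rintro ⟨Φ, Ψ⟩ h h0
  obtain rfl : Φ = 0 := h0
  refine Fock.ext_ae fun r s n => ?_
  filter_upwards [h r s n, Fock.toFun_zero r s n,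
    T.congr 0 (0 : Fock).toFun (fun r s n => (Fock.toFun_zero r s n).symm) r s n] with w h1 h2 h3
  obtain ⟨h4, h5⟩ := T.zero r s n w
  exact h1.2.trans (((h3 h4).2.trans h5).trans h2.symm)

/-! ## The free Hamiltonian -/

/-- The total energy of a configuration of free particles. -/
def freeEnergy (me mZ : ℝ) (r s n : ℕ) (w : Sector r s n) : ℝ :=
  ∑ i, omega me (w.1 i).1 + ∑ i, omega me (w.2.1 i).1 + ∑ i, omega3 mZ (w.2.2 i).1

/-- `∫ ω b_+^* b_+ + ∫ ω b_-^* b_- + ∫ ω₃ a^* a`, as multiplication by the total energy. -/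
def freeFormal (me mZ : ℝ) : FormalOp where
  conv _ _ _ _ _ := True
  app φ r s n w := (freeEnergy me mZ r s n w : ℂ) * φ r s n w
  congr φ ψ h r s n := by
    filter_upwards [h r s n] with w hw _
    exact ⟨trivial, by rw [hw]⟩
  zero r s n w := ⟨trivial, by simp⟩
  add φ ψ r s n w _ _ := ⟨trivial, by simp [mul_add]⟩
  smul c φ r s n w _ := ⟨trivial, by simp only [Pi.smul_apply, smul_eq_mul]; ring⟩

/-- The free Hamiltonian `H_0`, as a self-adjoint multiplication operator on its maximal
domain. -/
def freeHam (me mZ : ℝ) : Fock →ₗ.[ℂ] Fock := (freeFormal me mZ).op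

/-! ## Creation and annihilation -/

/-- Adding an electron to a configuration. -/
def addE {r s n : ℕ} (x : Sector r s n × Fermion) : Sector (r + 1) s n :=
  (Fin.cons x.2 x.1.1, x.1.2.1, x.1.2.2)

/-- Adding a positron to a configuration. -/
def addP {r s n : ℕ} (x : Sector r s n × Fermion) : Sector r (s + 1) n :=
  (x.1.1, Fin.cons x.2 x.1.2.1, x.1.2.2)

/-- Adding a boson to a configuration. -/
def addZ {r s n : ℕ} (x : Sector r s n × Boson) : Sector r s (n + 1) :=
  (x.1.1, x.1.2.1, Fin.cons x.2 x.1.2.2)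

/-- The annihilation operator `b_+(ξ)` of an electron. -/
def annE (ξ : Fermion) (φ : FockFun) : FockFun := fun r s n w =>
  (Real.sqrt (r + 1) : ℂ) * φ (r + 1) s n (addE (w, ξ))

/-- The annihilation operator `b_-(ξ)` of a positron, with the sign `(-1)^r` of the tensor factor `(-1)^{N_+}`. -/
def annP (ξ : Fermion) (φ : FockFun) : FockFun := fun r s n w =>
  (-1) ^ r * (Real.sqrt (s + 1) : ℂ) * φ r (s + 1) n (addP (w, ξ))

/-- The annihilation operator `a(ξ)` of a boson. -/
def annZ (ξ : Boson) (φ : FockFun) : FockFun := fun r s n w =>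
  (Real.sqrt (n + 1) : ℂ) * φ r s (n + 1) (addZ (w, ξ))

theorem annE_zero (ξ : Fermion) : annE ξ 0 = 0 := by
  funext r s n w
  simp [annE]

theorem annE_add (ξ : Fermion) (φ ψ : FockFun) : annE ξ (φ + ψ) = annE ξ φ + annE ξ ψ := by
  funext r s n w
  simp [annE, mul_add]

theorem annE_smul (ξ : Fermion) (c : ℂ) (φ : FockFun) : annE ξ (c • φ) = c • annE ξ φ := by
  funext r s n w
  simp only [annE, Pi.smul_apply, smul_eq_mul]
  ring

theorem annP_zero (ξ : Fermion) : annP ξ 0 = 0 := by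
  funext r s n w
  simp [annP]

theorem annP_add (ξ : Fermion) (φ ψ : FockFun) : annP ξ (φ + ψ) = annP ξ φ + annP ξ ψ := by
  funext r s n w
  simp [annP, mul_add]

theorem annP_smul (ξ : Fermion) (c : ℂ) (φ : FockFun) : annP ξ (c • φ) = c • annP ξ φ := by
  funext r s n w
  simp only [annP, Pi.smul_apply, smul_eq_mul]
  ring

theorem annZ_zero (ξ : Boson) : annZ ξ 0 = 0 := by
  funext r s n w
  simp [annZ]

theorem annZ_add (ξ : Boson) (φ ψ : FockFun) : annZ ξ (φ + ψ) = annZ ξ φ + annZ ξ ψ := by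
  funext r s n w
  simp [annZ, mul_add]

theorem annZ_smul (ξ : Boson) (c : ℂ) (φ : FockFun) : annZ ξ (c • φ) = c • annZ ξ φ := by
  funext r s n w
  simp only [annZ, Pi.smul_apply, smul_eq_mul]
  ring

/-- `∫ b_+^*(ξ) Θ_ξ dξ` for a family `Θ_ξ`: the electron that is created occupies, in turn, each
of the electron positions, with the sign of antisymmetry. -/
def creE (Θ : Fermion → FockFun) : FockFun
  | 0, _, _ => fun _ => 0
  | r + 1, s, n => fun w => (1 / Real.sqrt (r + 1) : ℂ) *
      ∑ i : Fin (r + 1), (-1) ^ (i : ℕ) * Θ (w.1 i) r s n (w.1 ∘ i.succAbove, w.2.1, w.2.2)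

/-- The property `P` holds for all terms that occur in `creE`. -/
def allE (P : Fermion → ∀ r s n : ℕ, Sector r s n → Prop) :
    ∀ r s n : ℕ, Sector r s n → Prop
  | 0, _, _ => fun _ => True
  | r + 1, s, n => fun w => ∀ i : Fin (r + 1), P (w.1 i) r s n (w.1 ∘ i.succAbove, w.2.1, w.2.2)

theorem allE_mono {P Q : Fermion → ∀ r s n : ℕ, Sector r s n → Prop}
    (h : ∀ ξ r s n w, P ξ r s n w → Q ξ r s n w) (r s n : ℕ) (w : Sector r s n)
    (hP : allE P r s n w) : allE Q r s n w := by
  cases r with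
  | zero => trivial
  | succ m => exact fun i => h _ _ _ _ _ (hP i)

theorem allE_and {P Q : Fermion → ∀ r s n : ℕ, Sector r s n → Prop}
    {r s n : ℕ} {w : Sector r s n} (hP : allE P r s n w) (hQ : allE Q r s n w) :
    allE (fun ξ r s n w => P ξ r s n w ∧ Q ξ r s n w) r s n w := by
  cases r with
  | zero => trivial
  | succ m => exact fun i => ⟨hP i, hQ i⟩

theorem allE_of {P : Fermion → ∀ r s n : ℕ, Sector r s n → Prop}
    (h : ∀ ξ r s n w, P ξ r s n w) (r s n : ℕ) (w : Sector r s n) : allE P r s n w := by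
  cases r with
  | zero => trivial
  | succ m => exact fun i => h _ _ _ _ _

theorem creE_congr {Θ Θ' : Fermion → FockFun} {r s n : ℕ} {w : Sector r s n}
    (h : allE (fun ξ r s n w => Θ ξ r s n w = Θ' ξ r s n w) r s n w) :
    creE Θ r s n w = creE Θ' r s n w := by
  cases r with
  | zero => rfl
  | succ m =>
    simp only [creE]
    congr 1
    exact Finset.sum_congr rfl fun i _ => by rw [h i]

theorem creE_zero (r s n : ℕ) (w : Sector r s n) :
    creE (fun _ => 0) r s n w = 0 := by
  cases r <;> simp [creE]

theorem creE_add (Θ Θ' : Fermion → FockFun) (r s n : ℕ) (w : Sector r s n) :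
    creE (fun ξ => Θ ξ + Θ' ξ) r s n w = creE Θ r s n w + creE Θ' r s n w := by
  cases r <;> simp [creE, mul_add, Finset.sum_add_distrib]

theorem creE_smul (c : ℂ) (Θ : Fermion → FockFun) (r s n : ℕ) (w : Sector r s n) :
    creE (fun ξ => c • Θ ξ) r s n w = c * creE Θ r s n w := by
  cases r <;> simp [creE, mul_left_comm, Finset.mul_sum]

/-- `∫ b_-^*(ξ) Θ_ξ dξ` for a family `Θ_ξ`: the positron that is created occupies, in turn, each
of the positron positions, with the sign of antisymmetry. -/
def creP (Θ : Fermion → FockFun) : FockFun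
  | _, 0, _ => fun _ => 0
  | r, s + 1, n => fun w => (-1) ^ r * (1 / Real.sqrt (s + 1) : ℂ) *
      ∑ i : Fin (s + 1), (-1) ^ (i : ℕ) * Θ (w.2.1 i) r s n (w.1, w.2.1 ∘ i.succAbove, w.2.2)

/-- The property `P` holds for all terms that occur in `creP`. -/
def allP (P : Fermion → ∀ r s n : ℕ, Sector r s n → Prop) :
    ∀ r s n : ℕ, Sector r s n → Prop
  | _, 0, _ => fun _ => True
  | r, s + 1, n => fun w => ∀ i : Fin (s + 1), P (w.2.1 i) r s n (w.1, w.2.1 ∘ i.succAbove, w.2.2)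

theorem allP_mono {P Q : Fermion → ∀ r s n : ℕ, Sector r s n → Prop}
    (h : ∀ ξ r s n w, P ξ r s n w → Q ξ r s n w) (r s n : ℕ) (w : Sector r s n)
    (hP : allP P r s n w) : allP Q r s n w := by
  cases s with
  | zero => trivial
  | succ m => exact fun i => h _ _ _ _ _ (hP i)

theorem allP_and {P Q : Fermion → ∀ r s n : ℕ, Sector r s n → Prop}
    {r s n : ℕ} {w : Sector r s n} (hP : allP P r s n w) (hQ : allP Q r s n w) :
    allP (fun ξ r s n w => P ξ r s n w ∧ Q ξ r s n w) r s n w := by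
  cases s with
  | zero => trivial
  | succ m => exact fun i => ⟨hP i, hQ i⟩

theorem allP_of {P : Fermion → ∀ r s n : ℕ, Sector r s n → Prop}
    (h : ∀ ξ r s n w, P ξ r s n w) (r s n : ℕ) (w : Sector r s n) : allP P r s n w := by
  cases s with
  | zero => trivial
  | succ m => exact fun i => h _ _ _ _ _

theorem creP_congr {Θ Θ' : Fermion → FockFun} {r s n : ℕ} {w : Sector r s n}
    (h : allP (fun ξ r s n w => Θ ξ r s n w = Θ' ξ r s n w) r s n w) :
    creP Θ r s n w = creP Θ' r s n w := by
  cases s with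
  | zero => rfl
  | succ m =>
    simp only [creP]
    congr 1
    exact Finset.sum_congr rfl fun i _ => by rw [h i]

theorem creP_zero (r s n : ℕ) (w : Sector r s n) :
    creP (fun _ => 0) r s n w = 0 := by
  cases s <;> simp [creP]

theorem creP_add (Θ Θ' : Fermion → FockFun) (r s n : ℕ) (w : Sector r s n) :
    creP (fun ξ => Θ ξ + Θ' ξ) r s n w = creP Θ r s n w + creP Θ' r s n w := by
  cases s <;> simp [creP, mul_add, Finset.sum_add_distrib]

theorem creP_smul (c : ℂ) (Θ : Fermion → FockFun) (r s n : ℕ) (w : Sector r s n) :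
    creP (fun ξ => c • Θ ξ) r s n w = c * creP Θ r s n w := by
  cases s <;> simp [creP, mul_left_comm, Finset.mul_sum]

/-- `∫ a^*(ξ) Θ_ξ dξ` for a family `Θ_ξ`: the boson that is created occupies, in turn, each
of the boson positions. -/
def creZ (Θ : Boson → FockFun) : FockFun
  | _, _, 0 => fun _ => 0
  | r, s, n + 1 => fun w => (1 / Real.sqrt (n + 1) : ℂ) *
      ∑ i : Fin (n + 1), Θ (w.2.2 i) r s n (w.1, w.2.1, w.2.2 ∘ i.succAbove)

/-- The property `P` holds for all terms that occur in `creZ`. -/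
def allZ (P : Boson → ∀ r s n : ℕ, Sector r s n → Prop) :
    ∀ r s n : ℕ, Sector r s n → Prop
  | _, _, 0 => fun _ => True
  | r, s, n + 1 => fun w => ∀ i : Fin (n + 1), P (w.2.2 i) r s n (w.1, w.2.1, w.2.2 ∘ i.succAbove)

theorem allZ_mono {P Q : Boson → ∀ r s n : ℕ, Sector r s n → Prop}
    (h : ∀ ξ r s n w, P ξ r s n w → Q ξ r s n w) (r s n : ℕ) (w : Sector r s n)
    (hP : allZ P r s n w) : allZ Q r s n w := by
  cases n with
  | zero => trivial
  | succ m => exact fun i => h _ _ _ _ _ (hP i)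

theorem allZ_and {P Q : Boson → ∀ r s n : ℕ, Sector r s n → Prop}
    {r s n : ℕ} {w : Sector r s n} (hP : allZ P r s n w) (hQ : allZ Q r s n w) :
    allZ (fun ξ r s n w => P ξ r s n w ∧ Q ξ r s n w) r s n w := by
  cases n with
  | zero => trivial
  | succ m => exact fun i => ⟨hP i, hQ i⟩

theorem allZ_of {P : Boson → ∀ r s n : ℕ, Sector r s n → Prop}
    (h : ∀ ξ r s n w, P ξ r s n w) (r s n : ℕ) (w : Sector r s n) : allZ P r s n w := by
  cases n with
  | zero => trivial
  | succ m => exact fun i => h _ _ _ _ _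

theorem creZ_congr {Θ Θ' : Boson → FockFun} {r s n : ℕ} {w : Sector r s n}
    (h : allZ (fun ξ r s n w => Θ ξ r s n w = Θ' ξ r s n w) r s n w) :
    creZ Θ r s n w = creZ Θ' r s n w := by
  cases n with
  | zero => rfl
  | succ m =>
    simp only [creZ]
    congr 1
    exact Finset.sum_congr rfl fun i _ => by rw [h i]

theorem creZ_zero (r s n : ℕ) (w : Sector r s n) :
    creZ (fun _ => 0) r s n w = 0 := by
  cases n <;> simp [creZ]

theorem creZ_add (Θ Θ' : Boson → FockFun) (r s n : ℕ) (w : Sector r s n) :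
    creZ (fun ξ => Θ ξ + Θ' ξ) r s n w = creZ Θ r s n w + creZ Θ' r s n w := by
  cases n <;> simp [creZ, mul_add, Finset.sum_add_distrib]

theorem creZ_smul (c : ℂ) (Θ : Boson → FockFun) (r s n : ℕ) (w : Sector r s n) :
    creZ (fun ξ => c • Θ ξ) r s n w = c * creZ Θ r s n w := by
  cases n <;> simp [creZ, mul_left_comm, Finset.mul_sum]

theorem quasiMeasurePreserving_comp_succAbove {α : Type*} [MeasurableSpace α] (μ : Measure α)
    [SigmaFinite μ] {m : ℕ} (i : Fin (m + 1)) :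
    Measure.QuasiMeasurePreserving (fun x : Fin (m + 1) → α => x ∘ i.succAbove)
      (Measure.pi fun _ => μ) (Measure.pi fun _ => μ) :=
  Measure.quasiMeasurePreserving_snd.comp
    (measurePreserving_piFinSuccAbove (fun _ : Fin (m + 1) => μ) i).quasiMeasurePreserving

theorem quasiMeasurePreserving_cons {α : Type*} [MeasurableSpace α] (μ : Measure α)
    [SigmaFinite μ] (m : ℕ) :
    Measure.QuasiMeasurePreserving (fun x : α × (Fin m → α) => (Fin.cons x.1 x.2 : Fin (m + 1) → α))
      (μ.prod (Measure.pi fun _ => μ)) (Measure.pi fun _ => μ) := by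
  have h := (measurePreserving_piFinSuccAbove (fun _ : Fin (m + 1) => μ) 0).symm
  convert h.quasiMeasurePreserving using 1
  funext x
  exact (Fin.insertNth_zero' x.1 x.2).symm

theorem ae_allE {P : ∀ r s n : ℕ, Sector r s n → Prop}
    (h : ∀ r s n, ∀ᵐ w ∂muS r s n, P r s n w) (r s n : ℕ) :
    ∀ᵐ w ∂muS r s n, allE (fun _ => P) r s n w := by
  cases r with
  | zero => exact Filter.Eventually.of_forall fun _ => trivial
  | succ m =>
    refine ae_all_iff.2 fun i => ?_
    exact (MeasureTheory.QuasiMeasurePreserving.prodMap (quasiMeasurePreserving_comp_succAbove muF i) (Measure.QuasiMeasurePreserving.id _)).ae (h m s n)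

theorem ae_allP {P : ∀ r s n : ℕ, Sector r s n → Prop}
    (h : ∀ r s n, ∀ᵐ w ∂muS r s n, P r s n w) (r s n : ℕ) :
    ∀ᵐ w ∂muS r s n, allP (fun _ => P) r s n w := by
  cases s with
  | zero => exact Filter.Eventually.of_forall fun _ => trivial
  | succ m =>
    refine ae_all_iff.2 fun i => ?_
    exact (MeasureTheory.QuasiMeasurePreserving.prodMap (Measure.QuasiMeasurePreserving.id _)
      (MeasureTheory.QuasiMeasurePreserving.prodMap (quasiMeasurePreserving_comp_succAbove muF i) (Measure.QuasiMeasurePreserving.id _))).ae (h r m n)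

theorem ae_allZ {P : ∀ r s n : ℕ, Sector r s n → Prop}
    (h : ∀ r s n, ∀ᵐ w ∂muS r s n, P r s n w) (r s n : ℕ) :
    ∀ᵐ w ∂muS r s n, allZ (fun _ => P) r s n w := by
  cases n with
  | zero => exact Filter.Eventually.of_forall fun _ => trivial
  | succ m =>
    refine ae_all_iff.2 fun i => ?_
    exact (MeasureTheory.QuasiMeasurePreserving.prodMap (Measure.QuasiMeasurePreserving.id _)
      (MeasureTheory.QuasiMeasurePreserving.prodMap (Measure.QuasiMeasurePreserving.id _) (quasiMeasurePreserving_comp_succAbove muB i))).ae (h r s m)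

theorem quasiMeasurePreserving_reorder {α β γ : Type*} [MeasurableSpace α] [MeasurableSpace β]
    [MeasurableSpace γ] (μ : Measure α) (ν : Measure β) (ρ : Measure γ) [SigmaFinite μ]
    [SigmaFinite ν] [SigmaFinite ρ] :
    Measure.QuasiMeasurePreserving (fun x : α × (β × γ) => ((x.1, x.2.2), x.2.1))
      (μ.prod (ν.prod ρ)) ((μ.prod ρ).prod ν) :=
  ((measurePreserving_prodAssoc μ ρ ν).symm.comp
    ((MeasurePreserving.id μ).prod Measure.measurePreserving_swap)).quasiMeasurePreserving

theorem quasiMeasurePreserving_addE (r s n : ℕ) :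
    Measure.QuasiMeasurePreserving (addE (r := r) (s := s) (n := n))
      ((muS r s n).prod muF) (muS (r + 1) s n) :=
  (MeasureTheory.QuasiMeasurePreserving.prodMap (quasiMeasurePreserving_cons muF r)
    (Measure.QuasiMeasurePreserving.id _)).comp
    (((measurePreserving_prodAssoc muF (Measure.pi fun _ : Fin r => muF)
      ((Measure.pi fun _ : Fin s => muF).prod (Measure.pi fun _ : Fin n => muB))).symm).comp
      Measure.measurePreserving_swap).quasiMeasurePreserving

theorem quasiMeasurePreserving_addP (r s n : ℕ) :
    Measure.QuasiMeasurePreserving (addP (r := r) (s := s) (n := n))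
      ((muS r s n).prod muF) (muS r (s + 1) n) :=
  (MeasureTheory.QuasiMeasurePreserving.prodMap (Measure.QuasiMeasurePreserving.id _)
    ((MeasureTheory.QuasiMeasurePreserving.prodMap
      (quasiMeasurePreserving_cons muF s) (Measure.QuasiMeasurePreserving.id _)).comp
      (((measurePreserving_prodAssoc muF (Measure.pi fun _ : Fin s => muF)
        (Measure.pi fun _ : Fin n => muB)).symm).comp
        Measure.measurePreserving_swap).quasiMeasurePreserving)).comp
    (measurePreserving_prodAssoc (Measure.pi fun _ : Fin r => muF)
      ((Measure.pi fun _ : Fin s => muF).prod (Measure.pi fun _ : Fin n => muB))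
      muF).quasiMeasurePreserving

theorem quasiMeasurePreserving_addZ (r s n : ℕ) :
    Measure.QuasiMeasurePreserving (addZ (r := r) (s := s) (n := n))
      ((muS r s n).prod muB) (muS r s (n + 1)) :=
  (MeasureTheory.QuasiMeasurePreserving.prodMap (Measure.QuasiMeasurePreserving.id _)
    ((MeasureTheory.QuasiMeasurePreserving.prodMap (Measure.QuasiMeasurePreserving.id _)
      ((quasiMeasurePreserving_cons muB n).comp
        (Measure.measurePreserving_swap).quasiMeasurePreserving)).comp
      (measurePreserving_prodAssoc (Measure.pi fun _ : Fin s => muF)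
        (Measure.pi fun _ : Fin n => muB) muB).quasiMeasurePreserving)).comp
    (measurePreserving_prodAssoc (Measure.pi fun _ : Fin r => muF)
      ((Measure.pi fun _ : Fin s => muF).prod (Measure.pi fun _ : Fin n => muB))
      muB).quasiMeasurePreserving

theorem quasiMeasurePreserving_addEP (r s n : ℕ) :
    Measure.QuasiMeasurePreserving
      (fun x : Sector r s n × (Fermion × Fermion) => addE (addP (x.1, x.2.2), x.2.1))
      ((muS r s n).prod (muF.prod muF)) (muS (r + 1) (s + 1) n) :=
  (quasiMeasurePreserving_addE r (s + 1) n).comp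
    ((MeasureTheory.QuasiMeasurePreserving.prodMap (quasiMeasurePreserving_addP r s n)
      (Measure.QuasiMeasurePreserving.id _)).comp
      (quasiMeasurePreserving_reorder (muS r s n) muF muF))

theorem quasiMeasurePreserving_addPZ (r s n : ℕ) :
    Measure.QuasiMeasurePreserving
      (fun x : Sector r s n × (Fermion × Boson) => addP (addZ (x.1, x.2.2), x.2.1))
      ((muS r s n).prod (muF.prod muB)) (muS r (s + 1) (n + 1)) :=
  (quasiMeasurePreserving_addP r s (n + 1)).comp
    ((MeasureTheory.QuasiMeasurePreserving.prodMap (quasiMeasurePreserving_addZ r s n)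
      (Measure.QuasiMeasurePreserving.id _)).comp
      (quasiMeasurePreserving_reorder (muS r s n) muF muB))

theorem quasiMeasurePreserving_addEPZ (r s n : ℕ) :
    Measure.QuasiMeasurePreserving
      (fun x : Sector r s n × (Fermion × Fermion × Boson) =>
        addE (addP (addZ (x.1, x.2.2.2), x.2.2.1), x.2.1))
      ((muS r s n).prod muFFB) (muS (r + 1) (s + 1) (n + 1)) :=
  (quasiMeasurePreserving_addE r (s + 1) (n + 1)).comp
    ((MeasureTheory.QuasiMeasurePreserving.prodMap (quasiMeasurePreserving_addPZ r s n)
      (Measure.QuasiMeasurePreserving.id _)).comp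
      (quasiMeasurePreserving_reorder (muS r s n) muF (muF.prod muB)))

/-! ## The interaction -/

/-- The formula `∫ F(ξ₁, ξ₂, ξ₃) b_+^*(ξ₁) b_-^*(ξ₂) a(ξ₃) dξ₁ dξ₂ dξ₃`. -/
def formalOne (F : Kernel3) : FormalOp where
  conv φ := allE fun ξ₁ => allP fun ξ₂ => fun r s n w =>
    Integrable (fun ξ₃ => F ξ₁ ξ₂ ξ₃ * annZ ξ₃ φ r s n w) muB
  app φ := creE fun ξ₁ => creP fun ξ₂ => fun r s n w =>
    ∫ ξ₃, F ξ₁ ξ₂ ξ₃ * annZ ξ₃ φ r s n w ∂muB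
  congr φ ψ h r s n := by
    have h1 : ∀ r s n, ∀ᵐ w ∂muS r s n, ∀ᵐ ξ₃ ∂muB,
        annZ ξ₃ φ r s n w = annZ ξ₃ ψ r s n w := by
      intro r s n
      filter_upwards [Measure.ae_ae_of_ae_prod
        ((quasiMeasurePreserving_addZ r s n).ae (h r s (n + 1)))] with w hw
      filter_upwards [hw] with ξ hξ
      simp only [annZ, hξ]
    filter_upwards [ae_allE (ae_allP h1) r s n] with w hw hc
    have h2 := allE_mono (fun ξ₁ r s n w h => allP_and h.1 h.2) r s n w (allE_and hw hc)
    refine ⟨?_, creE_congr ?_⟩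
    · refine allE_mono (fun ξ₁ => allP_mono fun ξ₂ r s n w h => ?_) r s n w h2
      exact h.2.congr (h.1.mono fun ξ₃ e => by simp only [e])
    · refine allE_mono (fun ξ₁ r s n w h => creP_congr
        (allP_mono (fun ξ₂ r s n w h => ?_) r s n w h)) r s n w h2
      exact integral_congr_ae (h.1.mono fun ξ₃ e => by simp only [e])
  zero r s n w := by
    refine ⟨allE_of (fun ξ₁ => allP_of fun ξ₂ r s n w => ?_) r s n w, ?_⟩
    · simp [annZ_zero]
    · refine (creE_congr (Θ' := fun _ => 0) (allE_of (fun ξ₁ r s n w => ?_) r s n w)).trans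
        (creE_zero r s n w)
      refine (creP_congr (Θ' := fun _ => 0) (allP_of (fun ξ₂ r s n w => ?_) r s n w)).trans
        (creP_zero r s n w)
      simp [annZ_zero]
  add φ ψ r s n w h1 h2 := by
    have h3 := allE_mono (fun ξ₁ r s n w h => allP_and h.1 h.2) r s n w (allE_and h1 h2)
    refine ⟨?_, ?_⟩
    · refine allE_mono (fun ξ₁ => allP_mono fun ξ₂ r s n w h => ?_) r s n w h3
      simp only [annZ_add, Pi.add_apply, mul_add]
      exact h.1.add h.2
    · refine (creE_congr ?_).trans (creE_add _ _ r s n w)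
      refine allE_mono (fun ξ₁ r s n w h => (creP_congr ?_).trans (creP_add _ _ r s n w))
        r s n w h3
      refine allP_mono (fun ξ₂ r s n w h => ?_) r s n w h
      simpa only [annZ_add, Pi.add_apply, mul_add] using integral_add h.1 h.2
  smul c φ r s n w h1 := by
    refine ⟨?_, ?_⟩
    · refine allE_mono (fun ξ₁ => allP_mono fun ξ₂ r s n w h => ?_) r s n w h1
      simpa only [annZ_smul, Pi.smul_apply, smul_eq_mul, mul_left_comm] using h.const_mul c
    · refine (creE_congr ?_).trans (creE_smul c _ r s n w)
      refine allE_of (fun ξ₁ r s n w => (creP_congr ?_).trans (creP_smul c _ r s n w)) r s n w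
      refine allP_of (fun ξ₂ r s n w => ?_) r s n w
      simp only [annZ_smul, Pi.smul_apply, smul_eq_mul, mul_left_comm _ c]
      exact integral_const_mul c _

/-- The formula `∫ conj F(ξ₁, ξ₂, ξ₃) a^*(ξ₃) b_-(ξ₂) b_+(ξ₁) dξ₁ dξ₂ dξ₃`. -/
def formalOneStar (F : Kernel3) : FormalOp where
  conv φ := allZ fun ξ₃ => fun r s n w =>
    Integrable (fun ξ : Fermion × Fermion =>
      conj (F ξ.1 ξ.2 ξ₃) * annP ξ.2 (annE ξ.1 φ) r s n w) (muF.prod muF)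
  app φ := creZ fun ξ₃ => fun r s n w =>
    ∫ ξ : Fermion × Fermion,
      conj (F ξ.1 ξ.2 ξ₃) * annP ξ.2 (annE ξ.1 φ) r s n w ∂(muF.prod muF)
  congr φ ψ h r s n := by
    have h1 : ∀ r s n, ∀ᵐ w ∂muS r s n, ∀ᵐ ξ ∂muF.prod muF,
        annP ξ.2 (annE ξ.1 φ) r s n w = annP ξ.2 (annE ξ.1 ψ) r s n w := by
      intro r s n
      filter_upwards [Measure.ae_ae_of_ae_prod
        ((quasiMeasurePreserving_addEP r s n).ae (h (r + 1) (s + 1) n))] with w hw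
      filter_upwards [hw] with ξ hξ
      simp only [annP, annE, hξ]
    filter_upwards [ae_allZ h1 r s n] with w hw hc
    have h2 := allZ_and hw hc
    refine ⟨allZ_mono (fun ξ₃ r s n w h => ?_) r s n w h2,
      creZ_congr (allZ_mono (fun ξ₃ r s n w h => ?_) r s n w h2)⟩
    · exact h.2.congr (h.1.mono fun ξ e => by simp only [e])
    · exact integral_congr_ae (h.1.mono fun ξ e => by simp only [e])
  zero r s n w := by
    refine ⟨allZ_of (fun ξ₃ r s n w => ?_) r s n w, ?_⟩
    · simp [annE_zero, annP_zero]
    · refine (creZ_congr (Θ' := fun _ => 0) (allZ_of (fun ξ₃ r s n w => ?_) r s n w)).trans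
        (creZ_zero r s n w)
      simp [annE_zero, annP_zero]
  add φ ψ r s n w h1 h2 := by
    have h3 := allZ_and h1 h2
    refine ⟨allZ_mono (fun ξ₃ r s n w h => ?_) r s n w h3,
      (creZ_congr (allZ_mono (fun ξ₃ r s n w h => ?_) r s n w h3)).trans
        (creZ_add _ _ r s n w)⟩
    · simp only [annE_add, annP_add, Pi.add_apply, mul_add]
      exact h.1.add h.2
    · simpa only [annE_add, annP_add, Pi.add_apply, mul_add] using integral_add h.1 h.2
  smul c φ r s n w h1 := by
    refine ⟨allZ_mono (fun ξ₃ r s n w h => ?_) r s n w h1,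
      (creZ_congr (allZ_of (fun ξ₃ r s n w => ?_) r s n w)).trans (creZ_smul c _ r s n w)⟩
    · simpa only [annE_smul, annP_smul, Pi.smul_apply, smul_eq_mul, mul_left_comm]
        using h.const_mul c
    · simp only [annE_smul, annP_smul, Pi.smul_apply, smul_eq_mul, mul_left_comm _ c]
      exact integral_const_mul c _

/-- The formula `∫ F(ξ₁, ξ₂, ξ₃) b_+^*(ξ₁) b_-^*(ξ₂) a^*(ξ₃) dξ₁ dξ₂ dξ₃`. -/
def formalTwo (F : Kernel3) : FormalOp where
  conv _ _ _ _ _ := True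
  app φ := creE fun ξ₁ => creP fun ξ₂ => creZ fun ξ₃ => F ξ₁ ξ₂ ξ₃ • φ
  congr φ ψ h r s n := by
    filter_upwards [ae_allE (ae_allP (ae_allZ h)) r s n] with w hw _
    refine ⟨trivial, creE_congr (allE_mono (fun ξ₁ r s n w h => creP_congr
      (allP_mono (fun ξ₂ r s n w h => creZ_congr
        (allZ_mono (fun ξ₃ r s n w h => ?_) r s n w h)) r s n w h)) r s n w hw)⟩
    simp only [Pi.smul_apply, h]
  zero r s n w := by
    refine ⟨trivial, ?_⟩
    refine (creE_congr (Θ' := fun _ => 0) (allE_of (fun ξ₁ r s n w => ?_) r s n w)).trans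
      (creE_zero r s n w)
    refine (creP_congr (Θ' := fun _ => 0) (allP_of (fun ξ₂ r s n w => ?_) r s n w)).trans
      (creP_zero r s n w)
    refine (creZ_congr (Θ' := fun _ => 0) (allZ_of (fun ξ₃ r s n w => ?_) r s n w)).trans
      (creZ_zero r s n w)
    simp
  add φ ψ r s n w _ _ := by
    refine ⟨trivial, (creE_congr (allE_of (fun ξ₁ r s n w => ?_) r s n w)).trans
      (creE_add _ _ r s n w)⟩
    refine (creP_congr (allP_of (fun ξ₂ r s n w => ?_) r s n w)).trans (creP_add _ _ r s n w)
    refine (creZ_congr (allZ_of (fun ξ₃ r s n w => ?_) r s n w)).trans (creZ_add _ _ r s n w)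
    rw [smul_add]
  smul c φ r s n w _ := by
    refine ⟨trivial, (creE_congr (allE_of (fun ξ₁ r s n w => ?_) r s n w)).trans
      (creE_smul c _ r s n w)⟩
    refine (creP_congr (allP_of (fun ξ₂ r s n w => ?_) r s n w)).trans (creP_smul c _ r s n w)
    refine (creZ_congr (allZ_of (fun ξ₃ r s n w => ?_) r s n w)).trans (creZ_smul c _ r s n w)
    rw [smul_comm]

/-- The formula `∫ conj F(ξ₁, ξ₂, ξ₃) a(ξ₃) b_-(ξ₂) b_+(ξ₁) dξ₁ dξ₂ dξ₃`. -/
def formalTwoStar (F : Kernel3) : FormalOp where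
  conv φ r s n w :=
    Integrable (fun ξ : Fermion × Fermion × Boson =>
      conj (F ξ.1 ξ.2.1 ξ.2.2) * annZ ξ.2.2 (annP ξ.2.1 (annE ξ.1 φ)) r s n w) muFFB
  app φ r s n w :=
    ∫ ξ : Fermion × Fermion × Boson,
      conj (F ξ.1 ξ.2.1 ξ.2.2) * annZ ξ.2.2 (annP ξ.2.1 (annE ξ.1 φ)) r s n w ∂muFFB
  congr φ ψ h r s n := by
    filter_upwards [Measure.ae_ae_of_ae_prod
      ((quasiMeasurePreserving_addEPZ r s n).ae (h (r + 1) (s + 1) (n + 1)))] with w hw hc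
    have e : ∀ᵐ ξ ∂muFFB, conj (F ξ.1 ξ.2.1 ξ.2.2) *
        annZ ξ.2.2 (annP ξ.2.1 (annE ξ.1 φ)) r s n w = conj (F ξ.1 ξ.2.1 ξ.2.2) *
        annZ ξ.2.2 (annP ξ.2.1 (annE ξ.1 ψ)) r s n w := by
      filter_upwards [hw] with ξ hξ
      simp only [annZ, annP, annE, hξ]
    exact ⟨hc.congr e, (integral_congr_ae e).symm⟩
  zero r s n w := by simp [annE_zero, annP_zero, annZ_zero]
  add φ ψ r s n w h1 h2 := by
    simp only [annE_add, annP_add, annZ_add, Pi.add_apply, mul_add]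
    exact ⟨h1.add h2, integral_add h1 h2⟩
  smul c φ r s n w h1 := by
    simp only [annE_smul, annP_smul, annZ_smul, Pi.smul_apply, smul_eq_mul, mul_left_comm _ c]
    exact ⟨h1.const_mul c, integral_const_mul c _⟩

/-- The interaction Hamiltonian `H_I = H_I⁽¹⁾ + H_I⁽¹⁾* + H_I⁽²⁾ + H_I⁽²⁾*` with kernels
`F⁽¹⁾ = h⁽¹⁾ G⁽¹⁾` and `F⁽²⁾ = h⁽²⁾ G⁽²⁾`, on the intersection of the maximal domains of the four
terms. -/
def interactionHam (me mZ gV : ℝ) (f : ℝ → ℝ) (G₁ G₂ : Kernel3) : Fock →ₗ.[ℂ] Fock :=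
  let F₁ : Kernel3 := fun ξ₁ ξ₂ ξ₃ => hOne me mZ gV f ξ₁ ξ₂ ξ₃ * G₁ ξ₁ ξ₂ ξ₃
  let F₂ : Kernel3 := fun ξ₁ ξ₂ ξ₃ => hTwo me mZ gV f ξ₁ ξ₂ ξ₃ * G₂ ξ₁ ξ₂ ξ₃
  (formalOne F₁).op + (formalOneStar F₁).op + (formalTwo F₂).op + (formalTwoStar F₂).op

/-- The total Hamiltonian `H = H_0 + g H_I`, on the intersection of the domains of `H_0` and
`H_I`. -/
def totalHam (me mZ gV : ℝ) (f : ℝ → ℝ) (G₁ G₂ : Kernel3) (g : ℝ) : Fock →ₗ.[ℂ] Fock :=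
  freeHam me mZ + (g : ℂ) • interactionHam me mZ gV f G₁ G₂

/-- The integrability assumptions on a kernel `G`: square integrability, and
`∫ A(ξ₁)² A(ξ₂)² (|k|² + m_Z²)^{1/2} |G(ξ₁, ξ₂, ξ₃)|² dξ₁ dξ₂ dξ₃ < ∞`. -/
structure AdmissibleKernel (me mZ : ℝ) (f : ℝ → ℝ) (G : Kernel3) : Prop where
  memLp : MemLp (fun ξ : Fermion × Fermion × Boson => G ξ.1 ξ.2.1 ξ.2.2) 2 muFFB
  weighted : Integrable (fun ξ : Fermion × Fermion × Boson =>
    weightA me f ξ.1 ^ 2 * weightA me f ξ.2.1 ^ 2 * Real.sqrt (‖ξ.2.2.1‖ ^ 2 + mZ ^ 2) *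
      ‖G ξ.1 ξ.2.1 ξ.2.2‖ ^ 2) muFFB

end ZDecay

end

open MeasureTheory Set
open scoped ENNReal ComplexConjugate ContDiff

noncomputable section

namespace ZDecay

/-! The interaction is infinitesimally small relative to `H_0`, and the theorem is then Kato–Rellich
(`katoRellich`), applied to `g H_I` with relative bound 1/2. Three facts feed it: the kernels `F = h
G` are square integrable; a square integrable kernel gives terms of relative bound zero; the four
terms form two formally adjoint pairs (`AdjPair`), so that their sum is symmetric.

Relative bound. Annihilating an electron, a positron and a boson is, up to sign,
`√((r+1)(s+1)(n+1))` times the contraction of the wave function with `conj F`. The Pauli principle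
(`pauli_principle`) gains the factor `s + 1` in the positron variable, while the other two variables
are treated by Cauchy–Schwarz; there remains `(n+1)(r+1)‖F‖²`, quadratic in the number `N` of
particles (`annTriple_bound`, `annPair_bound`). Each particle has energy at least `min(m_e, m_Z)`,
so `N²` is controlled by `H_0²` (`numSq_le_of_free`), but only with a constant proportional to
`‖F‖²`. For a product kernel `u(ξ₁) G(ξ₂, ξ₃)` the Pauli principle applies to both fermions in turn;
only `n + 1` remains, which is of lower order. Finite sums of product kernels are dense in `L²`, so
`F` splits into such a sum and a remainder of small norm, and the quadratic coefficient becomes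
arbitrarily small (`annBound_small`). The adjoint terms inherit the same bounds by duality, sector
by sector (`AdjPair.bound_left`).

Square integrability. What is needed is `|h| ≤ D (1 + A(ξ₁) A(ξ₂) (1+|k|²)^(1/4))`, uniformly in the
angular quantum numbers (`exists_norm_couplingInt_le`); the two hypotheses on `G` take care of the
two terms. Taking absolute values and using Cauchy–Schwarz in `r` gives `A(ξ₁) A(ξ₂) (1+|k|²)^(1/4)
/ (p₁ p₂)`, since `A` has one power of `p` more than the eigenfunctions; this is good unless `p₁ p₂`
is small. For small `p₁ p₂`, `r ψ` is Lipschitz in `r` with constant proportional to `p`. In polar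
coordinates the radial integral is the Fourier transform, at frequency `k · θ`, of a compactly
supported Lipschitz function, hence of order `p₁ p₂ min(1, |k·θ|^(-1/2))`; the average over
directions is of order `|k|^(-1/2)` at large `|k|` and cancels the growth of the polarization
vectors. Uniformity in `j` comes from elementary bounds: `√(2l+1)` for spherical harmonics,
Lipschitz constants growing like `(2n+3)(3/2)^n`, and a gain `4^(-n)` in the direct estimate, whose
combination is bounded because `(2n+3)² (3/8)^n` is. -/

/-! ## The Kato–Rellich theorem -/

section KatoRellich

variable {E : Type*} [NormedAddCommGroup E] [InnerProductSpace ℂ E]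

/-- For a symmetric operator, `‖(A + i c) x‖² = ‖A x‖² + c² ‖x‖²`. -/
theorem norm_sq_add_I_smul {A : E →ₗ.[ℂ] E} (hsym : ∀ x y : A.domain, inner ℂ (A x) (y : E) =
    inner ℂ (x : E) (A y)) (c : ℝ) (x : A.domain) :
    ‖A x + ((c : ℂ) * Complex.I) • (x : E)‖ ^ 2 = ‖A x‖ ^ 2 + c ^ 2 * ‖(x : E)‖ ^ 2 := by
  have h0 : (inner ℂ (A x) (x : E)).im = 0 := by
    have h1 := hsym x x
    rw [← inner_conj_symm (x : E) (A x)] at h1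
    exact Complex.conj_eq_iff_im.1 h1.symm
  -- The cross term vanishes: `⟨A x, x⟩` is real, so `⟨A x, i c x⟩` is purely imaginary.
  rw [@norm_add_sq ℂ]
  have h2 : RCLike.re (inner ℂ (A x) (((c : ℂ) * Complex.I) • (x : E))) = 0 := by
    rw [inner_smul_right]
    simp [h0]
  rw [h2, norm_smul, norm_mul, Complex.norm_real, Complex.norm_I, mul_one, mul_pow,
    Real.norm_eq_abs, sq_abs]
  ring

variable [CompleteSpace E]

/-- A symmetric operator `A` such that `A + i c` and `A - i c` are onto is self-adjoint. -/
theorem isSelfAdjoint_of_surjective {A : E →ₗ.[ℂ] E}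
    (hsym : ∀ x y : A.domain, inner ℂ (A x) (y : E) = inner ℂ (x : E) (A y))
    {c : ℝ} (hc : 0 < c)
    (hplus : ∀ y : E, ∃ x : A.domain, A x + ((c : ℂ) * Complex.I) • (x : E) = y)
    (hminus : ∀ y : E, ∃ x : A.domain, A x + (((-c : ℝ) : ℂ) * Complex.I) • (x : E) = y) :
    IsSelfAdjoint A := by
  have hdense : Dense (A.domain : Set E) := by
    rw [Submodule.dense_iff_topologicalClosure_eq_top,
      Submodule.topologicalClosure_eq_top_iff, Submodule.eq_bot_iff]
    -- A vector orthogonal to the domain can be written `(A + i c) x`; pairing it with `x` and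
    -- taking imaginary parts gives `c ‖x‖² = 0`.
    intro y hy
    obtain ⟨x, rfl⟩ := hplus y
    have h1 := hy x x.2
    have h2 : inner ℂ (x : E) (A x) = -((c : ℂ) * Complex.I) * inner ℂ (x : E) (x : E) := by
      rw [inner_add_right, inner_smul_right] at h1
      linear_combination h1
    have h0 : (inner ℂ (x : E) (A x)).im = 0 := by
      have h1 := hsym x x
      rw [← inner_conj_symm (A x) (x : E)] at h1
      exact Complex.conj_eq_iff_im.1 h1
    rw [h2, inner_self_eq_norm_sq_to_K] at h0
    have h3 : c * ‖(x : E)‖ ^ 2 = 0 := by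
      have : (-((c : ℂ) * Complex.I) * (((‖(x : E)‖ : ℝ) : ℂ)) ^ 2).im = -(c * ‖(x : E)‖ ^ 2) := by
        rw [← Complex.ofReal_pow, neg_mul, Complex.neg_im, mul_right_comm, ← Complex.ofReal_mul,
        Complex.im_ofReal_mul, Complex.I_im, mul_one]
      rw [← neg_eq_zero, ← this]; exact h0
    have h4 : (x : E) = 0 := by
      rcases mul_eq_zero.1 h3 with h | h
      · exact absurd h hc.ne'
      · exact norm_eq_zero.1 (pow_eq_zero_iff two_ne_zero |>.1 h)
    have h5 : x = 0 := Subtype.ext h4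
    simp [h5]
  have hform : A.IsFormalAdjoint A := fun x y => hsym x y
  have hle : A ≤ A.adjoint := hform.le_adjoint hdense
  rw [LinearPMap.isSelfAdjoint_def]
  refine (LinearPMap.eq_of_le_of_domain_eq hle (le_antisymm hle.1 ?_)).symm
  intro y hy
  -- For `y` in the domain of the adjoint, solve `(A - i c) x = (A* - i c) y` inside the domain of
  -- `A`. Then `y - x` is orthogonal to the range of `A + i c`, which is everything.
  obtain ⟨x, hx⟩ := hminus (A.adjoint ⟨y, hy⟩ + (((-c : ℝ) : ℂ) * Complex.I) • y)
  suffices h : y = x by rw [h]; exact x.2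
  obtain ⟨z, hz⟩ := hplus (y - x)
  have h1 := LinearPMap.adjoint_isFormalAdjoint hdense ⟨y, hy⟩ z
  have h2 := hsym x z
  have h3 : inner ℂ (y - (x : E)) (A z + ((c : ℂ) * Complex.I) • (z : E)) = 0 := by
    rw [inner_add_right, inner_smul_right, inner_sub_left, inner_sub_left, ← h2]
    have h1' : inner ℂ y (A z) = inner ℂ (A.adjoint ⟨y, hy⟩) (z : E) := h1.symm
    rw [h1']
    have h4 : A.adjoint ⟨y, hy⟩ = A x + (((-c : ℝ) : ℂ) * Complex.I) • (x : E) -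
      (((-c : ℝ) : ℂ) * Complex.I) • y := by rw [hx]; abel
    rw [h4, inner_sub_left, inner_add_left, inner_smul_left, inner_smul_left]
    simp only [map_mul, Complex.conj_ofReal, Complex.conj_I]
    push_cast
    ring
  rw [hz, inner_self_eq_zero, sub_eq_zero] at h3
  exact h3

/-- Perturbation of surjectivity of `A + i c` by a relatively bounded operator. -/
theorem surjective_add_of_relBounded {A V : E →ₗ.[ℂ] E} (hdom : A.domain ≤ V.domain)
    (hsym : ∀ x y : A.domain, inner ℂ (A x) (y : E) = inner ℂ (x : E) (A y))
    {a b : ℝ} (ha : 0 ≤ a) (hb : 0 ≤ b)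
    (hV : ∀ x : A.domain, ‖V ⟨x, hdom x.2⟩‖ ≤ a * ‖A x‖ + b * ‖(x : E)‖)
    {c : ℝ} (hc : c ≠ 0) (hlt : a + b / |c| < 1)
    (hsurj : ∀ y : E, ∃ x : A.domain, A x + ((c : ℂ) * Complex.I) • (x : E) = y) (y : E) :
    ∃ x : A.domain, A x + V ⟨x, hdom x.2⟩ + ((c : ℂ) * Complex.I) • (x : E) = y := by
  -- `‖(A + i c) x‖` dominates both `‖A x‖` and `|c| ‖x‖`, so `V (A + i c)⁻¹` has norm at most `a +
  -- b/|c| < 1`. Then `A + V + i c = (1 + V (A + i c)⁻¹)(A + i c)` is onto, by the Neumann series.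
  let S : A.domain →ₗ[ℂ] E := A.toFun + ((c : ℂ) * Complex.I) • A.domain.subtype
  have hS : ∀ x, S x = A x + ((c : ℂ) * Complex.I) • (x : E) := fun x => rfl
  have hnorm : ∀ x, ‖S x‖ ^ 2 = ‖A x‖ ^ 2 + c ^ 2 * ‖(x : E)‖ ^ 2 := fun x => by
    rw [hS]; exact norm_sq_add_I_smul hsym c x
  have h1 : ∀ x, ‖A x‖ ≤ ‖S x‖ := fun x => by
    refine le_of_sq_le_sq ?_ (norm_nonneg _)
    rw [hnorm]; nlinarith [mul_nonneg (sq_nonneg c) (sq_nonneg ‖(x : E)‖)]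
  have h2 : ∀ x : A.domain, ‖(x : E)‖ ≤ ‖S x‖ / |c| := fun x => by
    rw [le_div_iff₀ (abs_pos.2 hc)]
    refine le_of_sq_le_sq ?_ (norm_nonneg _)
    rw [hnorm, mul_pow, sq_abs]; nlinarith [sq_nonneg ‖A x‖]
  have hbij : Function.Bijective S := by
    refine ⟨?_, fun y => hsurj y⟩
    rw [injective_iff_map_eq_zero]
    intro x hx
    have := h2 x
    rw [hx, norm_zero, zero_div] at this
    exact Subtype.ext (norm_le_zero_iff.1 this)
  let e := LinearEquiv.ofBijective S hbij
  have he : ∀ y, S (e.symm y) = y := fun y => e.apply_symm_apply y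
  let K0 : E →ₗ[ℂ] E := (V.toFun.comp (Submodule.inclusion hdom)).comp e.symm.toLinearMap
  have hK0 : ∀ y, K0 y = V ⟨e.symm y, hdom (e.symm y).2⟩ := fun y => rfl
  let K : E →L[ℂ] E := K0.mkContinuous (a + b / |c|) fun y => by
    rw [hK0]
    refine (hV _).trans ?_
    have e1 := h1 (e.symm y)
    have e2 := h2 (e.symm y)
    rw [he] at e1 e2
    calc a * ‖A (e.symm y)‖ + b * ‖((e.symm y : A.domain) : E)‖
        ≤ a * ‖y‖ + b * (‖y‖ / |c|) := by gcongr
      _ = (a + b / |c|) * ‖y‖ := by ring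
  have hK : ‖-K‖ < 1 := by
    rw [norm_neg]
    exact (LinearMap.mkContinuous_norm_le _ (by positivity) _).trans_lt hlt
  have hunit : IsUnit (1 + K) := by
    have := isUnit_one_sub_of_norm_lt_one hK
    rwa [sub_neg_eq_add] at this
  obtain ⟨u, hu⟩ := hunit
  let z : E := (↑u⁻¹ : E →L[ℂ] E) y
  have hz : z + K z = y := by
    have : (1 + K) z = y := by
      rw [← hu]
      change ((u : E →L[ℂ] E) * (↑u⁻¹ : E →L[ℂ] E)) y = y
      rw [Units.mul_inv]; rfl
    simpa using this
  refine ⟨e.symm z, ?_⟩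
  have e1 := he z
  rw [hS] at e1
  have e2 : K z = V ⟨e.symm z, hdom (e.symm z).2⟩ := rfl
  rw [← e2, add_right_comm, e1, hz]

/-- Kato–Rellich: a symmetric perturbation with relative bound less than one of a symmetric
operator `A` with `A ± i c` onto. -/
theorem katoRellich {A V : E →ₗ.[ℂ] E} (hdom : A.domain ≤ V.domain)
    (hsym : ∀ x y : A.domain, inner ℂ (A x) (y : E) = inner ℂ (x : E) (A y))
    (hVsym : ∀ x y : A.domain, inner ℂ (V ⟨x, hdom x.2⟩) (y : E) =
      inner ℂ (x : E) (V ⟨y, hdom y.2⟩))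
    {a b : ℝ} (ha : 0 ≤ a) (ha1 : a < 1) (hb : 0 ≤ b)
    (hV : ∀ x : A.domain, ‖V ⟨x, hdom x.2⟩‖ ≤ a * ‖A x‖ + b * ‖(x : E)‖)
    (hsurj : ∀ c : ℝ, c ≠ 0 → ∀ y : E, ∃ x : A.domain,
      A x + ((c : ℂ) * Complex.I) • (x : E) = y) :
    IsSelfAdjoint (A + V) ∧ (A + V).domain = A.domain ∧
      ∀ D : Submodule ℂ E, A.HasCore D → (A + V).HasCore D := by
  have hD : (A + V).domain = A.domain := by
    rw [LinearPMap.add_domain]; exact inf_eq_left.2 hdom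
  have hval : ∀ (x : E) (hx : x ∈ (A + V).domain) (hx' : x ∈ A.domain),
      (A + V) ⟨x, hx⟩ = A ⟨x, hx'⟩ + V ⟨x, hdom hx'⟩ := fun x hx hx' =>
    LinearPMap.add_apply A V ⟨x, hx⟩
  have hsa : IsSelfAdjoint (A + V) := by
    obtain ⟨c, hc0, hc⟩ : ∃ c : ℝ, 0 < c ∧ a + b / c < 1 := by
      -- With this choice `b / c = (1 - a) b / (b + 1) < 1 - a`.
      refine ⟨(b + 1) / (1 - a), div_pos (by linarith) (by linarith), ?_⟩
      rw [div_div_eq_mul_div, ← lt_sub_iff_add_lt', div_lt_iff₀ (by linarith)]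
      nlinarith
    refine isSelfAdjoint_of_surjective (c := c) ?_ hc0 ?_ ?_
    · rintro ⟨x, hx⟩ ⟨y, hy⟩
      have hx' := hD ▸ hx
      have hy' := hD ▸ hy
      rw [hval x hx hx', hval y hy hy', inner_add_left, inner_add_right]
      exact congrArg₂ (· + ·) (hsym ⟨x, hx'⟩ ⟨y, hy'⟩) (hVsym ⟨x, hx'⟩ ⟨y, hy'⟩)
    · intro y
      obtain ⟨x, hx⟩ := surjective_add_of_relBounded hdom hsym ha hb hV hc0.ne'
        (by rwa [abs_of_pos hc0]) (hsurj c hc0.ne') y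
      exact ⟨⟨x, hD.symm ▸ x.2⟩, by rw [hval x _ x.2]; exact hx⟩
    · intro y
      obtain ⟨x, hx⟩ := surjective_add_of_relBounded hdom hsym ha hb hV (neg_ne_zero.2 hc0.ne')
        (by rwa [abs_neg, abs_of_pos hc0]) (hsurj (-c) (neg_ne_zero.2 hc0.ne')) y
      exact ⟨⟨x, hD.symm ▸ x.2⟩, by rw [hval x _ x.2]; exact hx⟩
  refine ⟨hsa, hD, fun D hcore => ?_⟩
  have hDle : D ≤ (A + V).domain := hD.symm ▸ hcore.le_domain
  refine ⟨hDle, ?_⟩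
  have hclosed := hsa.isClosed
  have hrle : (A + V).domRestrict D ≤ A + V := LinearPMap.domRestrict_le
  have hrcl : ((A + V).domRestrict D).IsClosable := hclosed.isClosable.leIsClosable hrle
  -- By convention the closure of a non-closable map is the map itself; the core property would then
  -- identify it with `A`, which is closed.
  have hAr : (A.domRestrict D).IsClosable := by
    by_contra h
    have h1 := LinearPMap.closure_def' h
    rw [hcore.closure_eq] at h1
    have hAs : IsSelfAdjoint A := isSelfAdjoint_of_surjective hsym one_pos
      (hsurj 1 one_ne_zero) (hsurj (-1) (by norm_num))
    exact h (h1 ▸ hAs.isClosed.isClosable)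
  refine LinearPMap.eq_of_eq_graph ?_
  rw [← hrcl.graph_closure_eq_closure_graph]
  refine le_antisymm ?_ ?_
  · refine Submodule.topologicalClosure_minimal _ (LinearPMap.le_graph_of_le hrle) hclosed
  · rintro ⟨x, y⟩ hxy
    rw [LinearPMap.mem_graph_iff] at hxy
    obtain ⟨⟨x', hx'⟩, rfl, rfl⟩ := hxy
    have hxA : x' ∈ A.domain := hD ▸ hx'
    have h1 : (x', A ⟨x', hxA⟩) ∈ (A.domRestrict D).graph.topologicalClosure := by
      rw [hAr.graph_closure_eq_closure_graph, hcore.closure_eq]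
      exact LinearPMap.mem_graph A ⟨x', hxA⟩
    rw [← SetLike.mem_coe, Submodule.topologicalClosure_coe, Metric.mem_closure_iff] at h1 ⊢
    intro ε hε
    -- Approximation in the graph of `A` is also approximation in the graph of `A + V`: an error `η`
    -- becomes less than `η + (a + b) η`, and `a ≤ 1` makes this at most `(2 + b) η`.
    obtain ⟨⟨z, w⟩, hz, hdist⟩ := h1 (ε / (2 + b)) (by positivity)
    rw [SetLike.mem_coe, LinearPMap.mem_graph_iff] at hz
    obtain ⟨⟨z', hz'⟩, rfl, rfl⟩ := hz
    have hz1 : z' ∈ D := hz'.1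
    have hz2 : z' ∈ A.domain := hcore.le_domain hz1
    have hzr : z' ∈ ((A + V).domRestrict D).domain := ⟨hz1, hDle hz1⟩
    refine ⟨(z', (A + V).domRestrict D ⟨z', hzr⟩), LinearPMap.mem_graph _ ⟨z', hzr⟩, ?_⟩
    have e1 : (A + V).domRestrict D ⟨z', hzr⟩ = A ⟨z', hz2⟩ + V ⟨z', hdom hz2⟩ := by
      rw [← hval z' (hDle hz1) hz2]; exact LinearPMap.domRestrict_apply rfl
    have e2 : A.domRestrict D ⟨z', hz'⟩ = A ⟨z', hz2⟩ := LinearPMap.domRestrict_apply rfl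
    rw [Prod.dist_eq, max_lt_iff] at hdist ⊢
    simp only [e1, e2, hval x' hx' hxA] at hdist ⊢
    obtain ⟨d1, d2⟩ := hdist
    have hpos : 0 < 2 + b := by positivity
    have hε1 : ε / (2 + b) ≤ ε := div_le_self hε.le (by linarith)
    refine ⟨d1.trans_le hε1, ?_⟩
    have hsub := hV (⟨x', hxA⟩ - ⟨z', hz2⟩)
    have hV1 : V ⟨((⟨x', hxA⟩ - ⟨z', hz2⟩ : A.domain) : E),
        hdom (⟨x', hxA⟩ - ⟨z', hz2⟩ : A.domain).2⟩ = V ⟨x', hdom hxA⟩ - V ⟨z', hdom hz2⟩ := by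
      rw [← LinearPMap.map_sub]; rfl
    rw [hV1, LinearPMap.map_sub, ← dist_eq_norm, ← dist_eq_norm] at hsub
    have hsub' : dist (V ⟨x', hdom hxA⟩) (V ⟨z', hdom hz2⟩) ≤
        a * dist (A ⟨x', hxA⟩) (A ⟨z', hz2⟩) + b * dist x' z' := by
      rw [dist_eq_norm x' z']; exact hsub
    calc _ ≤ dist (A ⟨x', hxA⟩) (A ⟨z', hz2⟩) + dist (V ⟨x', hdom hxA⟩) (V ⟨z', hdom hz2⟩) :=
          dist_add_add_le _ _ _ _
      _ ≤ dist (A ⟨x', hxA⟩) (A ⟨z', hz2⟩) + (1 * dist (A ⟨x', hxA⟩) (A ⟨z', hz2⟩) +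
          b * dist x' z') := by
          gcongr
          exact hsub'.trans (by gcongr)
      _ < ε / (2 + b) + (1 * (ε / (2 + b)) + b * (ε / (2 + b))) := by
          have := mul_le_mul_of_nonneg_left d1.le hb
          linarith
      _ = ε := by field_simp; ring

end KatoRellich

/-! ## Antisymmetric functions and antisymmetrized sums -/

section Antisymmetry

/-- For a permutation `σ` of `r + 1` letters and a letter `i`, the permutation of `r` letters
that remains after deleting `i` from the source and `σ i` from the target. -/
theorem exists_perm_succAbove {r : ℕ} (σ : Equiv.Perm (Fin (r + 1))) (i : Fin (r + 1)) :
    ∃ τ : Equiv.Perm (Fin r), (∀ j, σ (i.succAbove j) = (σ i).succAbove (τ j)) ∧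
      ((Equiv.Perm.sign τ : ℤˣ) : ℂ) * (-1) ^ (i : ℕ) =
        ((Equiv.Perm.sign σ : ℤˣ) : ℂ) * (-1) ^ (σ i : ℕ) := by
  -- The cycle `i.cycleRange` brings `i` to the front, keeps the order of the other letters and has
  -- sign `(-1) ^ i`. Flanking `σ` by two such cycles gives a permutation that fixes `0`; `τ` is its
  -- action on the remaining letters.
  let ρ : Equiv.Perm (Fin (r + 1)) := (σ i).cycleRange * σ * i.cycleRange.symm
  obtain ⟨⟨p, τ⟩, hτ⟩ := Equiv.Perm.decomposeFin.symm.surjective ρ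
  have h0 : ρ 0 = 0 := by
    simp [ρ, Fin.cycleRange_symm_zero, Fin.cycleRange_self]
  have hp : p = 0 := by
    rw [← h0, ← hτ, Equiv.Perm.decomposeFin_symm_apply_zero]
  subst hp
  refine ⟨τ, fun j => ?_, ?_⟩
  · have h1 : ρ j.succ = (τ j).succ := by
      rw [← hτ, Equiv.Perm.decomposeFin_symm_apply_succ]; simp
    have h2 : (σ i).cycleRange (σ (i.succAbove j)) = (τ j).succ := by
      rw [← h1]; simp [ρ, Fin.cycleRange_symm_succ]
    rw [← Fin.cycleRange_symm_succ (σ i), ← h2, Equiv.symm_apply_apply]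
  · have h1 : Equiv.Perm.sign ρ = Equiv.Perm.sign τ := by
      rw [← hτ, Equiv.Perm.decomposeFin.symm_sign]; simp
    have h2 : Equiv.Perm.sign ρ = (-1) ^ (σ i : ℕ) * Equiv.Perm.sign σ * (-1) ^ (i : ℕ) := by
      have : i.cycleRange.symm = (i.cycleRange)⁻¹ := rfl
      simp only [ρ, Equiv.Perm.sign_mul, this, Equiv.Perm.sign_inv, Fin.sign_cycleRange]
    rw [← h1, h2]
    push_cast
    rw [mul_assoc, ← mul_pow]
    simp [mul_comm]

variable {X : Type*} {r : ℕ}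

/-- Antisymmetric functions of `r` variables. -/
def IsAnti (φ : (Fin r → X) → ℂ) : Prop :=
  ∀ (σ : Equiv.Perm (Fin r)) (x : Fin r → X),
    φ (x ∘ σ) = ((Equiv.Perm.sign σ : ℤˣ) : ℂ) * φ x

/-- Symmetric functions of `r` variables. -/
def IsSymmFun (φ : (Fin r → X) → ℂ) : Prop :=
  ∀ (σ : Equiv.Perm (Fin r)) (x : Fin r → X), φ (x ∘ σ) = φ x

/-- The antisymmetrized sum `∑ (-1)^i Θ(x_i; x_0, …, x̂_i, …, x_r)`. -/
def antiSum (Θ : X → (Fin r → X) → ℂ) (x : Fin (r + 1) → X) : ℂ :=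
  ∑ i : Fin (r + 1), (-1) ^ (i : ℕ) * Θ (x i) (x ∘ i.succAbove)

/-- Relabelling by `σ` carries the `i`-th summand to the `σ i`-th one; the sign of the induced
permutation of the remaining variables combines with `(-1) ^ i` as in `exists_perm_succAbove`. -/
theorem isAnti_antiSum {Θ : X → (Fin r → X) → ℂ} (h : ∀ ξ, IsAnti (Θ ξ)) :
    IsAnti (antiSum Θ) := by
  intro σ x
  simp only [antiSum]
  rw [Finset.mul_sum]
  refine Fintype.sum_equiv σ _ _ fun i => ?_
  obtain ⟨τ, h1, h2⟩ := exists_perm_succAbove σ i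
  have h3 : (x ∘ σ) ∘ i.succAbove = (x ∘ (σ i).succAbove) ∘ τ := by
    funext j; simp [h1 j]
  rw [h3, h, Function.comp_apply, ← mul_assoc, ← mul_assoc, mul_comm ((-1 : ℂ) ^ (i : ℕ)), h2]

theorem isSymmFun_sum {Θ : X → (Fin r → X) → ℂ} (h : ∀ ξ, IsSymmFun (Θ ξ)) :
    IsSymmFun (fun x : Fin (r + 1) → X => ∑ i : Fin (r + 1), Θ (x i) (x ∘ i.succAbove)) := by
  intro σ x
  refine Fintype.sum_equiv σ _ _ fun i => ?_
  obtain ⟨τ, h1, -⟩ := exists_perm_succAbove σ i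
  have h3 : (x ∘ σ) ∘ i.succAbove = (x ∘ (σ i).succAbove) ∘ τ := by
    funext j; simp [h1 j]
  rw [h3, h, Function.comp_apply]

/-- Bringing the `i`-th variable to the front is a cycle of sign `(-1) ^ i`. Because of this, all
summands of an antisymmetrized sum contribute equally when paired with an antisymmetric function. -/
theorem IsAnti.eq_cons {φ : (Fin (r + 1) → X) → ℂ} (h : IsAnti φ) (i : Fin (r + 1))
    (x : Fin (r + 1) → X) : φ x = (-1) ^ (i : ℕ) * φ (Fin.cons (x i) (x ∘ i.succAbove)) := by
  have h1 : (Fin.cons (x i) (x ∘ i.succAbove) : Fin (r + 1) → X) = x ∘ i.cycleRange.symm := by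
    funext j
    refine Fin.cases ?_ (fun j => ?_) j
    · simp [Fin.cycleRange_symm_zero]
    · simp [Fin.cycleRange_symm_succ]
  have h2 : i.cycleRange.symm = (i.cycleRange)⁻¹ := rfl
  rw [h1, h, h2, Equiv.Perm.sign_inv, Fin.sign_cycleRange]
  push_cast
  rw [← mul_assoc, ← mul_pow]
  simp

theorem IsSymmFun.eq_cons {φ : (Fin (r + 1) → X) → ℂ} (h : IsSymmFun φ) (i : Fin (r + 1))
    (x : Fin (r + 1) → X) : φ x = φ (Fin.cons (x i) (x ∘ i.succAbove)) := by
  have h1 : (Fin.cons (x i) (x ∘ i.succAbove) : Fin (r + 1) → X) = x ∘ i.cycleRange.symm := by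
    funext j
    refine Fin.cases ?_ (fun j => ?_) j
    · simp [Fin.cycleRange_symm_zero]
    · simp [Fin.cycleRange_symm_succ]
  rw [h1, h]

/-- The permutation of `r + 1` letters that fixes the first one and acts as `σ` on the others. -/
def consPerm (σ : Equiv.Perm (Fin r)) : Equiv.Perm (Fin (r + 1)) :=
  Equiv.Perm.decomposeFin.symm (0, σ)

theorem sign_consPerm (σ : Equiv.Perm (Fin r)) :
    Equiv.Perm.sign (consPerm σ) = Equiv.Perm.sign σ := by
  simp [consPerm, Equiv.Perm.decomposeFin.symm_sign]

theorem cons_comp_consPerm (σ : Equiv.Perm (Fin r)) (ξ : X) (x : Fin r → X) :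
    (Fin.cons ξ x : Fin (r + 1) → X) ∘ consPerm σ = Fin.cons ξ (x ∘ σ) := by
  funext j
  refine Fin.cases ?_ (fun j => ?_) j
  · simp [consPerm]
  · simp [consPerm, Equiv.Perm.decomposeFin_symm_apply_succ]

theorem IsAnti.cons {φ : (Fin (r + 1) → X) → ℂ} (h : IsAnti φ) (ξ : X) :
    IsAnti (fun w : Fin r → X => φ (Fin.cons ξ w)) := by
  intro σ x
  rw [← sign_consPerm, ← h, cons_comp_consPerm]

theorem IsSymmFun.cons {φ : (Fin (r + 1) → X) → ℂ} (h : IsSymmFun φ) (ξ : X) :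
    IsSymmFun (fun w : Fin r → X => φ (Fin.cons ξ w)) := by
  intro σ x
  simp only
  rw [← cons_comp_consPerm, h]

end Antisymmetry

/-! ## Square integrable functions -/

section SquareIntegrable

variable {α β : Type*} [MeasurableSpace α] [MeasurableSpace β] {μ : Measure α} {ν : Measure β}

theorem eLpNorm_two_sq (f : α → ℂ) : eLpNorm f 2 μ ^ 2 = ∫⁻ x, ‖f x‖ₑ ^ 2 ∂μ := by
  have h := eLpNorm_nnreal_pow_eq_lintegral (f := f) (μ := μ) (p := 2) two_ne_zero
  simpa using h

theorem memLp_two_iff {f : α → ℂ} (hf : AEStronglyMeasurable f μ) :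
    MemLp f 2 μ ↔ ∫⁻ x, ‖f x‖ₑ ^ 2 ∂μ < ⊤ := by
  rw [← eLpNorm_two_sq]
  constructor
  · exact fun h => ENNReal.pow_lt_top h.2
  · intro h
    exact ⟨hf, (ENNReal.pow_lt_top_iff.1 h).resolve_right two_ne_zero⟩

theorem integrable_conj_mul {f g : α → ℂ} (hf : MemLp f 2 μ) (hg : MemLp g 2 μ) :
    Integrable (fun x => conj (f x) * g x) μ :=
  MemLp.integrable_mul (p := 2) (q := 2) hf.star hg

theorem integral_conj_mul_self (f : α → ℂ) (hf : AEStronglyMeasurable f μ) :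
    ∫ x, conj (f x) * f x ∂μ = (((∫⁻ x, ‖f x‖ₑ ^ 2 ∂μ).toReal : ℝ) : ℂ) := by
  have h1 : ∀ x, conj (f x) * f x = ((‖f x‖ ^ 2 : ℝ) : ℂ) := fun x => by
    rw [Complex.conj_mul']; push_cast; rfl
  simp only [h1]
  rw [integral_complex_ofReal, integral_eq_lintegral_of_nonneg_ae (f := fun x => ‖f x‖ ^ 2)
    (Filter.Eventually.of_forall fun x => by positivity) (hf.norm.pow 2)]
  congr 2
  refine lintegral_congr fun x => ?_
  rw [ENNReal.ofReal_pow (norm_nonneg _), ofReal_norm]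

/-- Cauchy–Schwarz. -/
theorem lintegral_sqrt_mul_sq_le {a b : α → ℝ≥0∞} (ha : Measurable a) (hb : Measurable b) :
    (∫⁻ x, (a x * b x) ^ (1 / 2 : ℝ) ∂μ) ^ 2 ≤ (∫⁻ x, a x ∂μ) * ∫⁻ x, b x ∂μ := by
  have h := ENNReal.lintegral_mul_le_Lp_mul_Lq μ (p := 2) (q := 2) Real.HolderConjugate.two_two
    (f := fun x => a x ^ (1 / 2 : ℝ)) (g := fun x => b x ^ (1 / 2 : ℝ))
    (ha.pow_const _).aemeasurable (hb.pow_const _).aemeasurable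
  simp only [← ENNReal.rpow_mul] at h
  have e : (1 / 2 * 2 : ℝ) = 1 := by norm_num
  simp only [e, ENNReal.rpow_one, Pi.mul_apply] at h
  simp only [ENNReal.mul_rpow_of_nonneg _ _ (show (0 : ℝ) ≤ 1 / 2 by norm_num)]
  refine (pow_le_pow_left' h 2).trans ?_
  rw [mul_pow, ← ENNReal.rpow_natCast, ← ENNReal.rpow_natCast, ← ENNReal.rpow_mul,
    ← ENNReal.rpow_mul]
  norm_num

variable [SigmaFinite ν]

theorem MemLp.slice {f : α × β → ℂ} (hf : MemLp f 2 (μ.prod ν)) :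
    ∀ᵐ x ∂μ, MemLp (fun y => f (x, y)) 2 ν := by
  have h1 := (memLp_two_iff hf.1).1 hf
  rw [lintegral_prod _ (hf.1.enorm.pow_const 2)] at h1
  filter_upwards [ae_lt_top' (hf.1.enorm.pow_const 2).lintegral_prod_right' h1.ne,
    hf.1.prodMk_left] with x hx hx2
  exact (memLp_two_iff hx2).2 hx

theorem memLp_mul_prod {f : α → ℂ} {g : β → ℂ} (hf : MemLp f 2 μ) (hg : MemLp g 2 ν) :
    MemLp (fun z : α × β => f z.1 * g z.2) 2 (μ.prod ν) := by
  have hm : AEStronglyMeasurable (fun z : α × β => f z.1 * g z.2) (μ.prod ν) :=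
    hf.1.comp_fst.mul hg.1.comp_snd
  rw [memLp_two_iff hm]
  simp only [enorm_mul, mul_pow]
  rw [lintegral_prod_mul (hf.1.enorm.pow_const 2) (hg.1.enorm.pow_const 2)]
  exact ENNReal.mul_lt_top ((memLp_two_iff hf.1).1 hf) ((memLp_two_iff hg.1).1 hg)

variable [SigmaFinite μ]

/-- No integrability is needed: if `g` is not integrable, the left side is the default value `0` of
the integral. -/
theorem enorm_integral_prod_le (g : α × β → ℂ) :
    ‖∫ z, g z ∂μ.prod ν‖ₑ ≤ ∫⁻ x, ‖∫ y, g (x, y) ∂ν‖ₑ ∂μ := by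
  by_cases h : Integrable g (μ.prod ν)
  · rw [integral_prod _ h]
    exact enorm_integral_le_lintegral_enorm _
  · rw [integral_undef h]; simp

theorem enorm_integral_prod_symm_le (g : α × β → ℂ) :
    ‖∫ z, g z ∂μ.prod ν‖ₑ ≤ ∫⁻ y, ‖∫ x, g (x, y) ∂μ‖ₑ ∂ν := by
  by_cases h : Integrable g (μ.prod ν)
  · rw [integral_prod_symm _ h]
    exact enorm_integral_le_lintegral_enorm _
  · rw [integral_undef h]; simp

/-- The integral Minkowski inequality combined with Cauchy–Schwarz. -/
theorem lintegral_lintegral_sq_le {χ : α → β → ℝ≥0∞} (hχ : Measurable (Function.uncurry χ))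
    {a b : α → ℝ≥0∞} (ha : Measurable a) (hb : Measurable b)
    (h : ∀ x, ∫⁻ y, χ x y ^ 2 ∂ν ≤ a x * b x) :
    ∫⁻ y, (∫⁻ x, χ x y ∂μ) ^ 2 ∂ν ≤ (∫⁻ x, a x ∂μ) * ∫⁻ x, b x ∂μ := by
  have hm1 : ∀ y, Measurable fun x => χ x y := fun y => hχ.of_uncurry_right
  have hm2 : ∀ x, Measurable (χ x) := fun x => hχ.of_uncurry_left
  set s : α → ℝ≥0∞ := fun x => (a x * b x) ^ (1 / 2 : ℝ) with hs
  have hsm : Measurable s := (ha.mul hb).pow_const _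
  -- The square of the `x`-integral is a double integral over `x, x'`. After Tonelli each inner
  -- product of `χ x` and `χ x'` is at most `s x * s x'` by Cauchy–Schwarz, and the double integral
  -- factors.
  have key : ∀ x x', ∫⁻ y, χ x y * χ x' y ∂ν ≤ s x * s x' := fun x x' => by
    have h1 := lintegral_sqrt_mul_sq_le (μ := ν) ((hm2 x).pow_const 2) ((hm2 x').pow_const 2)
    have h2 : ∀ y, (χ x y ^ 2 * χ x' y ^ 2) ^ (1 / 2 : ℝ) = χ x y * χ x' y := fun y => by
      rw [← mul_pow, ← ENNReal.rpow_natCast, ← ENNReal.rpow_mul]; norm_num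
    simp only [h2] at h1
    have h3 := h1.trans (mul_le_mul' (h x) (h x'))
    have h4 : (s x * s x') ^ 2 = a x * b x * (a x' * b x') := by
      simp only [hs]
      rw [mul_pow, ← ENNReal.rpow_natCast, ← ENNReal.rpow_natCast, ← ENNReal.rpow_mul,
        ← ENNReal.rpow_mul]
      norm_num
    rw [← h4] at h3
    exact (ENNReal.pow_le_pow_left_iff two_ne_zero).1 h3
  calc ∫⁻ y, (∫⁻ x, χ x y ∂μ) ^ 2 ∂ν
      = ∫⁻ y, ∫⁻ x, ∫⁻ x', χ x y * χ x' y ∂μ ∂μ ∂ν := by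
        refine lintegral_congr fun y => ?_
        rw [sq, ← lintegral_mul_const _ (hm1 y)]
        exact lintegral_congr fun x => (lintegral_const_mul _ (hm1 y)).symm
    _ = ∫⁻ x, ∫⁻ y, ∫⁻ x', χ x y * χ x' y ∂μ ∂ν ∂μ := by
        refine lintegral_lintegral_swap (Measurable.aemeasurable ?_)
        refine Measurable.lintegral_prod_right' (f := fun z : (β × α) × α =>
          χ z.1.2 z.1.1 * χ z.2 z.1.1) ?_
        exact (hχ.comp (by fun_prop : Measurable fun z : (β × α) × α => (z.1.2, z.1.1))).mul
          (hχ.comp (by fun_prop : Measurable fun z : (β × α) × α => (z.2, z.1.1)))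
    _ = ∫⁻ x, ∫⁻ x', ∫⁻ y, χ x y * χ x' y ∂ν ∂μ ∂μ := by
        refine lintegral_congr fun x => lintegral_lintegral_swap (Measurable.aemeasurable ?_)
        exact ((hm2 x).comp measurable_fst).mul
          (hχ.comp (by fun_prop : Measurable fun z : β × α => (z.2, z.1)))
    _ ≤ ∫⁻ x, ∫⁻ x', s x * s x' ∂μ ∂μ :=
        lintegral_mono fun x => lintegral_mono fun x' => key x x'
    _ = (∫⁻ x, s x ∂μ) ^ 2 := by
        rw [sq, ← lintegral_mul_const _ hsm]
        exact lintegral_congr fun x => lintegral_const_mul _ hsm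
    _ ≤ _ := lintegral_sqrt_mul_sq_le ha hb

end SquareIntegrable

/-! ## The Pauli principle -/

section Pauli

@[fun_prop]
theorem measurable_finCons {α X : Type*} [MeasurableSpace α] [MeasurableSpace X] {m : ℕ}
    {f : α → X} {g : α → Fin m → X} (hf : Measurable f) (hg : Measurable g) :
    Measurable fun a => (Fin.cons (f a) (g a) : Fin (m + 1) → X) := by
  rw [measurable_pi_iff]
  intro j
  refine Fin.cases ?_ (fun j => ?_) j
  · simpa using hf
  · simpa using measurable_pi_iff.1 hg j

/-- The summand that singles out the first variable is split off; in all others the position of the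
singled-out variable shifts by one, whence the minus sign. This is the source of the anticommutation
relation behind the Pauli principle. -/
theorem antiSum_cons {X : Type*} {r : ℕ} (Θ : X → (Fin (r + 1) → X) → ℂ) (ξ : X) (w : Fin (r + 1) → X) :
    antiSum Θ (Fin.cons ξ w) =
      Θ ξ w - antiSum (fun η w' => Θ η (Fin.cons ξ w')) w := by
  simp only [antiSum]
  rw [Fin.sum_univ_succ, sub_eq_add_neg, ← Finset.sum_neg_distrib]
  congr 1
  · have : (Fin.cons ξ w : Fin (r + 2) → X) ∘ Fin.succAbove 0 = w := by funext j; simp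
    rw [this]; simp
  · refine Finset.sum_congr rfl fun j _ => ?_
    have : (Fin.cons ξ w : Fin (r + 2) → X) ∘ j.succ.succAbove =
        Fin.cons ξ (w ∘ j.succAbove) := by
      funext k
      refine Fin.cases ?_ (fun k => ?_) k
      · simp
      · simp [Fin.succ_succAbove_succ]
    rw [this]
    simp [pow_succ]

variable {X : Type*} [MeasurableSpace X] (μ : Measure X) [SigmaFinite μ]

/-- Singling out one of the variables preserves the measure. -/
theorem measurePreserving_split {r : ℕ} (i : Fin (r + 1)) :
    MeasurePreserving (fun x : Fin (r + 1) → X => (x i, x ∘ i.succAbove))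
      (Measure.pi fun _ => μ) (μ.prod (Measure.pi fun _ => μ)) :=
  measurePreserving_piFinSuccAbove (fun _ : Fin (r + 1) => μ) i

/-- Adding a variable preserves the measure. -/
theorem measurePreserving_cons (r : ℕ) :
    MeasurePreserving (fun x : X × (Fin r → X) => (Fin.cons x.1 x.2 : Fin (r + 1) → X))
      (μ.prod (Measure.pi fun _ => μ)) (Measure.pi fun _ => μ) := by
  have h := (measurePreserving_piFinSuccAbove (fun _ : Fin (r + 1) => μ) 0).symm
  convert h using 1
  funext x
  exact (Fin.insertNth_zero' x.1 x.2).symm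

theorem MeasurePreserving.integral_comp_of_aestronglyMeasurable {α β : Type*} [MeasurableSpace α]
    [MeasurableSpace β] {ν : Measure α} {ρ : Measure β} {p : α → β} (hp : MeasurePreserving p ν ρ)
    {g : β → ℂ} (hg : AEStronglyMeasurable g ρ) : ∫ x, g (p x) ∂ν = ∫ y, g y ∂ρ := by
  have hg' : AEStronglyMeasurable g (ν.map p) := hp.map_eq.symm ▸ hg
  rw [← integral_map hp.measurable.aemeasurable hg', hp.map_eq]

/-- Pairing of a symmetrized sum with a function that has the same symmetry. -/
theorem integral_conj_sum_mul {ι N M : Type*} [Fintype ι] [MeasurableSpace N] [MeasurableSpace M]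
    {ν : Measure N} {ρ : Measure M} {p : ι → N → M} (hp : ∀ i, MeasurePreserving (p i) ν ρ)
    {c : ι → ℂ} (hc : ∀ i, conj (c i) * c i = 1) {Θ ψ' : M → ℂ} {ψ : N → ℂ}
    (hΘ : MemLp Θ 2 ρ) (hψ' : MemLp ψ' 2 ρ) (hψ : ∀ i w, ψ w = c i * ψ' (p i w)) :
    ∫ w, conj (∑ i, c i * Θ (p i w)) * ψ w ∂ν =
      Fintype.card ι * ∫ z, conj (Θ z) * ψ' z ∂ρ := by
  have h1 : ∀ i w, conj (c i * Θ (p i w)) * ψ w = conj (Θ (p i w)) * ψ' (p i w) := fun i w => by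
    rw [hψ i w, map_mul]
    linear_combination (conj (Θ (p i w)) * ψ' (p i w)) * hc i
  have hint := integrable_conj_mul hΘ hψ'
  simp only [map_sum, Finset.sum_mul, h1]
  have h2 : ∀ i, Integrable (fun w => conj (Θ (p i w)) * ψ' (p i w)) ν :=
    fun i => (hp i).integrable_comp_of_integrable hint
  rw [integral_finsetSum _ fun i _ => h2 i]
  simp [fun i => MeasurePreserving.integral_comp_of_aestronglyMeasurable (hp i) hint.1]

theorem conj_neg_one_pow_mul (i : ℕ) : conj ((-1 : ℂ) ^ i) * (-1) ^ i = 1 := by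
  rw [map_pow, ← mul_pow]; simp

/-- Pairing of an antisymmetrized sum with an antisymmetric function. -/
theorem integral_conj_antiSum_mul {r : ℕ} {Θ : X → (Fin r → X) → ℂ} {ψ : (Fin (r + 1) → X) → ℂ}
    (hΘ : MemLp (Function.uncurry Θ) 2 (μ.prod (Measure.pi fun _ => μ)))
    (hψ : MemLp ψ 2 (Measure.pi fun _ => μ)) (hanti : IsAnti ψ) :
    ∫ x, conj (antiSum Θ x) * ψ x ∂(Measure.pi fun _ => μ) =
      (r + 1) * ∫ z : X × (Fin r → X), conj (Θ z.1 z.2) * ψ (Fin.cons z.1 z.2)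
        ∂(μ.prod (Measure.pi fun _ => μ)) := by
  have h := integral_conj_sum_mul (fun i => measurePreserving_split μ (r := r) i)
    (c := fun i => (-1) ^ (i : ℕ)) (fun i => conj_neg_one_pow_mul i) hΘ
    (hψ.comp_measurePreserving (measurePreserving_cons μ r))
    (ψ := ψ) (fun i w => hanti.eq_cons i w)
  simp only [Fintype.card_fin] at h
  push_cast at h
  exact h

/-- The contraction of the first variable of `φ` with `u`. -/
def contract {r : ℕ} (u : X → ℂ) (φ : (Fin (r + 1) → X) → ℂ) (w : Fin r → X) : ℂ :=
  ∫ ξ, conj (u ξ) * φ (Fin.cons ξ w) ∂μ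

theorem stronglyMeasurable_contract {r : ℕ} {u : X → ℂ} (hu : StronglyMeasurable u)
    {φ : (Fin (r + 1) → X) → ℂ} (hφ : StronglyMeasurable φ) :
    StronglyMeasurable (contract μ u φ) := by
  refine StronglyMeasurable.integral_prod_right' (f := fun z : (Fin r → X) × X =>
    conj (u z.2) * φ (Fin.cons z.2 z.1)) ?_
  have h1 : StronglyMeasurable fun z : (Fin r → X) × X => conj (u z.2) :=
    Complex.continuous_conj.comp_stronglyMeasurable (hu.comp_measurable measurable_snd)
  exact h1.mul (hφ.comp_measurable (by fun_prop))

/-- Plain Minkowski and Cauchy–Schwarz, without the gain `r + 1`. It makes the contraction square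
integrable, so that the integrals in the proof of the Pauli principle exist. -/
theorem lintegral_contract_sq_le {r : ℕ} {u : X → ℂ} (hu : StronglyMeasurable u)
    {φ : (Fin (r + 1) → X) → ℂ} (hφ : StronglyMeasurable φ) :
    ∫⁻ w, ‖contract μ u φ w‖ₑ ^ 2 ∂(Measure.pi fun _ => μ) ≤
      (∫⁻ ξ, ‖u ξ‖ₑ ^ 2 ∂μ) * ∫⁻ x, ‖φ x‖ₑ ^ 2 ∂(Measure.pi fun _ => μ) := by
  have hm : Measurable fun z : X × (Fin r → X) => ‖φ (Fin.cons z.1 z.2)‖ₑ :=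
    hφ.enorm.comp (by fun_prop)
  have h1 : ∫⁻ x, ‖φ x‖ₑ ^ 2 ∂(Measure.pi fun _ => μ) =
      ∫⁻ ξ, ∫⁻ w : Fin r → X, ‖φ (Fin.cons ξ w)‖ₑ ^ 2 ∂(Measure.pi fun _ => μ) ∂μ := by
    rw [← (measurePreserving_cons μ r).lintegral_comp (hφ.enorm.pow_const 2),
      lintegral_prod _ (hm.pow_const 2).aemeasurable]
  rw [h1]
  refine le_trans (lintegral_mono fun w => ?_) (lintegral_lintegral_sq_le (μ := μ)
    (ν := Measure.pi fun _ => μ) (χ := fun ξ w => ‖u ξ‖ₑ * ‖φ (Fin.cons ξ w)‖ₑ)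
    (a := fun ξ => ‖u ξ‖ₑ ^ 2)
    (b := fun ξ => ∫⁻ w : Fin r → X, ‖φ (Fin.cons ξ w)‖ₑ ^ 2 ∂(Measure.pi fun _ => μ)) ?_ ?_ ?_ ?_)
  · refine pow_le_pow_left' ((enorm_integral_le_lintegral_enorm _).trans_eq ?_) 2
    simp [enorm_mul]
  · exact (hu.enorm.comp measurable_fst).mul hm
  · exact hu.enorm.pow_const 2
  · exact (hm.pow_const 2).lintegral_prod_right'
  · intro ξ
    simp only [mul_pow]
    rw [lintegral_const_mul]
    exact (hm.comp measurable_prodMk_left).pow_const 2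

/-- The Pauli principle for square integrable functions: `b(u)` is bounded by `‖u‖`. -/
theorem pauli_of_memLp {r : ℕ} {u : X → ℂ} (hu : StronglyMeasurable u) (hu2 : MemLp u 2 μ)
    {φ : (Fin (r + 1) → X) → ℂ} (hφ : StronglyMeasurable φ)
    (hφ2 : MemLp φ 2 (Measure.pi fun _ => μ)) (hanti : IsAnti φ) :
    (r + 1 : ℝ≥0∞) * ∫⁻ w, ‖contract μ u φ w‖ₑ ^ 2 ∂(Measure.pi fun _ => μ) ≤
      (∫⁻ ξ, ‖u ξ‖ₑ ^ 2 ∂μ) * ∫⁻ x, ‖φ x‖ₑ ^ 2 ∂(Measure.pi fun _ => μ) := by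
  set κ := contract μ u φ with hκ
  have hκm : StronglyMeasurable κ := stronglyMeasurable_contract μ hu hφ
  have hU := (memLp_two_iff hu2.1).1 hu2
  have hΦ := (memLp_two_iff hφ2.1).1 hφ2
  have hκ2 : MemLp κ 2 (Measure.pi fun _ => μ) :=
    (memLp_two_iff hκm.aestronglyMeasurable).2
      ((lintegral_contract_sq_le μ hu hφ).trans_lt (ENNReal.mul_lt_top hU hΦ))
  let Θ : X → (Fin (r + 1) → X) → ℂ := fun ξ w => u ξ * φ w
  have hΘ : MemLp (Function.uncurry Θ) 2 (μ.prod (Measure.pi fun _ => μ)) :=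
    memLp_mul_prod hu2 hφ2
  -- Up to normalization `S` is `b*(u) φ`, and the whole proof is `‖S‖² ≥ 0`: pairing `S` with
  -- itself and splitting off the first variable gives `‖S‖² = (r + 2) (‖u‖² ‖φ‖² - (r + 1) ‖κ‖²)`.
  let S := antiSum Θ
  have hSanti : IsAnti S := isAnti_antiSum fun ξ σ x => by
    simp only [Θ]; rw [hanti]; ring
  have hS2 : MemLp S 2 (Measure.pi fun _ => μ) := by
    refine memLp_finsetSum _ fun i _ => ?_
    exact (hΘ.comp_measurePreserving (measurePreserving_split μ i)).const_mul _
  have e1 := integral_conj_antiSum_mul μ hΘ hS2 hSanti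
  have hsplit : ∀ ξ w, conj (Θ ξ w) * S (Fin.cons ξ w) =
      conj (Θ ξ w) * Θ ξ w - conj (Θ ξ w) *
        antiSum (fun η w' => Θ η (Fin.cons ξ w')) w := fun ξ w => by
    simp only [S]; rw [antiSum_cons, mul_sub]
  have hΘΘ := integrable_conj_mul hΘ hΘ
  have hΘS := integrable_conj_mul hΘ (hS2.comp_measurePreserving (measurePreserving_cons μ (r + 1)))
  have hrest : Integrable (fun z : X × (Fin (r + 1) → X) => conj (Θ z.1 z.2) *
      antiSum (fun η w' => Θ η (Fin.cons z.1 w')) z.2) (μ.prod (Measure.pi fun _ => μ)) := by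
    refine (hΘΘ.sub hΘS).congr (Filter.Eventually.of_forall fun z => ?_)
    have := hsplit z.1 z.2
    simp only [Function.uncurry, Pi.sub_apply, Function.comp] at this ⊢
    rw [this]; ring
  have hφc : MemLp (fun z : X × (Fin r → X) => φ (Fin.cons z.1 z.2)) 2
      (μ.prod (Measure.pi fun _ => μ)) := hφ2.comp_measurePreserving (measurePreserving_cons μ r)
  -- For fixed `ξ` the second term of the splitting is again an antisymmetrized sum paired with `φ`;
  -- it collapses once more and produces the contraction `κ`.
  have e2 : ∀ᵐ ξ ∂μ, ∫ w, conj (Θ ξ w) * antiSum (fun η w' => Θ η (Fin.cons ξ w')) w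
      ∂(Measure.pi fun _ => μ) = (r + 1) * ∫ w, conj (u ξ * κ w) * φ (Fin.cons ξ w)
        ∂(Measure.pi fun _ => μ) := by
    filter_upwards [MemLp.slice hφc] with ξ hξ
    have h1 := integral_conj_antiSum_mul μ (Θ := fun η w' => u η * φ (Fin.cons ξ w'))
      (memLp_mul_prod hu2 hξ) hφ2 hanti
    have h2 : ∀ w, conj (Θ ξ w) * antiSum (fun η w' => Θ η (Fin.cons ξ w')) w =
        conj (u ξ) * conj (conj (antiSum (fun η w' => u η * φ (Fin.cons ξ w')) w) * φ w) := by
      intro w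
      simp only [Θ, map_mul, Complex.conj_conj]; ring
    simp only [h2]
    rw [integral_const_mul, integral_conj, h1]
    have h3 : Integrable (fun z : X × (Fin r → X) => conj (u z.1 * φ (Fin.cons ξ z.2)) *
        φ (Fin.cons z.1 z.2)) (μ.prod (Measure.pi fun _ => μ)) :=
      integrable_conj_mul (memLp_mul_prod hu2 hξ) hφc
    rw [integral_prod_symm _ h3, map_mul, ← integral_conj]
    have h4 : ∀ w, conj (∫ x, conj (u x * φ (Fin.cons ξ w)) * φ (Fin.cons x w) ∂μ) =
        φ (Fin.cons ξ w) * conj (κ w) := fun w => by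
      have : ∀ x, conj (u x * φ (Fin.cons ξ w)) * φ (Fin.cons x w) =
          conj (φ (Fin.cons ξ w)) * (conj (u x) * φ (Fin.cons x w)) := fun x => by
        rw [map_mul]; ring
      simp only [this]
      rw [integral_const_mul, map_mul, Complex.conj_conj]; rfl
    simp only [h4, map_add, map_natCast, map_one]
    rw [mul_left_comm, ← integral_const_mul]
    congr 2
    funext w
    rw [map_mul]; ring
  have hκu : Integrable (fun z : X × (Fin r → X) => conj (u z.1 * κ z.2) *
      φ (Fin.cons z.1 z.2)) (μ.prod (Measure.pi fun _ => μ)) :=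
    integrable_conj_mul (memLp_mul_prod hu2 hκ2) hφc
  have e3 : ∫ z : X × (Fin (r + 1) → X), conj (Θ z.1 z.2) * S (Fin.cons z.1 z.2)
      ∂(μ.prod (Measure.pi fun _ => μ)) =
      ∫ z : X × (Fin (r + 1) → X), conj (Θ z.1 z.2) * Θ z.1 z.2 ∂(μ.prod (Measure.pi fun _ => μ)) -
      (r + 1) * ∫ w, conj (κ w) * κ w ∂(Measure.pi fun _ => μ) := by
    simp only [hsplit]
    have h1 : Integrable (fun z : X × (Fin (r + 1) → X) => conj (Θ z.1 z.2) * Θ z.1 z.2)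
      (μ.prod (Measure.pi fun _ => μ)) := hΘΘ
    rw [integral_sub h1 hrest, integral_prod _ hrest, integral_congr_ae e2, integral_const_mul,
      ← integral_prod _ hκu, integral_prod_symm _ hκu]
    congr 3
    funext w
    have : ∀ x, conj (u x * κ w) * φ (Fin.cons x w) =
        conj (κ w) * (conj (u x) * φ (Fin.cons x w)) := fun x => by rw [map_mul]; ring
    simp only [this]
    rw [integral_const_mul]; rfl
  rw [e3, integral_conj_mul_self S hS2.1, integral_conj_mul_self κ hκ2.1] at e1
  have e4 := integral_conj_mul_self (Function.uncurry Θ) hΘ.1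
  have e5 : ∫⁻ z, ‖Function.uncurry Θ z‖ₑ ^ 2 ∂(μ.prod (Measure.pi fun _ => μ)) =
      (∫⁻ ξ, ‖u ξ‖ₑ ^ 2 ∂μ) * ∫⁻ x, ‖φ x‖ₑ ^ 2 ∂(Measure.pi fun _ => μ) := by
    rw [← lintegral_prod_mul (hu.enorm.pow_const 2).aemeasurable
      (hφ.enorm.pow_const 2).aemeasurable]
    simp only [Function.uncurry, Θ, enorm_mul, mul_pow]
  rw [e5] at e4
  have e6 : ∫ z : X × (Fin (r + 1) → X), conj (Θ z.1 z.2) * Θ z.1 z.2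
      ∂(μ.prod (Measure.pi fun _ => μ)) = ∫ z, conj (Function.uncurry Θ z) * Function.uncurry Θ z
      ∂(μ.prod (Measure.pi fun _ => μ)) := rfl
  rw [e6, e4] at e1
  have e7 := congrArg Complex.re e1
  have e8 : (((r + 1 : ℕ) : ℂ) + 1) = ((r + 2 : ℝ) : ℂ) := by push_cast; ring
  have e9 : ((r : ℂ) + 1) = ((r + 1 : ℝ) : ℂ) := by push_cast; ring
  rw [e8, e9, ← Complex.ofReal_mul, ← Complex.ofReal_sub, ← Complex.ofReal_mul,
    Complex.ofReal_re, Complex.ofReal_re] at e7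
  have e10 : 0 ≤ (r + 2 : ℝ) * (((∫⁻ ξ, ‖u ξ‖ₑ ^ 2 ∂μ) *
      ∫⁻ x, ‖φ x‖ₑ ^ 2 ∂(Measure.pi fun _ => μ)).toReal -
      (r + 1) * (∫⁻ w, ‖κ w‖ₑ ^ 2 ∂(Measure.pi fun _ => μ)).toReal) := by
    rw [← e7]; exact ENNReal.toReal_nonneg
  have e11 := nonneg_of_mul_nonneg_right e10 (by positivity)
  have hκ3 := (memLp_two_iff hκ2.1).1 hκ2
  rw [← ENNReal.toReal_le_toReal (ENNReal.mul_ne_top (by finiteness) hκ3.ne)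
    (ENNReal.mul_ne_top hU.ne hΦ.ne), ENNReal.toReal_mul]
  have e12 : (r + 1 : ℝ≥0∞).toReal = r + 1 := by
    rw [ENNReal.toReal_add (by finiteness) (by finiteness)]; simp
  rw [e12]
  linarith

/-- The Pauli principle. -/
theorem pauli_principle {r : ℕ} {u : X → ℂ} (hu : StronglyMeasurable u)
    {φ : (Fin (r + 1) → X) → ℂ} (hφ : StronglyMeasurable φ) (hanti : IsAnti φ) :
    (r + 1 : ℝ≥0∞) * ∫⁻ w, ‖contract μ u φ w‖ₑ ^ 2 ∂(Measure.pi fun _ => μ) ≤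
      (∫⁻ ξ, ‖u ξ‖ₑ ^ 2 ∂μ) * ∫⁻ x, ‖φ x‖ₑ ^ 2 ∂(Measure.pi fun _ => μ) := by
  -- In `ℝ≥0∞` one has `0 * ⊤ = 0`, so an infinite norm does not make the claim trivial; a vanishing
  -- right side is covered by the plain bound.
  by_cases h0 : (∫⁻ ξ, ‖u ξ‖ₑ ^ 2 ∂μ) * ∫⁻ x, ‖φ x‖ₑ ^ 2 ∂(Measure.pi fun _ => μ) = 0
  · have h1 := lintegral_contract_sq_le μ hu hφ
    rw [h0] at h1
    rw [nonpos_iff_eq_zero.1 h1, mul_zero]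
    exact zero_le
  · obtain ⟨hU, hΦ⟩ := mul_ne_zero_iff.1 h0
    by_cases hU' : ∫⁻ ξ, ‖u ξ‖ₑ ^ 2 ∂μ = ⊤
    · rw [hU', ENNReal.top_mul hΦ]; exact le_top
    by_cases hΦ' : ∫⁻ x, ‖φ x‖ₑ ^ 2 ∂(Measure.pi fun _ => μ) = ⊤
    · rw [hΦ', ENNReal.mul_top hU]; exact le_top
    exact pauli_of_memLp μ hu ((memLp_two_iff hu.aestronglyMeasurable).2 (lt_top_iff_ne_top.2 hU'))
      hφ ((memLp_two_iff hφ.aestronglyMeasurable).2 (lt_top_iff_ne_top.2 hΦ')) hanti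

end Pauli

/-! ## Bounds on contractions -/

section Contraction

/-! ### Rearrangements of product measures. -/

section Reorder

variable {α β γ δ : Type*} [MeasurableSpace α] [MeasurableSpace β] [MeasurableSpace γ]
  [MeasurableSpace δ] (a : Measure α) (b : Measure β) (c : Measure γ) (d : Measure δ)
  [SigmaFinite a] [SigmaFinite b] [SigmaFinite c] [SigmaFinite d]

theorem measurePreserving_reorder :
    MeasurePreserving (fun x : (α × γ) × β => (x.1.1, x.2, x.1.2))
      ((a.prod c).prod b) (a.prod (b.prod c)) :=
  ((MeasurePreserving.id a).prod Measure.measurePreserving_swap).comp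
    (measurePreserving_prodAssoc a c b)

theorem measurePreserving_reorder' :
    MeasurePreserving (fun x : α × (β × γ) => ((x.1, x.2.2), x.2.1))
      (a.prod (b.prod c)) ((a.prod c).prod b) :=
  (measurePreserving_prodAssoc a c b).symm.comp
    ((MeasurePreserving.id a).prod Measure.measurePreserving_swap)

end Reorder

variable {X Y Z : Type*} [MeasurableSpace X] [MeasurableSpace Y] [MeasurableSpace Z]
  (μ : Measure X) (η : Measure Y) (ζ : Measure Z) [SigmaFinite μ]

/-- The Pauli principle in the presence of spectator variables. -/
theorem pauli_spectator {s : ℕ} {u : X → ℂ} (hu : StronglyMeasurable u)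
    {θ : Y → (Fin (s + 1) → X) → ℂ} (hθ : StronglyMeasurable (Function.uncurry θ))
    (hanti : ∀ y, IsAnti (θ y)) :
    (s + 1 : ℝ≥0∞) * ∫⁻ z, ‖contract μ u (θ z.1) z.2‖ₑ ^ 2 ∂(η.prod (Measure.pi fun _ => μ)) ≤
      (∫⁻ ξ, ‖u ξ‖ₑ ^ 2 ∂μ) *
        ∫⁻ z, ‖Function.uncurry θ z‖ₑ ^ 2 ∂(η.prod (Measure.pi fun _ => μ)) := by
  have hm : StronglyMeasurable fun z : Y × (Fin s → X) => contract μ u (θ z.1) z.2 := by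
    unfold contract
    refine StronglyMeasurable.integral_prod_right' (f := fun z : (Y × (Fin s → X)) × X =>
      conj (u z.2) * Function.uncurry θ (z.1.1, Fin.cons z.2 z.1.2)) ?_
    have h1 : StronglyMeasurable fun z : (Y × (Fin s → X)) × X => conj (u z.2) :=
      Complex.continuous_conj.comp_stronglyMeasurable (hu.comp_measurable measurable_snd)
    exact h1.mul (hθ.comp_measurable (by fun_prop))
  have hm2 : Measurable fun z : Y × (Fin s → X) => ‖contract μ u (θ z.1) z.2‖ₑ ^ 2 :=
    hm.enorm.pow_const 2
  have hθ2 : Measurable fun z : Y × (Fin (s + 1) → X) => ‖Function.uncurry θ z‖ₑ ^ 2 :=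
    hθ.enorm.pow_const 2
  rw [lintegral_prod _ hm2.aemeasurable, lintegral_prod _ hθ2.aemeasurable,
    ← lintegral_const_mul _ hm2.lintegral_prod_right',
    ← lintegral_const_mul _ hθ2.lintegral_prod_right']
  refine lintegral_mono fun y => ?_
  have h := pauli_principle μ (φ := θ y) hu (hθ.comp_measurable measurable_prodMk_left) (hanti y)
  exact h

variable [SigmaFinite η] [SigmaFinite ζ]

/-- A contraction over one antisymmetric variable and one further variable `z`. -/
theorem contraction_bound {s : ℕ} {K : Z → X → ℂ} (hK : StronglyMeasurable (Function.uncurry K))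
    {θ : Z → Y → (Fin (s + 1) → X) → ℂ}
    (hθ : StronglyMeasurable fun p : Z × (Y × (Fin (s + 1) → X)) => θ p.1 p.2.1 p.2.2)
    (hanti : ∀ z y, IsAnti (θ z y)) :
    (s + 1 : ℝ≥0∞) * ∫⁻ p, (∫⁻ z, ‖contract μ (K z) (θ z p.1) p.2‖ₑ ∂ζ) ^ 2
        ∂(η.prod (Measure.pi fun _ => μ)) ≤
      (∫⁻ p, ‖Function.uncurry K p‖ₑ ^ 2 ∂(ζ.prod μ)) *
        ∫⁻ p, ‖θ p.1 p.2.1 p.2.2‖ₑ ^ 2 ∂(ζ.prod (η.prod (Measure.pi fun _ => μ))) := by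
  have hm : StronglyMeasurable fun p : Z × (Y × (Fin s → X)) =>
      contract μ (K p.1) (θ p.1 p.2.1) p.2.2 := by
    refine StronglyMeasurable.integral_prod_right' (f := fun z : (Z × (Y × (Fin s → X))) × X =>
      conj (Function.uncurry K (z.1.1, z.2)) *
        (fun p : Z × (Y × (Fin (s + 1) → X)) => θ p.1 p.2.1 p.2.2)
          (z.1.1, z.1.2.1, Fin.cons z.2 z.1.2.2)) ?_
    have h1 : StronglyMeasurable fun z : (Z × (Y × (Fin s → X))) × X =>
        conj (Function.uncurry K (z.1.1, z.2)) :=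
      Complex.continuous_conj.comp_stronglyMeasurable (hK.comp_measurable (by fun_prop))
    exact h1.mul (hθ.comp_measurable (by fun_prop))
  have hs0 : (s + 1 : ℝ≥0∞) ≠ 0 := by positivity
  have hs1 : (s + 1 : ℝ≥0∞) ≠ ⊤ := by finiteness
  have hKm : Measurable fun z => ∫⁻ x, ‖Function.uncurry K (z, x)‖ₑ ^ 2 ∂μ :=
    (hK.enorm.pow_const 2).lintegral_prod_right'
  have hθm : Measurable fun z => ∫⁻ q, ‖θ z q.1 q.2‖ₑ ^ 2 ∂(η.prod (Measure.pi fun _ => μ)) :=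
    (hθ.enorm.pow_const 2).lintegral_prod_right'
  -- Pauli for each fixed `z`, then Minkowski and Cauchy–Schwarz in `z`. The gain `s + 1` is put
  -- into the weight `a`, so that it survives the integration over `z`.
  have h := lintegral_lintegral_sq_le (μ := ζ) (ν := η.prod (Measure.pi fun _ => μ))
    (χ := fun z p => ‖contract μ (K z) (θ z p.1) p.2‖ₑ) hm.enorm
    (a := fun z => (s + 1 : ℝ≥0∞)⁻¹ * ∫⁻ x, ‖Function.uncurry K (z, x)‖ₑ ^ 2 ∂μ)
    (hKm.const_mul _) hθm fun z => by
      have h1 := pauli_spectator μ η (u := K z) (θ := θ z)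
        (hK.comp_measurable measurable_prodMk_left)
        (hθ.comp_measurable measurable_prodMk_left) (hanti z)
      rw [mul_assoc]
      exact (ENNReal.mul_le_iff_le_inv hs0 hs1).1 h1
  rw [lintegral_const_mul _ hKm, mul_assoc, ← ENNReal.mul_le_iff_le_inv hs0 hs1] at h
  rw [lintegral_prod _ (hK.enorm.pow_const 2).aemeasurable,
    lintegral_prod _ (hθ.enorm.pow_const 2).aemeasurable]
  exact h

end Contraction

/-! ## Annihilation of pairs and triples in a sector -/

section Annihilation

/-- Functions on a sector with the symmetry of Fock space. -/
def IsFockSym {r s n : ℕ} (ψ : Sector r s n → ℂ) : Prop :=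
  ∀ σ τ π w, ψ (relabel σ τ π w) = ((Equiv.Perm.sign σ * Equiv.Perm.sign τ : ℤˣ) : ℂ) * ψ w

variable {r s n : ℕ}

theorem IsFockSym.anti₁ {ψ : Sector r s n → ℂ} (h : IsFockSym ψ) (w₂ : Fin s → Fermion)
    (w₃ : Fin n → Boson) : IsAnti fun w₁ => ψ (w₁, w₂, w₃) := by
  intro σ x
  simpa [relabel] using h σ 1 1 (x, w₂, w₃)

theorem IsFockSym.anti₂ {ψ : Sector r s n → ℂ} (h : IsFockSym ψ) (w₁ : Fin r → Fermion)
    (w₃ : Fin n → Boson) : IsAnti fun w₂ => ψ (w₁, w₂, w₃) := by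
  intro σ x
  simpa [relabel] using h 1 σ 1 (w₁, x, w₃)

theorem IsFockSym.symm₃ {ψ : Sector r s n → ℂ} (h : IsFockSym ψ) (w₁ : Fin r → Fermion)
    (w₂ : Fin s → Fermion) : IsSymmFun fun w₃ => ψ (w₁, w₂, w₃) := by
  intro σ x
  simpa [relabel] using h 1 1 σ (w₁, w₂, x)

/-- Kernels as functions of one variable. -/
def kernelFun (F : Kernel3) (ξ : Fermion × Fermion × Boson) : ℂ := F ξ.1 ξ.2.1 ξ.2.2

/-- The squared `L²` norm of a kernel. -/
def kernelSq (F : Kernel3) : ℝ≥0∞ := ∫⁻ ξ, ‖kernelFun F ξ‖ₑ ^ 2 ∂muFFB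

/-- The squared `L²` norm of a function on a sector. -/
def sectorSq (ψ : Sector r s n → ℂ) : ℝ≥0∞ := ∫⁻ w, ‖ψ w‖ₑ ^ 2 ∂muS r s n

/-- Contraction of an electron, a positron and a boson with `F`. -/
def annTriple (F : Kernel3) (ψ : Sector (r + 1) (s + 1) (n + 1) → ℂ) (w : Sector r s n) : ℂ :=
  ∫ ξ : Fermion × Fermion × Boson, conj (kernelFun F ξ) *
    ψ (addE (addP (addZ (w, ξ.2.2), ξ.2.1), ξ.1)) ∂muFFB

/-- Contraction of an electron and a positron with `F(·, ·, ξ₃)`. -/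
def annPair (F : Kernel3) (ψ : Sector (r + 1) (s + 1) n → ℂ) (ξ₃ : Boson) (w : Sector r s n) : ℂ :=
  ∫ ξ : Fermion × Fermion, conj (F ξ.1 ξ.2 ξ₃) * ψ (addE (addP (w, ξ.2), ξ.1)) ∂muF.prod muF

/-- Contraction of an electron with `u`. -/
def annOne (u : Fermion → ℂ) (ψ : Sector (r + 1) s n → ℂ) (w : Sector r s n) : ℂ :=
  ∫ ξ, conj (u ξ) * ψ (addE (w, ξ)) ∂muF

/-- Contraction of a positron and a boson with `G`. -/
def annPosBos (G : Fermion → Boson → ℂ) (ψ : Sector r (s + 1) (n + 1) → ℂ) (w : Sector r s n) : ℂ :=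
  ∫ ξ : Fermion × Boson, conj (G ξ.1 ξ.2) * ψ (addP (addZ (w, ξ.2), ξ.1)) ∂muF.prod muB

/-- Contraction of a positron with `G(·, ξ₃)`. -/
def annPos (G : Fermion → Boson → ℂ) (ψ : Sector r (s + 1) n → ℂ) (ξ₃ : Boson)
    (w : Sector r s n) : ℂ :=
  ∫ ξ, conj (G ξ ξ₃) * ψ (addP (w, ξ)) ∂muF

@[fun_prop]
theorem measurable_addE : Measurable (addE (r := r) (s := s) (n := n)) := by
  unfold addE; fun_prop

@[fun_prop]
theorem measurable_addP : Measurable (addP (r := r) (s := s) (n := n)) := by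
  unfold addP; fun_prop

@[fun_prop]
theorem measurable_addZ : Measurable (addZ (r := r) (s := s) (n := n)) := by
  unfold addZ; fun_prop

theorem StronglyMeasurable.conj {α : Type*} [MeasurableSpace α] {f : α → ℂ}
    (hf : StronglyMeasurable f) : StronglyMeasurable fun x => conj (f x) :=
  Complex.continuous_conj.comp_stronglyMeasurable hf

theorem stronglyMeasurable_annOne {u : Fermion → ℂ} (hu : StronglyMeasurable u)
    {ψ : Sector (r + 1) s n → ℂ} (hψ : StronglyMeasurable ψ) :
    StronglyMeasurable (annOne u ψ) := by
  refine StronglyMeasurable.integral_prod_right' (f := fun z : Sector r s n × Fermion =>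
    conj (u z.2) * ψ (addE (z.1, z.2))) ?_
  exact (StronglyMeasurable.conj hu |>.comp_measurable measurable_snd).mul
    (hψ.comp_measurable (by fun_prop))

theorem isFockSym_annOne {u : Fermion → ℂ} {ψ : Sector (r + 1) s n → ℂ} (hψ : IsFockSym ψ) :
    IsFockSym (annOne u ψ) := by
  intro σ τ π w
  simp only [annOne]
  rw [← integral_const_mul]
  congr 1
  funext ξ
  have h := hψ (consPerm σ) τ π (addE (w, ξ))
  have e : relabel (consPerm σ) τ π (addE (w, ξ)) = addE (relabel σ τ π w, ξ) := by
    simp only [relabel, addE, cons_comp_consPerm]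
  rw [← e, h, sign_consPerm]
  ring

/-- The Pauli principle for the electrons. -/
theorem annOne_bound {u : Fermion → ℂ} (hu : StronglyMeasurable u)
    {ψ : Sector (r + 1) s n → ℂ} (hψ : StronglyMeasurable ψ) (hsym : IsFockSym ψ) :
    (r + 1 : ℝ≥0∞) * sectorSq (annOne u ψ) ≤ (∫⁻ ξ, ‖u ξ‖ₑ ^ 2 ∂muF) * sectorSq ψ := by
  have h := pauli_spectator muF ((Measure.pi fun _ : Fin s => muF).prod
    (Measure.pi fun _ : Fin n => muB)) hu (θ := fun y w₁ => ψ (w₁, y.1, y.2))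
    (hψ.comp_measurable (by fun_prop : Measurable fun p : ((Fin s → Fermion) × (Fin n → Boson)) ×
      (Fin (r + 1) → Fermion) => (p.2, p.1.1, p.1.2)))
    (fun y => hsym.anti₁ y.1 y.2)
  have e1 := (Measure.measurePreserving_swap (μ := Measure.pi fun _ : Fin r => muF)
    (ν := (Measure.pi fun _ : Fin s => muF).prod
      (Measure.pi fun _ : Fin n => muB))).lintegral_comp_emb MeasurableEquiv.prodComm.measurableEmbedding
    (fun z => ‖contract muF u (fun w₁ => ψ (w₁, z.1.1, z.1.2)) z.2‖ₑ ^ 2)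
  have e2 := (Measure.measurePreserving_swap (μ := Measure.pi fun _ : Fin (r + 1) => muF)
    (ν := (Measure.pi fun _ : Fin s => muF).prod
      (Measure.pi fun _ : Fin n => muB))).lintegral_comp_emb MeasurableEquiv.prodComm.measurableEmbedding
    (fun z => ‖ψ (z.2, z.1.1, z.1.2)‖ₑ ^ 2)
  rw [← e1] at h
  refine h.trans_eq ?_
  congr 1
  exact e2.symm

theorem stronglyMeasurable_annPosBos {G : Fermion → Boson → ℂ}
    (hG : StronglyMeasurable (Function.uncurry G))
    {ψ : Sector r (s + 1) (n + 1) → ℂ} (hψ : StronglyMeasurable ψ) :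
    StronglyMeasurable (annPosBos G ψ) := by
  refine StronglyMeasurable.integral_prod_right' (f := fun z : Sector r s n × (Fermion × Boson) =>
    conj (Function.uncurry G z.2) * ψ (addP (addZ (z.1, z.2.2), z.2.1))) ?_
  exact (StronglyMeasurable.conj hG |>.comp_measurable measurable_snd).mul
    (hψ.comp_measurable (by fun_prop))

theorem stronglyMeasurable_annTriple {F : Kernel3} (hF : StronglyMeasurable (kernelFun F))
    {ψ : Sector (r + 1) (s + 1) (n + 1) → ℂ} (hψ : StronglyMeasurable ψ) :
    StronglyMeasurable (annTriple F ψ) := by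
  refine StronglyMeasurable.integral_prod_right'
    (f := fun z : Sector r s n × (Fermion × Fermion × Boson) => conj (kernelFun F z.2) *
      ψ (addE (addP (addZ (z.1, z.2.2.2), z.2.2.1), z.2.1))) ?_
  exact (StronglyMeasurable.conj hF |>.comp_measurable measurable_snd).mul
    (hψ.comp_measurable (by fun_prop))

theorem stronglyMeasurable_annPair {F : Kernel3} (hF : StronglyMeasurable (kernelFun F))
    {ψ : Sector (r + 1) (s + 1) n → ℂ} (hψ : StronglyMeasurable ψ) :
    StronglyMeasurable fun p : Boson × Sector r s n => annPair F ψ p.1 p.2 := by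
  refine StronglyMeasurable.integral_prod_right'
    (f := fun z : (Boson × Sector r s n) × (Fermion × Fermion) =>
      conj (kernelFun F (z.2.1, z.2.2, z.1.1)) * ψ (addE (addP (z.1.2, z.2.2), z.2.1))) ?_
  exact (StronglyMeasurable.conj hF |>.comp_measurable (by fun_prop)).mul
    (hψ.comp_measurable (by fun_prop))

theorem stronglyMeasurable_annPos {G : Fermion → Boson → ℂ}
    (hG : StronglyMeasurable (Function.uncurry G))
    {ψ : Sector r (s + 1) n → ℂ} (hψ : StronglyMeasurable ψ) :
    StronglyMeasurable fun p : Boson × Sector r s n => annPos G ψ p.1 p.2 := by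
  refine StronglyMeasurable.integral_prod_right'
    (f := fun z : (Boson × Sector r s n) × Fermion =>
      conj (Function.uncurry G (z.2, z.1.1)) * ψ (addP (z.1.2, z.2))) ?_
  exact (StronglyMeasurable.conj hG |>.comp_measurable (by fun_prop)).mul
    (hψ.comp_measurable (by fun_prop))

theorem isFockSym_annTriple {F : Kernel3} {ψ : Sector (r + 1) (s + 1) (n + 1) → ℂ}
    (hψ : IsFockSym ψ) : IsFockSym (annTriple F ψ) := by
  intro σ τ π w
  simp only [annTriple]
  rw [← integral_const_mul]
  congr 1
  funext ξ
  have h := hψ (consPerm σ) (consPerm τ) (consPerm π) (addE (addP (addZ (w, ξ.2.2), ξ.2.1), ξ.1))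
  have e : relabel (consPerm σ) (consPerm τ) (consPerm π)
      (addE (addP (addZ (w, ξ.2.2), ξ.2.1), ξ.1)) =
      addE (addP (addZ (relabel σ τ π w, ξ.2.2), ξ.2.1), ξ.1) := by
    simp only [relabel, addE, addP, addZ, cons_comp_consPerm]
  rw [← e, h, sign_consPerm, sign_consPerm]
  ring

/-- The variables of a sector with the positrons last. -/
def posLast (p : ((Fin r → Fermion) × (Fin n → Boson)) × (Fin s → Fermion)) : Sector r s n :=
  (p.1.1, p.2, p.1.2)

theorem measurePreserving_posLast : MeasurePreserving (posLast (r := r) (s := s) (n := n))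
    (((Measure.pi fun _ => muF).prod (Measure.pi fun _ => muB)).prod (Measure.pi fun _ => muF))
    (muS r s n) :=
  measurePreserving_reorder _ _ _

theorem measurePreserving_addZ : MeasurePreserving
    (fun p : Boson × Sector r s n => addZ (p.2, p.1)) (muB.prod (muS r s n)) (muS r s (n + 1)) :=
  ((MeasurePreserving.id _).prod ((MeasurePreserving.id _).prod ((measurePreserving_cons muB n).comp
    Measure.measurePreserving_swap) |>.comp (measurePreserving_prodAssoc _ _ _))).comp
    ((measurePreserving_prodAssoc _ _ _).comp Measure.measurePreserving_swap)

theorem measurePreserving_addP : MeasurePreserving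
    (fun p : Fermion × Sector r s n => addP (p.2, p.1)) (muF.prod (muS r s n))
    (muS r (s + 1) n) := by
  have h1 := ((measurePreserving_cons muF s).prod (MeasurePreserving.id
    (Measure.pi fun _ : Fin n => muB))).comp (measurePreserving_prodAssoc muF
      (Measure.pi fun _ : Fin s => muF) (Measure.pi fun _ : Fin n => muB)).symm
  have h2 : MeasurePreserving (fun p : Fermion × Sector r s n => (p.2.1, (p.1, p.2.2)))
      (muF.prod (muS r s n)) ((Measure.pi fun _ : Fin r => muF).prod (muF.prod
        ((Measure.pi fun _ : Fin s => muF).prod (Measure.pi fun _ : Fin n => muB)))) :=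
    ((MeasurePreserving.id _).prod Measure.measurePreserving_swap).comp
      ((measurePreserving_prodAssoc _ _ _).comp Measure.measurePreserving_swap)
  exact ((MeasurePreserving.id _).prod h1).comp h2

theorem measurePreserving_addE : MeasurePreserving
    (fun p : Fermion × Sector r s n => addE (p.2, p.1)) (muF.prod (muS r s n))
    (muS (r + 1) s n) :=
  ((measurePreserving_cons muF r).prod (MeasurePreserving.id _)).comp
    (measurePreserving_prodAssoc _ _ _).symm

/-- The positron variable yields the gain `s + 1` by the Pauli principle; bosons obey no such
principle, and their variable is treated by Cauchy–Schwarz. -/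
theorem annPosBos_bound {G : Fermion → Boson → ℂ}
    (hG : StronglyMeasurable (Function.uncurry G))
    {ψ : Sector r (s + 1) (n + 1) → ℂ} (hψ : StronglyMeasurable ψ) (hsym : IsFockSym ψ) :
    (s + 1 : ℝ≥0∞) * sectorSq (annPosBos G ψ) ≤
      (∫⁻ ξ, ‖Function.uncurry G ξ‖ₑ ^ 2 ∂muF.prod muB) * sectorSq ψ := by
  have h := contraction_bound muF ((Measure.pi fun _ : Fin r => muF).prod
    (Measure.pi fun _ : Fin n => muB)) muB (K := fun ξ₃ ξ₂ => G ξ₂ ξ₃)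
    (hG.comp_measurable measurable_swap)
    (θ := fun ξ₃ y w₂ => ψ (addZ (posLast (y, w₂), ξ₃)))
    (hψ.comp_measurable (by unfold posLast addZ; fun_prop))
    (fun ξ₃ y => hsym.anti₂ y.1 (Fin.cons ξ₃ y.2))
  have e1 : ∫⁻ p, ‖Function.uncurry (fun ξ₃ ξ₂ => G ξ₂ ξ₃) p‖ₑ ^ 2 ∂muB.prod muF =
      ∫⁻ ξ, ‖Function.uncurry G ξ‖ₑ ^ 2 ∂muF.prod muB :=
    Measure.measurePreserving_swap.lintegral_comp (hG.enorm.pow_const 2)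
  have e2 := (measurePreserving_addZ.comp ((MeasurePreserving.id muB).prod
    (measurePreserving_posLast (r := r) (s := s + 1) (n := n)))).lintegral_comp
      (hψ.enorm.pow_const 2)
  have e3 := (measurePreserving_posLast (r := r) (s := s) (n := n)).lintegral_comp
      ((stronglyMeasurable_annPosBos hG hψ).enorm.pow_const 2)
  rw [e1] at h
  unfold sectorSq
  rw [← e2, ← e3]
  refine le_trans ?_ h
  gcongr with p
  exact enorm_integral_prod_symm_le _

/-- For fixed `ξ₃` this is the Pauli principle; the boson is only a parameter, integrated at the
end. -/
theorem annPos_bound {G : Fermion → Boson → ℂ}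
    (hG : StronglyMeasurable (Function.uncurry G))
    {ψ : Sector r (s + 1) n → ℂ} (hψ : StronglyMeasurable ψ) (hsym : IsFockSym ψ) :
    (s + 1 : ℝ≥0∞) * ∫⁻ ξ₃, sectorSq (annPos G ψ ξ₃) ∂muB ≤
      (∫⁻ ξ, ‖Function.uncurry G ξ‖ₑ ^ 2 ∂muF.prod muB) * sectorSq ψ := by
  have e2 := (measurePreserving_posLast (r := r) (s := s + 1) (n := n)).lintegral_comp
      (hψ.enorm.pow_const 2)
  have key : ∀ ξ₃, (s + 1 : ℝ≥0∞) * sectorSq (annPos G ψ ξ₃) ≤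
      (∫⁻ ξ, ‖G ξ ξ₃‖ₑ ^ 2 ∂muF) * sectorSq ψ := fun ξ₃ => by
    have h := pauli_spectator muF ((Measure.pi fun _ : Fin r => muF).prod
      (Measure.pi fun _ : Fin n => muB)) (u := fun ξ => G ξ ξ₃)
      (hG.comp_measurable measurable_prodMk_right)
      (θ := fun y w₂ => ψ (posLast (y, w₂)))
      (hψ.comp_measurable measurePreserving_posLast.measurable)
      (fun y => hsym.anti₂ y.1 y.2)
    have hm : StronglyMeasurable (annPos G ψ ξ₃ : Sector r s n → ℂ) :=
      (stronglyMeasurable_annPos hG hψ).comp_measurable measurable_prodMk_left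
    have e3 := (measurePreserving_posLast (r := r) (s := s) (n := n)).lintegral_comp
      (hm.enorm.pow_const 2)
    unfold sectorSq
    rw [← e2, ← e3]
    exact h
  have hm : Measurable fun ξ₃ => sectorSq (annPos G ψ ξ₃) :=
    ((stronglyMeasurable_annPos hG hψ).enorm.pow_const 2).lintegral_prod_right'
  rw [← lintegral_const_mul _ hm]
  refine (lintegral_mono key).trans_eq ?_
  have hm2 : Measurable fun p : Boson × Fermion => ‖Function.uncurry G p.swap‖ₑ ^ 2 :=
    (hG.comp_measurable measurable_swap).enorm.pow_const 2
  have hm3 : Measurable fun ξ₃ => ∫⁻ ξ, ‖G ξ ξ₃‖ₑ ^ 2 ∂muF := hm2.lintegral_prod_right'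
  rw [lintegral_mul_const _ hm3,
    ← Measure.measurePreserving_swap.lintegral_comp (hG.enorm.pow_const 2),
    lintegral_prod _ hm2.aemeasurable]
  rfl

/-- The variables `ξ₁, ξ₃` and `ξ₂` of a kernel. -/
theorem measurePreserving_kernelSplit : MeasurePreserving
    (fun p : (Fermion × Boson) × Fermion => (p.1.1, p.2, p.1.2))
    ((muF.prod muB).prod muF) muFFB :=
  measurePreserving_reorder _ _ _

/-- Pauli in the positron variable, Cauchy–Schwarz in the electron and boson variables together.
Only `s + 1` is gained; the factor `r + 1` of the electron normalization is left uncompensated. -/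
theorem annTriple_bound {F : Kernel3} (hF : StronglyMeasurable (kernelFun F))
    {ψ : Sector (r + 1) (s + 1) (n + 1) → ℂ} (hψ : StronglyMeasurable ψ) (hsym : IsFockSym ψ) :
    (s + 1 : ℝ≥0∞) * sectorSq (annTriple F ψ) ≤ kernelSq F * sectorSq ψ := by
  have h := contraction_bound muF ((Measure.pi fun _ : Fin r => muF).prod
    (Measure.pi fun _ : Fin n => muB)) (muF.prod muB) (K := fun ξ ξ₂ => F ξ.1 ξ₂ ξ.2)
    (hF.comp_measurable measurePreserving_kernelSplit.measurable)
    (θ := fun ξ y w₂ => ψ (addE (addZ (posLast (y, w₂), ξ.2), ξ.1)))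
    (hψ.comp_measurable (by unfold posLast addZ addE; fun_prop))
    (fun ξ y => hsym.anti₂ (Fin.cons ξ.1 y.1) (Fin.cons ξ.2 y.2))
  have e1 := measurePreserving_kernelSplit.lintegral_comp (hF.enorm.pow_const 2)
  have e2 := (measurePreserving_addE.comp (((MeasurePreserving.id muF).prod
    (measurePreserving_addZ.comp ((MeasurePreserving.id muB).prod
    (measurePreserving_posLast (r := r) (s := s + 1) (n := n))))).comp
      (measurePreserving_prodAssoc _ _ _))).lintegral_comp (hψ.enorm.pow_const 2)
  have e3 := (measurePreserving_posLast (r := r) (s := s) (n := n)).lintegral_comp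
      ((stronglyMeasurable_annTriple hF hψ).enorm.pow_const 2)
  unfold sectorSq kernelSq
  rw [← e1, ← e2, ← e3]
  refine le_trans ?_ h
  gcongr with p
  refine le_trans (le_of_eq ?_) (enorm_integral_prod_le (μ := muF.prod muB) (ν := muF)
    fun q : (Fermion × Boson) × Fermion => conj (kernelFun F (q.1.1, q.2, q.1.2)) *
      ψ (addE (addP (addZ (posLast p, q.1.2), q.2), q.1.1)))
  congr 1
  refine (MeasurePreserving.integral_comp_of_aestronglyMeasurable
    measurePreserving_kernelSplit ?_).symm
  exact ((StronglyMeasurable.conj hF).mul (hψ.comp_measurable (by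
    unfold posLast addZ addP addE; fun_prop))).aestronglyMeasurable

theorem lintegral_kernel_slice {F : Kernel3} (hF : StronglyMeasurable (kernelFun F)) :
    ∫⁻ ξ₃, ∫⁻ ξ, ‖F ξ.1 ξ.2 ξ₃‖ₑ ^ 2 ∂muF.prod muF ∂muB = kernelSq F := by
  have mp : MeasurePreserving (fun p : Boson × (Fermion × Fermion) => (p.2.1, p.2.2, p.1))
      (muB.prod (muF.prod muF)) muFFB :=
    (measurePreserving_prodAssoc muF muF muB).comp Measure.measurePreserving_swap
  have e := mp.lintegral_comp (hF.enorm.pow_const 2)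
  have hm : Measurable fun p : Boson × (Fermion × Fermion) =>
      ‖kernelFun F (p.2.1, p.2.2, p.1)‖ₑ ^ 2 :=
    (hF.comp_measurable mp.measurable).enorm.pow_const 2
  rw [kernelSq, ← e, lintegral_prod _ hm.aemeasurable]
  rfl

theorem annPair_bound {F : Kernel3} (hF : StronglyMeasurable (kernelFun F))
    {ψ : Sector (r + 1) (s + 1) n → ℂ} (hψ : StronglyMeasurable ψ) (hsym : IsFockSym ψ) :
    (s + 1 : ℝ≥0∞) * ∫⁻ ξ₃, sectorSq (annPair F ψ ξ₃) ∂muB ≤ kernelSq F * sectorSq ψ := by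
  have e2 := (measurePreserving_addE.comp ((MeasurePreserving.id muF).prod
    (measurePreserving_posLast (r := r) (s := s + 1) (n := n)))).lintegral_comp
      (hψ.enorm.pow_const 2)
  have key : ∀ ξ₃, (s + 1 : ℝ≥0∞) * sectorSq (annPair F ψ ξ₃) ≤
      (∫⁻ ξ, ‖F ξ.1 ξ.2 ξ₃‖ₑ ^ 2 ∂muF.prod muF) * sectorSq ψ := fun ξ₃ => by
    have h := contraction_bound muF ((Measure.pi fun _ : Fin r => muF).prod
      (Measure.pi fun _ : Fin n => muB)) muF (K := fun ξ₁ ξ₂ => F ξ₁ ξ₂ ξ₃)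
      (hF.comp_measurable (by fun_prop : Measurable fun p : Fermion × Fermion => (p.1, p.2, ξ₃)))
      (θ := fun ξ₁ y w₂ => ψ (addE (posLast (y, w₂), ξ₁)))
      (hψ.comp_measurable (by unfold posLast addE; fun_prop))
      (fun ξ₁ y => hsym.anti₂ (Fin.cons ξ₁ y.1) y.2)
    have hm : StronglyMeasurable (annPair F ψ ξ₃ : Sector r s n → ℂ) :=
      (stronglyMeasurable_annPair hF hψ).comp_measurable measurable_prodMk_left
    have e3 := (measurePreserving_posLast (r := r) (s := s) (n := n)).lintegral_comp
      (hm.enorm.pow_const 2)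
    unfold sectorSq
    rw [← e2, ← e3]
    refine le_trans ?_ h
    gcongr with p
    exact enorm_integral_prod_le _
  have hm : Measurable fun ξ₃ => sectorSq (annPair F ψ ξ₃) :=
    ((stronglyMeasurable_annPair hF hψ).enorm.pow_const 2).lintegral_prod_right'
  rw [← lintegral_const_mul _ hm]
  refine (lintegral_mono key).trans_eq ?_
  have hm2 : Measurable fun p : Boson × (Fermion × Fermion) => ‖kernelFun F (p.2.1, p.2.2, p.1)‖ₑ ^ 2 :=
    (hF.comp_measurable (by fun_prop)).enorm.pow_const 2
  have hm3 : Measurable fun ξ₃ => ∫⁻ ξ, ‖F ξ.1 ξ.2 ξ₃‖ₑ ^ 2 ∂muF.prod muF :=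
    hm2.lintegral_prod_right'
  rw [lintegral_mul_const _ hm3, lintegral_kernel_slice hF]

/-- The kernel `u(ξ₁) G(ξ₂, ξ₃)`. -/
def productKernel (u : Fermion → ℂ) (G : Fermion → Boson → ℂ) : Kernel3 :=
  fun ξ₁ ξ₂ ξ₃ => u ξ₁ * G ξ₂ ξ₃

/-- For a product kernel the electron can be contracted first. The inequality holds without
integrability, since a divergent joint integral has the value `0`. -/
theorem enorm_annTriple_productKernel_le (u : Fermion → ℂ) (G : Fermion → Boson → ℂ)
    (ψ : Sector (r + 1) (s + 1) (n + 1) → ℂ) (w : Sector r s n) :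
    ‖annTriple (productKernel u G) ψ w‖ₑ ≤ ‖annPosBos G (annOne u ψ) w‖ₑ := by
  unfold annTriple muFFB
  by_cases h : Integrable (fun ξ : Fermion × Fermion × Boson => conj (kernelFun
    (productKernel u G) ξ) * ψ (addE (addP (addZ (w, ξ.2.2), ξ.2.1), ξ.1)))
    (muF.prod (muF.prod muB))
  · rw [integral_prod_symm _ h]
    refine le_of_eq ?_
    congr 1
    unfold annPosBos annOne
    congr 1
    funext ξ
    rw [← integral_const_mul]
    congr 1
    funext ξ₁
    simp only [kernelFun, productKernel, map_mul]
    ring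
  · rw [integral_undef h]; simp

theorem enorm_annPair_productKernel_le (u : Fermion → ℂ) (G : Fermion → Boson → ℂ)
    (ψ : Sector (r + 1) (s + 1) n → ℂ) (ξ₃ : Boson) (w : Sector r s n) :
    ‖annPair (productKernel u G) ψ ξ₃ w‖ₑ ≤ ‖annPos G (annOne u ψ) ξ₃ w‖ₑ := by
  unfold annPair
  by_cases h : Integrable (fun ξ : Fermion × Fermion => conj (productKernel u G ξ.1 ξ.2 ξ₃) *
    ψ (addE (addP (w, ξ.2), ξ.1))) (muF.prod muF)
  · rw [integral_prod_symm _ h]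
    refine le_of_eq ?_
    congr 1
    unfold annPos annOne
    congr 1
    funext ξ
    rw [← integral_const_mul]
    congr 1
    funext ξ₁
    simp only [productKernel, map_mul]
    ring
  · rw [integral_undef h]; simp

/-- The electron contraction `annOne u ψ` still has the symmetry of Fock space, so the Pauli
principle applies a second time, to the positrons, and both `r + 1` and `s + 1` are gained. -/
theorem annTriple_productKernel_bound {u : Fermion → ℂ} (hu : StronglyMeasurable u)
    {G : Fermion → Boson → ℂ} (hG : StronglyMeasurable (Function.uncurry G))
    {ψ : Sector (r + 1) (s + 1) (n + 1) → ℂ} (hψ : StronglyMeasurable ψ) (hsym : IsFockSym ψ) :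
    (r + 1 : ℝ≥0∞) * (s + 1) * sectorSq (annTriple (productKernel u G) ψ) ≤
      (∫⁻ ξ, ‖u ξ‖ₑ ^ 2 ∂muF) * (∫⁻ ξ, ‖Function.uncurry G ξ‖ₑ ^ 2 ∂muF.prod muB) *
        sectorSq ψ := by
  have h1 : sectorSq (annTriple (productKernel u G) ψ) ≤ sectorSq (annPosBos G (annOne u ψ)) :=
    lintegral_mono fun w => pow_le_pow_left' (enorm_annTriple_productKernel_le u G ψ w) 2
  have h2 := annPosBos_bound hG (stronglyMeasurable_annOne hu hψ) (isFockSym_annOne (u := u) hsym)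
  have h3 := annOne_bound hu hψ hsym
  calc (r + 1 : ℝ≥0∞) * (s + 1) * sectorSq (annTriple (productKernel u G) ψ)
      ≤ (r + 1 : ℝ≥0∞) * ((s + 1) * sectorSq (annPosBos G (annOne u ψ))) := by
        rw [mul_assoc]; gcongr
    _ ≤ (r + 1 : ℝ≥0∞) * ((∫⁻ ξ, ‖Function.uncurry G ξ‖ₑ ^ 2 ∂muF.prod muB) *
        sectorSq (annOne u ψ)) := by gcongr
    _ = (∫⁻ ξ, ‖Function.uncurry G ξ‖ₑ ^ 2 ∂muF.prod muB) *
        ((r + 1 : ℝ≥0∞) * sectorSq (annOne u ψ)) := by ring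
    _ ≤ (∫⁻ ξ, ‖Function.uncurry G ξ‖ₑ ^ 2 ∂muF.prod muB) *
        ((∫⁻ ξ, ‖u ξ‖ₑ ^ 2 ∂muF) * sectorSq ψ) := by gcongr
    _ = _ := by ring

theorem annPair_productKernel_bound {u : Fermion → ℂ} (hu : StronglyMeasurable u)
    {G : Fermion → Boson → ℂ} (hG : StronglyMeasurable (Function.uncurry G))
    {ψ : Sector (r + 1) (s + 1) n → ℂ} (hψ : StronglyMeasurable ψ) (hsym : IsFockSym ψ) :
    (r + 1 : ℝ≥0∞) * (s + 1) * ∫⁻ ξ₃, sectorSq (annPair (productKernel u G) ψ ξ₃) ∂muB ≤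
      (∫⁻ ξ, ‖u ξ‖ₑ ^ 2 ∂muF) * (∫⁻ ξ, ‖Function.uncurry G ξ‖ₑ ^ 2 ∂muF.prod muB) *
        sectorSq ψ := by
  have h1 : ∫⁻ ξ₃, sectorSq (annPair (productKernel u G) ψ ξ₃) ∂muB ≤
      ∫⁻ ξ₃, sectorSq (annPos G (annOne u ψ) ξ₃) ∂muB :=
    lintegral_mono fun ξ₃ => lintegral_mono fun w =>
      pow_le_pow_left' (enorm_annPair_productKernel_le u G ψ ξ₃ w) 2
  have h2 := annPos_bound hG (stronglyMeasurable_annOne hu hψ) (isFockSym_annOne (u := u) hsym)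
  have h3 := annOne_bound hu hψ hsym
  calc (r + 1 : ℝ≥0∞) * (s + 1) * ∫⁻ ξ₃, sectorSq (annPair (productKernel u G) ψ ξ₃) ∂muB
      ≤ (r + 1 : ℝ≥0∞) * ((s + 1) * ∫⁻ ξ₃, sectorSq (annPos G (annOne u ψ) ξ₃) ∂muB) := by
        rw [mul_assoc]; gcongr
    _ ≤ (r + 1 : ℝ≥0∞) * ((∫⁻ ξ, ‖Function.uncurry G ξ‖ₑ ^ 2 ∂muF.prod muB) *
        sectorSq (annOne u ψ)) := by gcongr
    _ = (∫⁻ ξ, ‖Function.uncurry G ξ‖ₑ ^ 2 ∂muF.prod muB) *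
        ((r + 1 : ℝ≥0∞) * sectorSq (annOne u ψ)) := by ring
    _ ≤ (∫⁻ ξ, ‖Function.uncurry G ξ‖ₑ ^ 2 ∂muF.prod muB) *
        ((∫⁻ ξ, ‖u ξ‖ₑ ^ 2 ∂muF) * sectorSq ψ) := by gcongr
    _ = _ := by ring

end Annihilation

/-! ## Kernels of finite rank in the electron variable are dense -/

section FiniteRank

variable {α β : Type*} [MeasurableSpace α] [MeasurableSpace β] {μ : Measure α} {ν : Measure β}
  [SigmaFinite μ] [SigmaFinite ν]

/-- A square integrable function on a product space whose integrals over all measurable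
rectangles of finite measure vanish is zero almost everywhere. -/
theorem ae_eq_zero_of_integral_rectangle {f : α × β → ℂ} (hf : MemLp f 2 (μ.prod ν))
    (h : ∀ s t, MeasurableSet s → MeasurableSet t → μ s < ⊤ → ν t < ⊤ →
      ∫ z in s ×ˢ t, f z ∂μ.prod ν = 0) : f =ᵐ[μ.prod ν] 0 := by
  -- A π-λ argument on each rectangle `R n` of finite measure, where `f` is integrable; the step for
  -- complements uses that the integral over all of `R n` vanishes.
  let R : ℕ → Set (α × β) := fun n => spanningSets μ n ×ˢ spanningSets ν n
  have hRm : ∀ n, MeasurableSet (R n) := fun n =>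
    (measurableSet_spanningSets μ n).prod (measurableSet_spanningSets ν n)
  have hRfin : ∀ n, μ.prod ν (R n) < ⊤ := fun n => by
    rw [Measure.prod_prod]
    exact ENNReal.mul_lt_top (measure_spanningSets_lt_top μ n) (measure_spanningSets_lt_top ν n)
  have hint : ∀ n, IntegrableOn f (R n) (μ.prod ν) := fun n => by
    have : IsFiniteMeasure ((μ.prod ν).restrict (R n)) := ⟨by simpa using hRfin n⟩
    exact (hf.restrict (R n)).integrable (by norm_num)
  have key : ∀ n, ∀ S, MeasurableSet S → ∫ z in S, f z ∂(μ.prod ν).restrict (R n) = 0 := by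
    intro n S hS
    induction S, hS using MeasurableSpace.induction_on_inter generateFrom_prod.symm isPiSystem_prod
      with
    | empty => simp
    | basic t ht =>
      obtain ⟨s, hs, u, hu, rfl⟩ := ht
      rw [Measure.restrict_restrict (MeasurableSet.prod hs hu), prod_inter_prod]
      refine h _ _ (hs.inter (measurableSet_spanningSets μ n))
        (hu.inter (measurableSet_spanningSets ν n)) ?_ ?_
      · exact (measure_mono inter_subset_right).trans_lt (measure_spanningSets_lt_top μ n)
      · exact (measure_mono inter_subset_right).trans_lt (measure_spanningSets_lt_top ν n)
    | compl t ht ih =>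
      have h1 := integral_add_compl ht (hint n)
      have h2 : ∫ z in R n, f z ∂μ.prod ν = 0 :=
        h _ _ (measurableSet_spanningSets μ n) (measurableSet_spanningSets ν n)
          (measure_spanningSets_lt_top μ n) (measure_spanningSets_lt_top ν n)
      rw [ih, h2, zero_add] at h1
      exact h1
    | iUnion g hd hg ih =>
      rw [integral_iUnion hg hd (hint n).integrableOn]
      simp [ih]
  have hz : ∀ n, f =ᵐ[(μ.prod ν).restrict (R n)] 0 := fun n =>
    (hint n).ae_eq_zero_of_forall_setIntegral_eq_zero fun S hS _ => key n S hS
  have hun : (⋃ n, R n) = univ := by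
    have hmono : ∀ ⦃m n⦄, m ≤ n → R m ⊆ R n := fun m n hmn =>
      prod_mono (monotone_spanningSets μ hmn) (monotone_spanningSets ν hmn)
    refine eq_univ_of_forall fun z => ?_
    have h1 : z.1 ∈ ⋃ n, spanningSets μ n := by rw [iUnion_spanningSets]; trivial
    have h2 : z.2 ∈ ⋃ n, spanningSets ν n := by rw [iUnion_spanningSets]; trivial
    obtain ⟨m, hm⟩ := mem_iUnion.1 h1
    obtain ⟨n, hn⟩ := mem_iUnion.1 h2
    exact mem_iUnion.2 ⟨max m n, monotone_spanningSets μ (le_max_left m n) hm,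
      monotone_spanningSets ν (le_max_right m n) hn⟩
  have := (ae_restrict_iUnion_iff R (fun z => f z = (0 : α × β → ℂ) z)).2 hz
  rwa [hun, Measure.restrict_univ] at this

/-- A subspace of `L²` of a product space that contains the indicator functions of rectangles is
dense. -/
theorem dense_of_rectangles (M : Submodule ℂ (Lp ℂ 2 (μ.prod ν)))
    (hM : ∀ s t, (hs : MeasurableSet s) → (ht : MeasurableSet t) → (hs' : μ s < ⊤) →
      (ht' : ν t < ⊤) → indicatorConstLp 2 (hs.prod ht)
        (by rw [Measure.prod_prod]; exact (ENNReal.mul_lt_top hs' ht').ne) (1 : ℂ) ∈ M) :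
    M.topologicalClosure = ⊤ := by
  rw [Submodule.topologicalClosure_eq_top_iff, Submodule.eq_bot_iff]
  intro f hf
  refine Lp.ext ((ae_eq_zero_of_integral_rectangle (Lp.memLp f) fun s t hs ht hs' ht' => ?_).trans
    (Lp.coeFn_zero ℂ 2 (μ.prod ν)).symm)
  have h := hf _ (hM s t hs ht hs' ht')
  rwa [L2.inner_indicatorConstLp_one] at h

end FiniteRank

/-! ## Bounds on pair and triple annihilation with small relative bound -/

section SmallBound

variable {r s n : ℕ}

/-- Measurable square integrable functions on a sector with the symmetry of Fock space. -/
structure IsSectorFun (ψ : Sector r s n → ℂ) : Prop where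
  meas : StronglyMeasurable ψ
  symm : IsFockSym ψ
  memLp : MemLp ψ 2 (muS r s n)

/-- The squared `L²` norm of `annPair`. -/
def pairSq (F : Kernel3) (ψ : Sector (r + 1) (s + 1) n → ℂ) : ℝ≥0∞ :=
  ∫⁻ ξ₃, sectorSq (annPair F ψ ξ₃) ∂muB

/-- The annihilation of pairs and triples with kernel `F` is bounded with weights `C`. -/
def AnnBound (F : Kernel3) (C : ℕ → ℝ≥0∞) : Prop :=
  (∀ r s n (ψ : Sector (r + 1) (s + 1) (n + 1) → ℂ), IsSectorFun ψ →
    (r + 1 : ℝ≥0∞) * (s + 1) * sectorSq (annTriple F ψ) ≤ C r * sectorSq ψ) ∧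
  (∀ r s n (ψ : Sector (r + 1) (s + 1) n → ℂ), IsSectorFun ψ →
    (r + 1 : ℝ≥0∞) * (s + 1) * pairSq F ψ ≤ C r * sectorSq ψ)

/-- The weight grows with `r` because the Pauli principle has been used for the positrons only; the
factor `r + 1` is carried to the right side. -/
theorem annBound_of_kernelSq {F : Kernel3} (hF : StronglyMeasurable (kernelFun F)) :
    AnnBound F fun r => (r + 1) * kernelSq F := by
  refine ⟨fun r s n ψ hψ => ?_, fun r s n ψ hψ => ?_⟩
  · have h := annTriple_bound hF hψ.meas hψ.symm
    rw [mul_assoc, mul_assoc]; gcongr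
  · have h := annPair_bound hF hψ.meas hψ.symm
    rw [mul_assoc, mul_assoc]; unfold pairSq; gcongr

theorem annTriple_congr {F F' : Kernel3} (h : kernelFun F =ᵐ[muFFB] kernelFun F')
    (ψ : Sector (r + 1) (s + 1) (n + 1) → ℂ) (w : Sector r s n) :
    annTriple F ψ w = annTriple F' ψ w :=
  integral_congr_ae (h.mono fun ξ e => by simp only [e])

theorem measurePreserving_kernelLast : MeasurePreserving
    (fun p : Boson × (Fermion × Fermion) => ((p.2.1, p.2.2, p.1) : Fermion × Fermion × Boson))
      (muB.prod (muF.prod muF)) muFFB :=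
  (measurePreserving_prodAssoc muF muF muB).comp Measure.measurePreserving_swap

theorem ae_kernel_slice {p : Fermion × Fermion × Boson → Prop} (h : ∀ᵐ ξ ∂muFFB, p ξ) :
    ∀ᵐ ξ₃ ∂muB, ∀ᵐ ξ ∂muF.prod muF, p (ξ.1, ξ.2, ξ₃) :=
  Measure.ae_ae_of_ae_prod (measurePreserving_kernelLast.quasiMeasurePreserving.ae h)

theorem annPair_congr {F F' : Kernel3} (h : kernelFun F =ᵐ[muFFB] kernelFun F')
    (ψ : Sector (r + 1) (s + 1) n → ℂ) :
    ∀ᵐ ξ₃ ∂muB, ∀ w : Sector r s n, annPair F ψ ξ₃ w = annPair F' ψ ξ₃ w := by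
  filter_upwards [ae_kernel_slice h] with ξ₃ h w
  refine integral_congr_ae (h.mono fun ξ e => ?_)
  simp only [kernelFun] at e
  simp only [e]

theorem AnnBound.congr {F F' : Kernel3} (h : kernelFun F =ᵐ[muFFB] kernelFun F') {C : ℕ → ℝ≥0∞}
    (hF : AnnBound F C) : AnnBound F' C := by
  refine ⟨fun r s n ψ hψ => ?_, fun r s n ψ hψ => ?_⟩
  · have e : annTriple F' ψ = annTriple F ψ := funext fun w => (annTriple_congr h ψ w).symm
    rw [e]; exact hF.1 r s n ψ hψ
  · have e : pairSq F' ψ = pairSq F ψ := lintegral_congr_ae (by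
      filter_upwards [annPair_congr h ψ] with ξ₃ e
      exact lintegral_congr fun w => by rw [e])
    rw [e]; exact hF.2 r s n ψ hψ

theorem enorm_add_sq_le (a b : ℂ) : ‖a + b‖ₑ ^ 2 ≤ 2 * ‖a‖ₑ ^ 2 + 2 * ‖b‖ₑ ^ 2 := by
  have h : ‖a + b‖ ^ 2 ≤ 2 * ‖a‖ ^ 2 + 2 * ‖b‖ ^ 2 := by
    have h1 : ‖a + b‖ ^ 2 ≤ (‖a‖ + ‖b‖) ^ 2 := by gcongr; exact norm_add_le a b
    nlinarith [sq_nonneg (‖a‖ - ‖b‖)]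
  simp only [← ofReal_norm, ← ENNReal.ofReal_pow (norm_nonneg _)]
  have h2 : (2 : ℝ≥0∞) = ENNReal.ofReal 2 := by norm_num
  rw [h2, ← ENNReal.ofReal_mul (by norm_num), ← ENNReal.ofReal_mul (by norm_num),
    ← ENNReal.ofReal_add (by positivity) (by positivity)]
  exact ENNReal.ofReal_le_ofReal h

theorem memLp_slice_sector {ψ : Sector (r + 1) (s + 1) (n + 1) → ℂ}
    (hψ : MemLp ψ 2 (muS (r + 1) (s + 1) (n + 1))) :
    ∀ᵐ w ∂muS r s n, MemLp (fun ξ : Fermion × Fermion × Boson =>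
      ψ (addE (addP (addZ (w, ξ.2.2), ξ.2.1), ξ.1))) 2 muFFB := by
  have mp : MeasurePreserving (fun p : (Sector r s n) × (Fermion × Fermion × Boson) =>
      addE (addP (addZ (p.1, p.2.2.2), p.2.2.1), p.2.1)) ((muS r s n).prod muFFB)
      (muS (r + 1) (s + 1) (n + 1)) := by
    have h1 := measurePreserving_addE.comp ((MeasurePreserving.id muF).prod
      (measurePreserving_addP.comp ((MeasurePreserving.id muF).prod
        (measurePreserving_addZ (r := r) (s := s) (n := n)))))
    have h2 : MeasurePreserving (fun p : (Fermion × Fermion × Boson) × Sector r s n =>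
        (p.1.1, (p.1.2.1, (p.1.2.2, p.2)))) (muFFB.prod (muS r s n))
        (muF.prod (muF.prod (muB.prod (muS r s n)))) :=
      ((MeasurePreserving.id muF).prod (measurePreserving_prodAssoc muF muB (muS r s n))).comp
        (measurePreserving_prodAssoc muF (muF.prod muB) (muS r s n))
    exact (h1.comp h2).comp Measure.measurePreserving_swap
  exact MemLp.slice (hψ.comp_measurePreserving mp)

theorem measurePreserving_addEP : MeasurePreserving
    (fun p : Sector r s n × (Fermion × Fermion) => addE (addP (p.1, p.2.2), p.2.1))
    ((muS r s n).prod (muF.prod muF)) (muS (r + 1) (s + 1) n) := by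
  have h1 := measurePreserving_addE.comp ((MeasurePreserving.id muF).prod
    (measurePreserving_addP (r := r) (s := s) (n := n)))
  exact (h1.comp (measurePreserving_prodAssoc muF muF (muS r s n))).comp
    Measure.measurePreserving_swap

theorem memLp_slice_sector_pair {ψ : Sector (r + 1) (s + 1) n → ℂ}
    (hψ : MemLp ψ 2 (muS (r + 1) (s + 1) n)) :
    ∀ᵐ w ∂muS r s n, MemLp (fun ξ : Fermion × Fermion =>
      ψ (addE (addP (w, ξ.2), ξ.1))) 2 (muF.prod muF) :=
  MemLp.slice (hψ.comp_measurePreserving measurePreserving_addEP)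

theorem memLp_kernel_slice {F : Kernel3} (hF : MemLp (kernelFun F) 2 muFFB) :
    ∀ᵐ ξ₃ ∂muB, MemLp (fun ξ : Fermion × Fermion => F ξ.1 ξ.2 ξ₃) 2 (muF.prod muF) :=
  MemLp.slice (hF.comp_measurePreserving measurePreserving_kernelLast)

/-- The contraction is additive in the kernel only where both integrals converge. Square
integrability of the kernels and of `ψ` ensures this for almost every `w`. -/
theorem sectorSq_annTriple_add_le {F F' : Kernel3} (hF : StronglyMeasurable (kernelFun F))
    (hF2 : MemLp (kernelFun F) 2 muFFB) (hF'2 : MemLp (kernelFun F') 2 muFFB)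
    {ψ : Sector (r + 1) (s + 1) (n + 1) → ℂ} (hψ : IsSectorFun ψ) :
    sectorSq (annTriple (F + F') ψ) ≤
      2 * sectorSq (annTriple F ψ) + 2 * sectorSq (annTriple F' ψ) := by
  have hm : Measurable fun w => 2 * ‖annTriple F ψ w‖ₑ ^ 2 :=
    ((stronglyMeasurable_annTriple hF hψ.meas).enorm.pow_const 2).const_mul 2
  unfold sectorSq
  rw [← lintegral_const_mul' _ _ (by norm_num), ← lintegral_const_mul' _ _ (by norm_num),
    ← lintegral_add_left hm]
  refine lintegral_mono_ae ?_
  filter_upwards [memLp_slice_sector hψ.memLp] with w hw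
  refine le_of_eq_of_le ?_ (enorm_add_sq_le _ _)
  congr 2
  unfold annTriple
  rw [← integral_add (integrable_conj_mul hF2 hw) (integrable_conj_mul hF'2 hw)]
  congr 1
  funext ξ
  simp only [kernelFun, Pi.add_apply, map_add]
  ring

theorem sectorSq_annPair_add_le {F F' : Kernel3} {ξ₃ : Boson}
    {ψ : Sector (r + 1) (s + 1) n → ℂ}
    (hm : StronglyMeasurable (annPair F ψ ξ₃ : Sector r s n → ℂ))
    (h1 : MemLp (fun ξ : Fermion × Fermion => F ξ.1 ξ.2 ξ₃) 2 (muF.prod muF))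
    (h2 : MemLp (fun ξ : Fermion × Fermion => F' ξ.1 ξ.2 ξ₃) 2 (muF.prod muF))
    (hψ : IsSectorFun ψ) :
    sectorSq (annPair (F + F') ψ ξ₃ : Sector r s n → ℂ) ≤
      2 * sectorSq (annPair F ψ ξ₃ : Sector r s n → ℂ) +
        2 * sectorSq (annPair F' ψ ξ₃ : Sector r s n → ℂ) := by
  have hm3 : Measurable fun w : Sector r s n => 2 * ‖annPair F ψ ξ₃ w‖ₑ ^ 2 :=
    (hm.enorm.pow_const 2).const_mul 2
  unfold sectorSq
  rw [← lintegral_const_mul' _ _ (by norm_num), ← lintegral_const_mul' _ _ (by norm_num),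
    ← lintegral_add_left hm3]
  refine lintegral_mono_ae ?_
  filter_upwards [memLp_slice_sector_pair hψ.memLp] with w hw
  refine le_of_eq_of_le ?_ (enorm_add_sq_le _ _)
  congr 2
  unfold annPair
  rw [← integral_add (integrable_conj_mul h1 hw) (integrable_conj_mul h2 hw)]
  congr 1
  funext ξ
  simp only [Pi.add_apply, map_add]
  ring

theorem pairSq_add_le {F F' : Kernel3} (hF : StronglyMeasurable (kernelFun F))
    (hF2 : MemLp (kernelFun F) 2 muFFB) (hF'2 : MemLp (kernelFun F') 2 muFFB)
    {ψ : Sector (r + 1) (s + 1) n → ℂ} (hψ : IsSectorFun ψ) :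
    pairSq (F + F') ψ ≤ 2 * pairSq F ψ + 2 * pairSq F' ψ := by
  have hm0 := stronglyMeasurable_annPair hF hψ.meas
  have hm2 : Measurable fun ξ₃ => 2 * sectorSq (annPair F ψ ξ₃ : Sector r s n → ℂ) :=
    ((hm0.enorm.pow_const 2).lintegral_prod_right').const_mul 2
  unfold pairSq
  rw [← lintegral_const_mul' _ _ (by norm_num), ← lintegral_const_mul' _ _ (by norm_num),
    ← lintegral_add_left hm2]
  refine lintegral_mono_ae ?_
  filter_upwards [memLp_kernel_slice hF2, memLp_kernel_slice hF'2] with ξ₃ h1 h2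
  exact sectorSq_annPair_add_le (hm0.comp_measurable measurable_prodMk_left) h1 h2 hψ

theorem AnnBound.add {F F' : Kernel3} (hF : StronglyMeasurable (kernelFun F))
    (hF2 : MemLp (kernelFun F) 2 muFFB) (hF'2 : MemLp (kernelFun F') 2 muFFB) {C C' : ℕ → ℝ≥0∞}
    (h : AnnBound F C) (h' : AnnBound F' C') :
    AnnBound (F + F') fun r => 2 * C r + 2 * C' r := by
  refine ⟨fun r s n ψ hψ => ?_, fun r s n ψ hψ => ?_⟩
  · calc (r + 1 : ℝ≥0∞) * (s + 1) * sectorSq (annTriple (F + F') ψ)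
        ≤ (r + 1 : ℝ≥0∞) * (s + 1) *
          (2 * sectorSq (annTriple F ψ) + 2 * sectorSq (annTriple F' ψ)) := by
          gcongr; exact sectorSq_annTriple_add_le hF hF2 hF'2 hψ
      _ = 2 * ((r + 1 : ℝ≥0∞) * (s + 1) * sectorSq (annTriple F ψ)) +
          2 * ((r + 1 : ℝ≥0∞) * (s + 1) * sectorSq (annTriple F' ψ)) := by ring
      _ ≤ 2 * (C r * sectorSq ψ) + 2 * (C' r * sectorSq ψ) := by
          exact add_le_add (mul_le_mul' le_rfl (h.1 r s n ψ hψ))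
            (mul_le_mul' le_rfl (h'.1 r s n ψ hψ))
      _ = _ := by ring
  · calc (r + 1 : ℝ≥0∞) * (s + 1) * pairSq (F + F') ψ
        ≤ (r + 1 : ℝ≥0∞) * (s + 1) * (2 * pairSq F ψ + 2 * pairSq F' ψ) := by
          gcongr; exact pairSq_add_le hF hF2 hF'2 hψ
      _ = 2 * ((r + 1 : ℝ≥0∞) * (s + 1) * pairSq F ψ) +
          2 * ((r + 1 : ℝ≥0∞) * (s + 1) * pairSq F' ψ) := by ring
      _ ≤ 2 * (C r * sectorSq ψ) + 2 * (C' r * sectorSq ψ) := by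
          exact add_le_add (mul_le_mul' le_rfl (h.2 r s n ψ hψ))
            (mul_le_mul' le_rfl (h'.2 r s n ψ hψ))
      _ = _ := by ring

theorem AnnBound.smul {F : Kernel3} {C : ℕ → ℝ≥0∞} (h : AnnBound F C) (c : ℂ) :
    AnnBound (c • F) fun r => ‖c‖ₑ ^ 2 * C r := by
  have e1 : ∀ r s n (ψ : Sector (r + 1) (s + 1) (n + 1) → ℂ),
      sectorSq (annTriple (c • F) ψ) = ‖c‖ₑ ^ 2 * sectorSq (annTriple F ψ) := by
    intro r s n ψ
    unfold sectorSq
    rw [← lintegral_const_mul' _ _ (by finiteness)]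
    refine lintegral_congr fun w => ?_
    have : annTriple (c • F) ψ w = conj c * annTriple F ψ w := by
      unfold annTriple
      rw [← integral_const_mul]
      congr 1
      funext ξ
      simp only [kernelFun, Pi.smul_apply, smul_eq_mul, map_mul]
      ring
    rw [this, enorm_mul, mul_pow]
    congr 2
    rw [← ofReal_norm, ← ofReal_norm, Complex.norm_conj]
  have e2 : ∀ r s n (ψ : Sector (r + 1) (s + 1) n → ℂ),
      pairSq (c • F) ψ = ‖c‖ₑ ^ 2 * pairSq F ψ := by
    intro r s n ψ
    unfold pairSq sectorSq
    rw [← lintegral_const_mul' _ _ (by finiteness)]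
    refine lintegral_congr fun ξ₃ => ?_
    rw [← lintegral_const_mul' _ _ (by finiteness)]
    refine lintegral_congr fun w => ?_
    have : annPair (c • F) ψ ξ₃ w = conj c * annPair F ψ ξ₃ w := by
      unfold annPair
      rw [← integral_const_mul]
      congr 1
      funext ξ
      simp only [Pi.smul_apply, smul_eq_mul, map_mul]
      ring
    rw [this, enorm_mul, mul_pow]
    congr 2
    rw [← ofReal_norm, ← ofReal_norm, Complex.norm_conj]
  refine ⟨fun r s n ψ hψ => ?_, fun r s n ψ hψ => ?_⟩
  · rw [e1, mul_left_comm]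
    refine le_of_le_of_eq ?_ (mul_assoc (‖c‖ₑ ^ 2) (C r) _).symm
    exact mul_le_mul' le_rfl (h.1 r s n ψ hψ)
  · rw [e2, mul_left_comm]
    refine le_of_le_of_eq ?_ (mul_assoc (‖c‖ₑ ^ 2) (C r) _).symm
    exact mul_le_mul' le_rfl (h.2 r s n ψ hψ)

/-- A square integrable function as a kernel. -/
def kernelOf (f : Fermion × Fermion × Boson → ℂ) : Kernel3 := fun ξ₁ ξ₂ ξ₃ => f (ξ₁, ξ₂, ξ₃)

theorem kernelFun_kernelOf (f : Fermion × Fermion × Boson → ℂ) : kernelFun (kernelOf f) = f := rfl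

/-- The kernels for which the annihilation of pairs and triples is bounded uniformly in the number
of fermions. -/
def boundedKernels : Submodule ℂ (Lp ℂ 2 muFFB) where
  carrier := {f | ∃ C : NNReal, AnnBound (kernelOf f) fun _ => C}
  zero_mem' := by
    refine ⟨0, ?_⟩
    have h0 : AnnBound (0 : Kernel3) fun _ => ((0 : NNReal) : ℝ≥0∞) := by
      refine ⟨fun r s n ψ _ => ?_, fun r s n ψ _ => ?_⟩
      · simp [sectorSq, annTriple, kernelFun]
      · simp [pairSq, sectorSq, annPair]
    exact AnnBound.congr (F := 0) (F' := kernelOf (0 : Lp ℂ 2 muFFB)) (Lp.coeFn_zero ℂ 2 muFFB).symm h0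
  add_mem' := by
    rintro f g ⟨C, hC⟩ ⟨C', hC'⟩
    refine ⟨2 * C + 2 * C', ?_⟩
    have h := AnnBound.add (F := kernelOf f) (F' := kernelOf g) (Lp.stronglyMeasurable f) (Lp.memLp f) (Lp.memLp g) hC hC'
    have h2 := AnnBound.congr (F := kernelOf f + kernelOf g)
      (F' := kernelOf (f + g : Lp ℂ 2 muFFB)) (Lp.coeFn_add f g).symm h
    simpa using h2
  smul_mem' := by
    rintro c f ⟨C, hC⟩
    refine ⟨‖c‖₊ ^ 2 * C, ?_⟩
    have h := AnnBound.congr (F := c • kernelOf f) (F' := kernelOf (c • f : Lp ℂ 2 muFFB))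
      (Lp.coeFn_smul c f).symm (hC.smul c)
    simpa [enorm_eq_nnnorm] using h

/-- Indicators of rectangles in `ξ₁` and `(ξ₂, ξ₃)` are product kernels, for which both Pauli gains
are available, and their span is dense. -/
theorem boundedKernels_dense : boundedKernels.topologicalClosure = ⊤ := by
  refine dense_of_rectangles (μ := muF) (ν := muF.prod muB) _ fun s t hs ht hs' ht' => ?_
  let u : Fermion → ℂ := s.indicator fun _ => 1
  let G : Fermion → Boson → ℂ := fun ξ₂ ξ₃ => t.indicator (fun _ => 1) (ξ₂, ξ₃)
  have hu : StronglyMeasurable u := stronglyMeasurable_const.indicator hs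
  have hG : StronglyMeasurable (Function.uncurry G) := stronglyMeasurable_const.indicator ht
  have hu2 : ∫⁻ ξ, ‖u ξ‖ₑ ^ 2 ∂muF < ⊤ := by
    rw [← memLp_two_iff hu.aestronglyMeasurable]
    exact memLp_indicator_const 2 hs 1 (Or.inr hs'.ne)
  have hG2 : ∫⁻ ξ, ‖Function.uncurry G ξ‖ₑ ^ 2 ∂muF.prod muB < ⊤ := by
    rw [← memLp_two_iff hG.aestronglyMeasurable]
    exact memLp_indicator_const 2 ht 1 (Or.inr ht'.ne)
  have hb : AnnBound (productKernel u G) fun _ =>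
      (((∫⁻ ξ, ‖u ξ‖ₑ ^ 2 ∂muF) * ∫⁻ ξ, ‖Function.uncurry G ξ‖ₑ ^ 2 ∂muF.prod muB).toNNReal :
        NNReal) := by
    rw [ENNReal.coe_toNNReal (ENNReal.mul_lt_top hu2 hG2).ne]
    exact ⟨fun r s n ψ hψ => annTriple_productKernel_bound hu hG hψ.meas hψ.symm,
      fun r s n ψ hψ => annPair_productKernel_bound hu hG hψ.meas hψ.symm⟩
  refine ⟨_, hb.congr ?_⟩
  refine Filter.EventuallyEq.trans ?_ indicatorConstLp_coeFn.symm
  refine Filter.Eventually.of_forall fun ξ => ?_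
  simp only [kernelFun, productKernel, u, G]
  by_cases h1 : ξ.1 ∈ s <;> by_cases h2 : ξ.2 ∈ t <;> simp [indicator, h1, h2, mem_prod]

/-- For square integrable kernels the annihilation of pairs and triples has relative bound zero. -/
theorem annBound_small {F : Kernel3} (hF : MemLp (kernelFun F) 2 muFFB) {ε : ℝ≥0∞} (hε : ε ≠ 0) :
    ∃ C : NNReal, AnnBound F fun r => ε * (r + 1) + C := by
  -- The factor `2` is that of `AnnBound.add`: a remainder of norm less than `δ` contributes `2 δ²
  -- (r + 1)`, which has to stay below `ε (r + 1)`.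
  obtain ⟨δ, hδ0, hδ⟩ : ∃ δ : ℝ, 0 < δ ∧ 2 * ENNReal.ofReal δ ^ 2 ≤ ε := by
    obtain ⟨η, hη0, hη⟩ := ENNReal.lt_iff_exists_nnreal_btwn.1 (pos_iff_ne_zero.2 hε)
    have hη1 : (0 : ℝ) < η := by exact_mod_cast ENNReal.coe_pos.1 hη0
    refine ⟨Real.sqrt (η / 2), by positivity, le_trans (le_of_eq ?_) hη.le⟩
    rw [← ENNReal.ofReal_pow (Real.sqrt_nonneg _), Real.sq_sqrt (by positivity)]
    have h2 : (2 : ℝ≥0∞) = ENNReal.ofReal 2 := by norm_num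
    rw [h2, ← ENNReal.ofReal_mul (by norm_num), mul_div_cancel₀ _ (by norm_num)]
    exact ENNReal.ofReal_coe_nnreal
  let f := hF.toLp
  have hmem : f ∈ closure (boundedKernels : Set (Lp ℂ 2 muFFB)) := by
    rw [← Submodule.topologicalClosure_coe, boundedKernels_dense]; trivial
  -- `g` has a bound uniform in `r`; only the small remainder `f - g` pays the factor `r + 1`.
  obtain ⟨g, ⟨C, hC⟩, hg⟩ := Metric.mem_closure_iff.1 hmem δ hδ0
  have h1 : kernelSq (kernelOf (f - g : Lp ℂ 2 muFFB)) ≤ ENNReal.ofReal δ ^ 2 := by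
    unfold kernelSq
    rw [kernelFun_kernelOf, ← eLpNorm_two_sq]
    gcongr
    rw [dist_eq_norm] at hg
    rw [← ENNReal.ofReal_toReal (Lp.eLpNorm_ne_top (f - g)), ← Lp.norm_def]
    exact ENNReal.ofReal_le_ofReal hg.le
  have h2 := annBound_of_kernelSq (F := kernelOf (f - g : Lp ℂ 2 muFFB))
    (Lp.stronglyMeasurable (f - g))
  have h3 := AnnBound.add (F := kernelOf (f - g : Lp ℂ 2 muFFB)) (F' := kernelOf g) (Lp.stronglyMeasurable (f - g)) (Lp.memLp (f - g))
    (Lp.memLp g) h2 hC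
  have h4 : kernelFun (kernelOf (f - g : Lp ℂ 2 muFFB) + kernelOf g) =ᵐ[muFFB] kernelFun F := by
    filter_upwards [Lp.coeFn_sub f g, hF.coeFn_toLp] with ξ e1 e2
    have e3 : kernelFun (kernelOf (f - g : Lp ℂ 2 muFFB) + kernelOf g) ξ =
      (f - g : Lp ℂ 2 muFFB) ξ + g ξ := rfl
    rw [e3, e1, Pi.sub_apply, sub_add_cancel, e2]
  have h5 := AnnBound.congr h4 h3
  refine ⟨2 * C, fun r s n ψ hψ => (h5.1 r s n ψ hψ).trans ?_,
    fun r s n ψ hψ => (h5.2 r s n ψ hψ).trans ?_⟩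
  all_goals
    gcongr ?_ * _
    push_cast
    gcongr ?_ + _
    calc 2 * ((r + 1 : ℝ≥0∞) * kernelSq (kernelOf (f - g : Lp ℂ 2 muFFB)))
        ≤ 2 * ((r + 1 : ℝ≥0∞) * ENNReal.ofReal δ ^ 2) := by gcongr
      _ = 2 * ENNReal.ofReal δ ^ 2 * (r + 1) := by ring
      _ ≤ ε * (r + 1) := by gcongr

end SmallBound

/-! ## Creation and annihilation for families of functions -/

section Families

variable {P : Type*} [MeasurableSpace P] {ρ : Measure P} [SigmaFinite ρ] {r s n : ℕ}

theorem creE_succ (Θ : Fermion → FockFun) (r s n : ℕ) (w : Sector (r + 1) s n) :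
    creE Θ (r + 1) s n w = (1 / Real.sqrt (r + 1) : ℂ) * ∑ i : Fin (r + 1),
      (-1) ^ (i : ℕ) * Θ (w.1 i) r s n (w.1 ∘ i.succAbove, w.2.1, w.2.2) := rfl

theorem creP_succ (Θ : Fermion → FockFun) (r s n : ℕ) (w : Sector r (s + 1) n) :
    creP Θ r (s + 1) n w = (-1) ^ r * (1 / Real.sqrt (s + 1) : ℂ) * ∑ i : Fin (s + 1),
      (-1) ^ (i : ℕ) * Θ (w.2.1 i) r s n (w.1, w.2.1 ∘ i.succAbove, w.2.2) := rfl

theorem creZ_succ (Θ : Boson → FockFun) (r s n : ℕ) (w : Sector r s (n + 1)) :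
    creZ Θ r s (n + 1) w = (1 / Real.sqrt (n + 1) : ℂ) * ∑ i : Fin (n + 1),
      Θ (w.2.2 i) r s n (w.1, w.2.1, w.2.2 ∘ i.succAbove) := rfl

/-- Families of functions of the particle variables that are square integrable in every sector,
jointly with a parameter. -/
structure L2Fam (ρ : Measure P) (Θ : P → FockFun) : Prop where
  meas : ∀ r s n, StronglyMeasurable fun z : P × Sector r s n => Θ z.1 r s n z.2
  memLp : ∀ r s n, MemLp (fun z : P × Sector r s n => Θ z.1 r s n z.2) 2 (ρ.prod (muS r s n))

theorem measurePreserving_leftComm {α β γ : Type*} [MeasurableSpace α] [MeasurableSpace β]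
    [MeasurableSpace γ] (a : Measure α) (b : Measure β) (c : Measure γ) [SigmaFinite a]
    [SigmaFinite b] [SigmaFinite c] :
    MeasurePreserving (fun x : α × (β × γ) => (x.2.1, (x.1, x.2.2)))
      (a.prod (b.prod c)) (b.prod (a.prod c)) :=
  (measurePreserving_prodAssoc b a c).comp
    ((Measure.measurePreserving_swap.prod (MeasurePreserving.id c)).comp
      (measurePreserving_prodAssoc a b c).symm)

/-- Singling out an electron. -/
def splitE (i : Fin (r + 1)) (z : P × Sector (r + 1) s n) : (P × Fermion) × Sector r s n :=
  ((z.1, z.2.1 i), (z.2.1 ∘ i.succAbove, z.2.2.1, z.2.2.2))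

/-- Singling out a positron. -/
def splitP (i : Fin (s + 1)) (z : P × Sector r (s + 1) n) : (P × Fermion) × Sector r s n :=
  ((z.1, z.2.2.1 i), (z.2.1, z.2.2.1 ∘ i.succAbove, z.2.2.2))

/-- Singling out a boson. -/
def splitZ (i : Fin (n + 1)) (z : P × Sector r s (n + 1)) : (P × Boson) × Sector r s n :=
  ((z.1, z.2.2.2 i), (z.2.1, z.2.2.1, z.2.2.2 ∘ i.succAbove))

theorem measurePreserving_splitE (i : Fin (r + 1)) :
    MeasurePreserving (splitE i) (ρ.prod (muS (r + 1) s n)) ((ρ.prod muF).prod (muS r s n)) :=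
  (measurePreserving_prodAssoc ρ muF (muS r s n)).symm.comp
    ((MeasurePreserving.id ρ).prod ((measurePreserving_prodAssoc muF _ _).comp
      ((measurePreserving_split muF i).prod (MeasurePreserving.id
        ((Measure.pi fun _ : Fin s => muF).prod (Measure.pi fun _ : Fin n => muB))))))

theorem measurePreserving_splitP (i : Fin (s + 1)) :
    MeasurePreserving (splitP i) (ρ.prod (muS r (s + 1) n)) ((ρ.prod muF).prod (muS r s n)) :=
  (measurePreserving_prodAssoc ρ muF (muS r s n)).symm.comp
    ((MeasurePreserving.id ρ).prod ((measurePreserving_leftComm _ _ _).comp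
      ((MeasurePreserving.id _).prod ((measurePreserving_prodAssoc muF _ _).comp
      ((measurePreserving_split muF i).prod (MeasurePreserving.id
        (Measure.pi fun _ : Fin n => muB)))))))

theorem measurePreserving_splitZ (i : Fin (n + 1)) :
    MeasurePreserving (splitZ i) (ρ.prod (muS r s (n + 1))) ((ρ.prod muB).prod (muS r s n)) :=
  (measurePreserving_prodAssoc ρ muB (muS r s n)).symm.comp
    ((MeasurePreserving.id ρ).prod ((measurePreserving_leftComm _ _ _).comp
      ((MeasurePreserving.id _).prod ((measurePreserving_leftComm _ _ _).comp
      ((MeasurePreserving.id _).prod (measurePreserving_split muB i))))))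

theorem measurePreserving_addE_param : MeasurePreserving
    (fun z : (P × Fermion) × Sector r s n => (z.1.1, addE (z.2, z.1.2)))
    ((ρ.prod muF).prod (muS r s n)) (ρ.prod (muS (r + 1) s n)) :=
  ((MeasurePreserving.id ρ).prod measurePreserving_addE).comp (measurePreserving_prodAssoc _ _ _)

theorem measurePreserving_addP_param : MeasurePreserving
    (fun z : (P × Fermion) × Sector r s n => (z.1.1, addP (z.2, z.1.2)))
    ((ρ.prod muF).prod (muS r s n)) (ρ.prod (muS r (s + 1) n)) :=
  ((MeasurePreserving.id ρ).prod measurePreserving_addP).comp (measurePreserving_prodAssoc _ _ _)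

theorem measurePreserving_addZ_param : MeasurePreserving
    (fun z : (P × Boson) × Sector r s n => (z.1.1, addZ (z.2, z.1.2)))
    ((ρ.prod muB).prod (muS r s n)) (ρ.prod (muS r s (n + 1))) :=
  ((MeasurePreserving.id ρ).prod measurePreserving_addZ).comp (measurePreserving_prodAssoc _ _ _)

theorem l2Fam_annE {ψ : P → FockFun} (h : L2Fam ρ ψ) :
    L2Fam (ρ.prod muF) fun q => annE q.2 (ψ q.1) where
  meas r s n := ((h.meas (r + 1) s n).comp_measurable
    (measurePreserving_addE_param (ρ := ρ)).measurable).const_mul _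
  memLp r s n := ((h.memLp (r + 1) s n).comp_measurePreserving
    measurePreserving_addE_param).const_mul _

theorem l2Fam_annP {ψ : P → FockFun} (h : L2Fam ρ ψ) :
    L2Fam (ρ.prod muF) fun q => annP q.2 (ψ q.1) where
  meas r s n := ((h.meas r (s + 1) n).comp_measurable
    (measurePreserving_addP_param (ρ := ρ)).measurable).const_mul _
  memLp r s n := ((h.memLp r (s + 1) n).comp_measurePreserving
    measurePreserving_addP_param).const_mul _

theorem l2Fam_annZ {ψ : P → FockFun} (h : L2Fam ρ ψ) :
    L2Fam (ρ.prod muB) fun q => annZ q.2 (ψ q.1) where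
  meas r s n := ((h.meas r s (n + 1)).comp_measurable
    (measurePreserving_addZ_param (ρ := ρ)).measurable).const_mul _
  memLp r s n := ((h.memLp r s (n + 1)).comp_measurePreserving
    measurePreserving_addZ_param).const_mul _

/-- The parameter `p` makes nesting possible: in `creE (creP (creZ …))` the inner operations see the
variables created further out as parameters. -/
theorem l2Fam_creE {Θ : P × Fermion → FockFun} (h : L2Fam (ρ.prod muF) Θ) :
    L2Fam ρ fun p => creE fun ξ => Θ (p, ξ) where
  meas r s n := by
    cases r with
    | zero => exact stronglyMeasurable_const
    | succ r =>
      have h2 : ∀ i : Fin (r + 1), StronglyMeasurable fun z : P × Sector (r + 1) s n =>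
          (-1) ^ (i : ℕ) * Θ (z.1, z.2.1 i) r s n (z.2.1 ∘ i.succAbove, z.2.2.1, z.2.2.2) := fun i =>
        ((h.meas r s n).comp_measurable (measurePreserving_splitE (ρ := ρ) i).measurable).const_mul _
      simp only [creE_succ]
      exact (Finset.stronglyMeasurable_fun_sum _ fun i _ => h2 i).const_mul _
  memLp r s n := by
    cases r with
    | zero => exact MemLp.zero
    | succ r =>
      have h2 : ∀ i : Fin (r + 1), MemLp (fun z : P × Sector (r + 1) s n =>
          (-1) ^ (i : ℕ) * Θ (z.1, z.2.1 i) r s n (z.2.1 ∘ i.succAbove, z.2.2.1, z.2.2.2)) 2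
          (ρ.prod (muS (r + 1) s n)) := fun i =>
        ((h.memLp r s n).comp_measurePreserving (measurePreserving_splitE i)).const_mul _
      simp only [creE_succ]
      exact (memLp_finsetSum _ fun i _ => h2 i).const_mul _

theorem l2Fam_creP {Θ : P × Fermion → FockFun} (h : L2Fam (ρ.prod muF) Θ) :
    L2Fam ρ fun p => creP fun ξ => Θ (p, ξ) where
  meas r s n := by
    cases s with
    | zero => exact stronglyMeasurable_const
    | succ s =>
      have h2 : ∀ i : Fin (s + 1), StronglyMeasurable fun z : P × Sector r (s + 1) n =>
          (-1) ^ (i : ℕ) * Θ (z.1, z.2.2.1 i) r s n (z.2.1, z.2.2.1 ∘ i.succAbove, z.2.2.2) := fun i =>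
        ((h.meas r s n).comp_measurable (measurePreserving_splitP (ρ := ρ) i).measurable).const_mul _
      simp only [creP_succ]
      exact (Finset.stronglyMeasurable_fun_sum _ fun i _ => h2 i).const_mul _
  memLp r s n := by
    cases s with
    | zero => exact MemLp.zero
    | succ s =>
      have h2 : ∀ i : Fin (s + 1), MemLp (fun z : P × Sector r (s + 1) n =>
          (-1) ^ (i : ℕ) * Θ (z.1, z.2.2.1 i) r s n (z.2.1, z.2.2.1 ∘ i.succAbove, z.2.2.2)) 2
          (ρ.prod (muS r (s + 1) n)) := fun i =>
        ((h.memLp r s n).comp_measurePreserving (measurePreserving_splitP i)).const_mul _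
      simp only [creP_succ]
      exact (memLp_finsetSum _ fun i _ => h2 i).const_mul _

theorem l2Fam_creZ {Θ : P × Boson → FockFun} (h : L2Fam (ρ.prod muB) Θ) :
    L2Fam ρ fun p => creZ fun ξ => Θ (p, ξ) where
  meas r s n := by
    cases n with
    | zero => exact stronglyMeasurable_const
    | succ n =>
      have h2 : ∀ i : Fin (n + 1), StronglyMeasurable fun z : P × Sector r s (n + 1) =>
          Θ (z.1, z.2.2.2 i) r s n (z.2.1, z.2.2.1, z.2.2.2 ∘ i.succAbove) := fun i =>
        ((h.meas r s n).comp_measurable (measurePreserving_splitZ (ρ := ρ) i).measurable)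
      simp only [creZ_succ]
      exact (Finset.stronglyMeasurable_fun_sum _ fun i _ => h2 i).const_mul _
  memLp r s n := by
    cases n with
    | zero => exact MemLp.zero
    | succ n =>
      have h2 : ∀ i : Fin (n + 1), MemLp (fun z : P × Sector r s (n + 1) =>
          Θ (z.1, z.2.2.2 i) r s n (z.2.1, z.2.2.1, z.2.2.2 ∘ i.succAbove)) 2
          (ρ.prod (muS r s (n + 1))) := fun i =>
        ((h.memLp r s n).comp_measurePreserving (measurePreserving_splitZ i))
      simp only [creZ_succ]
      exact (memLp_finsetSum _ fun i _ => h2 i).const_mul _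

/-! ### Symmetry -/

/-- Families of functions with the symmetry of Fock space. -/
def FockSym (φ : FockFun) : Prop := ∀ r s n, IsFockSym (φ r s n)

theorem isFockSym_of {ψ : Sector r s n → ℂ}
    (h1 : ∀ w₂ w₃, IsAnti fun w₁ => ψ (w₁, w₂, w₃)) (h2 : ∀ w₁ w₃, IsAnti fun w₂ => ψ (w₁, w₂, w₃))
    (h3 : ∀ w₁ w₂, IsSymmFun fun w₃ => ψ (w₁, w₂, w₃)) : IsFockSym ψ := by
  intro σ τ π w
  have e1 := h1 (w.2.1 ∘ τ) (w.2.2 ∘ π) σ w.1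
  have e2 := h2 w.1 (w.2.2 ∘ π) τ w.2.1
  have e3 := h3 w.1 w.2.1 π w.2.2
  simp only at e1 e2 e3
  simp only [relabel]
  rw [e1, e2, e3]
  push_cast
  ring

theorem IsAnti.const_mul {X : Type*} {φ : (Fin r → X) → ℂ} (h : IsAnti φ) (c : ℂ) :
    IsAnti fun x => c * φ x := by
  intro σ x
  simp only [h σ x]
  ring

theorem IsAnti.sum {ι X : Type*} {t : Finset ι} {φ : ι → (Fin r → X) → ℂ}
    (h : ∀ i, IsAnti (φ i)) : IsAnti fun x => ∑ i ∈ t, φ i x := by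
  intro σ x
  simp only [fun i => h i σ x, Finset.mul_sum]

theorem IsSymmFun.const_mul {X : Type*} {φ : (Fin r → X) → ℂ} (h : IsSymmFun φ) (c : ℂ) :
    IsSymmFun fun x => c * φ x := by
  intro σ x
  simp only [h σ x]

theorem IsSymmFun.sum {ι X : Type*} {t : Finset ι} {φ : ι → (Fin r → X) → ℂ}
    (h : ∀ i, IsSymmFun (φ i)) : IsSymmFun fun x => ∑ i ∈ t, φ i x := by
  intro σ x
  simp only [fun i => h i σ x]

theorem isFockSym_zero : IsFockSym fun _ : Sector r s n => (0 : ℂ) := by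
  intro σ τ π w
  simp

/-- The alternating signs produce the antisymmetry in the electrons (`isAnti_antiSum`); for the
other two species each summand already has the right symmetry. -/
theorem fockSym_creE {Θ : Fermion → FockFun} (h : ∀ ξ, FockSym (Θ ξ)) : FockSym (creE Θ) := by
  intro r s n
  cases r with
  | zero => exact isFockSym_zero
  | succ r =>
    refine isFockSym_of (fun w₂ w₃ => ?_) (fun w₁ w₃ => ?_) fun w₁ w₂ => ?_
    all_goals simp only [creE_succ]
    · exact IsAnti.const_mul (isAnti_antiSum (Θ := fun ξ w => Θ ξ r s n (w, w₂, w₃)) fun ξ =>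
        (h ξ r s n).anti₁ w₂ w₃) _
    · exact IsAnti.const_mul (IsAnti.sum fun i =>
        ((h (w₁ i) r s n).anti₂ (w₁ ∘ i.succAbove) w₃).const_mul _) _
    · exact IsSymmFun.const_mul (IsSymmFun.sum fun i =>
        ((h (w₁ i) r s n).symm₃ (w₁ ∘ i.succAbove) w₂).const_mul _) _

theorem fockSym_creP {Θ : Fermion → FockFun} (h : ∀ ξ, FockSym (Θ ξ)) : FockSym (creP Θ) := by
  intro r s n
  cases s with
  | zero => exact isFockSym_zero
  | succ s =>
    refine isFockSym_of (fun w₂ w₃ => ?_) (fun w₁ w₃ => ?_) fun w₁ w₂ => ?_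
    all_goals simp only [creP_succ]
    · exact IsAnti.const_mul (IsAnti.sum fun i =>
        ((h (w₂ i) r s n).anti₁ (w₂ ∘ i.succAbove) w₃).const_mul _) _
    · exact IsAnti.const_mul (isAnti_antiSum (Θ := fun ξ w => Θ ξ r s n (w₁, w, w₃)) fun ξ =>
        (h ξ r s n).anti₂ w₁ w₃) _
    · exact IsSymmFun.const_mul (IsSymmFun.sum fun i =>
        ((h (w₂ i) r s n).symm₃ w₁ (w₂ ∘ i.succAbove)).const_mul _) _

theorem fockSym_creZ {Θ : Boson → FockFun} (h : ∀ ξ, FockSym (Θ ξ)) : FockSym (creZ Θ) := by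
  intro r s n
  cases n with
  | zero => exact isFockSym_zero
  | succ n =>
    refine isFockSym_of (fun w₂ w₃ => ?_) (fun w₁ w₃ => ?_) fun w₁ w₂ => ?_
    all_goals simp only [creZ_succ]
    · exact IsAnti.const_mul (IsAnti.sum fun i =>
        (h (w₃ i) r s n).anti₁ w₂ (w₃ ∘ i.succAbove)) _
    · exact IsAnti.const_mul (IsAnti.sum fun i =>
        (h (w₃ i) r s n).anti₂ w₁ (w₃ ∘ i.succAbove)) _
    · exact IsSymmFun.const_mul (isSymmFun_sum (Θ := fun ξ w => Θ ξ r s n (w₁, w₂, w)) fun ξ =>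
        (h ξ r s n).symm₃ w₁ w₂) _

theorem fockSym_annE {φ : FockFun} (h : FockSym φ) (ξ : Fermion) : FockSym (annE ξ φ) := by
  intro r s n
  refine isFockSym_of (fun w₂ w₃ => ?_) (fun w₁ w₃ => ?_) fun w₁ w₂ => ?_
  all_goals simp only [annE, addE]
  · exact IsAnti.const_mul (((h (r + 1) s n).anti₁ w₂ w₃).cons ξ) _
  · exact IsAnti.const_mul ((h (r + 1) s n).anti₂ (Fin.cons ξ w₁ : Fin (r + 1) → Fermion) w₃) _
  · exact IsSymmFun.const_mul
      ((h (r + 1) s n).symm₃ (Fin.cons ξ w₁ : Fin (r + 1) → Fermion) w₂) _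

theorem fockSym_annP {φ : FockFun} (h : FockSym φ) (ξ : Fermion) : FockSym (annP ξ φ) := by
  intro r s n
  refine isFockSym_of (fun w₂ w₃ => ?_) (fun w₁ w₃ => ?_) fun w₁ w₂ => ?_
  all_goals simp only [annP, addP]
  · exact IsAnti.const_mul ((h r (s + 1) n).anti₁ (Fin.cons ξ w₂ : Fin (s + 1) → Fermion) w₃) _
  · exact IsAnti.const_mul (((h r (s + 1) n).anti₂ w₁ w₃).cons ξ) _
  · exact IsSymmFun.const_mul
      ((h r (s + 1) n).symm₃ w₁ (Fin.cons ξ w₂ : Fin (s + 1) → Fermion)) _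

theorem fockSym_annZ {φ : FockFun} (h : FockSym φ) (ξ : Boson) : FockSym (annZ ξ φ) := by
  intro r s n
  refine isFockSym_of (fun w₂ w₃ => ?_) (fun w₁ w₃ => ?_) fun w₁ w₂ => ?_
  all_goals simp only [annZ, addZ]
  · exact IsAnti.const_mul ((h r s (n + 1)).anti₁ w₂ (Fin.cons ξ w₃ : Fin (n + 1) → Boson)) _
  · exact IsAnti.const_mul ((h r s (n + 1)).anti₂ w₁ (Fin.cons ξ w₃ : Fin (n + 1) → Boson)) _
  · exact IsSymmFun.const_mul (((h r s (n + 1)).symm₃ w₁ w₂).cons ξ) _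

theorem FockSym.smul {φ : FockFun} (h : FockSym φ) (c : ℂ) : FockSym (c • φ) := by
  intro r s n σ τ π w
  simp only [Pi.smul_apply, smul_eq_mul, h r s n σ τ π w]
  ring

theorem FockSym.integral {Q : Type*} [MeasurableSpace Q] {η : Measure Q} {K : Q → ℂ}
    {φ : Q → FockFun} (h : ∀ q, FockSym (φ q)) :
    FockSym fun r s n w => ∫ q, K q * φ q r s n w ∂η := by
  intro r s n σ τ π w
  simp only
  rw [← integral_const_mul]
  congr 1
  funext q
  rw [h q r s n σ τ π w]
  ring

/-! ### Duality -/

/-- Pairing of a symmetrized sum with a prefactor. -/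
theorem integral_conj_const_mul_sum_mul {ι N M : Type*} [Fintype ι] [MeasurableSpace N]
    [MeasurableSpace M] {ν : Measure N} {η : Measure M} {p : ι → N → M}
    (hp : ∀ i, MeasurePreserving (p i) ν η) {c : ι → ℂ} (hc : ∀ i, conj (c i) * c i = 1)
    {κ κ' : ℂ} (hκ : conj κ * Fintype.card ι = κ') {Θ ψ' : M → ℂ} {ψ : N → ℂ}
    (hΘ : MemLp Θ 2 η) (hψ' : MemLp ψ' 2 η) (hψ : ∀ i w, ψ w = c i * ψ' (p i w)) :
    ∫ w, conj (κ * ∑ i, c i * Θ (p i w)) * ψ w ∂ν = ∫ z, conj (Θ z) * (κ' * ψ' z) ∂η := by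
  simp only [map_mul, mul_assoc, mul_left_comm _ κ']
  rw [integral_const_mul, integral_const_mul, integral_conj_sum_mul hp hc hΘ hψ' hψ, ← hκ]
  ring

/-- The normalization `1/√(m+1)` of creation times the number `m + 1` of equal summands is the
normalization `√(m+1)` of annihilation. -/
theorem conj_inv_sqrt_mul (m : ℕ) :
    conj (1 / (Real.sqrt (m + 1) : ℂ)) * (m + 1 : ℂ) = Real.sqrt (m + 1) := by
  have h : (Real.sqrt (m + 1) : ℂ) * Real.sqrt (m + 1) = m + 1 := by
    rw [← Complex.ofReal_mul, Real.mul_self_sqrt (by positivity)]; push_cast; ring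
  have h0 : (Real.sqrt (m + 1) : ℂ) ≠ 0 := by
    rw [Complex.ofReal_ne_zero]; positivity
  rw [map_div₀, map_one, Complex.conj_ofReal, ← h]
  field_simp

/-- Adjointness of `b_+^*` and `b_+` in the presence of parameters: `ψ` is antisymmetric, so all `r
+ 1` summands of the creation operator contribute equally. -/
theorem integral_conj_creE_mul {Θ : P × Fermion → FockFun} (hΘ : L2Fam (ρ.prod muF) Θ)
    {ψ : P → FockFun} (hψ : L2Fam ρ ψ) (hsym : ∀ p, FockSym (ψ p)) (r s n : ℕ) :
    ∫ z : P × Sector (r + 1) s n, conj (creE (fun ξ => Θ (z.1, ξ)) (r + 1) s n z.2) *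
        ψ z.1 (r + 1) s n z.2 ∂ρ.prod (muS (r + 1) s n) =
      ∫ z : (P × Fermion) × Sector r s n, conj (Θ z.1 r s n z.2) *
        annE z.1.2 (ψ z.1.1) r s n z.2 ∂(ρ.prod muF).prod (muS r s n) := by
  have h := integral_conj_const_mul_sum_mul (ν := ρ.prod (muS (r + 1) s n))
    (fun i => measurePreserving_splitE (ρ := ρ) i) (c := fun i : Fin (r + 1) => (-1) ^ (i : ℕ))
    (fun i => conj_neg_one_pow_mul i) (κ := 1 / (Real.sqrt (r + 1) : ℂ))
    (κ' := (Real.sqrt (r + 1) : ℂ)) ?_ (hΘ.memLp r s n) (ψ := fun z => ψ z.1 (r + 1) s n z.2)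
    ((hψ.memLp (r + 1) s n).comp_measurePreserving measurePreserving_addE_param) fun i z => ?_
  · simp only [creE_succ]
    exact h
  · rw [Fintype.card_fin]; push_cast; exact conj_inv_sqrt_mul r
  · exact ((hsym z.1 (r + 1) s n).anti₁ z.2.2.1 z.2.2.2).eq_cons i z.2.1

theorem integral_conj_creP_mul {Θ : P × Fermion → FockFun} (hΘ : L2Fam (ρ.prod muF) Θ)
    {ψ : P → FockFun} (hψ : L2Fam ρ ψ) (hsym : ∀ p, FockSym (ψ p)) (r s n : ℕ) :
    ∫ z : P × Sector r (s + 1) n, conj (creP (fun ξ => Θ (z.1, ξ)) r (s + 1) n z.2) *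
        ψ z.1 r (s + 1) n z.2 ∂ρ.prod (muS r (s + 1) n) =
      ∫ z : (P × Fermion) × Sector r s n, conj (Θ z.1 r s n z.2) *
        annP z.1.2 (ψ z.1.1) r s n z.2 ∂(ρ.prod muF).prod (muS r s n) := by
  have h := integral_conj_const_mul_sum_mul (ν := ρ.prod (muS r (s + 1) n))
    (fun i => measurePreserving_splitP (ρ := ρ) i) (c := fun i : Fin (s + 1) => (-1) ^ (i : ℕ))
    (fun i => conj_neg_one_pow_mul i) (κ := (-1) ^ r * (1 / (Real.sqrt (s + 1) : ℂ)))
    (κ' := (-1) ^ r * (Real.sqrt (s + 1) : ℂ)) ?_ (hΘ.memLp r s n)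
    (ψ := fun z => ψ z.1 r (s + 1) n z.2)
    ((hψ.memLp r (s + 1) n).comp_measurePreserving measurePreserving_addP_param) fun i z => ?_
  · simp only [creP_succ]
    exact h
  · rw [Fintype.card_fin, map_mul, mul_assoc]
    push_cast
    rw [conj_inv_sqrt_mul s]
    simp
  · exact ((hsym z.1 r (s + 1) n).anti₂ z.2.1 z.2.2.2).eq_cons i z.2.2.1

theorem integral_conj_creZ_mul {Θ : P × Boson → FockFun} (hΘ : L2Fam (ρ.prod muB) Θ)
    {ψ : P → FockFun} (hψ : L2Fam ρ ψ) (hsym : ∀ p, FockSym (ψ p)) (r s n : ℕ) :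
    ∫ z : P × Sector r s (n + 1), conj (creZ (fun ξ => Θ (z.1, ξ)) r s (n + 1) z.2) *
        ψ z.1 r s (n + 1) z.2 ∂ρ.prod (muS r s (n + 1)) =
      ∫ z : (P × Boson) × Sector r s n, conj (Θ z.1 r s n z.2) *
        annZ z.1.2 (ψ z.1.1) r s n z.2 ∂(ρ.prod muB).prod (muS r s n) := by
  have h := integral_conj_const_mul_sum_mul (ν := ρ.prod (muS r s (n + 1)))
    (fun i => measurePreserving_splitZ (ρ := ρ) i) (c := fun i : Fin (n + 1) => 1)
    (fun i => by simp) (κ := 1 / (Real.sqrt (n + 1) : ℂ)) (κ' := (Real.sqrt (n + 1) : ℂ)) ?_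
    (hΘ.memLp r s n) (ψ := fun z => ψ z.1 r s (n + 1) z.2)
    ((hψ.memLp r s (n + 1)).comp_measurePreserving measurePreserving_addZ_param) fun i z => ?_
  · simp only [one_mul] at h
    simp only [creZ_succ]
    exact h
  · rw [Fintype.card_fin]; push_cast; exact conj_inv_sqrt_mul n
  · rw [one_mul]
    exact ((hsym z.1 r s (n + 1)).symm₃ z.2.1 z.2.2.1).eq_cons i z.2.2.2

/-! ### Almost everywhere statements -/

theorem ae_allE_param {R : P → Fermion → ∀ r s n : ℕ, Sector r s n → Prop}
    (h : ∀ r s n, ∀ᵐ z ∂(ρ.prod muF).prod (muS r s n), R z.1.1 z.1.2 r s n z.2) (r s n : ℕ) :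
    ∀ᵐ z ∂ρ.prod (muS r s n), allE (R z.1) r s n z.2 := by
  cases r with
  | zero => exact Filter.Eventually.of_forall fun _ => trivial
  | succ m => exact ae_all_iff.2 fun i =>
      (measurePreserving_splitE (ρ := ρ) i).quasiMeasurePreserving.ae (h m s n)

theorem ae_allP_param {R : P → Fermion → ∀ r s n : ℕ, Sector r s n → Prop}
    (h : ∀ r s n, ∀ᵐ z ∂(ρ.prod muF).prod (muS r s n), R z.1.1 z.1.2 r s n z.2) (r s n : ℕ) :
    ∀ᵐ z ∂ρ.prod (muS r s n), allP (R z.1) r s n z.2 := by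
  cases s with
  | zero => exact Filter.Eventually.of_forall fun _ => trivial
  | succ m => exact ae_all_iff.2 fun i =>
      (measurePreserving_splitP (ρ := ρ) i).quasiMeasurePreserving.ae (h r m n)

theorem ae_allZ_param {R : P → Boson → ∀ r s n : ℕ, Sector r s n → Prop}
    (h : ∀ r s n, ∀ᵐ z ∂(ρ.prod muB).prod (muS r s n), R z.1.1 z.1.2 r s n z.2) (r s n : ℕ) :
    ∀ᵐ z ∂ρ.prod (muS r s n), allZ (R z.1) r s n z.2 := by
  cases n with
  | zero => exact Filter.Eventually.of_forall fun _ => trivial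
  | succ m => exact ae_all_iff.2 fun i =>
      (measurePreserving_splitZ (ρ := ρ) i).quasiMeasurePreserving.ae (h r s m)

/-- A measure on the one-point space. -/
def muUnit : Measure Unit := Measure.dirac ()

instance : IsProbabilityMeasure muUnit := by unfold muUnit; infer_instance

/-- A one-point parameter space lets the results on parametrized families apply to a single family.
-/
theorem measurePreserving_unit {α : Type*} [MeasurableSpace α] (a : Measure α) [SigmaFinite a] :
    MeasurePreserving (fun x : α => ((), x)) a (muUnit.prod a) :=
  ⟨measurable_prodMk_left, (Measure.dirac_prod () : _ = _).symm⟩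

end Families

/-! ## Integral kernels acting on families of functions -/

section IntegralKernel

variable {X Y W : Type*} [MeasurableSpace X] [MeasurableSpace Y] [MeasurableSpace W]
  {μ : Measure X} {ν : Measure Y} {τ : Measure W} [SigmaFinite μ] [SigmaFinite ν] [SigmaFinite τ]
  {K : X × Y → ℂ} {φ : Y × W → ℂ}

theorem measurable_kernel_mul (hK : StronglyMeasurable K) (hφ : StronglyMeasurable φ) :
    Measurable fun p : (X × W) × Y => ‖K (p.1.1, p.2) * φ (p.2, p.1.2)‖ₑ :=
  ((hK.comp_measurable (by fun_prop)).mul (hφ.comp_measurable (by fun_prop))).enorm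

/-- The Hilbert–Schmidt bound for `K` acting on the variable `y`, with `w` as a spectator. Having
the absolute value inside the integral, it also gives convergence almost everywhere. -/
theorem lintegral_kernel_sq_le (hK : StronglyMeasurable K) (hφ : StronglyMeasurable φ) :
    ∫⁻ z, (∫⁻ y, ‖K (z.1, y) * φ (y, z.2)‖ₑ ∂ν) ^ 2 ∂μ.prod τ ≤
      (∫⁻ p, ‖K p‖ₑ ^ 2 ∂μ.prod ν) * ∫⁻ p, ‖φ p‖ₑ ^ 2 ∂ν.prod τ := by
  have hK2 : Measurable fun p : Y × X => ‖K (p.2, p.1)‖ₑ ^ 2 :=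
    (hK.comp_measurable measurable_swap).enorm.pow_const 2
  have hφ2 : Measurable fun p : Y × W => ‖φ p‖ₑ ^ 2 := hφ.enorm.pow_const 2
  have hK3 : Measurable fun y => ∫⁻ x, ‖K (x, y)‖ₑ ^ 2 ∂μ := hK2.lintegral_prod_right'
  have hφ3 : Measurable fun y => ∫⁻ w, ‖φ (y, w)‖ₑ ^ 2 ∂τ := hφ2.lintegral_prod_right'
  have h0 : Measurable fun p : Y × (X × W) => ‖K (p.2.1, p.1) * φ (p.1, p.2.2)‖ₑ :=
    ((hK.comp_measurable (g := fun p : Y × (X × W) => (p.2.1, p.1)) (by fun_prop)).mul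
      (hφ.comp_measurable (g := fun p : Y × (X × W) => (p.1, p.2.2)) (by fun_prop))).enorm
  have hχ : Measurable (Function.uncurry fun (y : Y) (z : X × W) =>
      ‖K (z.1, y) * φ (y, z.2)‖ₑ) := h0
  refine (lintegral_lintegral_sq_le (μ := ν) (ν := μ.prod τ)
    (χ := fun y z => ‖K (z.1, y) * φ (y, z.2)‖ₑ)
    hχ
    (a := fun y => ∫⁻ x, ‖K (x, y)‖ₑ ^ 2 ∂μ) (b := fun y => ∫⁻ w, ‖φ (y, w)‖ₑ ^ 2 ∂τ)
    hK3 hφ3 fun y => ?_).trans_eq ?_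
  · simp only [enorm_mul, mul_pow]
    have h1 : Measurable fun x => ‖K (x, y)‖ₑ ^ 2 := hK2.comp measurable_prodMk_left
    have h2 : Measurable fun w => ‖φ (y, w)‖ₑ ^ 2 := hφ2.comp measurable_prodMk_left
    exact (lintegral_prod_mul (f := fun x => ‖K (x, y)‖ₑ ^ 2) (g := fun w => ‖φ (y, w)‖ₑ ^ 2)
      h1.aemeasurable h2.aemeasurable).le
  · rw [lintegral_prod _ hφ2.aemeasurable, lintegral_prod_symm _ (hK.enorm.pow_const 2).aemeasurable]

theorem stronglyMeasurable_integral_kernel (hK : StronglyMeasurable K)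
    (hφ : StronglyMeasurable φ) :
    StronglyMeasurable fun z : X × W => ∫ y, K (z.1, y) * φ (y, z.2) ∂ν :=
  StronglyMeasurable.integral_prod_right' (f := fun p : (X × W) × Y =>
    K (p.1.1, p.2) * φ (p.2, p.1.2))
    ((hK.comp_measurable (by fun_prop)).mul (hφ.comp_measurable (by fun_prop)))

theorem ae_integrable_kernel (hK : StronglyMeasurable K) (hφ : StronglyMeasurable φ)
    (hK2 : MemLp K 2 (μ.prod ν)) (hφ2 : MemLp φ 2 (ν.prod τ)) :
    ∀ᵐ z ∂μ.prod τ, Integrable (fun y => K (z.1, y) * φ (y, z.2)) ν := by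
  have h := (lintegral_kernel_sq_le (μ := μ) (ν := ν) (τ := τ) hK hφ).trans_lt
    (ENNReal.mul_lt_top ((memLp_two_iff hK2.1).1 hK2) ((memLp_two_iff hφ2.1).1 hφ2))
  filter_upwards [ae_lt_top ((measurable_kernel_mul hK hφ).lintegral_prod_right'.pow_const 2)
    h.ne] with z hz
  refine ⟨?_, (ENNReal.pow_lt_top_iff.1 hz).resolve_right two_ne_zero⟩
  exact ((hK.comp_measurable measurable_prodMk_left).mul
    (hφ.comp_measurable measurable_prodMk_right)).aestronglyMeasurable

theorem memLp_integral_kernel (hK : StronglyMeasurable K) (hφ : StronglyMeasurable φ)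
    (hK2 : MemLp K 2 (μ.prod ν)) (hφ2 : MemLp φ 2 (ν.prod τ)) :
    MemLp (fun z : X × W => ∫ y, K (z.1, y) * φ (y, z.2) ∂ν) 2 (μ.prod τ) := by
  rw [memLp_two_iff (stronglyMeasurable_integral_kernel hK hφ).aestronglyMeasurable]
  refine lt_of_le_of_lt (lintegral_mono fun z => ?_)
    ((lintegral_kernel_sq_le (μ := μ) (ν := ν) (τ := τ) hK hφ).trans_lt
    (ENNReal.mul_lt_top ((memLp_two_iff hK2.1).1 hK2) ((memLp_two_iff hφ2.1).1 hφ2)))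
  exact pow_le_pow_left' (enorm_integral_le_lintegral_enorm _) 2

/-- Absolute convergence in all variables at once; it justifies Fubini in the adjoint formula. -/
theorem integrable_kernel_mul (hK : StronglyMeasurable K) (hφ : StronglyMeasurable φ)
    (hK2 : MemLp K 2 (μ.prod ν)) (hφ2 : MemLp φ 2 (ν.prod τ)) {ψ : X × W → ℂ}
    (hψ : StronglyMeasurable ψ) (hψ2 : MemLp ψ 2 (μ.prod τ)) :
    Integrable (fun p : (X × W) × Y => conj (K (p.1.1, p.2) * φ (p.2, p.1.2)) * ψ p.1)
      ((μ.prod τ).prod ν) := by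
  have hm : StronglyMeasurable fun p : (X × W) × Y =>
      conj (K (p.1.1, p.2) * φ (p.2, p.1.2)) * ψ p.1 :=
    (StronglyMeasurable.conj ((hK.comp_measurable (by fun_prop)).mul
      (hφ.comp_measurable (by fun_prop)))).mul (hψ.comp_measurable measurable_fst)
  refine ⟨hm.aestronglyMeasurable, ?_⟩
  have hg := (measurable_kernel_mul hK hφ).lintegral_prod_right' (ν := ν)
  unfold HasFiniteIntegral
  rw [lintegral_prod _ hm.enorm.aemeasurable]
  have e : ∀ z : X × W, ∫⁻ y, ‖conj (K (z.1, y) * φ (y, z.2)) * ψ z‖ₑ ∂ν =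
      ((∫⁻ y, ‖K (z.1, y) * φ (y, z.2)‖ₑ ∂ν) ^ 2 * ‖ψ z‖ₑ ^ 2) ^ (1 / 2 : ℝ) := fun z => by
    have h1 : ∀ y, ‖conj (K (z.1, y) * φ (y, z.2)) * ψ z‖ₑ =
        ‖K (z.1, y) * φ (y, z.2)‖ₑ * ‖ψ z‖ₑ := fun y => by
      rw [enorm_mul]
      congr 1
      rw [← ofReal_norm, ← ofReal_norm, Complex.norm_conj]
    simp only [h1]
    rw [lintegral_mul_const' _ _ (by finiteness), ← mul_pow, ← ENNReal.rpow_natCast,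
      ← ENNReal.rpow_mul]
    norm_num
  simp only [e]
  have h2 := lintegral_sqrt_mul_sq_le (μ := μ.prod τ) (hg.pow_const 2) (hψ.enorm.pow_const 2)
  have h3 := h2.trans_lt (ENNReal.mul_lt_top
    ((lintegral_kernel_sq_le (μ := μ) (ν := ν) (τ := τ) hK hφ).trans_lt
      (ENNReal.mul_lt_top ((memLp_two_iff hK2.1).1 hK2) ((memLp_two_iff hφ2.1).1 hφ2)))
    ((memLp_two_iff hψ2.1).1 hψ2))
  exact (ENNReal.pow_lt_top_iff.1 h3).resolve_right two_ne_zero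

/-- The adjoint of an integral operator with square integrable kernel. -/
theorem integral_conj_kernel_mul (hK : StronglyMeasurable K) (hφ : StronglyMeasurable φ)
    (hK2 : MemLp K 2 (μ.prod ν)) (hφ2 : MemLp φ 2 (ν.prod τ)) {ψ : X × W → ℂ}
    (hψ : StronglyMeasurable ψ) (hψ2 : MemLp ψ 2 (μ.prod τ)) :
    ∫ z, conj (∫ y, K (z.1, y) * φ (y, z.2) ∂ν) * ψ z ∂μ.prod τ =
      ∫ p, conj (φ p) * ∫ x, conj (K (x, p.1)) * ψ (x, p.2) ∂μ ∂ν.prod τ := by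
  have hint := integrable_kernel_mul hK hφ hK2 hφ2 hψ hψ2
  have e1 : ∀ z : X × W, conj (∫ y, K (z.1, y) * φ (y, z.2) ∂ν) * ψ z =
      ∫ y, conj (K (z.1, y) * φ (y, z.2)) * ψ z ∂ν := fun z => by
    rw [integral_mul_const, integral_conj]
  have e2 : ∀ p : Y × W, conj (φ p) * ∫ x, conj (K (x, p.1)) * ψ (x, p.2) ∂μ =
      ∫ x, conj (K (x, p.1) * φ p) * ψ (x, p.2) ∂μ := fun p => by
    rw [← integral_const_mul]
    congr 1
    funext x
    rw [map_mul]
    ring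
  simp only [e1, e2]
  rw [← integral_prod _ hint]
  have mp : MeasurePreserving (fun q : (Y × W) × X => ((q.2, q.1.2), q.1.1))
      ((ν.prod τ).prod μ) ((μ.prod τ).prod ν) :=
    (Measure.measurePreserving_swap).comp ((measurePreserving_reorder' ν μ τ
      |> fun h => (measurePreserving_prodAssoc ν μ τ).comp
        ((measurePreserving_prodAssoc ν μ τ).symm.comp ((MeasurePreserving.id ν).prod
          (Measure.measurePreserving_swap (μ := τ) (ν := μ))))).comp
      (measurePreserving_prodAssoc ν τ μ))
  have hint2 : Integrable (fun q : (Y × W) × X => conj (K (q.2, q.1.1) * φ q.1) * ψ (q.2, q.1.2))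
      ((ν.prod τ).prod μ) := mp.integrable_comp_of_integrable hint
  rw [← integral_prod (f := fun q : (Y × W) × X => conj (K (q.2, q.1.1) * φ q.1) * ψ (q.2, q.1.2))
    hint2]
  exact (MeasurePreserving.integral_comp_of_aestronglyMeasurable mp hint.1).symm

end IntegralKernel

/-! ## The four terms of the interaction in the sectors -/

section Terms

variable {F : Kernel3} {φ ψ : FockFun}

/-- Families of functions that represent vectors in every sector. -/
def SecFam (φ : FockFun) : Prop := ∀ r s n, IsSectorFun (φ r s n)

theorem SecFam.fockSym (h : SecFam φ) : FockSym φ := fun r s n => (h r s n).symm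

theorem SecFam.l2Fam (h : SecFam φ) : L2Fam muUnit fun _ => φ where
  meas r s n := (h r s n).meas.comp_measurable measurable_snd
  memLp r s n := (h r s n).memLp.comp_snd muUnit

theorem secFam_of (h : L2Fam muUnit fun _ => φ) (hs : FockSym φ) : SecFam φ := fun r s n =>
  ⟨(h.meas r s n).comp_measurable (measurePreserving_unit (muS r s n)).measurable, hs r s n,
    (h.memLp r s n).comp_measurePreserving (measurePreserving_unit (muS r s n))⟩

theorem L2Fam.comp {P Q : Type*} [MeasurableSpace P] [MeasurableSpace Q] {ρ : Measure P}
    {η : Measure Q} [SigmaFinite ρ] [SigmaFinite η] {Θ : P → FockFun} (h : L2Fam ρ Θ) {f : Q → P}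
    (hf : MeasurePreserving f η ρ) : L2Fam η fun q => Θ (f q) where
  meas r s n := (h.meas r s n).comp_measurable (hf.measurable.prodMap measurable_id)
  memLp r s n := (h.memLp r s n).comp_measurePreserving (hf.prod (MeasurePreserving.id _))

/-- The integral of a family against a kernel. -/
theorem l2Fam_integral {X Y : Type*} [MeasurableSpace X] [MeasurableSpace Y] {μ : Measure X}
    {ν : Measure Y} [SigmaFinite μ] [SigmaFinite ν] {K : X × Y → ℂ} (hK : StronglyMeasurable K)
    (hK2 : MemLp K 2 (μ.prod ν)) {Θ : Y → FockFun} (h : L2Fam ν Θ) :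
    L2Fam μ fun x r s n w => ∫ y, K (x, y) * Θ y r s n w ∂ν where
  meas r s n := stronglyMeasurable_integral_kernel hK (h.meas r s n)
  memLp r s n := memLp_integral_kernel hK (h.meas r s n) hK2 (h.memLp r s n)

theorem measurePreserving_unitFF : MeasurePreserving
    (fun ξ : Fermion × Fermion => (((), ξ.1), ξ.2)) (muF.prod muF)
      ((muUnit.prod muF).prod muF) :=
  (measurePreserving_unit muF).prod (MeasurePreserving.id muF)

theorem measurePreserving_unitFF_symm : MeasurePreserving
    (fun ξ : (Unit × Fermion) × Fermion => (ξ.1.2, ξ.2)) ((muUnit.prod muF).prod muF)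
      (muF.prod muF) := by
  have h : MeasurePreserving (Prod.snd : Unit × Fermion → Fermion) (muUnit.prod muF) muF :=
    ⟨measurable_snd, by
      rw [← (measurePreserving_unit muF).map_eq, Measure.map_map measurable_snd
        measurable_prodMk_left]
      exact Measure.map_id⟩
  exact h.prod (MeasurePreserving.id muF)

theorem measurePreserving_kernelOne : MeasurePreserving
    (fun p : ((Unit × Fermion) × Fermion) × Boson =>
      ((p.1.1.2, p.1.2, p.2) : Fermion × Fermion × Boson))
    (((muUnit.prod muF).prod muF).prod muB) muFFB :=
  (measurePreserving_prodAssoc muF muF muB).comp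
    (measurePreserving_unitFF_symm.prod (MeasurePreserving.id muB))

theorem SecFam.annPair (h : SecFam φ) :
    L2Fam (muF.prod muF) fun q => annP q.2 (annE q.1 φ) :=
  L2Fam.comp (l2Fam_annP (l2Fam_annE h.l2Fam)) measurePreserving_unitFF

theorem SecFam.annBoson (h : SecFam φ) : L2Fam muB fun q => annZ q φ :=
  L2Fam.comp (l2Fam_annZ h.l2Fam) (measurePreserving_unit muB)

theorem stronglyMeasurable_kernelOne (hF : StronglyMeasurable (kernelFun F)) :
    StronglyMeasurable fun p : ((Unit × Fermion) × Fermion) × Boson => F p.1.1.2 p.1.2 p.2 := by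
  have h := hF.comp_measurable measurePreserving_kernelOne.measurable
  exact h

theorem memLp_kernelOne (hF2 : MemLp (kernelFun F) 2 muFFB) :
    MemLp (fun p : ((Unit × Fermion) × Fermion) × Boson => F p.1.1.2 p.1.2 p.2) 2
      (((muUnit.prod muF).prod muF).prod muB) := by
  have h := hF2.comp_measurePreserving measurePreserving_kernelOne
  exact h

/-- The family whose symmetrization is `formalOne`. -/
def oneFam (F : Kernel3) (φ : FockFun) (p : (Unit × Fermion) × Fermion) : FockFun :=
  fun r s n w => ∫ ξ₃, F p.1.2 p.2 ξ₃ * annZ ξ₃ φ r s n w ∂muB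

/-- The family whose symmetrization is `formalOneStar`. -/
def starFam (F : Kernel3) (φ : FockFun) (p : Unit × Boson) : FockFun :=
  fun r s n w => ∫ ξ : Fermion × Fermion, conj (F ξ.1 ξ.2 p.2) * annP ξ.2 (annE ξ.1 φ) r s n w
    ∂muF.prod muF

theorem formalOne_app (F : Kernel3) (φ : FockFun) : (formalOne F).app φ =
    creE fun ξ₁ => creP fun ξ₂ => oneFam F φ (((), ξ₁), ξ₂) := rfl

theorem formalOneStar_app (F : Kernel3) (φ : FockFun) : (formalOneStar F).app φ =
    creZ fun ξ₃ => starFam F φ ((), ξ₃) := rfl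

theorem l2Fam_oneFam (hF : StronglyMeasurable (kernelFun F))
    (hF2 : MemLp (kernelFun F) 2 muFFB) (h : SecFam φ) :
    L2Fam ((muUnit.prod muF).prod muF) (oneFam F φ) :=
  l2Fam_integral (stronglyMeasurable_kernelOne hF) (memLp_kernelOne hF2) h.annBoson

theorem l2Fam_creP_oneFam (hF : StronglyMeasurable (kernelFun F))
    (hF2 : MemLp (kernelFun F) 2 muFFB) (h : SecFam φ) :
    L2Fam (muUnit.prod muF) fun p => creP fun ξ₂ => oneFam F φ (p, ξ₂) :=
  l2Fam_creP (l2Fam_oneFam hF hF2 h)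

theorem secFam_formalOne (hF : StronglyMeasurable (kernelFun F))
    (hF2 : MemLp (kernelFun F) 2 muFFB) (h : SecFam φ) : SecFam ((formalOne F).app φ) := by
  rw [formalOne_app]
  have h1 := l2Fam_creE (Θ := fun p : Unit × Fermion => creP fun ξ₂ => oneFam F φ (p, ξ₂))
    (l2Fam_creP_oneFam hF hF2 h)
  refine secFam_of h1 (fockSym_creE fun ξ₁ => fockSym_creP fun ξ₂ => ?_)
  exact FockSym.integral (φ := fun ξ₃ => annZ ξ₃ φ) fun ξ₃ => fockSym_annZ h.fockSym ξ₃

theorem measurePreserving_unit_snd {α : Type*} [MeasurableSpace α] (a : Measure α) [SigmaFinite a] :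
    MeasurePreserving (Prod.snd : Unit × α → α) (muUnit.prod a) a :=
  ⟨measurable_snd, by
    rw [← (measurePreserving_unit a).map_eq, Measure.map_map measurable_snd measurable_prodMk_left]
    exact Measure.map_id⟩

theorem measurePreserving_kernelStar : MeasurePreserving
    (fun p : (Unit × Boson) × (Fermion × Fermion) =>
      ((p.2.1, p.2.2, p.1.2) : Fermion × Fermion × Boson))
      ((muUnit.prod muB).prod (muF.prod muF)) muFFB :=
  measurePreserving_kernelLast.comp
    ((measurePreserving_unit_snd muB).prod (MeasurePreserving.id (muF.prod muF)))

theorem stronglyMeasurable_kernelStar (hF : StronglyMeasurable (kernelFun F)) :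
    StronglyMeasurable fun p : (Unit × Boson) × (Fermion × Fermion) =>
      conj (F p.2.1 p.2.2 p.1.2) := by
  have h := StronglyMeasurable.conj (hF.comp_measurable measurePreserving_kernelStar.measurable)
  exact h

theorem memLp_kernelStar (hF2 : MemLp (kernelFun F) 2 muFFB) :
    MemLp (fun p : (Unit × Boson) × (Fermion × Fermion) => conj (F p.2.1 p.2.2 p.1.2)) 2
      ((muUnit.prod muB).prod (muF.prod muF)) := by
  have h := (hF2.comp_measurePreserving measurePreserving_kernelStar).star
  exact h

theorem l2Fam_starFam (hF : StronglyMeasurable (kernelFun F))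
    (hF2 : MemLp (kernelFun F) 2 muFFB) (h : SecFam φ) :
    L2Fam (muUnit.prod muB) (starFam F φ) :=
  l2Fam_integral (stronglyMeasurable_kernelStar hF) (memLp_kernelStar hF2) h.annPair

theorem secFam_formalOneStar (hF : StronglyMeasurable (kernelFun F))
    (hF2 : MemLp (kernelFun F) 2 muFFB) (h : SecFam φ) : SecFam ((formalOneStar F).app φ) := by
  rw [formalOneStar_app]
  refine secFam_of (l2Fam_creZ (l2Fam_starFam hF hF2 h)) (fockSym_creZ fun ξ₃ => ?_)
  exact FockSym.integral (φ := fun ξ : Fermion × Fermion => annP ξ.2 (annE ξ.1 φ))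
    fun ξ => fockSym_annP (fockSym_annE h.fockSym ξ.1) ξ.2

theorem ae_integrable_oneFam (hF : StronglyMeasurable (kernelFun F))
    (hF2 : MemLp (kernelFun F) 2 muFFB) (h : SecFam φ) (r s n : ℕ) :
    ∀ᵐ z ∂((muUnit.prod muF).prod muF).prod (muS r s n),
      Integrable (fun ξ₃ => F z.1.1.2 z.1.2 ξ₃ * annZ ξ₃ φ r s n z.2) muB :=
  ae_integrable_kernel (μ := (muUnit.prod muF).prod muF) (ν := muB) (τ := muS r s n)
    (K := fun p : ((Unit × Fermion) × Fermion) × Boson => F p.1.1.2 p.1.2 p.2)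
    (φ := fun q : Boson × Sector r s n => annZ q.1 φ r s n q.2)
    (stronglyMeasurable_kernelOne hF) (h.annBoson.meas r s n)
    (memLp_kernelOne hF2) (h.annBoson.memLp r s n)

theorem conv_formalOne (hF : StronglyMeasurable (kernelFun F))
    (hF2 : MemLp (kernelFun F) 2 muFFB) (h : SecFam φ) (r s n : ℕ) :
    ∀ᵐ w ∂muS r s n, (formalOne F).conv φ r s n w := by
  have h1 := ae_allE_param (ρ := muUnit) (R := fun _ ξ₁ => allP fun ξ₂ r s n w =>
      Integrable (fun ξ₃ => F ξ₁ ξ₂ ξ₃ * annZ ξ₃ φ r s n w) muB)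
    (fun r s n => ae_allP_param (R := fun (p : Unit × Fermion) ξ₂ r s n w =>
      Integrable (fun ξ₃ => F p.2 ξ₂ ξ₃ * annZ ξ₃ φ r s n w) muB)
      (ae_integrable_oneFam hF hF2 h) r s n) r s n
  exact (measurePreserving_unit (muS r s n)).quasiMeasurePreserving.ae h1

theorem ae_integrable_starFam (hF : StronglyMeasurable (kernelFun F))
    (hF2 : MemLp (kernelFun F) 2 muFFB) (h : SecFam φ) (r s n : ℕ) :
    ∀ᵐ z ∂(muUnit.prod muB).prod (muS r s n),
      Integrable (fun ξ : Fermion × Fermion => conj (F ξ.1 ξ.2 z.1.2) *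
        annP ξ.2 (annE ξ.1 φ) r s n z.2) (muF.prod muF) :=
  ae_integrable_kernel (μ := muUnit.prod muB) (ν := muF.prod muF) (τ := muS r s n)
    (K := fun p : (Unit × Boson) × (Fermion × Fermion) => conj (F p.2.1 p.2.2 p.1.2))
    (φ := fun q : (Fermion × Fermion) × Sector r s n => annP q.1.2 (annE q.1.1 φ) r s n q.2)
    (stronglyMeasurable_kernelStar hF) (h.annPair.meas r s n)
    (memLp_kernelStar hF2) (h.annPair.memLp r s n)

theorem conv_formalOneStar (hF : StronglyMeasurable (kernelFun F))
    (hF2 : MemLp (kernelFun F) 2 muFFB) (h : SecFam φ) (r s n : ℕ) :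
    ∀ᵐ w ∂muS r s n, (formalOneStar F).conv φ r s n w := by
  have h1 := ae_allZ_param (ρ := muUnit) (R := fun _ ξ₃ r s n w =>
        Integrable (fun ξ : Fermion × Fermion => conj (F ξ.1 ξ.2 ξ₃) *
          annP ξ.2 (annE ξ.1 φ) r s n w) (muF.prod muF)) (ae_integrable_starFam hF hF2 h) r s n
  exact (measurePreserving_unit (muS r s n)).quasiMeasurePreserving.ae h1

theorem integral_unit {r s n : ℕ} {g : Unit × Sector r s n → ℂ}
    (hg : StronglyMeasurable fun w : Sector r s n => g ((), w)) :
    ∫ z, g z ∂muUnit.prod (muS r s n) = ∫ w, g ((), w) ∂muS r s n :=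
  MeasurePreserving.integral_comp_of_aestronglyMeasurable
    (measurePreserving_unit_snd (muS r s n)) hg.aestronglyMeasurable

/-- Both creation operators move to the other side and become annihilation operators on `ψ`; the
boson integral stays inside `oneFam`. -/
theorem integral_conj_formalOne_eq (hF : StronglyMeasurable (kernelFun F))
    (hF2 : MemLp (kernelFun F) 2 muFFB) (h : SecFam φ) (hψ : SecFam ψ) (r s n : ℕ) :
    ∫ w, conj ((formalOne F).app φ (r + 1) (s + 1) n w) * ψ (r + 1) (s + 1) n w
        ∂muS (r + 1) (s + 1) n =
      ∫ z : ((Unit × Fermion) × Fermion) × Sector r s n, conj (oneFam F φ z.1 r s n z.2) *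
        annP z.1.2 (annE z.1.1.2 ψ) r s n z.2 ∂((muUnit.prod muF).prod muF).prod (muS r s n) := by
  have h1 := integral_conj_creE_mul (Θ := fun p : Unit × Fermion =>
    creP fun ξ₂ => oneFam F φ (p, ξ₂)) (l2Fam_creP_oneFam hF hF2 h) hψ.l2Fam
    (fun _ => hψ.fockSym) r (s + 1) n
  have h2 := integral_conj_creP_mul (l2Fam_oneFam hF hF2 h) (l2Fam_annE hψ.l2Fam)
    (fun p => fockSym_annE hψ.fockSym p.2) r s n
  rw [← h2, ← h1, integral_unit]
  · rfl
  · exact (StronglyMeasurable.conj (secFam_formalOne hF hF2 h _ _ _).meas).mul (hψ _ _ _).meas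

theorem integral_conj_formalOneStar_eq (hF : StronglyMeasurable (kernelFun F))
    (hF2 : MemLp (kernelFun F) 2 muFFB) (h : SecFam φ) (hψ : SecFam ψ) (r s n : ℕ) :
    ∫ w, conj ((formalOneStar F).app φ r s (n + 1) w) * ψ r s (n + 1) w ∂muS r s (n + 1) =
      ∫ z : (Unit × Boson) × Sector r s n, conj (starFam F φ z.1 r s n z.2) *
        annZ z.1.2 ψ r s n z.2 ∂(muUnit.prod muB).prod (muS r s n) := by
  have h3 := integral_conj_creZ_mul (l2Fam_starFam hF hF2 h) hψ.l2Fam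
    (fun _ => hψ.fockSym) r s n
  rw [← h3, integral_unit]
  · rfl
  · exact (StronglyMeasurable.conj (secFam_formalOneStar hF hF2 h _ _ _).meas).mul (hψ _ _ _).meas

/-- `formalOneStar` is the formal adjoint of `formalOne`. -/
theorem integral_conj_formalOne_mul (hF : StronglyMeasurable (kernelFun F))
    (hF2 : MemLp (kernelFun F) 2 muFFB) (h : SecFam φ) (hψ : SecFam ψ) (r s n : ℕ) :
    ∫ w, conj ((formalOne F).app φ (r + 1) (s + 1) n w) * ψ (r + 1) (s + 1) n w
        ∂muS (r + 1) (s + 1) n =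
      ∫ w, conj (φ r s (n + 1) w) * (formalOneStar F).app ψ r s (n + 1) w ∂muS r s (n + 1) := by
  have hA : L2Fam ((muUnit.prod muF).prod muF) fun p => annP p.2 (annE p.1.2 ψ) :=
    l2Fam_annP (l2Fam_annE hψ.l2Fam)
  -- `F` is regarded as the kernel of an operator from functions of a boson to functions of a
  -- fermion pair. Its Hilbert–Schmidt adjoint has kernel `conj F`, which trades `oneFam` for
  -- `starFam`.
  have h4 := integral_conj_kernel_mul (stronglyMeasurable_kernelOne hF) (h.annBoson.meas r s n)
    (memLp_kernelOne hF2) (h.annBoson.memLp r s n) (hA.meas r s n) (hA.memLp r s n)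
  have h5 : ∫ w, conj (φ r s (n + 1) w) * (formalOneStar F).app ψ r s (n + 1) w ∂muS r s (n + 1) =
      conj (∫ w, conj ((formalOneStar F).app ψ r s (n + 1) w) * φ r s (n + 1) w
        ∂muS r s (n + 1)) := by
    rw [← integral_conj]
    congr 1
    funext w
    rw [map_mul, Complex.conj_conj, mul_comm]
  have h6 : ∀ z : (Unit × Boson) × Sector r s n,
      conj (conj (starFam F ψ z.1 r s n z.2) * annZ z.1.2 φ r s n z.2) =
      conj (annZ z.1.2 φ r s n z.2) * starFam F ψ z.1 r s n z.2 := fun z => by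
    rw [map_mul, Complex.conj_conj, mul_comm]
  have h7 : ∀ p : Boson × Sector r s n, starFam F ψ ((), p.1) r s n p.2 =
      ∫ x : (Unit × Fermion) × Fermion, conj (F x.1.2 x.2 p.1) *
        annP x.2 (annE x.1.2 ψ) r s n p.2 ∂(muUnit.prod muF).prod muF := fun p => by
    have hm : StronglyMeasurable fun x : Fermion × Fermion => conj (F x.1 x.2 p.1) *
        annP x.2 (annE x.1 ψ) r s n p.2 := by
      have e1 := (stronglyMeasurable_kernelStar hF).comp_measurable
        (measurable_prodMk_left (x := (((), p.1) : Unit × Boson)))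
      have e2 := (hψ.annPair.meas r s n).comp_measurable (measurable_prodMk_right (y := p.2))
      exact e1.mul e2
    exact (MeasurePreserving.integral_comp_of_aestronglyMeasurable
      measurePreserving_unitFF_symm hm.aestronglyMeasurable).symm
  rw [integral_conj_formalOne_eq hF hF2 h hψ, h5, integral_conj_formalOneStar_eq hF hF2 hψ h,
    ← integral_conj]
  simp only [h6]
  refine h4.trans ?_
  simp only [← h7]
  have mp : MeasurePreserving (fun z : (Unit × Boson) × Sector r s n => (z.1.2, z.2))
      ((muUnit.prod muB).prod (muS r s n)) (muB.prod (muS r s n)) :=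
    (measurePreserving_unit_snd muB).prod (MeasurePreserving.id _)
  refine (MeasurePreserving.integral_comp_of_aestronglyMeasurable mp ?_).symm
  have e1 := (l2Fam_starFam hF hF2 hψ).meas r s n
  have e2 := e1.comp_measurable (g := fun p : Boson × Sector r s n => (((), p.1), p.2))
    (by fun_prop)
  exact ((StronglyMeasurable.conj (h.annBoson.meas r s n)).mul e2).aestronglyMeasurable

end Terms

/-! ### The term with three creation operators, its adjoint, and the bounds in the sectors. -/

section TermsTwo

variable {F : Kernel3} {φ ψ : FockFun}

/-- The family whose symmetrization is `formalTwo`. -/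
def twoFam (F : Kernel3) (φ : FockFun) (p : ((Unit × Fermion) × Fermion) × Boson) : FockFun :=
  F p.1.1.2 p.1.2 p.2 • φ

theorem formalTwo_app (F : Kernel3) (φ : FockFun) : (formalTwo F).app φ =
    creE fun ξ₁ => creP fun ξ₂ => creZ fun ξ₃ => twoFam F φ ((((), ξ₁), ξ₂), ξ₃) := rfl

theorem l2Fam_twoFam (hF : StronglyMeasurable (kernelFun F))
    (hF2 : MemLp (kernelFun F) 2 muFFB) (h : SecFam φ) :
    L2Fam (((muUnit.prod muF).prod muF).prod muB) (twoFam F φ) where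
  meas r s n := ((stronglyMeasurable_kernelOne hF).comp_measurable measurable_fst).mul
    ((h r s n).meas.comp_measurable measurable_snd)
  memLp r s n := memLp_mul_prod (memLp_kernelOne hF2) (h r s n).memLp

theorem l2Fam_creZ_twoFam (hF : StronglyMeasurable (kernelFun F))
    (hF2 : MemLp (kernelFun F) 2 muFFB) (h : SecFam φ) :
    L2Fam ((muUnit.prod muF).prod muF) fun p => creZ fun ξ₃ => twoFam F φ (p, ξ₃) :=
  l2Fam_creZ (l2Fam_twoFam hF hF2 h)

theorem l2Fam_creP_twoFam (hF : StronglyMeasurable (kernelFun F))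
    (hF2 : MemLp (kernelFun F) 2 muFFB) (h : SecFam φ) :
    L2Fam (muUnit.prod muF) fun p => creP fun ξ₂ => creZ fun ξ₃ => twoFam F φ ((p, ξ₂), ξ₃) :=
  l2Fam_creP (Θ := fun p : (Unit × Fermion) × Fermion => creZ fun ξ₃ => twoFam F φ (p, ξ₃))
    (l2Fam_creZ_twoFam hF hF2 h)

theorem secFam_formalTwo (hF : StronglyMeasurable (kernelFun F))
    (hF2 : MemLp (kernelFun F) 2 muFFB) (h : SecFam φ) : SecFam ((formalTwo F).app φ) := by
  rw [formalTwo_app]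
  have h1 := l2Fam_creE (Θ := fun p : Unit × Fermion => creP fun ξ₂ => creZ fun ξ₃ =>
    twoFam F φ ((p, ξ₂), ξ₃)) (l2Fam_creP_twoFam hF hF2 h)
  exact secFam_of h1 (fockSym_creE fun ξ₁ => fockSym_creP fun ξ₂ => fockSym_creZ fun ξ₃ =>
    h.fockSym.smul _)

theorem conv_formalTwo (φ : FockFun) (r s n : ℕ) :
    ∀ᵐ w ∂muS r s n, (formalTwo F).conv φ r s n w :=
  Filter.Eventually.of_forall fun _ => trivial

/-- The factor that relates `formalTwoStar` and `annTriple`. -/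
def annFactor (r s n : ℕ) : ℂ :=
  (Real.sqrt (n + 1) : ℂ) * ((-1) ^ r * (Real.sqrt (s + 1) : ℂ) * (Real.sqrt (r + 1) : ℂ))

theorem annZ_annP_annE (ψ : FockFun) (ξ : Fermion × Fermion × Boson) {r s n : ℕ}
    (w : Sector r s n) : annZ ξ.2.2 (annP ξ.2.1 (annE ξ.1 ψ)) r s n w =
      annFactor r s n * ψ (r + 1) (s + 1) (n + 1) (addE (addP (addZ (w, ξ.2.2), ξ.2.1), ξ.1)) := by
  simp only [annZ, annP, annE, annFactor]
  ring

theorem formalTwoStar_app (F : Kernel3) (ψ : FockFun) {r s n : ℕ} (w : Sector r s n) :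
    (formalTwoStar F).app ψ r s n w =
      annFactor r s n * annTriple F (ψ (r + 1) (s + 1) (n + 1)) w := by
  unfold formalTwoStar annTriple
  simp only [annZ_annP_annE]
  rw [← integral_const_mul]
  congr 1
  funext ξ
  simp only [kernelFun]
  ring

theorem enorm_annFactor_sq (r s n : ℕ) :
    ‖annFactor r s n‖ₑ ^ 2 = (n + 1 : ℝ≥0∞) * ((r + 1 : ℝ≥0∞) * (s + 1)) := by
  have h : ‖annFactor r s n‖ ^ 2 = (n + 1 : ℝ) * ((r + 1) * (s + 1)) := by
    unfold annFactor
    simp only [norm_mul, norm_pow, norm_neg, norm_one, one_pow, one_mul, Complex.norm_real,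
      Real.norm_eq_abs, mul_pow, sq_abs]
    rw [Real.sq_sqrt (by positivity), Real.sq_sqrt (by positivity), Real.sq_sqrt (by positivity)]
    ring
  have e : ∀ m : ℕ, ENNReal.ofReal (m + 1 : ℝ) = m + 1 := fun m => by
    rw [ENNReal.ofReal_add (by positivity) (by norm_num)]; simp
  rw [← ofReal_norm, ← ENNReal.ofReal_pow (norm_nonneg _), h, ENNReal.ofReal_mul (by positivity),
    ENNReal.ofReal_mul (by positivity), e, e, e]

theorem secFam_formalTwoStar (hF : StronglyMeasurable (kernelFun F))
    (hF2 : MemLp (kernelFun F) 2 muFFB) (h : SecFam φ) : SecFam ((formalTwoStar F).app φ) := by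
  intro r s n
  have hm := stronglyMeasurable_annTriple hF (h (r + 1) (s + 1) (n + 1)).meas
  have e : (formalTwoStar F).app φ r s n = fun w : Sector r s n =>
      annFactor r s n * annTriple F (φ (r + 1) (s + 1) (n + 1)) w :=
    funext fun w => formalTwoStar_app F φ w
  have hk : kernelSq F < ⊤ := (memLp_two_iff hF2.1).1 hF2
  have h2 : sectorSq (φ (r + 1) (s + 1) (n + 1)) < ⊤ :=
    (memLp_two_iff (h _ _ _).memLp.1).1 (h (r + 1) (s + 1) (n + 1)).memLp
  have h1 : MemLp (annTriple F (φ (r + 1) (s + 1) (n + 1))) 2 (muS r s n) := by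
    rw [memLp_two_iff hm.aestronglyMeasurable]
    have hb := annTriple_bound hF (h (r + 1) (s + 1) (n + 1)).meas (h _ _ _).symm
    refine lt_of_le_of_lt ?_ (hb.trans_lt (ENNReal.mul_lt_top hk h2))
    exact le_mul_of_one_le_left zero_le le_add_self
  have hs := isFockSym_annTriple (F := F) (h (r + 1) (s + 1) (n + 1)).symm
  rw [e]
  exact ⟨hm.const_mul _, isFockSym_of (fun w₂ w₃ => (hs.anti₁ w₂ w₃).const_mul _)
    (fun w₁ w₃ => (hs.anti₂ w₁ w₃).const_mul _) fun w₁ w₂ => (hs.symm₃ w₁ w₂).const_mul _,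
    h1.const_mul _⟩

theorem conv_formalTwoStar (hF2 : MemLp (kernelFun F) 2 muFFB) (h : SecFam φ) (r s n : ℕ) :
    ∀ᵐ w ∂muS r s n, (formalTwoStar F).conv φ r s n w := by
  filter_upwards [memLp_slice_sector (h (r + 1) (s + 1) (n + 1)).memLp] with w hw
  have h1 := (integrable_conj_mul hF2 hw).const_mul (annFactor r s n)
  refine h1.congr (Filter.Eventually.of_forall fun ξ => ?_)
  simp only [annZ_annP_annE, kernelFun]
  ring

theorem integral_conj_formalTwo_eq (hF : StronglyMeasurable (kernelFun F))
    (hF2 : MemLp (kernelFun F) 2 muFFB) (h : SecFam φ) (hψ : SecFam ψ) (r s n : ℕ) :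
    ∫ w, conj ((formalTwo F).app φ (r + 1) (s + 1) (n + 1) w) * ψ (r + 1) (s + 1) (n + 1) w
        ∂muS (r + 1) (s + 1) (n + 1) =
      ∫ z : (((Unit × Fermion) × Fermion) × Boson) × Sector r s n,
        conj (twoFam F φ z.1 r s n z.2) *
        annZ z.1.2 (annP z.1.1.2 (annE z.1.1.1.2 ψ)) r s n z.2
          ∂(((muUnit.prod muF).prod muF).prod muB).prod (muS r s n) := by
  have h1 := integral_conj_creE_mul (Θ := fun p : Unit × Fermion =>
    creP fun ξ₂ => creZ fun ξ₃ => twoFam F φ ((p, ξ₂), ξ₃)) (l2Fam_creP_twoFam hF hF2 h)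
    hψ.l2Fam (fun _ => hψ.fockSym) r (s + 1) (n + 1)
  have h2 := integral_conj_creP_mul (Θ := fun p : (Unit × Fermion) × Fermion =>
    creZ fun ξ₃ => twoFam F φ (p, ξ₃)) (l2Fam_creZ_twoFam hF hF2 h) (l2Fam_annE hψ.l2Fam)
    (fun p => fockSym_annE hψ.fockSym p.2) r s (n + 1)
  have h3 := integral_conj_creZ_mul (l2Fam_twoFam hF hF2 h)
    (l2Fam_annP (l2Fam_annE hψ.l2Fam))
    (fun p => fockSym_annP (fockSym_annE hψ.fockSym p.1.2) p.2) r s n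
  rw [← h3, ← h2, ← h1, integral_unit]
  · rfl
  · exact (StronglyMeasurable.conj (secFam_formalTwo hF hF2 h _ _ _).meas).mul (hψ _ _ _).meas

/-- `formalTwoStar` is the formal adjoint of `formalTwo`. -/
theorem integral_conj_formalTwo_mul (hF : StronglyMeasurable (kernelFun F))
    (hF2 : MemLp (kernelFun F) 2 muFFB) (h : SecFam φ) (hψ : SecFam ψ) (r s n : ℕ) :
    ∫ w, conj ((formalTwo F).app φ (r + 1) (s + 1) (n + 1) w) * ψ (r + 1) (s + 1) (n + 1) w
        ∂muS (r + 1) (s + 1) (n + 1) =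
      ∫ w, conj (φ r s n w) * (formalTwoStar F).app ψ r s n w ∂muS r s n := by
  have hA : L2Fam (((muUnit.prod muF).prod muF).prod muB)
      fun p => annZ p.2 (annP p.1.2 (annE p.1.1.2 ψ)) :=
    l2Fam_annZ (l2Fam_annP (l2Fam_annE hψ.l2Fam))
  -- After the three creation operators have moved to `ψ`, the particle variables are integrated
  -- first; `conj (φ w)` does not depend on them and comes out.
  rw [integral_conj_formalTwo_eq hF hF2 h hψ,
    integral_prod_symm _ (integrable_conj_mul ((l2Fam_twoFam hF hF2 h).memLp r s n)
      (hA.memLp r s n))]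
  congr 1
  funext w
  have e1 : ∀ p : ((Unit × Fermion) × Fermion) × Boson, conj (twoFam F φ p r s n w) *
      annZ p.2 (annP p.1.2 (annE p.1.1.2 ψ)) r s n w = conj (φ r s n w) *
        (conj (F p.1.1.2 p.1.2 p.2) * annZ p.2 (annP p.1.2 (annE p.1.1.2 ψ)) r s n w) :=
    fun p => by
      simp only [twoFam, Pi.smul_apply, smul_eq_mul, map_mul]
      ring
  simp only [e1]
  rw [integral_const_mul]
  congr 1
  have hm : StronglyMeasurable fun ξ : Fermion × Fermion × Boson =>
      conj (F ξ.1 ξ.2.1 ξ.2.2) * annZ ξ.2.2 (annP ξ.2.1 (annE ξ.1 ψ)) r s n w := by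
    simp only [annZ_annP_annE]
    exact (StronglyMeasurable.conj hF).mul
      (((hψ (r + 1) (s + 1) (n + 1)).meas.comp_measurable (by fun_prop)).const_mul _)
  exact MeasurePreserving.integral_comp_of_aestronglyMeasurable
      measurePreserving_kernelOne hm.aestronglyMeasurable

/-! ### Vanishing components -/

theorem formalOne_app_zero_right (F : Kernel3) (φ : FockFun) (r n : ℕ) (w : Sector r 0 n) :
    (formalOne F).app φ r 0 n w = 0 := by
  cases r with
  | zero => rfl
  | succ r => simp [formalOne_app, creE_succ, creP]

theorem formalTwo_app_zero_right (F : Kernel3) (φ : FockFun) (r n : ℕ) (w : Sector r 0 n) :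
    (formalTwo F).app φ r 0 n w = 0 := by
  cases r with
  | zero => rfl
  | succ r => simp [formalTwo_app, creE_succ, creP]

theorem formalTwo_app_zero_boson (F : Kernel3) (φ : FockFun) (r s : ℕ) (w : Sector r s 0) :
    (formalTwo F).app φ r s 0 w = 0 := by
  cases r with
  | zero => rfl
  | succ r =>
    cases s with
    | zero => simp [formalTwo_app, creE_succ, creP]
    | succ s => simp [formalTwo_app, creE_succ, creP_succ, creZ]

/-! ### Bounds -/

theorem enorm_const_mul_sq {α : Type*} [MeasurableSpace α] {μ : Measure α} (c : ℂ) (f : α → ℂ) :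
    ∫⁻ x, ‖c * f x‖ₑ ^ 2 ∂μ = ‖c‖ₑ ^ 2 * ∫⁻ x, ‖f x‖ₑ ^ 2 ∂μ := by
  simp only [enorm_mul, mul_pow]
  exact lintegral_const_mul' _ _ (by finiteness)

/-- `AnnBound` absorbs the fermionic normalization `(r + 1) (s + 1)` contained in `annFactor`; the
bosonic factor `n + 1` is all that remains besides `C r`. -/
theorem formalTwoStar_bound {C : ℕ → ℝ≥0∞} (hC : AnnBound F C) (h : SecFam φ) (r s n : ℕ) :
    sectorSq ((formalTwoStar F).app φ r s n) ≤
      (n + 1) * C r * sectorSq (φ (r + 1) (s + 1) (n + 1)) := by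
  have e : sectorSq ((formalTwoStar F).app φ r s n) =
      ‖annFactor r s n‖ₑ ^ 2 * sectorSq (annTriple F (φ (r + 1) (s + 1) (n + 1))) := by
    unfold sectorSq
    simp only [formalTwoStar_app]
    exact enorm_const_mul_sq _ _
  rw [e, enorm_annFactor_sq]
  simp only [mul_assoc (n + 1 : ℝ≥0∞)]
  exact mul_le_mul' le_rfl (hC.1 r s n _ (h _ _ _))

/-- Cauchy–Schwarz for `n + 1` summands, against the normalization `1/√(n+1)`. -/
theorem enorm_creZ_sq_le (Θ : Boson → FockFun) (r s n : ℕ) (w : Sector r s (n + 1)) :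
    ‖creZ Θ r s (n + 1) w‖ₑ ^ 2 ≤ ∑ i : Fin (n + 1),
      ‖Θ (w.2.2 i) r s n (w.1, w.2.1, w.2.2 ∘ i.succAbove)‖ₑ ^ 2 := by
  have h : ∀ a : Fin (n + 1) → ℂ, ‖(1 / Real.sqrt (n + 1) : ℂ) * ∑ i, a i‖ ^ 2 ≤
      ∑ i, ‖a i‖ ^ 2 := fun a => by
    rw [norm_mul, mul_pow, norm_div, norm_one, Complex.norm_real, Real.norm_eq_abs, div_pow, sq_abs,
      Real.sq_sqrt (by positivity), one_pow]
    have h1 : ‖∑ i, a i‖ ^ 2 ≤ (n + 1) * ∑ i, ‖a i‖ ^ 2 := by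
      have h2 := sq_sum_le_card_mul_sum_sq (s := Finset.univ) (f := fun i => ‖a i‖)
      simp only [Finset.card_univ, Fintype.card_fin] at h2
      push_cast at h2
      exact (pow_le_pow_left₀ (norm_nonneg _) (norm_sum_le _ _) 2).trans h2
    rw [one_div, inv_mul_le_iff₀ (by positivity)]
    exact h1
  have h2 := ENNReal.ofReal_le_ofReal (h fun i =>
    Θ (w.2.2 i) r s n (w.1, w.2.1, w.2.2 ∘ i.succAbove))
  rw [ENNReal.ofReal_sum_of_nonneg fun i _ => by positivity] at h2
  simp only [ENNReal.ofReal_pow (norm_nonneg _), ofReal_norm] at h2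
  exact h2

/-- Singling out any one of the `n + 1` bosons preserves the measure, so all summands have the same
integral. -/
theorem sectorSq_creZ_le {Θ : Unit × Boson → FockFun} (h : L2Fam (muUnit.prod muB) Θ)
    (r s n : ℕ) : sectorSq (creZ (fun ξ => Θ ((), ξ)) r s (n + 1)) ≤
      (n + 1) * ∫⁻ ξ, sectorSq (Θ ((), ξ) r s n) ∂muB := by
  have hm : Measurable fun z : (Unit × Boson) × Sector r s n => ‖Θ z.1 r s n z.2‖ₑ ^ 2 :=
    (h.meas r s n).enorm.pow_const 2
  have e : ∀ i : Fin (n + 1), ∫⁻ w : Sector r s (n + 1), ‖Θ ((), w.2.2 i) r s n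
      (w.1, w.2.1, w.2.2 ∘ i.succAbove)‖ₑ ^ 2 ∂muS r s (n + 1) =
        ∫⁻ ξ, sectorSq (Θ ((), ξ) r s n) ∂muB := fun i => by
    have mp := (measurePreserving_splitZ (ρ := muUnit) (r := r) (s := s) i).comp
      (measurePreserving_unit (muS r s (n + 1)))
    have e1 := mp.lintegral_comp hm
    have hm' : Measurable fun p : Unit × Boson => ∫⁻ w, ‖Θ p r s n w‖ₑ ^ 2 ∂muS r s n :=
      hm.lintegral_prod_right'
    have e2 := (measurePreserving_unit muB).lintegral_comp hm'
    rw [lintegral_prod _ hm.aemeasurable, ← e2] at e1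
    exact e1
  refine (lintegral_mono fun w => enorm_creZ_sq_le _ r s n w).trans_eq ?_
  rw [lintegral_finsetSum]
  · simp only [e, Finset.sum_const, Finset.card_univ, Fintype.card_fin, nsmul_eq_mul]
    push_cast
    rfl
  · intro i _
    exact hm.comp ((measurePreserving_splitZ (ρ := muUnit) (r := r) (s := s) i).comp
      (measurePreserving_unit (muS r s (n + 1)))).measurable

theorem formalOneStar_bound (hF : StronglyMeasurable (kernelFun F))
    (hF2 : MemLp (kernelFun F) 2 muFFB) {C : ℕ → ℝ≥0∞} (hC : AnnBound F C) (h : SecFam φ)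
    (r s n : ℕ) : sectorSq ((formalOneStar F).app φ r s (n + 1)) ≤
      (n + 1) * C r * sectorSq (φ (r + 1) (s + 1) n) := by
  have h1 := sectorSq_creZ_le (l2Fam_starFam hF hF2 h) r s n
  -- The third argument `0` removes the boson factor: `annFactor r s 0` is the normalization `(-1)^r
  -- √(s+1) √(r+1)` of a fermion pair.
  have e0 : ∀ ξ₃ (w : Sector r s n), starFam F φ ((), ξ₃) r s n w =
      annFactor r s 0 * annPair F (φ (r + 1) (s + 1) n) ξ₃ w := fun ξ₃ w => by
    unfold starFam annPair
    rw [← integral_const_mul]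
    congr 1
    funext ξ
    simp only [annP, annE, annFactor]
    simp
    ring
  have e1 : ∀ ξ₃, sectorSq (starFam F φ ((), ξ₃) r s n) =
      (r + 1 : ℝ≥0∞) * (s + 1) * sectorSq (annPair F (φ (r + 1) (s + 1) n) ξ₃) := fun ξ₃ => by
    unfold sectorSq
    simp only [e0]
    rw [enorm_const_mul_sq, enorm_annFactor_sq]
    simp
  simp only [e1] at h1
  rw [lintegral_const_mul' _ _ (by finiteness)] at h1
  refine h1.trans ?_
  rw [mul_assoc (n + 1 : ℝ≥0∞)]
  exact mul_le_mul' le_rfl (hC.2 r s n _ (h _ _ _))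

end TermsTwo

/-! ## Changing the kernel on a null set -/

section KernelCongr

variable {F F' : Kernel3}

theorem ae_prod_muS {Q : Type*} [MeasurableSpace Q] {ρ : Measure Q} [SigmaFinite ρ]
    {p : Q → Prop} (h : ∀ᵐ q ∂ρ, p q) (r s n : ℕ) :
    ∀ᵐ z ∂ρ.prod (muS r s n), p z.1 :=
  Measure.quasiMeasurePreserving_fst.ae h

theorem ae_kernel_pair (h : kernelFun F =ᵐ[muFFB] kernelFun F') :
    ∀ᵐ p ∂(muUnit.prod muF).prod muF, ∀ᵐ ξ₃ ∂muB, F p.1.2 p.2 ξ₃ = F' p.1.2 p.2 ξ₃ :=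
  Measure.ae_ae_of_ae_prod (measurePreserving_kernelOne.quasiMeasurePreserving.ae h)

theorem ae_allE_pair (h : kernelFun F =ᵐ[muFFB] kernelFun F') (r s n : ℕ) :
    ∀ᵐ w ∂muS r s n, allE (fun ξ₁ => allP fun ξ₂ _ _ _ _ =>
      ∀ᵐ ξ₃ ∂muB, F ξ₁ ξ₂ ξ₃ = F' ξ₁ ξ₂ ξ₃) r s n w := by
  have h1 : ∀ r s n, ∀ᵐ z ∂(muUnit.prod muF).prod (muS r s n), allP (fun ξ₂ _ _ _ _ =>
      ∀ᵐ ξ₃ ∂muB, F z.1.2 ξ₂ ξ₃ = F' z.1.2 ξ₂ ξ₃) r s n z.2 :=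
    ae_allP_param (R := fun (p : Unit × Fermion) ξ₂ _ _ _ _ =>
      ∀ᵐ ξ₃ ∂muB, F p.2 ξ₂ ξ₃ = F' p.2 ξ₂ ξ₃)
      (fun r s n => ae_prod_muS (ae_kernel_pair h) r s n)
  have h2 := ae_allE_param (ρ := muUnit) (R := fun _ ξ₁ => allP fun ξ₂ _ _ _ _ =>
      ∀ᵐ ξ₃ ∂muB, F ξ₁ ξ₂ ξ₃ = F' ξ₁ ξ₂ ξ₃) h1 r s n
  exact (measurePreserving_unit (muS r s n)).quasiMeasurePreserving.ae h2

theorem formalOne_conv (F : Kernel3) (φ : FockFun) : (formalOne F).conv φ =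
    allE fun ξ₁ => allP fun ξ₂ => fun r s n w =>
      Integrable (fun ξ₃ => F ξ₁ ξ₂ ξ₃ * annZ ξ₃ φ r s n w) muB := rfl

theorem formalOneStar_conv (F : Kernel3) (φ : FockFun) : (formalOneStar F).conv φ =
    allZ fun ξ₃ => fun r s n w => Integrable (fun ξ : Fermion × Fermion =>
      conj (F ξ.1 ξ.2 ξ₃) * annP ξ.2 (annE ξ.1 φ) r s n w) (muF.prod muF) := rfl

theorem formalOne_conv_congr {r s n : ℕ} {w : Sector r s n} (φ : FockFun)
    (hk : allE (fun ξ₁ => allP fun ξ₂ _ _ _ _ => ∀ᵐ ξ₃ ∂muB, F ξ₁ ξ₂ ξ₃ = F' ξ₁ ξ₂ ξ₃) r s n w)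
    (hc : (formalOne F).conv φ r s n w) : (formalOne F').conv φ r s n w := by
  rw [formalOne_conv] at hc ⊢
  refine allE_mono (fun ξ₁ r s n w h => ?_) r s n w (allE_and hk hc)
  refine allP_mono (fun ξ₂ r s n w h => ?_) r s n w (allP_and h.1 h.2)
  exact h.2.congr (h.1.mono fun ξ₃ e => by simp only [e])

theorem formalOne_app_congr {r s n : ℕ} {w : Sector r s n} (φ : FockFun)
    (hk : allE (fun ξ₁ => allP fun ξ₂ _ _ _ _ => ∀ᵐ ξ₃ ∂muB, F ξ₁ ξ₂ ξ₃ = F' ξ₁ ξ₂ ξ₃) r s n w) :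
    (formalOne F).app φ r s n w = (formalOne F').app φ r s n w := by
  rw [formalOne_app, formalOne_app]
  refine creE_congr (allE_mono (fun ξ₁ r s n w h => ?_) r s n w hk)
  refine creP_congr (allP_mono (fun ξ₂ r s n w h => ?_) r s n w h)
  exact integral_congr_ae (h.mono fun ξ₃ e => by simp only [e])

/-- The kernel `h G` is only almost everywhere strongly measurable, whereas the estimates above use
strongly measurable kernels. A null set of kernel variables turns into a null set of configurations
when followed through the creation operators. One inclusion suffices because the hypothesis is
symmetric. -/
theorem graph_formalOne_congr (h : kernelFun F =ᵐ[muFFB] kernelFun F') :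
    (formalOne F).graph ≤ (formalOne F').graph := by
  intro P hP r s n
  filter_upwards [hP r s n, ae_allE_pair h r s n] with w hw hk
  exact ⟨formalOne_conv_congr _ hk hw.1, hw.2.trans (formalOne_app_congr _ hk)⟩

theorem ae_allZ_slice (h : kernelFun F =ᵐ[muFFB] kernelFun F') (r s n : ℕ) :
    ∀ᵐ w ∂muS r s n, allZ (fun ξ₃ _ _ _ _ => ∀ᵐ ξ : Fermion × Fermion ∂muF.prod muF,
      F ξ.1 ξ.2 ξ₃ = F' ξ.1 ξ.2 ξ₃) r s n w := by
  have h0 : ∀ᵐ p ∂muUnit.prod muB, ∀ᵐ ξ : Fermion × Fermion ∂muF.prod muF,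
      F ξ.1 ξ.2 p.2 = F' ξ.1 ξ.2 p.2 :=
    (measurePreserving_unit_snd muB).quasiMeasurePreserving.ae (ae_kernel_slice h)
  have h1 := ae_allZ_param (ρ := muUnit) (R := fun _ ξ₃ _ _ _ _ =>
    ∀ᵐ ξ : Fermion × Fermion ∂muF.prod muF, F ξ.1 ξ.2 ξ₃ = F' ξ.1 ξ.2 ξ₃)
    (fun r s n => ae_prod_muS h0 r s n) r s n
  exact (measurePreserving_unit (muS r s n)).quasiMeasurePreserving.ae h1

theorem graph_formalOneStar_congr (h : kernelFun F =ᵐ[muFFB] kernelFun F') :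
    (formalOneStar F).graph ≤ (formalOneStar F').graph := by
  intro P hP r s n
  filter_upwards [hP r s n, ae_allZ_slice h r s n] with w hw hk
  obtain ⟨hc, ha⟩ := hw
  rw [formalOneStar_conv] at hc
  rw [formalOneStar_app] at ha
  rw [formalOneStar_conv, formalOneStar_app]
  refine ⟨allZ_mono (fun ξ₃ r s n w h => ?_) r s n w (allZ_and hk hc),
    ha.trans (creZ_congr (allZ_mono (fun ξ₃ r s n w h => ?_) r s n w hk))⟩
  · exact h.2.congr (h.1.mono fun ξ e => by simp only [e])
  · exact integral_congr_ae (h.mono fun ξ e => by simp only [e])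

theorem ae_allZ_kernel (h : kernelFun F =ᵐ[muFFB] kernelFun F') (r s n : ℕ) :
    ∀ᵐ z ∂((muUnit.prod muF).prod muF).prod (muS r s n), allZ (fun ξ₃ _ _ _ _ =>
      F z.1.1.2 z.1.2 ξ₃ = F' z.1.1.2 z.1.2 ξ₃) r s n z.2 := by
  have h0 : ∀ᵐ p ∂((muUnit.prod muF).prod muF).prod muB, F p.1.1.2 p.1.2 p.2 =
      F' p.1.1.2 p.1.2 p.2 := measurePreserving_kernelOne.quasiMeasurePreserving.ae h
  exact ae_allZ_param (R := fun (p : (Unit × Fermion) × Fermion) ξ₃ _ _ _ _ =>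
        F p.1.2 p.2 ξ₃ = F' p.1.2 p.2 ξ₃) (fun r s n => ae_prod_muS h0 r s n) r s n

theorem ae_allE_kernel (h : kernelFun F =ᵐ[muFFB] kernelFun F') (r s n : ℕ) :
    ∀ᵐ w ∂muS r s n, allE (fun ξ₁ => allP fun ξ₂ => allZ fun ξ₃ _ _ _ _ =>
      F ξ₁ ξ₂ ξ₃ = F' ξ₁ ξ₂ ξ₃) r s n w := by
  have h1 : ∀ r s n, ∀ᵐ z ∂(muUnit.prod muF).prod (muS r s n), allP (fun ξ₂ => allZ
      fun ξ₃ _ _ _ _ => F z.1.2 ξ₂ ξ₃ = F' z.1.2 ξ₂ ξ₃) r s n z.2 :=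
    ae_allP_param (R := fun (p : Unit × Fermion) ξ₂ => allZ fun ξ₃ _ _ _ _ =>
      F p.2 ξ₂ ξ₃ = F' p.2 ξ₂ ξ₃) (ae_allZ_kernel h)
  have h2 := ae_allE_param (ρ := muUnit) (R := fun _ ξ₁ => allP fun ξ₂ => allZ fun ξ₃ _ _ _ _ =>
      F ξ₁ ξ₂ ξ₃ = F' ξ₁ ξ₂ ξ₃) h1 r s n
  exact (measurePreserving_unit (muS r s n)).quasiMeasurePreserving.ae h2

theorem formalTwo_app_congr {r s n : ℕ} {w : Sector r s n} (φ : FockFun)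
    (hk : allE (fun ξ₁ => allP fun ξ₂ => allZ fun ξ₃ _ _ _ _ =>
      F ξ₁ ξ₂ ξ₃ = F' ξ₁ ξ₂ ξ₃) r s n w) :
    (formalTwo F).app φ r s n w = (formalTwo F').app φ r s n w := by
  rw [formalTwo_app, formalTwo_app]
  refine creE_congr (allE_mono (fun ξ₁ r s n w h => ?_) r s n w hk)
  refine creP_congr (allP_mono (fun ξ₂ r s n w h => ?_) r s n w h)
  refine creZ_congr (allZ_mono (fun ξ₃ r s n w h => ?_) r s n w h)
  simp only [twoFam, Pi.smul_apply, h]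

theorem graph_formalTwo_congr (h : kernelFun F =ᵐ[muFFB] kernelFun F') :
    (formalTwo F).graph ≤ (formalTwo F').graph := by
  intro P hP r s n
  filter_upwards [hP r s n, ae_allE_kernel h r s n] with w hw hk
  exact ⟨trivial, hw.2.trans (formalTwo_app_congr _ hk)⟩

theorem graph_formalTwoStar_congr (h : kernelFun F =ᵐ[muFFB] kernelFun F') :
    (formalTwoStar F).graph ≤ (formalTwoStar F').graph := by
  intro P hP r s n
  filter_upwards [hP r s n] with w hw
  have e : ∀ᵐ ξ ∂muFFB, conj (F ξ.1 ξ.2.1 ξ.2.2) *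
        annZ ξ.2.2 (annP ξ.2.1 (annE ξ.1 P.1.toFun)) r s n w = conj (F' ξ.1 ξ.2.1 ξ.2.2) *
        annZ ξ.2.2 (annP ξ.2.1 (annE ξ.1 P.1.toFun)) r s n w := by
    filter_upwards [h] with ξ hξ
    simp only [kernelFun] at hξ
    simp only [hξ]
  exact ⟨hw.1.congr e, hw.2.trans (integral_congr_ae e)⟩

end KernelCongr

/-! ## Representatives of the vectors of Fock space -/

section Representatives

variable {r s n : ℕ}

/-- The projection onto the functions with the symmetry of Fock space. -/
def symmetrize (g : Sector r s n → ℂ) (w : Sector r s n) : ℂ :=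
  (Fintype.card (Equiv.Perm (Fin r) × Equiv.Perm (Fin s) × Equiv.Perm (Fin n)) : ℂ)⁻¹ *
    ∑ q : Equiv.Perm (Fin r) × Equiv.Perm (Fin s) × Equiv.Perm (Fin n),
      ((Equiv.Perm.sign q.1 * Equiv.Perm.sign q.2.1 : ℤˣ) : ℂ) * g (relabel q.1 q.2.1 q.2.2 w)

theorem sign_mul_self_complex (u : ℤˣ) : ((u : ℤˣ) : ℂ) * (u : ℂ) = 1 := by
  rcases Int.units_eq_one_or u with h | h <;> simp [h]

theorem isFockSym_symmetrize (g : Sector r s n → ℂ) : IsFockSym (symmetrize g) := by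
  intro σ τ π w
  simp only [symmetrize]
  rw [mul_left_comm]
  congr 1
  rw [Finset.mul_sum]
  refine Fintype.sum_equiv (Equiv.mulLeft (σ, τ, π)) _ _ fun q => ?_
  have e : relabel q.1 q.2.1 q.2.2 (relabel σ τ π w) =
      relabel (σ * q.1) (τ * q.2.1) (π * q.2.2) w := rfl
  have e2 := sign_mul_self_complex (Equiv.Perm.sign σ)
  have e3 := sign_mul_self_complex (Equiv.Perm.sign τ)
  simp only [Equiv.coe_mulLeft, Prod.fst_mul, Prod.snd_mul, e, Equiv.Perm.sign_mul]
  push_cast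
  linear_combination (-(((Equiv.Perm.sign q.1 : ℤˣ) : ℂ) * ((Equiv.Perm.sign q.2.1 : ℤˣ) : ℂ) *
    g (relabel (σ * q.1) (τ * q.2.1) (π * q.2.2) w))) * (e2 * (((Equiv.Perm.sign τ : ℤˣ) : ℂ) *
      (Equiv.Perm.sign τ : ℂ)) + e3)

/-- A vector of `FockSector` is symmetric only up to null sets. Averaging a representative over the
finitely many permutations makes the symmetry hold at every configuration and alters it on a null
set only. -/
theorem exists_isSectorFun (Φ : FockSector r s n) :
    ∃ φ : Sector r s n → ℂ, IsSectorFun φ ∧ φ =ᵐ[muS r s n] (Φ : Lp ℂ 2 (muS r s n)) := by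
  have hae : symmetrize ((Φ : Lp ℂ 2 (muS r s n)) : Sector r s n → ℂ) =ᵐ[muS r s n]
      (Φ : Lp ℂ 2 (muS r s n)) := by
    have h : ∀ᵐ w ∂muS r s n, ∀ q : Equiv.Perm (Fin r) × Equiv.Perm (Fin s) × Equiv.Perm (Fin n),
        (Φ : Lp ℂ 2 (muS r s n)) (relabel q.1 q.2.1 q.2.2 w) =
          ((Equiv.Perm.sign q.1 * Equiv.Perm.sign q.2.1 : ℤˣ) : ℂ) *
            (Φ : Lp ℂ 2 (muS r s n)) w := ae_all_iff.2 fun q => Φ.2 q.1 q.2.1 q.2.2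
    filter_upwards [h] with w hw
    simp only [symmetrize, hw, ← mul_assoc, sign_mul_self_complex, one_mul, Finset.sum_const,
      Finset.card_univ, nsmul_eq_mul]
    rw [inv_mul_cancel₀, one_mul]
    exact_mod_cast Fintype.card_ne_zero
  have hm := Lp.stronglyMeasurable (Φ : Lp ℂ 2 (muS r s n))
  refine ⟨_, ⟨?_, isFockSym_symmetrize _, (memLp_congr_ae hae).2 (Lp.memLp _)⟩, hae⟩
  refine (Finset.stronglyMeasurable_fun_sum _ fun q _ => ?_).const_mul _
  exact (hm.comp_measurable (measurePreserving_relabel q.1 q.2.1 q.2.2).measurable).const_mul _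

/-- A family of functions represents a vector of Fock space. -/
def Rep (Φ : Fock) (φ : FockFun) : Prop :=
  SecFam φ ∧ ∀ r s n, φ r s n =ᵐ[muS r s n] Φ.toFun r s n

theorem exists_rep (Φ : Fock) : ∃ φ, Rep Φ φ := by
  choose φ h1 h2 using fun i : ℕ × ℕ × ℕ => exists_isSectorFun (Φ i)
  exact ⟨fun r s n => φ (r, s, n), fun r s n => h1 (r, s, n), fun r s n => h2 (r, s, n)⟩

/-- The components of a family of functions, as a function of one index. -/
def compSq (φ : FockFun) (i : ℕ × ℕ × ℕ) : ℝ≥0∞ := sectorSq (φ i.1 i.2.1 i.2.2)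

/-- The squared norm of a family of functions. -/
def fockSq (φ : FockFun) : ℝ≥0∞ := ∑' i, compSq φ i

theorem enorm_toLp_sq {ψ : Sector r s n → ℂ} (h : MemLp ψ 2 (muS r s n)) :
    ‖h.toLp‖ₑ ^ 2 = sectorSq ψ := by
  rw [Lp.enorm_toLp, eLpNorm_two_sq]
  rfl

theorem Rep.enorm_sq {Φ : Fock} {φ : FockFun} (h : Rep Φ φ) (i : ℕ × ℕ × ℕ) :
    ‖Φ i‖ₑ ^ 2 = compSq φ i := by
  have e : ((Φ i : FockSector i.1 i.2.1 i.2.2) : Lp ℂ 2 (muS i.1 i.2.1 i.2.2)) =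
      (h.1 i.1 i.2.1 i.2.2).memLp.toLp := Lp.ext
    ((h.2 i.1 i.2.1 i.2.2).symm.trans (MemLp.coeFn_toLp _).symm)
  have e2 : ‖Φ i‖ₑ = ‖((Φ i : FockSector i.1 i.2.1 i.2.2) : Lp ℂ 2 (muS i.1 i.2.1 i.2.2))‖ₑ := rfl
  rw [e2, e, enorm_toLp_sq]
  rfl

theorem Rep.fockSq {Φ : Fock} {φ : FockFun} (h : Rep Φ φ) :
    fockSq φ = ENNReal.ofReal (‖Φ‖ ^ 2) := by
  have h1 := lp.hasSum_norm (p := 2) (by norm_num) Φ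
  have e : ∀ x : ℝ, x ^ (2 : ℝ≥0∞).toReal = x ^ 2 := fun x => by
    rw [ENNReal.toReal_ofNat]; exact Real.rpow_two x
  simp only [e] at h1
  rw [← h1.tsum_eq, ENNReal.ofReal_tsum_of_nonneg (fun i => by positivity) h1.summable]
  refine tsum_congr fun i => ?_
  rw [← h.enorm_sq, ENNReal.ofReal_pow (norm_nonneg _), ofReal_norm]

theorem Rep.fockSq_lt_top {Φ : Fock} {φ : FockFun} (h : Rep Φ φ) : ZDecay.fockSq φ < ⊤ := by
  rw [h.fockSq]; exact ENNReal.ofReal_lt_top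

theorem exists_fock {φ : FockFun} (h : SecFam φ) (hφ : fockSq φ < ⊤) : ∃ Φ : Fock, Rep Φ φ := by
  let f : ∀ i : ℕ × ℕ × ℕ, FockSector i.1 i.2.1 i.2.2 := fun i =>
    ⟨(h i.1 i.2.1 i.2.2).memLp.toLp, by
      intro σ τ π
      have e := (h i.1 i.2.1 i.2.2).memLp.coeFn_toLp
      filter_upwards [e, (measurePreserving_relabel σ τ π).quasiMeasurePreserving.ae e]
        with w h1 h2
      rw [h1, h2, (h i.1 i.2.1 i.2.2).symm σ τ π w]⟩
  have hf : ∀ i, ‖f i‖ₑ ^ 2 = compSq φ i := fun i => enorm_toLp_sq (h i.1 i.2.1 i.2.2).memLp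
  have hmem : Memℓp f 2 := by
    refine memℓp_gen ?_
    have e : ∀ x : ℝ, x ^ (2 : ℝ≥0∞).toReal = x ^ 2 := fun x => by
      rw [ENNReal.toReal_ofNat]; exact Real.rpow_two x
    simp only [e]
    have h1 := ENNReal.summable_toReal hφ.ne
    refine h1.congr fun i => ?_
    rw [← hf, ENNReal.toReal_pow, toReal_enorm]
  refine ⟨⟨f, hmem⟩, h, fun r s n => ?_⟩
  exact (h r s n).memLp.coeFn_toLp.symm

theorem Rep.hasSum_inner {Φ Ψ : Fock} {φ ψ : FockFun} (h : Rep Φ φ) (h' : Rep Ψ ψ) :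
    HasSum (fun i : ℕ × ℕ × ℕ => ∫ w, conj (φ i.1 i.2.1 i.2.2 w) * ψ i.1 i.2.1 i.2.2 w
      ∂muS i.1 i.2.1 i.2.2) (inner ℂ Φ Ψ) := by
  have h1 := lp.hasSum_inner (𝕜 := ℂ) Φ Ψ
  have e : (fun i : ℕ × ℕ × ℕ => ∫ w, conj (φ i.1 i.2.1 i.2.2 w) * ψ i.1 i.2.1 i.2.2 w
      ∂muS i.1 i.2.1 i.2.2) = fun i => inner ℂ (Φ i) (Ψ i) := by
    funext i
    have e1 : inner ℂ (Φ i) (Ψ i) = inner ℂ ((Φ i : FockSector i.1 i.2.1 i.2.2) :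
      Lp ℂ 2 (muS i.1 i.2.1 i.2.2)) ((Ψ i : FockSector i.1 i.2.1 i.2.2) :
      Lp ℂ 2 (muS i.1 i.2.1 i.2.2)) := rfl
    rw [e1, L2.inner_def]
    refine integral_congr_ae ?_
    filter_upwards [h.2 i.1 i.2.1 i.2.2, h'.2 i.1 i.2.1 i.2.2] with w h2 h3
    rw [h2, h3, RCLike.inner_apply, mul_comm]
    rfl
  rw [e]
  exact h1

end Representatives

/-! ## Pairs of formally adjoint operations that change the particle numbers -/

section AdjointPairs

/-- The total number of particles. -/
def total (i : ℕ × ℕ × ℕ) : ℕ := i.1 + i.2.1 + i.2.2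

/-- The expectation of the squared number of particles. -/
def numSq (φ : FockFun) : ℝ≥0∞ := ∑' i, ENNReal.ofReal (total i ^ 2) * compSq φ i

/-- Sums up sector-to-sector bounds. Sectors outside the range of `dst` contribute nothing,
injectivity avoids counting a sector twice, and `total i ≤ total (src i)` lets the weight be
evaluated in the source sector. -/
theorem fockSq_le_of {φ χ : FockFun} {src dst : ℕ × ℕ × ℕ → ℕ × ℕ × ℕ}
    (hsrc : Function.Injective src) (hdst : Function.Injective dst)
    (h0 : ∀ i, i ∉ range dst → ∀ w, χ i.1 i.2.1 i.2.2 w = 0) (hle : ∀ i, total i ≤ total (src i))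
    {δ C : ℝ} (hδ : 0 ≤ δ) (hC : 0 ≤ C)
    (hb : ∀ i, compSq χ (dst i) ≤ ENNReal.ofReal (δ * total i ^ 2 + C) * compSq φ (src i)) :
    fockSq χ ≤ ENNReal.ofReal δ * numSq φ + ENNReal.ofReal C * fockSq φ := by
  have hsupp : Function.support (compSq χ) ⊆ range dst := by
    intro i hi
    by_contra h
    exact hi (by simp [compSq, sectorSq, h0 i h])
  unfold fockSq numSq
  rw [← hdst.tsum_eq hsupp, ← ENNReal.tsum_mul_left, ← ENNReal.tsum_mul_left, ← ENNReal.tsum_add]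
  refine le_trans (ENNReal.tsum_le_tsum fun i => ?_) (ENNReal.tsum_comp_le_tsum_of_injective hsrc
    fun j => ENNReal.ofReal δ * (ENNReal.ofReal (total j ^ 2) * compSq φ j) +
      ENNReal.ofReal C * compSq φ j)
  refine (hb i).trans ?_
  rw [← mul_assoc, ← ENNReal.ofReal_mul hδ, ← add_mul, ← ENNReal.ofReal_add (by positivity) hC]
  gcongr
  exact hle i

/-- A pair of formally adjoint operations; `S` maps the sector `a i` to the sector `b i`, and `T`
maps `b i` to `a i`. -/
structure AdjPair (S T : FormalOp) (a b : ℕ × ℕ × ℕ → ℕ × ℕ × ℕ) : Prop where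
  conv_left : ∀ φ, SecFam φ → ∀ r s n, ∀ᵐ w ∂muS r s n, S.conv φ r s n w
  conv_right : ∀ φ, SecFam φ → ∀ r s n, ∀ᵐ w ∂muS r s n, T.conv φ r s n w
  sec_left : ∀ φ, SecFam φ → SecFam (S.app φ)
  sec_right : ∀ φ, SecFam φ → SecFam (T.app φ)
  zero_left : ∀ φ i, i ∉ range b → ∀ w, S.app φ i.1 i.2.1 i.2.2 w = 0
  zero_right : ∀ φ i, i ∉ range a → ∀ w, T.app φ i.1 i.2.1 i.2.2 w = 0
  inj_left : Function.Injective a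
  inj_right : Function.Injective b
  le_left : ∀ i, total i ≤ total (a i)
  le_right : ∀ i, total i ≤ total (b i)
  dual : ∀ φ ψ, SecFam φ → SecFam ψ → ∀ i,
    ∫ w, conj (S.app φ (b i).1 (b i).2.1 (b i).2.2 w) * ψ (b i).1 (b i).2.1 (b i).2.2 w
        ∂muS (b i).1 (b i).2.1 (b i).2.2 =
      ∫ w, conj (φ (a i).1 (a i).2.1 (a i).2.2 w) * T.app ψ (a i).1 (a i).2.1 (a i).2.2 w
        ∂muS (a i).1 (a i).2.1 (a i).2.2
  bound_right : ∀ δ : ℝ, 0 < δ → ∃ C : ℝ, 0 ≤ C ∧ ∀ φ, SecFam φ → ∀ i,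
    compSq (T.app φ) (a i) ≤ ENNReal.ofReal (δ * total i ^ 2 + C) * compSq φ (b i)

theorem enorm_integral_conj_mul_sq_le {α : Type*} [MeasurableSpace α] {μ : Measure α} {f g : α → ℂ}
    (hf : StronglyMeasurable f) (hg : StronglyMeasurable g) :
    ‖∫ x, conj (f x) * g x ∂μ‖ₑ ^ 2 ≤ (∫⁻ x, ‖f x‖ₑ ^ 2 ∂μ) * ∫⁻ x, ‖g x‖ₑ ^ 2 ∂μ := by
  refine le_trans (pow_le_pow_left' ((enorm_integral_le_lintegral_enorm _).trans_eq ?_) 2)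
    (lintegral_sqrt_mul_sq_le (hf.enorm.pow_const 2) (hg.enorm.pow_const 2))
  refine lintegral_congr fun x => ?_
  rw [enorm_mul, ← mul_pow, ← ENNReal.rpow_natCast, ← ENNReal.rpow_mul]
  norm_num

variable {S T : FormalOp} {a b : ℕ × ℕ × ℕ → ℕ × ℕ × ℕ}

theorem IsSectorFun.sectorSq_lt_top {r s n : ℕ} {ψ : Sector r s n → ℂ} (h : IsSectorFun ψ) :
    sectorSq ψ < ⊤ := (memLp_two_iff h.memLp.1).1 h.memLp

/-- Duality: if `x` is the squared norm of the component of `S φ`, then `x² = |⟨φ, T S φ⟩|² ≤ ‖φ‖² ·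
c x` with the constant `c` of `T`. As `x` is finite, one may divide by it, and `S` has the same
constant. -/
theorem AdjPair.bound_left (h : AdjPair S T a b) {δ C : ℝ} {φ : FockFun} (hφ : SecFam φ)
    (hb : ∀ φ, SecFam φ → ∀ i,
      compSq (T.app φ) (a i) ≤ ENNReal.ofReal (δ * total i ^ 2 + C) * compSq φ (b i))
    (i : ℕ × ℕ × ℕ) :
    compSq (S.app φ) (b i) ≤ ENNReal.ofReal (δ * total i ^ 2 + C) * compSq φ (a i) := by
  have hS := h.sec_left φ hφ
  have hSi := hS (b i).1 (b i).2.1 (b i).2.2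
  have hT := h.sec_right _ hS (a i).1 (a i).2.1 (a i).2.2
  have hx : compSq (S.app φ) (b i) < ⊤ := hSi.sectorSq_lt_top
  have h1 := h.dual φ (S.app φ) hφ hS i
  rw [integral_conj_mul_self _ hSi.memLp.1] at h1
  have h2 := enorm_integral_conj_mul_sq_le (μ := muS (a i).1 (a i).2.1 (a i).2.2)
    (hφ (a i).1 (a i).2.1 (a i).2.2).meas hT.meas
  rw [← h1] at h2
  have h3 : ‖(((∫⁻ w, ‖S.app φ (b i).1 (b i).2.1 (b i).2.2 w‖ₑ ^ 2
      ∂muS (b i).1 (b i).2.1 (b i).2.2).toReal : ℝ) : ℂ)‖ₑ = compSq (S.app φ) (b i) := by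
    rw [← ofReal_norm, Complex.norm_real, Real.norm_of_nonneg ENNReal.toReal_nonneg,
      ENNReal.ofReal_toReal]
    · rfl
    · exact hx.ne
  rw [h3] at h2
  have h4 : compSq (S.app φ) (b i) ^ 2 ≤ compSq φ (a i) *
      (ENNReal.ofReal (δ * total i ^ 2 + C) * compSq (S.app φ) (b i)) :=
    h2.trans (mul_le_mul' le_rfl (hb _ hS i))
  by_cases h0 : compSq (S.app φ) (b i) = 0
  · rw [h0]; exact zero_le
  · rw [sq, ← mul_assoc, mul_comm (compSq φ (a i))] at h4
    exact (ENNReal.mul_le_mul_iff_left h0 hx.ne).1 h4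

theorem Rep.of_graph (h : ∀ φ, SecFam φ → SecFam (S.app φ)) {Φ Ψ : Fock} {φ : FockFun}
    (hΦ : Rep Φ φ) (hg : (Φ, Ψ) ∈ S.graph) : Rep Ψ (S.app φ) := by
  refine ⟨h φ hΦ.1, fun r s n => ?_⟩
  filter_upwards [hg r s n, S.congr Φ.toFun φ (fun r s n => (hΦ.2 r s n).symm) r s n] with w h1 h2
  exact (h2 h1.1).2.trans h1.2.symm

theorem mem_graph_of_rep (h : ∀ φ, SecFam φ → ∀ r s n, ∀ᵐ w ∂muS r s n, S.conv φ r s n w)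
    {Φ Ψ : Fock} {φ : FockFun} (hΦ : Rep Φ φ) (hΨ : Rep Ψ (S.app φ)) : (Φ, Ψ) ∈ S.graph := by
  intro r s n
  filter_upwards [h φ hΦ.1 r s n, hΨ.2 r s n, S.congr φ Φ.toFun hΦ.2 r s n] with w h1 h2 h3
  exact ⟨(h3 h1).1, h2.symm.trans (h3 h1).2.symm⟩

/-- The operators of an adjoint pair are formally adjoint. -/
theorem AdjPair.inner_eq (h : AdjPair S T a b) {Φ Φ' Ψ Ψ' : Fock} (hS : (Φ, Φ') ∈ S.graph)
    (hT : (Ψ, Ψ') ∈ T.graph) : inner ℂ Φ' Ψ = inner ℂ Φ Ψ' := by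
  obtain ⟨φ, hφ⟩ := exists_rep Φ
  obtain ⟨ψ, hψ⟩ := exists_rep Ψ
  have h1 := (hφ.of_graph h.sec_left hS).hasSum_inner hψ
  have h2 := hφ.hasSum_inner (hψ.of_graph h.sec_right hT)
  rw [← h1.tsum_eq, ← h2.tsum_eq]
  rw [← h.inj_right.tsum_eq (f := fun i : ℕ × ℕ × ℕ =>
      ∫ w, conj (S.app φ i.1 i.2.1 i.2.2 w) * ψ i.1 i.2.1 i.2.2 w ∂muS i.1 i.2.1 i.2.2),
    ← h.inj_left.tsum_eq (f := fun i : ℕ × ℕ × ℕ =>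
      ∫ w, conj (φ i.1 i.2.1 i.2.2 w) * T.app ψ i.1 i.2.1 i.2.2 w ∂muS i.1 i.2.1 i.2.2)]
  · exact tsum_congr fun i => h.dual φ ψ hφ.1 hψ.1 i
  · intro i hi
    by_contra hc
    exact hi (by simp [h.zero_right ψ i hc])
  · intro i hi
    by_contra hc
    exact hi (by simp [h.zero_left φ i hc])

/-- A finite second moment of the particle number makes the components of the formal image square
summable. The image is then a vector of Fock space, which places `Φ` in the maximal domain and gives
the bound at the same time. -/
theorem AdjPair.exists_left (h : AdjPair S T a b) {δ : ℝ} (hδ : 0 < δ) :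
    ∃ C : ℝ, 0 ≤ C ∧ ∀ Φ φ, Rep Φ φ → numSq φ < ⊤ → ∃ Ψ : Fock, (Φ, Ψ) ∈ S.graph ∧
      ENNReal.ofReal (‖Ψ‖ ^ 2) ≤ ENNReal.ofReal δ * numSq φ +
        ENNReal.ofReal C * ENNReal.ofReal (‖Φ‖ ^ 2) := by
  obtain ⟨C, hC0, hC⟩ := h.bound_right δ hδ
  refine ⟨C, hC0, fun Φ φ hφ hN => ?_⟩
  have h1 := fockSq_le_of h.inj_left h.inj_right (h.zero_left φ) h.le_left hδ.le hC0
    (h.bound_left hφ.1 hC)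
  rw [hφ.fockSq] at h1
  obtain ⟨Ψ, hΨ⟩ := exists_fock (h.sec_left φ hφ.1) (h1.trans_lt (by finiteness))
  refine ⟨Ψ, mem_graph_of_rep h.conv_left hφ hΨ, ?_⟩
  rw [← hΨ.fockSq]
  exact h1

theorem AdjPair.exists_right (h : AdjPair S T a b) {δ : ℝ} (hδ : 0 < δ) :
    ∃ C : ℝ, 0 ≤ C ∧ ∀ Φ φ, Rep Φ φ → numSq φ < ⊤ → ∃ Ψ : Fock, (Φ, Ψ) ∈ T.graph ∧
      ENNReal.ofReal (‖Ψ‖ ^ 2) ≤ ENNReal.ofReal δ * numSq φ +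
        ENNReal.ofReal C * ENNReal.ofReal (‖Φ‖ ^ 2) := by
  obtain ⟨C, hC0, hC⟩ := h.bound_right δ hδ
  refine ⟨C, hC0, fun Φ φ hφ hN => ?_⟩
  have h1 := fockSq_le_of h.inj_right h.inj_left (h.zero_right φ) h.le_right hδ.le hC0
    (hC φ hφ.1)
  rw [hφ.fockSq] at h1
  obtain ⟨Ψ, hΨ⟩ := exists_fock (h.sec_right φ hφ.1) (h1.trans_lt (by finiteness))
  refine ⟨Ψ, mem_graph_of_rep h.conv_right hφ hΨ, ?_⟩
  rw [← hΨ.fockSq]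
  exact h1

/-! ### The interaction terms -/

theorem ofReal_bound {δ : ℝ} (hδ : 0 < δ) (K : NNReal) : ∃ C : ℝ, 0 ≤ C ∧ ∀ r s n : ℕ,
    (n + 1 : ℝ≥0∞) * (ENNReal.ofReal (δ / 3) * (r + 1) + K) ≤
      ENNReal.ofReal (δ * total (r, s, n) ^ 2 + C) := by
  -- Both `r + 1` and `n + 1` are at most `N + 1`. The estimate `(N + 1)² ≤ 2 N² + 2` uses two
  -- thirds of `δ N²`, and Young's inequality for `K N` uses the last third; hence the coefficient
  -- `δ / 3`.
  refine ⟨δ + K + 3 * K ^ 2 / δ, by positivity, fun r s n => ?_⟩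
  have e : (n + 1 : ℝ≥0∞) * (ENNReal.ofReal (δ / 3) * (r + 1) + K) =
      ENNReal.ofReal ((n + 1) * (δ / 3 * (r + 1) + K)) := by
    have h : ∀ m : ℕ, ENNReal.ofReal ((m : ℝ) + 1) = m + 1 := fun m => by
      rw [ENNReal.ofReal_add (by positivity) (by norm_num)]; simp
    rw [ENNReal.ofReal_mul (by positivity),
      ENNReal.ofReal_add (p := δ / 3 * (r + 1)) (q := K) (by positivity) K.2,
      ENNReal.ofReal_mul (p := δ / 3) (by positivity), h, h, ENNReal.ofReal_coe_nnreal]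
  rw [e]
  refine ENNReal.ofReal_le_ofReal ?_
  have hN : ((total (r, s, n) : ℕ) : ℝ) = r + s + n := by simp [total]
  rw [hN]
  have hr : (0 : ℝ) ≤ r := by positivity
  have hs : (0 : ℝ) ≤ s := by positivity
  have hn : (0 : ℝ) ≤ n := by positivity
  have hK : (0 : ℝ) ≤ K := K.2
  set N : ℝ := r + s + n with hNd
  have h1 : ((n : ℝ) + 1) * (δ / 3 * (r + 1) + K) ≤ (N + 1) * (δ / 3 * (N + 1) + K) := by
    gcongr <;> linarith
  have h2 : (N + 1) ^ 2 ≤ 2 * N ^ 2 + 2 := by nlinarith [sq_nonneg (N - 1)]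
  have h3 : K * N ≤ δ / 3 * N ^ 2 + 3 * K ^ 2 / δ := by
    have h4 : δ / 3 * N ^ 2 + 3 * K ^ 2 / δ - K * N =
        (δ / 3) * ((N - 3 * K / (2 * δ)) ^ 2 + 27 / 4 * (K / δ) ^ 2) := by
      field_simp
      ring
    have : 0 ≤ (δ / 3) * ((N - 3 * K / (2 * δ)) ^ 2 + 27 / 4 * ((K : ℝ) / δ) ^ 2) := by positivity
    linarith
  have h5 : δ / 3 * (N + 1) ^ 2 ≤ δ / 3 * (2 * N ^ 2 + 2) := by gcongr
  nlinarith

variable {F : Kernel3}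

theorem annBound_ofReal (hF2 : MemLp (kernelFun F) 2 muFFB) {δ : ℝ} (hδ : 0 < δ) :
    ∃ C : ℝ, 0 ≤ C ∧ ∃ B : ℕ → ℝ≥0∞, AnnBound F B ∧ ∀ r s n : ℕ,
      (n + 1 : ℝ≥0∞) * B r ≤ ENNReal.ofReal (δ * total (r, s, n) ^ 2 + C) := by
  obtain ⟨K, hK⟩ := annBound_small hF2 (ε := ENNReal.ofReal (δ / 3))
    (by simpa using (by positivity : 0 < δ / 3))
  obtain ⟨C, hC0, hC⟩ := ofReal_bound hδ K
  exact ⟨C, hC0, _, hK, hC⟩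

/-- The index `i = (r, s, n)` labels the spectator particles; the term exchanges one additional
boson (sector `a i`) for one additional pair (sector `b i`). -/
theorem adjPair_one (hF : StronglyMeasurable (kernelFun F)) (hF2 : MemLp (kernelFun F) 2 muFFB) :
    AdjPair (formalOne F) (formalOneStar F) (fun i => (i.1, i.2.1, i.2.2 + 1))
      (fun i => (i.1 + 1, i.2.1 + 1, i.2.2)) where
  conv_left φ hφ := conv_formalOne hF hF2 hφ
  conv_right φ hφ := conv_formalOneStar hF hF2 hφ
  sec_left φ hφ := secFam_formalOne hF hF2 hφ
  sec_right φ hφ := secFam_formalOneStar hF hF2 hφ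
  zero_left φ i hi w := by
    obtain ⟨r, s, n⟩ := i
    cases r with
    | zero => rfl
    | succ r =>
      cases s with
      | zero => exact formalOne_app_zero_right F φ _ _ w
      | succ s => exact absurd ⟨(r, s, n), rfl⟩ hi
  zero_right φ i hi w := by
    obtain ⟨r, s, n⟩ := i
    cases n with
    | zero => rfl
    | succ n => exact absurd ⟨(r, s, n), rfl⟩ hi
  inj_left := fun i j h => by simpa [Prod.ext_iff] using h
  inj_right := fun i j h => by simpa [Prod.ext_iff] using h
  le_left i := by simp only [total]; omega
  le_right i := by simp only [total]; omega
  dual φ ψ hφ hψ i := integral_conj_formalOne_mul hF hF2 hφ hψ i.1 i.2.1 i.2.2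
  bound_right δ hδ := by
    obtain ⟨C, hC0, B, hB, hC⟩ := annBound_ofReal hF2 hδ
    exact ⟨C, hC0, fun φ hφ i => (formalOneStar_bound hF hF2 hB hφ i.1 i.2.1 i.2.2).trans
      (mul_le_mul' (hC i.1 i.2.1 i.2.2) le_rfl)⟩

theorem adjPair_two (hF : StronglyMeasurable (kernelFun F)) (hF2 : MemLp (kernelFun F) 2 muFFB) :
    AdjPair (formalTwo F) (formalTwoStar F) (fun i => i)
      (fun i => (i.1 + 1, i.2.1 + 1, i.2.2 + 1)) where
  conv_left φ _ := conv_formalTwo φ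
  conv_right φ hφ := conv_formalTwoStar hF2 hφ
  sec_left φ hφ := secFam_formalTwo hF hF2 hφ
  sec_right φ hφ := secFam_formalTwoStar hF hF2 hφ
  zero_left φ i hi w := by
    obtain ⟨r, s, n⟩ := i
    cases r with
    | zero => rfl
    | succ r =>
      cases s with
      | zero => exact formalTwo_app_zero_right F φ _ _ w
      | succ s =>
        cases n with
        | zero => exact formalTwo_app_zero_boson F φ _ _ w
        | succ n => exact absurd ⟨(r, s, n), rfl⟩ hi
  zero_right φ i hi w := absurd ⟨i, rfl⟩ hi
  inj_left := fun i j h => h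
  inj_right := fun i j h => by simpa [Prod.ext_iff] using h
  le_left i := le_rfl
  le_right i := by simp only [total]; omega
  dual φ ψ hφ hψ i := integral_conj_formalTwo_mul hF hF2 hφ hψ i.1 i.2.1 i.2.2
  bound_right δ hδ := by
    obtain ⟨C, hC0, B, hB, hC⟩ := annBound_ofReal hF2 hδ
    exact ⟨C, hC0, fun φ hφ i => (formalTwoStar_bound hB hφ i.1 i.2.1 i.2.2).trans
      (mul_le_mul' (hC i.1 i.2.1 i.2.2) le_rfl)⟩

end AdjointPairs

/-! ## The free Hamiltonian -/

section Free

variable {me mZ : ℝ} {r s n : ℕ}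

theorem measurable_freeEnergy : Measurable (freeEnergy me mZ r s n) := by
  unfold freeEnergy omega omega3
  fun_prop

theorem freeEnergy_relabel (σ : Equiv.Perm (Fin r)) (τ : Equiv.Perm (Fin s))
    (π : Equiv.Perm (Fin n)) (w : Sector r s n) :
    freeEnergy me mZ r s n (relabel σ τ π w) = freeEnergy me mZ r s n w := by
  simp only [freeEnergy, relabel, Function.comp_apply]
  rw [Equiv.sum_comp σ fun i => omega me (w.1 i).1, Equiv.sum_comp τ fun i => omega me (w.2.1 i).1,
    Equiv.sum_comp π fun i => omega3 mZ (w.2.2 i).1]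

/-- Each particle contributes at least its rest mass. This is the mass gap through which `H_0`
controls the number of particles. -/
theorem freeEnergy_ge (w : Sector r s n) :
    min me mZ * total (r, s, n) ≤ freeEnergy me mZ r s n w := by
  have h1 : ∀ p, min me mZ ≤ omega me p := fun p =>
    (min_le_left _ _).trans (Real.le_sqrt_of_sq_le (by nlinarith [sq_nonneg p]))
  have h2 : ∀ k, min me mZ ≤ omega3 mZ k := fun k =>
    (min_le_right _ _).trans (Real.le_sqrt_of_sq_le (by nlinarith [sq_nonneg ‖k‖]))
  have a1 := Finset.card_nsmul_le_sum Finset.univ (fun i => omega me (w.1 i).1) _ fun i _ => h1 _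
  have a2 := Finset.card_nsmul_le_sum Finset.univ (fun i => omega me (w.2.1 i).1) _ fun i _ => h1 _
  have a3 := Finset.card_nsmul_le_sum Finset.univ (fun i => omega3 mZ (w.2.2 i).1) _ fun i _ => h2 _
  simp only [Finset.card_univ, Fintype.card_fin, nsmul_eq_mul] at a1 a2 a3
  simp only [freeEnergy, total]
  push_cast
  linarith

theorem IsSectorFun.mul {φ m : Sector r s n → ℂ} (hφ : IsSectorFun φ) (hm : Measurable m)
    (hs : ∀ σ τ π w, m (relabel σ τ π w) = m w) (h2 : MemLp (fun w => m w * φ w) 2 (muS r s n)) :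
    IsSectorFun fun w => m w * φ w :=
  ⟨hm.stronglyMeasurable.mul hφ.meas, fun σ τ π w => by
    simp only [hs, hφ.symm σ τ π w]; ring, h2⟩

theorem Rep.free {Φ Ψ : Fock} {φ : FockFun} (h : Rep Φ φ)
    (hg : (Φ, Ψ) ∈ (freeFormal me mZ).graph) : Rep Ψ ((freeFormal me mZ).app φ) := by
  have e : ∀ r s n, (freeFormal me mZ).app φ r s n =ᵐ[muS r s n] Ψ.toFun r s n := by
    intro r s n
    filter_upwards [hg r s n, h.2 r s n] with w h1 h2
    rw [h1.2]
    change (freeEnergy me mZ r s n w : ℂ) * φ r s n w =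
      (freeEnergy me mZ r s n w : ℂ) * Φ.toFun r s n w
    rw [h2]
  refine ⟨fun r s n => (h.1 r s n).mul (Complex.measurable_ofReal.comp measurable_freeEnergy)
    (fun σ τ π w => by simp only [freeEnergy_relabel])
    ((memLp_congr_ae (e r s n)).2 (Lp.memLp _)), e⟩

theorem numSq_le_of_free (hme : 0 < me) (hmZ : 0 < mZ) {Φ Ψ : Fock} {φ : FockFun} (h : Rep Φ φ)
    (hg : (Φ, Ψ) ∈ (freeFormal me mZ).graph) :
    numSq φ ≤ ENNReal.ofReal (‖Ψ‖ ^ 2 / min me mZ ^ 2) := by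
  have hm : 0 < min me mZ := lt_min hme hmZ
  rw [ENNReal.ofReal_div_of_pos (by positivity), ← (h.free hg).fockSq,
    ENNReal.le_div_iff_mul_le (by simp [hm.ne']) (by simp)]
  unfold numSq fockSq
  rw [← ENNReal.tsum_mul_right]
  refine ENNReal.tsum_le_tsum fun i => ?_
  obtain ⟨r, s, n⟩ := i
  unfold compSq sectorSq
  dsimp only
  rw [mul_right_comm, ← ENNReal.ofReal_mul (by positivity), ← lintegral_const_mul' _ _ (by finiteness)]
  refine lintegral_mono fun w => ?_
  have e : (freeFormal me mZ).app φ r s n w = (freeEnergy me mZ r s n w : ℂ) * φ r s n w := rfl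
  rw [e, enorm_mul, mul_pow]
  refine mul_le_mul' ?_ le_rfl
  have h1 := freeEnergy_ge w (me := me) (mZ := mZ)
  have h0 : 0 ≤ min me mZ * total (r, s, n) := by positivity
  rw [← ofReal_norm, Complex.norm_real, Real.norm_of_nonneg (h0.trans h1),
    ← ENNReal.ofReal_pow (h0.trans h1)]
  refine ENNReal.ofReal_le_ofReal ?_
  rw [← mul_pow, mul_comm]
  gcongr

theorem freeHam_mem {Φ : Fock} (h : Φ ∈ (freeHam me mZ).domain) :
    (Φ, freeHam me mZ ⟨Φ, h⟩) ∈ (freeFormal me mZ).graph := by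
  rw [← FormalOp.graph_op]
  exact LinearPMap.mem_graph (freeFormal me mZ).op ⟨Φ, h⟩

theorem freeHam_symm (x y : (freeHam me mZ).domain) :
    inner ℂ (freeHam me mZ x) (y : Fock) = inner ℂ (x : Fock) (freeHam me mZ y) := by
  obtain ⟨φ, hφ⟩ := exists_rep (x : Fock)
  obtain ⟨ψ, hψ⟩ := exists_rep (y : Fock)
  have h1 := (hφ.free (freeHam_mem x.2)).hasSum_inner hψ
  have h2 := hφ.hasSum_inner (hψ.free (freeHam_mem y.2))
  refine h1.unique ?_
  convert h2 using 2 with i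
  congr 1
  funext w
  change conj ((freeEnergy me mZ _ _ _ w : ℂ) * _) * _ =
    conj _ * ((freeEnergy me mZ _ _ _ w : ℂ) * _)
  rw [map_mul, Complex.conj_ofReal]
  ring

theorem formalOp_apply {S : FormalOp} {Φ Ψ : Fock} (h : (Φ, Ψ) ∈ S.graph) :
    ∃ hd : Φ ∈ S.op.domain, S.op ⟨Φ, hd⟩ = Ψ := by
  rw [← FormalOp.graph_op] at h
  obtain ⟨y, h1, h2⟩ := (LinearPMap.mem_graph_iff _).1 h
  subst h1
  exact ⟨y.2, h2⟩

/-- The solution is `Y` multiplied by `(E(w) + i c)⁻¹`, `E` being the free energy: a function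
bounded by `1/|c|` and invariant under relabelling. -/
theorem freeHam_surjective {c : ℝ} (hc : c ≠ 0) (Y : Fock) : ∃ x : (freeHam me mZ).domain,
    freeHam me mZ x + ((c : ℂ) * Complex.I) • (x : Fock) = Y := by
  obtain ⟨y, hy⟩ := exists_rep Y
  have hne : ∀ E : ℝ, (E : ℂ) + c * Complex.I ≠ 0 := fun E h => hc (by
    simpa using congrArg Complex.im h)
  have hn : ∀ E : ℝ, ‖((E : ℂ) + c * Complex.I)⁻¹‖ ≤ |c|⁻¹ := fun E => by
    rw [norm_inv]
    refine inv_anti₀ (abs_pos.2 hc) ?_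
    have h := Complex.abs_im_le_norm ((E : ℂ) + c * Complex.I)
    simpa using h
  let φ : FockFun := fun r s n w => ((freeEnergy me mZ r s n w : ℂ) + c * Complex.I)⁻¹ * y r s n w
  have hm : ∀ r s n, Measurable fun w =>
      ((freeEnergy me mZ r s n w : ℂ) + c * Complex.I)⁻¹ := fun r s n =>
    ((Complex.measurable_ofReal.comp measurable_freeEnergy).add_const _).inv
  have hφ : SecFam φ := fun r s n => (hy.1 r s n).mul (hm r s n)
    (fun σ τ π w => by simp only [freeEnergy_relabel])
    ((hy.1 r s n).memLp.of_le_mul (c := |c|⁻¹)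
      ((hm r s n).aestronglyMeasurable.mul (hy.1 r s n).meas.aestronglyMeasurable)
      (Filter.Eventually.of_forall fun w => by
        rw [norm_mul]; exact mul_le_mul_of_nonneg_right (hn _) (norm_nonneg _)))
  have hlt : fockSq φ < ⊤ := by
    refine lt_of_le_of_lt (b := ENNReal.ofReal (|c|⁻¹) ^ 2 * fockSq y) ?_
      (ENNReal.mul_lt_top (by finiteness) hy.fockSq_lt_top)
    unfold fockSq
    rw [← ENNReal.tsum_mul_left]
    refine ENNReal.tsum_le_tsum fun i => ?_
    unfold compSq sectorSq
    rw [← lintegral_const_mul' _ _ (by finiteness)]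
    refine lintegral_mono fun w => ?_
    dsimp only [φ]
    rw [enorm_mul, mul_pow]
    refine mul_le_mul' (pow_le_pow_left' ?_ 2) le_rfl
    rw [← ofReal_norm]
    exact ENNReal.ofReal_le_ofReal (hn _)
  obtain ⟨Φ, hΦ⟩ := exists_fock hφ hlt
  have hg : (Φ, Y + (-((c : ℂ) * Complex.I)) • Φ) ∈ (freeFormal me mZ).graph := by
    intro r s n
    filter_upwards [hΦ.2 r s n, hy.2 r s n, Fock.toFun_add Y ((-((c : ℂ) * Complex.I)) • Φ) r s n,
      Fock.toFun_smul (-((c : ℂ) * Complex.I)) Φ r s n] with w h1 h2 h3 h4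
    refine ⟨trivial, ?_⟩
    change (Y + (-((c : ℂ) * Complex.I)) • Φ).toFun r s n w =
      (freeEnergy me mZ r s n w : ℂ) * Φ.toFun r s n w
    rw [h3, Pi.add_apply, Pi.add_apply, Pi.add_apply, Pi.add_apply, h4, Pi.smul_apply,
      Pi.smul_apply, Pi.smul_apply, Pi.smul_apply, smul_eq_mul, ← h1, ← h2]
    dsimp only [φ]
    field_simp [hne (freeEnergy me mZ r s n w)]
    ring
  obtain ⟨hd, he⟩ := formalOp_apply hg
  refine ⟨⟨Φ, hd⟩, ?_⟩
  change (freeFormal me mZ).op ⟨Φ, hd⟩ + _ = _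
  rw [he]
  simp

end Free

/-! ## Self-adjointness for square integrable kernels -/

section SelfAdjoint

variable {E : Type*} [NormedAddCommGroup E] [InnerProductSpace ℂ E]

/-- The operator `V` is bounded relative to `A`, with relative bound zero. -/
def InfSmall (A V : E →ₗ.[ℂ] E) : Prop :=
  ∃ h : A.domain ≤ V.domain, ∀ ε : ℝ, 0 < ε → ∃ b : ℝ, 0 ≤ b ∧ ∀ x : A.domain,
    ‖V ⟨x, h x.2⟩‖ ≤ ε * ‖A x‖ + b * ‖(x : E)‖

theorem InfSmall.add {A V W : E →ₗ.[ℂ] E} (hV : InfSmall A V) (hW : InfSmall A W) :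
    InfSmall A (V + W) := by
  obtain ⟨hV1, hV2⟩ := hV
  obtain ⟨hW1, hW2⟩ := hW
  refine ⟨fun x hx => ⟨hV1 hx, hW1 hx⟩, fun ε hε => ?_⟩
  obtain ⟨b, hb, h1⟩ := hV2 (ε / 2) (by positivity)
  obtain ⟨b', hb', h2⟩ := hW2 (ε / 2) (by positivity)
  refine ⟨b + b', by positivity, fun x => ?_⟩
  rw [LinearPMap.add_apply]
  refine (norm_add_le _ _).trans ((add_le_add (h1 x) (h2 x)).trans_eq (by ring))

theorem InfSmall.smul {A V : E →ₗ.[ℂ] E} (hV : InfSmall A V) (c : ℂ) : InfSmall A (c • V) := by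
  obtain ⟨hV1, hV2⟩ := hV
  refine ⟨hV1, fun ε hε => ?_⟩
  obtain ⟨b, hb, h1⟩ := hV2 (ε / (‖c‖ + 1)) (by positivity)
  refine ⟨‖c‖ * b, by positivity, fun x => ?_⟩
  rw [LinearPMap.smul_apply, norm_smul]
  refine (mul_le_mul_of_nonneg_left (h1 x) (norm_nonneg c)).trans ?_
  rw [mul_add, ← mul_assoc, ← mul_assoc]
  gcongr
  rw [mul_div_assoc', div_le_iff₀ (by positivity)]
  nlinarith [norm_nonneg c]

variable {me mZ : ℝ} {S T : FormalOp} {a b : ℕ × ℕ × ℕ → ℕ × ℕ × ℕ} {F F' : Kernel3}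

/-- Passage from squared norms to norms by `√(α² + β²) ≤ α + β`. The quadratic coefficient is taken
as `ε² m²`, so that the mass gap `m` cancels and `ε` is left. -/
theorem le_of_ofReal_sq_le {ε m C p x y : ℝ} (hε : 0 < ε) (hm : 0 < m) (hC : 0 ≤ C) (hp : 0 ≤ p)
    (hx : 0 ≤ x) (h : ENNReal.ofReal (y ^ 2) ≤ ENNReal.ofReal (ε ^ 2 * m ^ 2) *
      ENNReal.ofReal (p ^ 2 / m ^ 2) + ENNReal.ofReal C * ENNReal.ofReal (x ^ 2)) :
    y ≤ ε * p + Real.sqrt C * x := by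
  rw [← ENNReal.ofReal_mul (by positivity), ← ENNReal.ofReal_mul hC,
    ← ENNReal.ofReal_add (by positivity) (by positivity),
    ENNReal.ofReal_le_ofReal_iff (by positivity)] at h
  have e : ε ^ 2 * m ^ 2 * (p ^ 2 / m ^ 2) = (ε * p) ^ 2 := by field_simp
  have e2 : C * x ^ 2 = (Real.sqrt C * x) ^ 2 := by rw [mul_pow, Real.sq_sqrt hC]
  have h2 : 0 ≤ ε * p := by positivity
  have h3 : 0 ≤ Real.sqrt C * x := by positivity
  rw [e, e2] at h
  exact le_of_sq_le_sq (h.trans (by nlinarith)) (by positivity)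

theorem infSmall_of_mem_graph {A V : E →ₗ.[ℂ] E} (h : ∀ ε : ℝ, 0 < ε → ∃ b : ℝ, 0 ≤ b ∧
    ∀ x : A.domain, ∃ y : E, ((x : E), y) ∈ V.graph ∧ ‖y‖ ≤ ε * ‖A x‖ + b * ‖(x : E)‖) :
    InfSmall A V := by
  have hd : A.domain ≤ V.domain := fun x hx => by
    obtain ⟨b, -, hb⟩ := h 1 one_pos
    obtain ⟨y, hy, -⟩ := hb ⟨x, hx⟩
    exact LinearPMap.mem_domain_of_mem_graph hy
  refine ⟨hd, fun ε hε => ?_⟩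
  obtain ⟨b, hb0, hb⟩ := h ε hε
  refine ⟨b, hb0, fun x => ?_⟩
  obtain ⟨y, hy, hle⟩ := hb x
  obtain ⟨z, hz, rfl⟩ := (LinearPMap.mem_graph_iff _).1 hy
  have e : z = ⟨x, hd x.2⟩ := Subtype.ext hz
  rwa [← e]

theorem exists_graph_le (hme : 0 < me) (hmZ : 0 < mZ)
    (h : ∀ δ : ℝ, 0 < δ → ∃ C : ℝ, 0 ≤ C ∧ ∀ Φ φ, Rep Φ φ → numSq φ < ⊤ →
      ∃ Ψ : Fock, (Φ, Ψ) ∈ S.graph ∧ ENNReal.ofReal (‖Ψ‖ ^ 2) ≤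
        ENNReal.ofReal δ * numSq φ + ENNReal.ofReal C * ENNReal.ofReal (‖Φ‖ ^ 2))
    (ε : ℝ) (hε : 0 < ε) : ∃ b : ℝ, 0 ≤ b ∧ ∀ Φ Φ' : Fock, (Φ, Φ') ∈ (freeFormal me mZ).graph →
      ∃ Ψ : Fock, (Φ, Ψ) ∈ S.graph ∧ ‖Ψ‖ ≤ ε * ‖Φ'‖ + b * ‖Φ‖ := by
  have hm : 0 < min me mZ := lt_min hme hmZ
  obtain ⟨C, hC0, hC⟩ := h (ε ^ 2 * min me mZ ^ 2) (by positivity)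
  refine ⟨Real.sqrt C, Real.sqrt_nonneg _, fun Φ Φ' hx => ?_⟩
  obtain ⟨φ, hφ⟩ := exists_rep Φ
  have hN := numSq_le_of_free hme hmZ hφ hx
  obtain ⟨Ψ, hΨ, hb⟩ := hC _ φ hφ (hN.trans_lt ENNReal.ofReal_lt_top)
  exact ⟨Ψ, hΨ, le_of_ofReal_sq_le hε hm hC0 (norm_nonneg _) (norm_nonneg _)
    (hb.trans (add_le_add (mul_le_mul' le_rfl hN) le_rfl))⟩

theorem infSmall_of_exists (hme : 0 < me) (hmZ : 0 < mZ)
    (h : ∀ δ : ℝ, 0 < δ → ∃ C : ℝ, 0 ≤ C ∧ ∀ Φ φ, Rep Φ φ → numSq φ < ⊤ →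
      ∃ Ψ : Fock, (Φ, Ψ) ∈ S.graph ∧ ENNReal.ofReal (‖Ψ‖ ^ 2) ≤
        ENNReal.ofReal δ * numSq φ + ENNReal.ofReal C * ENNReal.ofReal (‖Φ‖ ^ 2)) :
    InfSmall (freeHam me mZ) S.op := by
  refine infSmall_of_mem_graph fun ε hε => ?_
  rw [FormalOp.graph_op]
  obtain ⟨b, hb0, hb⟩ := exists_graph_le hme hmZ h ε hε
  exact ⟨b, hb0, fun x => hb _ _ (freeHam_mem x.2)⟩

theorem AdjPair.op_inner (h : AdjPair S T a b) (x : S.op.domain) (y : T.op.domain) :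
    inner ℂ (S.op x) (y : Fock) = inner ℂ (x : Fock) (T.op y) := by
  refine h.inner_eq ?_ ?_
  · rw [← FormalOp.graph_op]; exact LinearPMap.mem_graph _ x
  · rw [← FormalOp.graph_op]; exact LinearPMap.mem_graph _ y

theorem AdjPair.op_inner' (h : AdjPair S T a b) (x : T.op.domain) (y : S.op.domain) :
    inner ℂ (T.op x) (y : Fock) = inner ℂ (x : Fock) (S.op y) := by
  rw [← inner_conj_symm, ← h.op_inner y x, inner_conj_symm]

theorem op_congr {S S' : FormalOp} (h1 : S.graph ≤ S'.graph) (h2 : S'.graph ≤ S.graph) :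
    S.op = S'.op := by
  unfold FormalOp.op
  rw [le_antisymm h1 h2]

/-- `A + g V` is self-adjoint on the domain of `A`, and every core for `A` is a core. -/
def SelfAdjointPerturbation (A V : E →ₗ.[ℂ] E) [CompleteSpace E] (g : ℂ) : Prop :=
  IsSelfAdjoint (A + g • V) ∧ (A + g • V).domain = A.domain ∧
    ∀ D : Submodule ℂ E, A.HasCore D → (A + g • V).HasCore D

/-- The Kato–Rellich theorem for a perturbation that is a sum of two pairs of formally adjoint
operators. -/
theorem katoRellich_adjoint_pairs [CompleteSpace E] {A S₁ T₁ S₂ T₂ : E →ₗ.[ℂ] E}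
    (hsym : ∀ x y : A.domain, inner ℂ (A x) (y : E) = inner ℂ (x : E) (A y))
    (hsurj : ∀ c : ℝ, c ≠ 0 → ∀ y : E, ∃ x : A.domain, A x + ((c : ℂ) * Complex.I) • (x : E) = y)
    (hS₁ : InfSmall A S₁) (hT₁ : InfSmall A T₁) (hS₂ : InfSmall A S₂) (hT₂ : InfSmall A T₂)
    (h₁ : ∀ (x : S₁.domain) (y : T₁.domain), inner ℂ (S₁ x) (y : E) = inner ℂ (x : E) (T₁ y))
    (h₁' : ∀ (x : T₁.domain) (y : S₁.domain), inner ℂ (T₁ x) (y : E) = inner ℂ (x : E) (S₁ y))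
    (h₂ : ∀ (x : S₂.domain) (y : T₂.domain), inner ℂ (S₂ x) (y : E) = inner ℂ (x : E) (T₂ y))
    (h₂' : ∀ (x : T₂.domain) (y : S₂.domain), inner ℂ (T₂ x) (y : E) = inner ℂ (x : E) (S₂ y))
    (g : ℝ) :
    SelfAdjointPerturbation A (S₁ + T₁ + S₂ + T₂) g := by
  obtain ⟨hd, hb⟩ := (((hS₁.add hT₁).add hS₂).add hT₂).smul (g : ℂ)
  -- Any relative bound below one would serve.
  obtain ⟨b0, hb0, hb1⟩ := hb (1 / 2) (by norm_num)
  refine katoRellich hd hsym ?_ (by norm_num) (by norm_num) hb0 hb1 hsurj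
  intro x y
  obtain ⟨⟨⟨x1, x2⟩, x3⟩, x4⟩ := hd x.2
  obtain ⟨⟨⟨y1, y2⟩, y3⟩, y4⟩ := hd y.2
  have e1 := h₁ ⟨x, x1⟩ ⟨y, y2⟩
  have e2 := h₁' ⟨x, x2⟩ ⟨y, y1⟩
  have e3 := h₂ ⟨x, x3⟩ ⟨y, y4⟩
  have e4 := h₂' ⟨x, x4⟩ ⟨y, y3⟩
  simp only [LinearPMap.smul_apply, LinearPMap.add_apply, inner_smul_left, inner_smul_right,
    inner_add_left, inner_add_right, Complex.conj_ofReal]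
  congr 1
  linear_combination e1 + e2 + e3 + e4

/-- The free Hamiltonian, perturbed by two pairs of formally adjoint operators. -/
theorem selfAdjoint_of_adjPair (hme : 0 < me) (hmZ : 0 < mZ) {S₁ T₁ S₂ T₂ : FormalOp}
    {a' b' : ℕ × ℕ × ℕ → ℕ × ℕ × ℕ} (h₁ : AdjPair S₁ T₁ a b) (h₂ : AdjPair S₂ T₂ a' b') (g : ℝ) :
    SelfAdjointPerturbation (freeHam me mZ) (S₁.op + T₁.op + S₂.op + T₂.op) g :=
  katoRellich_adjoint_pairs freeHam_symm (fun _ hc y => freeHam_surjective hc y)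
    (infSmall_of_exists hme hmZ fun _ hδ => h₁.exists_left hδ)
    (infSmall_of_exists hme hmZ fun _ hδ => h₁.exists_right hδ)
    (infSmall_of_exists hme hmZ fun _ hδ => h₂.exists_left hδ)
    (infSmall_of_exists hme hmZ fun _ hδ => h₂.exists_right hδ)
    h₁.op_inner h₁.op_inner' h₂.op_inner h₂.op_inner' g

theorem exists_adjPair_one (hF : MemLp (kernelFun F) 2 muFFB) : ∃ K : Kernel3,
    AdjPair (formalOne K) (formalOneStar K) (fun i => (i.1, i.2.1, i.2.2 + 1))
      (fun i => (i.1 + 1, i.2.1 + 1, i.2.2)) ∧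
    (formalOne F).op = (formalOne K).op ∧ (formalOneStar F).op = (formalOneStar K).op := by
  let K : Kernel3 := fun ξ₁ ξ₂ ξ₃ => hF.1.mk _ (ξ₁, ξ₂, ξ₃)
  have hK : kernelFun F =ᵐ[muFFB] kernelFun K := hF.1.ae_eq_mk
  exact ⟨K, adjPair_one hF.1.stronglyMeasurable_mk ((memLp_congr_ae hK).1 hF),
    op_congr (graph_formalOne_congr hK) (graph_formalOne_congr hK.symm),
    op_congr (graph_formalOneStar_congr hK) (graph_formalOneStar_congr hK.symm)⟩

theorem exists_adjPair_two (hF : MemLp (kernelFun F) 2 muFFB) : ∃ K : Kernel3,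
    AdjPair (formalTwo K) (formalTwoStar K) (fun i => i)
      (fun i => (i.1 + 1, i.2.1 + 1, i.2.2 + 1)) ∧
    (formalTwo F).op = (formalTwo K).op ∧ (formalTwoStar F).op = (formalTwoStar K).op := by
  let K : Kernel3 := fun ξ₁ ξ₂ ξ₃ => hF.1.mk _ (ξ₁, ξ₂, ξ₃)
  have hK : kernelFun F =ᵐ[muFFB] kernelFun K := hF.1.ae_eq_mk
  exact ⟨K, adjPair_two hF.1.stronglyMeasurable_mk ((memLp_congr_ae hK).1 hF),
    op_congr (graph_formalTwo_congr hK) (graph_formalTwo_congr hK.symm),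
    op_congr (graph_formalTwoStar_congr hK) (graph_formalTwoStar_congr hK.symm)⟩

theorem selfAdjoint_of_memLp (hme : 0 < me) (hmZ : 0 < mZ) (hF : MemLp (kernelFun F) 2 muFFB)
    (hF' : MemLp (kernelFun F') 2 muFFB) (g : ℝ) :
    SelfAdjointPerturbation (freeHam me mZ)
      ((formalOne F).op + (formalOneStar F).op + (formalTwo F').op + (formalTwoStar F').op) g := by
  obtain ⟨K, h₁, hK⟩ := exists_adjPair_one hF
  obtain ⟨K', h₂, hK'⟩ := exists_adjPair_two hF'
  rw [hK.1, hK.2, hK'.1, hK'.2]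
  exact selfAdjoint_of_adjPair hme hmZ h₁ h₂ g

end SelfAdjoint

/-! ## Bounds for spherical harmonics -/

section SphericalHarmonics

open Polynomial in
theorem iteratedDeriv_polynomial (P : ℂ[X]) (n : ℕ) :
    iteratedDeriv n (fun z => P.eval z) = fun z => (derivative^[n] P).eval z := by
  induction n generalizing P with
  | zero => rfl
  | succ n ih =>
    have e : deriv (fun z => P.eval z) = fun z => (derivative P).eval z := by
      funext z; exact P.deriv
    rw [iteratedDeriv_succ', e, ih, Function.iterate_succ_apply]

/-- Cauchy's estimate for polynomials. -/
theorem norm_iterate_derivative_eval_le (P : Polynomial ℂ) (n : ℕ) {z : ℂ} {ρ B : ℝ} (hρ : 0 < ρ)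
    (hB : ∀ ε : ℂ, ‖ε‖ = ρ → ‖P.eval (z + ε)‖ ≤ B) :
    ‖(Polynomial.derivative^[n] P).eval z‖ ≤ n.factorial * B / ρ ^ n := by
  have h := Complex.norm_iteratedDeriv_le_of_forall_mem_sphere_norm_le (c := z) (C := B)
    (f := fun z => P.eval z) n hρ (P.differentiable.diffContOnCl) (fun w hw => by
      have := hB (w - z) (by simpa using hw)
      simpa using this)
  rwa [iteratedDeriv_polynomial] at h

/-! ### Factorial ratios and bounds on associated Legendre functions. -/

/-- The sequence `n! / (n + 1)ⁿ`. -/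
def factRatio (n : ℕ) : ℝ := n.factorial / (n + 1) ^ n

theorem factRatio_pos (n : ℕ) : 0 < factRatio n := by
  unfold factRatio; positivity

theorem factRatio_succ (n : ℕ) :
    factRatio (n + 1) = factRatio n * ((n + 1 : ℝ) / (n + 2)) ^ (n + 1) := by
  unfold factRatio
  rw [Nat.factorial_succ, div_pow]
  push_cast
  have h : (n : ℝ) + 1 + 1 = n + 2 := by ring
  rw [h]
  field_simp
  ring

/-- These are the reciprocals of `(1 + 1/(n+1))^(n+1)`, which increase to `e`; the proof is the
classical one by Bernoulli's inequality. -/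
theorem antitone_factRatio_quotient : Antitone fun n : ℕ => ((n + 1 : ℝ) / (n + 2)) ^ (n + 1) := by
  refine antitone_nat_of_succ_le fun n => ?_
  push_cast
  have h1 : (1 : ℝ) + ((n + 1 : ℕ) : ℝ) * (-(1 / (n + 2) ^ 2)) ≤
      (1 + -(1 / (n + 2 : ℝ) ^ 2)) ^ (n + 1) := by
    refine one_add_mul_le_pow ?_ _
    have : (1 : ℝ) / (n + 2) ^ 2 ≤ 1 := by
      rw [div_le_one (by positivity)]; nlinarith [(n.cast_nonneg : (0 : ℝ) ≤ n)]
    linarith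
  have h2 : ((n : ℝ) + 2) / (n + 3) ≤ 1 + ((n + 1 : ℕ) : ℝ) * (-(1 / (n + 2) ^ 2)) := by
    push_cast
    have e : 1 + ((n : ℝ) + 1) * (-(1 / (n + 2) ^ 2)) - (n + 2) / (n + 3) =
        1 / ((n + 2) ^ 2 * (n + 3)) := by
      field_simp
      ring
    have : (0 : ℝ) ≤ 1 / ((n + 2) ^ 2 * (n + 3)) := by positivity
    linarith
  have h3 : (1 + -(1 / (n + 2 : ℝ) ^ 2)) = ((n + 1) / (n + 2)) / ((n + 2) / (n + 3)) := by
    field_simp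
    ring
  rw [h3, div_pow, le_div_iff₀ (by positivity)] at h1
  have h4 : ((n : ℝ) + 1 + 1) / (n + 1 + 2) = (n + 2) / (n + 3) := by
    congr 1 <;> ring
  rw [h4, pow_succ _ (n + 1), mul_comm]
  exact (mul_le_mul_of_nonneg_right h2 (by positivity)).trans h1

/-- The successive quotients of `factRatio` decrease, that is, the sequence is log-concave; moving
two indices apart symmetrically therefore lowers the product. -/
theorem factRatio_mul_le {l m : ℕ} (h : m ≤ l) :
    factRatio (l - m) * factRatio (l + m) ≤ factRatio l ^ 2 := by
  induction m with
  | zero => simp [sq]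
  | succ m ih =>
    refine le_trans ?_ (ih (by omega))
    obtain ⟨k, hk⟩ : ∃ k, l - m = k + 1 := ⟨l - m - 1, by omega⟩
    have e : l - (m + 1) = k := by omega
    rw [e, hk, ← add_assoc, factRatio_succ, factRatio_succ]
    have h1 := antitone_factRatio_quotient (show k ≤ l + m by omega)
    have h2 := mul_pos (factRatio_pos k) (factRatio_pos (l + m))
    dsimp only at h1
    calc _ = factRatio k * factRatio (l + m) *
          (((l + m : ℕ) + 1 : ℝ) / ((l + m : ℕ) + 2)) ^ (l + m + 1) := by ring
      _ ≤ factRatio k * factRatio (l + m) * ((k + 1 : ℝ) / (k + 2)) ^ (k + 1) :=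
          mul_le_mul_of_nonneg_left h1 h2.le
      _ = _ := by ring

/-- With `x = Re ε`, the difference of the squares of the two sides is the perfect square `(t s (r²
- 1) - 2 s x)²`. -/
theorem normSq_circle_le {t s r : ℝ} (hts : s ^ 2 + t ^ 2 = 1) {ε : ℂ} (hε : ‖ε‖ = r * s)
    (hr : 0 < r) (hs : 0 < s) : ‖((t : ℂ) + ε) ^ 2 - 1‖ ≤ s * (1 + r ^ 2) := by
  refine le_of_sq_le_sq ?_ (by positivity)
  rw [Complex.sq_norm, Complex.normSq_apply]
  have h1 : ε.re ^ 2 + ε.im ^ 2 = r ^ 2 * s ^ 2 := by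
    have := Complex.sq_norm ε
    rw [hε, Complex.normSq_apply] at this
    linarith
  have e1 : (((t : ℂ) + ε) ^ 2 - 1).re = (t + ε.re) ^ 2 - ε.im ^ 2 - 1 := by
    simp [sq]
  have e2 : (((t : ℂ) + ε) ^ 2 - 1).im = 2 * (t + ε.re) * ε.im := by
    simp [sq]; ring
  rw [e1, e2]
  set x := ε.re
  set y := ε.im
  have hy : y ^ 2 = r ^ 2 * s ^ 2 - x ^ 2 := by linarith
  have ht : t ^ 2 = 1 - s ^ 2 := by linarith
  have key : (s * (1 + r ^ 2)) ^ 2 - (((t + x) ^ 2 - y ^ 2 - 1) * ((t + x) ^ 2 - y ^ 2 - 1) +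
      2 * (t + x) * y * (2 * (t + x) * y)) = (t * s * (r ^ 2 - 1) - 2 * s * x) ^ 2 := by
    have e3 : ((t + x) ^ 2 - y ^ 2 - 1) * ((t + x) ^ 2 - y ^ 2 - 1) +
      2 * (t + x) * y * (2 * (t + x) * y) = ((t + x) ^ 2 - y ^ 2 - 1) ^ 2 +
      4 * (t + x) ^ 2 * y ^ 2 := by ring
    rw [e3, hy]
    have e4 : (t + x) ^ 2 = 1 - s ^ 2 + 2 * t * x + x ^ 2 := by rw [← ht]; ring
    rw [e4]
    have e5 : (t * s * (r ^ 2 - 1) - 2 * s * x) ^ 2 = s ^ 2 * (t ^ 2 * (r ^ 2 - 1) ^ 2 -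
      4 * t * x * (r ^ 2 - 1) + 4 * x ^ 2) := by ring
    rw [e5]
    linear_combination (-(s ^ 2 * (r ^ 2 - 1) ^ 2) - 4 * x ^ 2) * ht
  have h5 := sq_nonneg (t * s * (r ^ 2 - 1) - 2 * s * x)
  linarith

/-- The derivatives in the definition of the associated Legendre functions. -/
def legendreDer (l k : ℕ) (t : ℝ) : ℝ :=
  (Polynomial.derivative^[k] ((Polynomial.X ^ 2 - 1 : Polynomial ℝ) ^ l)).eval t

/-- Cauchy's estimate on the circle of radius `r s` about `t`. Letting the radius scale with `s`
makes the powers of `s` cancel, for `k = l + m`, against the factor `s ^ m` of the Legendre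
function. -/
theorem abs_legendreDer_le (l k : ℕ) {t s r : ℝ} (hts : s ^ 2 + t ^ 2 = 1) (hr : 0 < r)
    (hs : 0 < s) :
    |legendreDer l k t| ≤ k.factorial * (s * (1 + r ^ 2)) ^ l / (r * s) ^ k := by
  have e : ((Polynomial.X ^ 2 - 1 : Polynomial ℂ) ^ l) =
      ((Polynomial.X ^ 2 - 1 : Polynomial ℝ) ^ l).map Complex.ofRealHom := by simp
  have h := norm_iterate_derivative_eval_le ((Polynomial.X ^ 2 - 1 : Polynomial ℂ) ^ l) k
    (z := t) (B := (s * (1 + r ^ 2)) ^ l) (mul_pos hr hs) (fun ε hε => by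
      simp only [Polynomial.eval_pow, Polynomial.eval_sub, Polynomial.eval_X, Polynomial.eval_one,
        norm_pow]
      exact pow_le_pow_left₀ (norm_nonneg _) (normSq_circle_le hts hε hr hs) l)
  rw [e, Polynomial.iterate_derivative_map] at h
  have e2 : ((Polynomial.map Complex.ofRealHom (Polynomial.derivative^[k]
      ((Polynomial.X ^ 2 - 1 : Polynomial ℝ) ^ l))).eval (t : ℂ)) = (legendreDer l k t : ℂ) :=
    Polynomial.eval_map_apply Complex.ofRealHom t
  rwa [e2, Complex.norm_real, Real.norm_eq_abs] at h

theorem legendre_sq_le {l m : ℕ} (hm : m ≤ l) {t s : ℝ} (hts : s ^ 2 + t ^ 2 = 1) (hs : 0 < s) :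
    ((l - m).factorial / (l + m).factorial : ℝ) *
      (s ^ m * (1 / (2 ^ l * l.factorial) * legendreDer l (l + m) t)) ^ 2 ≤ 1 := by
  set a : ℝ := ((l - m : ℕ) : ℝ) + 1 with ha
  set b : ℝ := ((l + m : ℕ) : ℝ) + 1 with hb
  have ha0 : 0 < a := by positivity
  have hb0 : 0 < b := by positivity
  -- Minimizing `(1 + r²)^l / r^(l+m)` would give `r² = (l + m)/(l - m)`. The shift by one avoids
  -- division by zero at `m = l` and turns the bound exactly into `factRatio (l - m) * factRatio (l
  -- + m) / factRatio l ^ 2`.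
  set r : ℝ := Real.sqrt (b / a)
  have hr : 0 < r := Real.sqrt_pos.2 (by positivity)
  have hr2 : r ^ 2 = b / a := Real.sq_sqrt (by positivity)
  have hab : a + b = 2 * (l + 1) := by
    rw [ha, hb, Nat.cast_sub hm]; push_cast; ring
  have h := abs_legendreDer_le l (l + m) hts hr hs
  have h2 : legendreDer l (l + m) t ^ 2 ≤
      ((l + m).factorial * (s * (1 + r ^ 2)) ^ l / (r * s) ^ (l + m)) ^ 2 := by
    rw [← sq_abs]; exact pow_le_pow_left₀ (abs_nonneg _) h 2
  have e : ((l - m).factorial / (l + m).factorial : ℝ) *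
      (s ^ m * (1 / (2 ^ l * l.factorial) *
        ((l + m).factorial * (s * (1 + r ^ 2)) ^ l / (r * s) ^ (l + m)))) ^ 2 =
      factRatio (l - m) * factRatio (l + m) / factRatio l ^ 2 := by
    have e1 : 1 + r ^ 2 = 2 * (l + 1) / a := by
      rw [hr2, ← hab]; field_simp
    have e2 : ((r * s) ^ (l + m)) ^ 2 = (b / a) ^ (l + m) * (s ^ (l + m)) ^ 2 := by
      rw [mul_pow, mul_pow, ← hr2]; ring
    have e3 : (a ^ l) ^ 2 = a ^ (l + m) * a ^ (l - m) := by
      rw [← pow_mul, ← pow_add]; congr 1; omega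
    unfold factRatio
    rw [e1, mul_pow, mul_pow, div_pow _ ((r * s) ^ (l + m)), e2, ← ha, ← hb]
    simp only [mul_pow, div_pow, pow_add s]
    rw [e3]
    field_simp
  have h4 : factRatio (l - m) * factRatio (l + m) / factRatio l ^ 2 ≤ 1 := by
    rw [div_le_one (by have := factRatio_pos l; positivity)]
    exact factRatio_mul_le hm
  refine le_trans ?_ (e.le.trans h4)
  simp only [mul_pow]
  simp only [mul_pow] at h2
  gcongr

/-- At the poles, `s = 0`, the circle degenerates. For `m > 0` the factor `s ^ m` vanishes there;
for `m = 0` the bound extends by continuity in `t`. -/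
theorem legendre_sq_le' {l m : ℕ} (hm : m ≤ l) {t s : ℝ} (hts : s ^ 2 + t ^ 2 = 1) (hs : 0 ≤ s) :
    ((l - m).factorial / (l + m).factorial : ℝ) *
      (s ^ m * (1 / (2 ^ l * l.factorial) * legendreDer l (l + m) t)) ^ 2 ≤ 1 := by
  rcases hs.lt_or_eq with hs | rfl
  · exact legendre_sq_le hm hts hs
  rcases Nat.eq_zero_or_pos m with rfl | hm0
  · have hc : Continuous (fun t : ℝ => ((l - 0).factorial / (l + 0).factorial : ℝ) *
        ((0 : ℝ) ^ 0 * (1 / (2 ^ l * l.factorial) * legendreDer l (l + 0) t)) ^ 2) := by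
      unfold legendreDer; fun_prop
    have ht : t ∈ closure (Ioo (-1 : ℝ) 1) := by
      rw [closure_Ioo (by norm_num)]
      constructor <;> nlinarith
    refine ContinuousWithinAt.closure_le ht hc.continuousWithinAt
      (continuousWithinAt_const (b := (1 : ℝ))) fun u hu => ?_
    have h := legendre_sq_le hm (t := u) (s := Real.sqrt (1 - u ^ 2))
      (by rw [Real.sq_sqrt (by nlinarith [hu.1, hu.2])]; ring)
      (Real.sqrt_pos.2 (by nlinarith [hu.1, hu.2]))
    simpa using h
  · simp [zero_pow hm0.ne']

theorem sq_add_sq_direction {x : R3} (hx : x ≠ 0) :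
    (Real.sqrt (x 0 ^ 2 + x 1 ^ 2) / ‖x‖) ^ 2 + (x 2 / ‖x‖) ^ 2 = 1 := by
  have h0 : 0 < ‖x‖ := norm_pos_iff.2 hx
  rw [div_pow, div_pow, Real.sq_sqrt (by positivity), ← add_div, div_eq_one_iff_eq (by positivity),
    EuclideanSpace.norm_sq_eq]
  simp [Fin.sum_univ_three]

/-- A bound for the spherical harmonics. -/
theorem norm_sphY_le (l : ℕ) (m : ℤ) {x : R3} (hx : x ≠ 0) :
    ‖sphY l m x‖ ≤ Real.sqrt (2 * l + 1) := by
  have e0 : ‖Complex.exp ((m : ℂ) * (Complex.arg ⟨x 0, x 1⟩ : ℂ) * Complex.I)‖ = 1 := by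
    have := Complex.norm_exp_ofReal_mul_I ((m : ℝ) * Complex.arg ⟨x 0, x 1⟩)
    push_cast at this
    exact this
  unfold sphY
  rw [norm_mul, e0, mul_one, Complex.norm_real, Real.norm_eq_abs]
  by_cases hm : m.natAbs ≤ l
  · set M := m.natAbs
    have h := legendre_sq_le' hm (sq_add_sq_direction hx) (by positivity)
    refine Real.abs_le_sqrt ?_
    change ((if 0 ≤ m then (-1) ^ M else 1) * √((2 * l + 1) / (4 * Real.pi) *
      ((l - M).factorial / (l + M).factorial)) * (√(x 0 ^ 2 + x 1 ^ 2) / ‖x‖) ^ M *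
      (1 / (2 ^ l * l.factorial) * legendreDer l (l + M) (x 2 / ‖x‖))) ^ 2 ≤ _
    have hs : (if 0 ≤ m then (-1 : ℝ) ^ M else 1) ^ 2 = 1 := by
      split_ifs
      · rw [← pow_mul, mul_comm, pow_mul]; simp
      · simp
    rw [mul_assoc, mul_pow, mul_pow _ (√_), hs, Real.sq_sqrt (by positivity), one_mul, mul_assoc]
    have h4 : (1 : ℝ) ≤ 4 * Real.pi := by nlinarith [Real.pi_gt_three]
    calc _ ≤ ((2 * l + 1) / (4 * Real.pi) : ℝ) * 1 := by gcongr
      _ ≤ _ := by rw [mul_one]; exact div_le_self (by positivity) h4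
  -- For `|m| > l` the order `l + |m|` of the derivative exceeds the degree `2 l`.
  · have hz : Polynomial.derivative^[l + m.natAbs] ((Polynomial.X ^ 2 - 1 : Polynomial ℝ) ^ l) =
        0 := by
      refine Polynomial.iterate_derivative_eq_zero (lt_of_le_of_lt (b := l * 2) ?_ (by omega))
      refine Polynomial.natDegree_pow_le.trans (Nat.mul_le_mul le_rfl ?_)
      compute_degree
    rw [hz]
    simp

theorem sphY_smul (l : ℕ) (m : ℤ) {r : ℝ} (hr : 0 < r) (x : R3) : sphY l m (r • x) = sphY l m x := by
  have e1 : Real.sqrt ((r • x) 0 ^ 2 + (r • x) 1 ^ 2) / ‖r • x‖ =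
      Real.sqrt (x 0 ^ 2 + x 1 ^ 2) / ‖x‖ := by
    have : (r • x) 0 ^ 2 + (r • x) 1 ^ 2 = r ^ 2 * (x 0 ^ 2 + x 1 ^ 2) := by simp; ring
    rw [this, Real.sqrt_mul (by positivity), Real.sqrt_sq hr.le, norm_smul, Real.norm_of_nonneg hr.le,
      mul_div_mul_left _ _ hr.ne']
  have e2 : (r • x) 2 / ‖r • x‖ = x 2 / ‖x‖ := by
    rw [norm_smul, Real.norm_of_nonneg hr.le, PiLp.smul_apply, smul_eq_mul,
      mul_div_mul_left _ _ hr.ne']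
  have e3 : Complex.arg ⟨(r • x) 0, (r • x) 1⟩ = Complex.arg ⟨x 0, x 1⟩ := by
    rw [← Complex.arg_real_mul ⟨x 0, x 1⟩ hr]
    congr 1
    apply Complex.ext <;> simp
  unfold sphY
  rw [e1, e2, e3]

theorem measurable_sphY (l : ℕ) (m : ℤ) : Measurable (sphY l m) := by
  have h : Measurable fun x : R3 => (⟨x 0, x 1⟩ : ℂ) := by
    have : (fun x : R3 => (⟨x 0, x 1⟩ : ℂ)) = fun x => (x 0 : ℂ) + (x 1 : ℂ) * Complex.I := by
      funext x; exact Complex.mk_eq_add_mul_I _ _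
    rw [this]; fun_prop
  have hp : Measurable fun t : ℝ => (Polynomial.derivative^[l + m.natAbs]
      ((Polynomial.X ^ 2 - 1 : Polynomial ℝ) ^ l)).eval t := (Polynomial.continuous _).measurable
  unfold sphY
  have h2 : Measurable fun x : R3 => x 2 / ‖x‖ := by fun_prop
  have h3 := hp.comp h2
  have h4 := Complex.measurable_arg.comp h
  simp only [Function.comp_def] at h3 h4
  fun_prop

/-- The Clebsch–Gordan coefficients are at most one, and the orbital angular momentum is at most
`γ_j`. -/
theorem norm_spinorY_le (up : Bool) (γ : QNum) {x : R3} (hx : x ≠ 0) (a : Fin 2) :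
    ‖spinorY up γ x a‖ ≤ Real.sqrt (2 * γ.gam + 1) := by
  have hi : ((γ.2.1 : ℕ) : ℝ) ≤ 2 * γ.1 + 1 := by
    have := γ.2.1.2
    exact_mod_cast Nat.lt_succ_iff.1 this
  have hi0 : (0 : ℝ) ≤ ((γ.2.1 : ℕ) : ℝ) := by positivity
  have hn : (0 : ℝ) ≤ γ.1 := by positivity
  have key : ∀ (c : ℝ) (l : ℕ) (m : ℤ), c ≤ 1 → l ≤ γ.gam →
      ‖(Real.sqrt c : ℂ) * sphY l m x‖ ≤ Real.sqrt (2 * γ.gam + 1) := by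
    intro c l m hc hl
    rw [norm_mul, Complex.norm_real, Real.norm_of_nonneg (Real.sqrt_nonneg _)]
    have h1 : Real.sqrt c ≤ 1 := Real.sqrt_le_one.2 hc
    have h2 := norm_sphY_le l m hx
    have h3 : Real.sqrt (2 * l + 1) ≤ Real.sqrt (2 * γ.gam + 1) := by gcongr
    calc _ ≤ 1 * ‖sphY l m x‖ := by gcongr
      _ ≤ _ := by rw [one_mul]; exact h2.trans h3
  have hj : γ.j = γ.1 + 1 / 2 := rfl
  have hmj : γ.mj = -γ.j + ((γ.2.1 : ℕ) : ℝ) := rfl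
  have hg : γ.gam = γ.1 + 1 := rfl
  unfold spinorY
  cases up <;> fin_cases a
  · exact key _ _ _ (by rw [div_le_one] <;> linarith) (by omega)
  · exact key _ _ _ (by rw [div_le_one] <;> linarith) (by omega)
  · have := key ((γ.j - γ.mj + 1) / (2 * γ.j + 2)) (γ.1 + 1) ((γ.2.1 : ℕ) - (γ.1 : ℤ) - 1)
      (by rw [div_le_one] <;> linarith) (by omega)
    simpa using this
  · exact key _ _ _ (by rw [div_le_one] <;> linarith) (by omega)

theorem spinorY_smul (up : Bool) (γ : QNum) {r : ℝ} (hr : 0 < r) (x : R3) :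
    spinorY up γ (r • x) = spinorY up γ x := by
  simp only [spinorY, sphY_smul _ _ hr]

theorem measurable_spinorY (up : Bool) (γ : QNum) (a : Fin 2) :
    Measurable fun x => spinorY up γ x a := by
  unfold spinorY
  cases up <;> fin_cases a <;> exact (measurable_sphY _ _).const_mul _

end SphericalHarmonics

/-! ## Radial functions -/

section ExpInt

open Polynomial

/-- The integral of a polynomial against an exponential. -/
def expInt (P : ℂ[X]) (a : ℝ) : ℂ :=
  ∫ u in (0 : ℝ)..1, Complex.exp ((a * (2 * u - 1) : ℝ) * Complex.I) * P.eval (u : ℂ)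

theorem hasDerivAt_exp_mul_eval (P : ℂ[X]) (a u : ℝ) :
    HasDerivAt (fun u : ℝ => Complex.exp ((a * (2 * u - 1) : ℝ) * Complex.I) * P.eval (u : ℂ))
      (2 * a * Complex.I * (Complex.exp ((a * (2 * u - 1) : ℝ) * Complex.I) * P.eval (u : ℂ)) +
        Complex.exp ((a * (2 * u - 1) : ℝ) * Complex.I) * (derivative P).eval (u : ℂ)) u := by
  have h1 : HasDerivAt (fun u : ℝ => ((a * (2 * u - 1) : ℝ) : ℂ) * Complex.I)
      ((a * 2 : ℝ) * Complex.I) u := by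
    refine HasDerivAt.mul_const (HasDerivAt.ofReal_comp ?_) _
    simpa using (((hasDerivAt_id u).const_mul 2).sub_const 1).const_mul a
  have h2 : HasDerivAt (fun u : ℝ => P.eval (u : ℂ)) ((derivative P).eval (u : ℂ)) u :=
    (P.hasDerivAt (u : ℂ)).comp_ofReal
  refine (h1.cexp.mul h2).congr_deriv ?_
  push_cast
  ring

theorem continuous_exp_mul_eval (P : ℂ[X]) (a : ℝ) :
    Continuous fun u : ℝ => Complex.exp ((a * (2 * u - 1) : ℝ) * Complex.I) * P.eval (u : ℂ) := by
  have : Continuous fun u : ℝ => P.eval (u : ℂ) := P.continuous.comp Complex.continuous_ofReal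
  fun_prop

/-- Integration by parts. -/
theorem mul_expInt (P : ℂ[X]) (a : ℝ) : 2 * a * Complex.I * expInt P a =
    Complex.exp (a * Complex.I) * P.eval 1 - Complex.exp (-(a * Complex.I)) * P.eval 0 -
      expInt (derivative P) a := by
  have h1 := (continuous_exp_mul_eval P a).intervalIntegrable (μ := volume) 0 1
  have h2 := (continuous_exp_mul_eval (derivative P) a).intervalIntegrable (μ := volume) 0 1
  have h := intervalIntegral.integral_eq_sub_of_hasDerivAt
    (fun u _ => hasDerivAt_exp_mul_eval P a u) ((h1.const_mul (2 * a * Complex.I)).add h2)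
  rw [intervalIntegral.integral_add (h1.const_mul _) h2, intervalIntegral.integral_const_mul] at h
  unfold expInt
  rw [eq_sub_iff_add_eq, h]
  norm_num

/-- `n` integrations by parts; the hypothesis removes all boundary terms. -/
theorem pow_mul_expInt (a : ℝ) (n : ℕ) (P : ℂ[X])
    (h : ∀ j < n, (derivative^[j] P).eval 0 = 0 ∧ (derivative^[j] P).eval 1 = 0) :
    (2 * a * Complex.I) ^ n * expInt P a = (-1) ^ n * expInt (derivative^[n] P) a := by
  induction n with
  | zero => simp
  | succ n ih =>
    rw [pow_succ', mul_assoc, ih fun j hj => h j (by omega), mul_left_comm, mul_expInt,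
      (h n (by omega)).1, (h n (by omega)).2, Function.iterate_succ_apply']
    ring

theorem norm_exp_sub_exp_le (x y : ℝ) :
    ‖Complex.exp (x * Complex.I) - Complex.exp (y * Complex.I)‖ ≤ |x - y| := by
  have h := Real.norm_exp_I_mul_ofReal_sub_one_le (x := x - y)
  have e : Complex.exp (x * Complex.I) - Complex.exp (y * Complex.I) =
      Complex.exp (y * Complex.I) * (Complex.exp (Complex.I * ((x - y : ℝ) : ℂ)) - 1) := by
    rw [mul_sub, ← Complex.exp_add, mul_one]
    congr 2
    push_cast
    ring
  rw [e, norm_mul, Complex.norm_exp_ofReal_mul_I, one_mul]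
  exact h

/-- On `[0, 1]` the phase `a (2u - 1)` has slope at most one in `a`. -/
theorem norm_expInt_sub_le {P : ℂ[X]} {B : ℝ}
    (hB : ∀ u : ℝ, 0 ≤ u → u ≤ 1 → ‖P.eval (u : ℂ)‖ ≤ B) (a b : ℝ) :
    ‖expInt P a - expInt P b‖ ≤ B * |a - b| := by
  have hB0 : 0 ≤ B := (norm_nonneg _).trans (hB 0 le_rfl zero_le_one)
  unfold expInt
  rw [← intervalIntegral.integral_sub ((continuous_exp_mul_eval P a).intervalIntegrable 0 1)
    ((continuous_exp_mul_eval P b).intervalIntegrable 0 1)]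
  have h := intervalIntegral.norm_integral_le_of_norm_le_const (a := (0 : ℝ)) (b := 1)
    (C := B * |a - b|) (f := fun u : ℝ =>
      Complex.exp ((a * (2 * u - 1) : ℝ) * Complex.I) * P.eval (u : ℂ) -
      Complex.exp ((b * (2 * u - 1) : ℝ) * Complex.I) * P.eval (u : ℂ)) (fun u hu => by
    rw [uIoc_of_le zero_le_one] at hu
    rw [← sub_mul, norm_mul, mul_comm]
    refine mul_le_mul (hB u hu.1.le hu.2) ((norm_exp_sub_exp_le _ _).trans ?_) (norm_nonneg _) hB0
    rw [← sub_mul, abs_mul]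
    exact mul_le_of_le_one_right (abs_nonneg _) (abs_le.2 ⟨by linarith [hu.1], by linarith [hu.2]⟩))
  simpa using h

/-- The polynomial `uⁿ⁺¹ (1 - u)ⁿ`. -/
def eulerPoly (n : ℕ) : ℂ[X] := X ^ (n + 1) * (1 - X) ^ n

theorem eulerPoly_derivative_zero {n j : ℕ} (h : j ≤ n) :
    (derivative^[j] (eulerPoly n)).eval 0 = 0 := by
  have h1 := pow_sub_dvd_iterate_derivative_of_pow_dvd j
    (show (X : ℂ[X]) ^ (n + 1) ∣ eulerPoly n from dvd_mul_right _ _)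
  obtain ⟨q, hq⟩ := h1
  rw [hq, eval_mul, eval_pow, eval_X, zero_pow (by omega), zero_mul]

theorem eulerPoly_derivative_one {n j : ℕ} (h : j < n) :
    (derivative^[j] (eulerPoly n)).eval 1 = 0 := by
  have h1 := pow_sub_dvd_iterate_derivative_of_pow_dvd j
    (show (1 - X : ℂ[X]) ^ n ∣ eulerPoly n from dvd_mul_left _ _)
  obtain ⟨q, hq⟩ := h1
  rw [hq, eval_mul, eval_pow, eval_sub, eval_X, eval_one, sub_self, zero_pow (by omega), zero_mul]

/-- Cauchy's estimate on circles of radius `1/2` about points of `[0, 1]`, on which `|z (1 - z)| ≤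
3/4` and `|z| ≤ 3/2`. -/
theorem norm_eulerPoly_derivative_le (n k : ℕ) {u : ℝ} (h0 : 0 ≤ u) (h1 : u ≤ 1) :
    ‖(derivative^[k] (eulerPoly n)).eval (u : ℂ)‖ ≤
      k.factorial * 2 ^ k * ((3 / 4) ^ n * (3 / 2)) := by
  refine (norm_iterate_derivative_eval_le (eulerPoly n) k (ρ := 1 / 2)
    (B := (3 / 4) ^ n * (3 / 2)) (by norm_num) fun ε hε => ?_).trans_eq ?_
  · have e : (eulerPoly n).eval ((u : ℂ) + ε) =
        (((u : ℂ) + ε) * (1 - (u + ε))) ^ n * ((u : ℂ) + ε) := by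
      simp only [eulerPoly, eval_mul, eval_pow, eval_sub, eval_X, eval_one, mul_pow]
      ring
    rw [e, norm_mul, norm_pow]
    have h2 : ‖(u : ℂ) + ε‖ ≤ 3 / 2 := by
      refine (norm_add_le _ _).trans ?_
      rw [Complex.norm_real, Real.norm_of_nonneg h0, hε]
      linarith
    have h3 : ‖((u : ℂ) + ε) * (1 - (u + ε))‖ ≤ 3 / 4 := by
      have e : ((u : ℂ) + ε) * (1 - (u + ε)) =
          ((u * (1 - u) : ℝ) : ℂ) + ((1 - 2 * u : ℝ) : ℂ) * ε - ε ^ 2 := by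
        push_cast; ring
      rw [e]
      refine (norm_sub_le _ _).trans ?_
      refine (add_le_add (norm_add_le _ _) le_rfl).trans ?_
      rw [norm_mul, norm_pow, Complex.norm_real, Complex.norm_real, hε, Real.norm_eq_abs,
        Real.norm_eq_abs, abs_of_nonneg (by nlinarith)]
      rcases abs_cases (1 - 2 * u) with h | h <;> rw [h.1] <;> nlinarith
    exact mul_le_mul (pow_le_pow_left₀ (norm_nonneg _) h3 n) h2 (norm_nonneg _) (by positivity)
  · rw [one_div, inv_pow, div_inv_eq_mul]
    ring

/-- The radial function `(2a)^{n+1}/n! ∫₀¹ e^{ia(2u-1)} u^{n+1} (1-u)^n du`. -/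
def radJ (n : ℕ) (a : ℝ) : ℂ := ((2 * a) ^ (n + 1) / n.factorial : ℝ) * expInt (eulerPoly n) a

/-- The power `a^(n+1)` is used up by `n + 1` integrations by parts. The first `n` have no boundary
terms; the last one leaves a term at `u = 1`, where `eulerPoly n` vanishes to order `n` only. What
remains on the right is visibly Lipschitz in `a`. -/
theorem radJ_eq (n : ℕ) (a : ℝ) : (n.factorial * Complex.I ^ (n + 1)) * radJ n a = (-1) ^ n *
    (Complex.exp (a * Complex.I) * (derivative^[n] (eulerPoly n)).eval 1 -
      expInt (derivative^[n + 1] (eulerPoly n)) a) := by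
  have h := pow_mul_expInt a n (eulerPoly n) fun j hj =>
    ⟨eulerPoly_derivative_zero hj.le, eulerPoly_derivative_one hj⟩
  have h2 := mul_expInt (derivative^[n] (eulerPoly n)) a
  rw [eulerPoly_derivative_zero le_rfl, mul_zero, sub_zero,
    ← Function.iterate_succ_apply' (derivative (R := ℂ))] at h2
  rw [← h2, mul_left_comm, ← h]
  unfold radJ
  push_cast
  have : (n.factorial : ℂ) ≠ 0 := by exact_mod_cast n.factorial_ne_zero
  field_simp
  ring

/-- After division by `n!` the boundary term and the integral in `radJ_eq` contribute `2^n` and `2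
(n+1) 2^n`, each times `(3/4)^n (3/2)`; the sum is `(2n+3) (3/2)^(n+1)`. -/
theorem norm_radJ_sub_le (n : ℕ) (a b : ℝ) :
    ‖radJ n a - radJ n b‖ ≤ (2 * n + 3) * (3 / 2) ^ (n + 1) * |a - b| := by
  have hf : (0 : ℝ) < n.factorial := by positivity
  have h1 := norm_expInt_sub_le (fun u h0 h1 => norm_eulerPoly_derivative_le n (n + 1) h0 h1) a b
  have h2 : ‖(derivative^[n] (eulerPoly n)).eval 1‖ ≤
      n.factorial * 2 ^ n * ((3 / 4) ^ n * (3 / 2)) := by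
    have := norm_eulerPoly_derivative_le n n (u := 1) zero_le_one le_rfl
    rwa [Complex.ofReal_one] at this
  have e : (n.factorial * Complex.I ^ (n + 1)) * (radJ n a - radJ n b) = (-1) ^ n *
      ((Complex.exp (a * Complex.I) - Complex.exp (b * Complex.I)) *
        (derivative^[n] (eulerPoly n)).eval 1 -
      (expInt (derivative^[n + 1] (eulerPoly n)) a -
        expInt (derivative^[n + 1] (eulerPoly n)) b)) := by
    rw [mul_sub, radJ_eq, radJ_eq]; ring
  have h3 := congrArg norm e
  rw [norm_mul, norm_mul, norm_mul, norm_pow, norm_pow, norm_neg, norm_one, one_pow, Complex.norm_I,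
    one_pow, mul_one, one_mul, Complex.norm_natCast] at h3
  have h4 : n.factorial * ‖radJ n a - radJ n b‖ ≤
      |a - b| * (n.factorial * 2 ^ n * ((3 / 4) ^ n * (3 / 2))) +
        (n + 1).factorial * 2 ^ (n + 1) * ((3 / 4) ^ n * (3 / 2)) * |a - b| := by
    rw [h3]
    refine (norm_sub_le _ _).trans (add_le_add ?_ h1)
    rw [norm_mul]
    exact mul_le_mul (norm_exp_sub_exp_le a b) h2 (norm_nonneg _) (abs_nonneg _)
  have e2 : (3 / 2 : ℝ) ^ (n + 1) = 2 ^ n * (3 / 4) ^ n * (3 / 2) := by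
    rw [pow_succ, ← mul_pow]; norm_num
  rw [Nat.factorial_succ] at h4
  push_cast at h4
  refine le_of_mul_le_mul_left (h4.trans_eq ?_) hf
  rw [e2]
  ring

theorem radJ_zero (n : ℕ) : radJ n 0 = 0 := by simp [radJ]

/-- The behaviour near `a = 0`, without integration by parts, from `u (1 - u) ≤ 1/4`. The factor
`(1/4)^n` will compensate the growth of the Lipschitz constants. -/
theorem norm_radJ_le (n : ℕ) (a : ℝ) :
    ‖radJ n a‖ ≤ (2 * |a|) ^ (n + 1) / n.factorial * (1 / 4) ^ n := by
  unfold radJ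
  rw [norm_mul, Complex.norm_real, Real.norm_eq_abs, abs_div, abs_pow, abs_mul, abs_two,
    Nat.abs_cast]
  gcongr
  have h := intervalIntegral.norm_integral_le_of_norm_le_const (a := (0 : ℝ)) (b := 1)
    (C := (1 / 4) ^ n) (f := fun u : ℝ =>
      Complex.exp ((a * (2 * u - 1) : ℝ) * Complex.I) * (eulerPoly n).eval (u : ℂ)) (fun u hu => by
    rw [uIoc_of_le zero_le_one] at hu
    have e : (eulerPoly n).eval (u : ℂ) = (((u * (1 - u)) ^ n * u : ℝ) : ℂ) := by
      simp only [eulerPoly, eval_mul, eval_pow, eval_sub, eval_X, eval_one, mul_pow]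
      push_cast
      ring
    have h1 : 0 ≤ u * (1 - u) := mul_nonneg hu.1.le (by linarith [hu.2])
    rw [norm_mul, Complex.norm_exp_ofReal_mul_I, one_mul, e, Complex.norm_real,
      Real.norm_of_nonneg (by have := hu.1; positivity)]
    have h2 : u * (1 - u) ≤ 1 / 4 := by nlinarith [sq_nonneg (u - 1 / 2)]
    exact (mul_le_mul (pow_le_pow_left₀ h1 h2 n) hu.2 hu.1.le (by positivity)).trans_eq
      (mul_one _))
  simpa [expInt] using h

end ExpInt

/-! ### Radial and angular factors of the eigenfunctions. -/

section RadialFunctions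

/-- The radial functions, times `r`. -/
def radU (c τ : ℂ) (γ : QNum) (p r : ℝ) : ℂ :=
  c * (Complex.exp (eta γ * Complex.I) * radJ γ.1 (p * r) +
    τ * (Complex.exp (-eta γ * Complex.I) * ((-1) ^ (γ.1 + 1) * radJ γ.1 (-(p * r)))))

theorem radU_zero (c τ : ℂ) (γ : QNum) (p : ℝ) : radU c τ γ p 0 = 0 := by
  simp [radU, radJ_zero]

theorem norm_exp_eta (x : ℝ) : ‖Complex.exp (-(x : ℂ) * Complex.I)‖ = 1 := by
  have := Complex.norm_exp_ofReal_mul_I (-x)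
  rwa [Complex.ofReal_neg] at this

theorem norm_radU_sub_le (c : ℂ) {τ : ℂ} (hτ : ‖τ‖ = 1) (γ : QNum) {p : ℝ} (hp : 0 ≤ p) (r r' : ℝ) :
    ‖radU c τ γ p r - radU c τ γ p r'‖ ≤
      ‖c‖ * (2 * ((2 * γ.1 + 3) * (3 / 2) ^ (γ.1 + 1) * (p * |r - r'|))) := by
  have h1 := norm_radJ_sub_le γ.1 (p * r) (p * r')
  have h2 := norm_radJ_sub_le γ.1 (-(p * r)) (-(p * r'))
  rw [← mul_sub, abs_mul, abs_of_nonneg hp] at h1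
  rw [neg_sub_neg, ← mul_sub, abs_mul, abs_of_nonneg hp, abs_sub_comm] at h2
  have e : radU c τ γ p r - radU c τ γ p r' =
      c * (Complex.exp (eta γ * Complex.I) * (radJ γ.1 (p * r) - radJ γ.1 (p * r')) +
    τ * (Complex.exp (-eta γ * Complex.I) * ((-1) ^ (γ.1 + 1) *
      (radJ γ.1 (-(p * r)) - radJ γ.1 (-(p * r')))))) := by
    unfold radU; ring
  rw [e, norm_mul]
  refine mul_le_mul_of_nonneg_left ((norm_add_le _ _).trans ?_) (norm_nonneg _)
  rw [norm_mul, norm_mul, norm_mul, norm_mul, norm_exp_eta, Complex.norm_exp_ofReal_mul_I, hτ,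
    norm_pow, norm_neg, norm_one, one_pow, one_mul, one_mul, one_mul, one_mul]
  linarith

theorem norm_radU_le (c : ℂ) {τ : ℂ} (hτ : ‖τ‖ = 1) (γ : QNum) {p r : ℝ} (hp : 0 ≤ p)
    (hr : 0 ≤ r) : ‖radU c τ γ p r‖ ≤
      ‖c‖ * (2 * ((2 * (p * r)) ^ (γ.1 + 1) / γ.1.factorial * (1 / 4) ^ γ.1)) := by
  have h1 := norm_radJ_le γ.1 (p * r)
  have h2 := norm_radJ_le γ.1 (-(p * r))
  rw [abs_neg] at h2
  rw [abs_of_nonneg (by positivity)] at h1 h2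
  unfold radU
  rw [norm_mul]
  refine mul_le_mul_of_nonneg_left ((norm_add_le _ _).trans ?_) (norm_nonneg _)
  rw [norm_mul, norm_mul, norm_mul, norm_mul, norm_exp_eta, Complex.norm_exp_ofReal_mul_I, hτ,
    norm_pow, norm_neg, norm_one, one_pow, one_mul, one_mul, one_mul, one_mul]
  linarith

/-- Euler's integral is inserted: the Gamma factors cancel down to `1/n!`, and the two exponentials
combine to the phase `s p r (2u - 1)`. The factor `r` removes the `1/r` of the prefactor. -/
theorem radial_eq {s : ℝ} (hs : s ^ 2 = 1) (me : ℝ) (γ : QNum) (p : ℝ) {r : ℝ} (hr : 0 < r) :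
    (r : ℂ) * ((radialPrefactor me γ p r : ℂ) * radialTerm s γ p r) =
      ((1 / Real.sqrt (omega me p) * (1 / (2 * Real.sqrt Real.pi)) : ℝ) : ℂ) *
        (Complex.exp ((s * eta γ : ℝ) * Complex.I) *
          ((s : ℂ) ^ (γ.1 + 1) * radJ γ.1 (s * (p * r)))) := by
  have hg : γ.gam = γ.1 + 1 := rfl
  have hint : Complex.exp (-(s * p * r : ℝ) * Complex.I) *
      ∫ u in (0 : ℝ)..1, Complex.exp ((2 * s * p * r : ℝ) * Complex.I * u) * (u : ℂ) ^ γ.gam *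
        ((1 - u : ℝ) : ℂ) ^ (γ.gam - 1) = expInt (eulerPoly γ.1) (s * (p * r)) := by
    unfold expInt
    rw [← intervalIntegral.integral_const_mul]
    refine intervalIntegral.integral_congr fun u _ => ?_
    simp only [hg, Nat.add_sub_cancel, eulerPoly, Polynomial.eval_mul, Polynomial.eval_pow,
      Polynomial.eval_sub, Polynomial.eval_X, Polynomial.eval_one]
    rw [← mul_assoc, ← mul_assoc, ← Complex.exp_add, mul_assoc]
    congr 2
    · push_cast; ring
    · push_cast; ring
  have h1 : Real.Gamma γ.gam = γ.1.factorial := by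
    rw [hg]; push_cast; exact Real.Gamma_nat_eq_factorial _
  have h2 : Real.Gamma (γ.gam + 1) = (γ.1 + 1).factorial := by
    rw [Real.Gamma_nat_eq_factorial, hg]
  have h3 : (0 : ℝ) < Real.Gamma (2 * γ.gam + 1) := Real.Gamma_pos_of_pos (by positivity)
  have hs2 : (s ^ (γ.1 + 1)) * (s ^ (γ.1 + 1)) = 1 := by
    rw [← mul_pow, ← sq, hs, one_pow]
  unfold radialTerm confluentF radJ radialPrefactor
  rw [h1, h2, ← hint]
  set J := ∫ u in (0 : ℝ)..1, Complex.exp ((2 * s * p * r : ℝ) * Complex.I * u) * (u : ℂ) ^ γ.gam *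
        ((1 - u : ℝ) : ℂ) ^ (γ.gam - 1)
  have hr' : (r : ℂ) ≠ 0 := by exact_mod_cast hr.ne'
  have hcoef : r * (1 / Real.sqrt (omega me p) * ((2 * p * r) ^ γ.gam / r) *
      (1 / (2 * Real.sqrt Real.pi)) * (γ.1.factorial / Real.Gamma (2 * γ.gam + 1))) *
      (γ.gam * (Real.Gamma (2 * γ.gam + 1) / ((γ.1 + 1).factorial * γ.1.factorial))) =
      (1 / Real.sqrt (omega me p) * (1 / (2 * Real.sqrt Real.pi))) *
        (s ^ (γ.1 + 1) * ((2 * (s * (p * r))) ^ (γ.1 + 1) / γ.1.factorial)) := by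
    have e : (2 * (s * (p * r))) ^ (γ.1 + 1) = s ^ (γ.1 + 1) * (2 * p * r) ^ (γ.1 + 1) := by
      rw [← mul_pow]; congr 1; ring
    rw [e, mul_div_assoc (s ^ (γ.1 + 1)), ← mul_assoc (s ^ (γ.1 + 1)), hs2, one_mul, hg,
      Nat.factorial_succ]
    push_cast
    field_simp
  have h5 := congrArg (fun x : ℝ => (x : ℂ)) hcoef
  simp only [Complex.ofReal_mul, Complex.ofReal_pow] at h5
  push_cast at h5 ⊢
  linear_combination (Complex.exp (-(s * p * r) * Complex.I) * Complex.exp (s * eta γ * Complex.I) *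
    J) * h5

/-- The coefficients of the radial functions. -/
def radCoef (me p : ℝ) (c : ℝ) : ℂ :=
  Complex.I * (c : ℂ) * ((1 / Real.sqrt (omega me p) * (1 / (2 * Real.sqrt Real.pi)) : ℝ) : ℂ)

/-- The radial parts of the eigenfunctions, times `r`. -/
def radialPart (me : ℝ) (pos : Bool) (ξ : Fermion) (r : ℝ) : Spinor :=
  Sum.elim
    (fun _ => radU (radCoef me ξ.1
      (if pos then Real.sqrt (omega me ξ.1 + me) else Real.sqrt (omega me ξ.1 - me))) 1 ξ.2 ξ.1 r)
    (fun _ => radU (radCoef me ξ.1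
      (-(if pos then Real.sqrt (omega me ξ.1 - me) else -Real.sqrt (omega me ξ.1 + me)))) (-1)
      ξ.2 ξ.1 r)

/-- The angular parts of the eigenfunctions. -/
def angularPart (γ : QNum) (x : R3) : Spinor :=
  Sum.elim (spinorY γ.2.2 γ x) (spinorY (!γ.2.2) γ x)

/-- Separation of variables: `r ψ` is a radial function, vanishing at `r = 0`, times an angular one.
The sign `τ = ±1` in `radU` distinguishes the sum `Z + conj Z` in `g` from the difference in `f`. -/
theorem psi_eq (me : ℝ) (pos : Bool) (ξ : Fermion) {x : R3} (hx : x ≠ 0) (a : Fin 2 ⊕ Fin 2) :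
    (‖x‖ : ℂ) * psi me pos ξ x a = radialPart me pos ξ ‖x‖ a * angularPart ξ.2 x a := by
  have hr : 0 < ‖x‖ := norm_pos_iff.2 hx
  have h1 := radial_eq (s := 1) (by norm_num) me ξ.2 ξ.1 hr
  have h2 := radial_eq (s := -1) (by norm_num) me ξ.2 ξ.1 hr
  simp only [one_mul, neg_one_mul] at h1 h2
  push_cast at h1 h2
  cases a with
  | inl a =>
    simp only [psi, radialPart, angularPart, Sum.elim_inl, gRadial, radU, radCoef]
    generalize (if pos then Real.sqrt (omega me ξ.1 + me) else Real.sqrt (omega me ξ.1 - me)) = c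
    push_cast
    linear_combination (Complex.I * c * spinorY ξ.2.2.2 ξ.2 x a) * (h1 + h2)
  | inr a =>
    simp only [psi, radialPart, angularPart, Sum.elim_inr, fRadial, radU, radCoef]
    generalize (if pos then Real.sqrt (omega me ξ.1 - me) else -Real.sqrt (omega me ξ.1 + me)) = c
    push_cast
    linear_combination (-Complex.I * c * spinorY (!ξ.2.2.2) ξ.2 x a) * (h1 - h2)

end RadialFunctions

/-! ## Oscillatory integrals -/

section Oscillation

variable {w : ℝ → ℂ} {L R : ℝ}

theorem norm_le_of_lipschitz (hL : 0 ≤ L) (hw : ∀ r r', ‖w r - w r'‖ ≤ L * |r - r'|)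
    (h0 : ∀ r ≤ 0, w r = 0) (hR : ∀ r, R ≤ r → w r = 0) (hR0 : 0 ≤ R) (r : ℝ) :
    ‖w r‖ ≤ L * R := by
  have hLR : 0 ≤ L * R := by positivity
  rcases le_total r 0 with h | h
  · rw [h0 r h, norm_zero]; exact hLR
  rcases le_total R r with h' | h'
  · rw [hR r h', norm_zero]; exact hLR
  have := hw r 0
  rw [h0 0 le_rfl, sub_zero, sub_zero, abs_of_nonneg h] at this
  exact this.trans (by gcongr)

theorem norm_integral_le_of_support {g : ℝ → ℂ} {a b D : ℝ} (hab : a ≤ b)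
    (hg : ∀ r, r ∉ Icc a b → g r = 0) (hD : ∀ r, ‖g r‖ ≤ D) : ‖∫ r, g r‖ ≤ D * (b - a) := by
  rw [← setIntegral_eq_integral_of_forall_compl_eq_zero hg]
  have h := norm_setIntegral_le_of_norm_le_const (μ := volume) (s := Icc a b) (f := g) (C := D)
    (by simp) fun r _ => hD r
  simpa [Real.volume_real_Icc_of_le hab] using h

theorem norm_integral_exp_le (hL : 0 ≤ L) (hw : ∀ r r', ‖w r - w r'‖ ≤ L * |r - r'|)
    (h0 : ∀ r ≤ 0, w r = 0) (hR : ∀ r, R ≤ r → w r = 0) (hR0 : 0 ≤ R) (κ : ℝ) :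
    ‖∫ r, w r * Complex.exp ((κ * r : ℝ) * Complex.I)‖ ≤ L * R ^ 2 := by
  refine (norm_integral_le_of_support (a := 0) (b := R) (D := L * R) hR0 (fun r hr => ?_)
    fun r => ?_).trans_eq (by ring)
  · rcases lt_or_ge r 0 with h | h
    · rw [h0 r h.le, zero_mul]
    · rw [hR r (not_lt.1 fun hlt => hr ⟨h, hlt.le⟩), zero_mul]
  · rw [norm_mul, Complex.norm_exp_ofReal_mul_I, mul_one]
    exact norm_le_of_lipschitz hL hw h0 hR hR0 r

/-- Translation by the half period `h = π/κ` reverses the sign of the exponential. Twice the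
integral is thus the integral of `w(r) - w(r + h)` against it, a function of size `L |h|` supported
in an interval of length `R + 2|h|`. -/
theorem norm_integral_exp_mul_le (hL : 0 ≤ L) (hw : ∀ r r', ‖w r - w r'‖ ≤ L * |r - r'|)
    (h0 : ∀ r ≤ 0, w r = 0) (hR : ∀ r, R ≤ r → w r = 0) (hR0 : 0 ≤ R) (κ : ℝ) :
    ‖∫ r, w r * Complex.exp ((κ * r : ℝ) * Complex.I)‖ * |κ| ≤ 2 * Real.pi * (L * R) := by
  have hb := norm_le_of_lipschitz hL hw h0 hR hR0
  rcases eq_or_ne κ 0 with rfl | hκ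
  · rw [abs_zero, mul_zero]; positivity
  set h : ℝ := Real.pi / κ with hh
  have habs : |h| * |κ| = Real.pi := by
    rw [← abs_mul, hh, div_mul_cancel₀ _ hκ, abs_of_pos Real.pi_pos]
  suffices H : ‖∫ r, w r * Complex.exp ((κ * r : ℝ) * Complex.I)‖ ≤ 2 * (L * R * |h|) by
    calc _ ≤ 2 * (L * R * |h|) * |κ| := by gcongr
      _ = _ := by rw [mul_assoc, mul_assoc, habs]; ring
  have h1 := norm_integral_exp_le hL hw h0 hR hR0 κ
  have hLR : 0 ≤ L * R := by positivity
  -- If the half period exceeds the length of the support, the trivial bound is enough; otherwise `R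
  -- + 2|h| ≤ 3R`.
  rcases le_total R |h| with hc | hc
  · refine h1.trans ?_
    have : L * R * R ≤ L * R * |h| := by gcongr
    nlinarith
  have hlip : LipschitzWith L.toNNReal w := LipschitzWith.of_dist_le_mul fun r r' => by
    rw [dist_eq_norm, dist_eq_norm, Real.norm_eq_abs, Real.coe_toNNReal _ hL]; exact hw r r'
  have hint : Integrable fun r => w r * Complex.exp ((κ * r : ℝ) * Complex.I) := by
    refine Continuous.integrable_of_hasCompactSupport
      (hlip.continuous.mul (by fun_prop)) ?_
    refine HasCompactSupport.intro (isCompact_Icc (a := (0 : ℝ)) (b := R)) fun r hr => ?_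
    rcases lt_or_ge r 0 with h | h
    · rw [h0 r h.le, zero_mul]
    · rw [hR r (not_lt.1 fun hlt => hr ⟨h, hlt.le⟩), zero_mul]
  have hexp : ∀ r : ℝ, Complex.exp ((κ * (r + h) : ℝ) * Complex.I) =
      -Complex.exp ((κ * r : ℝ) * Complex.I) := fun r => by
    have e : ((κ * (r + h) : ℝ) : ℂ) * Complex.I =
        ((κ * r : ℝ) : ℂ) * Complex.I + Real.pi * Complex.I := by
      have : κ * (r + h) = κ * r + Real.pi := by rw [hh]; field_simp
      rw [this]; push_cast; ring
    rw [e, Complex.exp_add, Complex.exp_pi_mul_I, mul_neg_one]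
  have htr := integral_add_right_eq_self (μ := (volume : Measure ℝ))
    (fun r => w r * Complex.exp ((κ * r : ℝ) * Complex.I)) h
  have hint2 := hint.comp_add_right h
  have h2 : 2 * ∫ r, w r * Complex.exp ((κ * r : ℝ) * Complex.I) =
      ∫ r, (w r - w (r + h)) * Complex.exp ((κ * r : ℝ) * Complex.I) := by
    have e : (fun r => (w r - w (r + h)) * Complex.exp ((κ * r : ℝ) * Complex.I)) = fun r =>
        w r * Complex.exp ((κ * r : ℝ) * Complex.I) +
          w (r + h) * Complex.exp ((κ * (r + h) : ℝ) * Complex.I) := by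
      funext r; rw [hexp]; ring
    rw [e, integral_add hint hint2, htr]
    ring
  have h3 : ‖∫ r, (w r - w (r + h)) * Complex.exp ((κ * r : ℝ) * Complex.I)‖ ≤
      L * |h| * (R + |h| - -|h|) := by
    refine norm_integral_le_of_support (by linarith [abs_nonneg h]) (fun r hr => ?_) fun r => ?_
    · have ha := abs_le.1 (le_refl |h|)
      rcases lt_or_ge r (-|h|) with hlt | hge
      · rw [h0 r (by linarith [abs_nonneg h]), h0 (r + h) (by linarith [le_abs_self h]), sub_zero,
          zero_mul]
      · have hgt : R + |h| < r := not_le.1 fun hle => hr ⟨hge, hle⟩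
        rw [hR r (by linarith [abs_nonneg h]), hR (r + h) (by linarith [neg_abs_le h]), sub_zero,
          zero_mul]
    · rw [norm_mul, Complex.norm_exp_ofReal_mul_I, mul_one]
      refine (hw r (r + h)).trans_eq ?_
      rw [sub_add_cancel_left, abs_neg]
  rw [← h2, norm_mul, Complex.norm_ofNat] at h3
  have h4 : L * |h| * (R + |h| - -|h|) ≤ L * |h| * (3 * R) := by gcongr; linarith
  have h5 : 0 ≤ L * R * |h| := by positivity
  linarith

/-- Decay of the Fourier transform of a Lipschitz function with compact support. -/
theorem enorm_integral_exp_le (hL : 0 ≤ L) (hw : ∀ r r', ‖w r - w r'‖ ≤ L * |r - r'|)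
    (h0 : ∀ r ≤ 0, w r = 0) (hR : ∀ r, R ≤ r → w r = 0) (hR1 : 1 ≤ R) (κ : ℝ) :
    ‖∫ r, w r * Complex.exp ((κ * r : ℝ) * Complex.I)‖ₑ ≤
      ENNReal.ofReal (3 * L * R ^ 2) * min 1 (‖κ‖ₑ ^ (-(1 / 2) : ℝ)) := by
  have hR0 : 0 ≤ R := zero_le_one.trans hR1
  have h1 := norm_integral_exp_le hL hw h0 hR hR0 κ
  have h2 := norm_integral_exp_mul_le hL hw h0 hR hR0 κ
  set I := ∫ r, w r * Complex.exp ((κ * r : ℝ) * Complex.I)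
  have hLR : 0 ≤ L * R ^ 2 := by positivity
  have h3 : ‖I‖ ≤ 3 * L * R ^ 2 := by linarith
  rw [← ofReal_norm]
  rcases eq_or_ne κ 0 with rfl | hκ
  · rw [enorm_zero, ENNReal.zero_rpow_of_neg (by norm_num), min_eq_left le_top, mul_one]
    exact ENNReal.ofReal_le_ofReal h3
  have hκ0 : 0 < |κ| := abs_pos.2 hκ
  have e : ‖κ‖ₑ ^ (-(1 / 2) : ℝ) = ENNReal.ofReal (|κ| ^ (-(1 / 2) : ℝ)) := by
    rw [← ofReal_norm, Real.norm_eq_abs, ENNReal.ofReal_rpow_of_pos hκ0]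
  rw [e, ← ENNReal.ofReal_one, ← ENNReal.ofReal_min, ← ENNReal.ofReal_mul (by positivity)]
  refine ENNReal.ofReal_le_ofReal ?_
  rw [mul_min_of_nonneg _ _ (by positivity), mul_one]
  refine le_min h3 ?_
  -- The geometric mean of the trivial bound and the `1/|κ|` bound. The exponent `-1/2`, unlike
  -- `-1`, is integrable over the sphere as a power of `k · θ`. The constant `3` comes from `2π ≤ 8
  -- ≤ 3²`.
  refine le_of_sq_le_sq ?_ (by positivity)
  have e2 : (|κ| ^ (-(1 / 2) : ℝ)) ^ 2 = |κ|⁻¹ := by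
    rw [← Real.rpow_natCast, ← Real.rpow_mul hκ0.le]
    norm_num
    exact Real.rpow_neg_one _
  rw [mul_pow, e2, ← div_eq_mul_inv, le_div_iff₀ hκ0, sq, mul_assoc]
  have h4 : 2 * Real.pi * (L * R) ≤ 8 * (L * R ^ 2) := by
    have h5 : L * R ≤ L * R ^ 2 := by
      rw [sq]; exact mul_le_mul_of_nonneg_left (le_mul_of_one_le_left hR0 hR1) hL
    have := Real.pi_lt_four
    have := Real.pi_pos
    have h6 : 0 ≤ L * R := by positivity
    nlinarith
  calc ‖I‖ * (‖I‖ * |κ|) ≤ (L * R ^ 2) * (8 * (L * R ^ 2)) :=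
        mul_le_mul h1 (h2.trans h4) (by positivity) hLR
    _ ≤ _ := by nlinarith [mul_nonneg hLR hLR]

end Oscillation

/-! ## Polar coordinates -/

section Polar

open Metric

/-- The surface measure of the unit sphere. -/
abbrev sphereMeas : Measure (sphere (0 : R3) 1) := (volume : Measure R3).toSphere

theorem finrank_R3_sub_one : Module.finrank ℝ R3 - 1 = 2 := by simp

theorem lintegral_polar (G : R3 → ℝ≥0∞) : ∫⁻ x, G x =
    ∫⁻ z, G ((z.2 : ℝ) • (z.1 : R3)) ∂sphereMeas.prod (Measure.volumeIoiPow 2) := by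
  have h := (volume : Measure R3).measurePreserving_homeomorphUnitSphereProd
  rw [finrank_R3_sub_one] at h
  have h2 := h.lintegral_comp_emb (Homeomorph.measurableEmbedding _)
    fun z => G ((z.2 : ℝ) • (z.1 : R3))
  rw [← h2]
  have e : ∀ x : ({0}ᶜ : Set R3), ((homeomorphUnitSphereProd R3 x).2 : ℝ) •
      ((homeomorphUnitSphereProd R3 x).1 : R3) = x := fun x => by
    have := congrArg Subtype.val ((homeomorphUnitSphereProd R3).symm_apply_apply x)
    rwa [homeomorphUnitSphereProd_symm_apply_coe] at this
  simp only [e]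
  rw [lintegral_subtype_comap (measurableSet_singleton _).compl, restrict_compl_singleton]

theorem integral_polar {F : R3 → ℂ} (hF : Integrable F) : ∫ x, F x =
    ∫ θ, (∫ r in Ioi (0 : ℝ), ((r ^ 2 : ℝ) : ℂ) * F (r • (θ : R3))) ∂sphereMeas := by
  have h := (volume : Measure R3).measurePreserving_homeomorphUnitSphereProd
  rw [finrank_R3_sub_one] at h
  have he := Homeomorph.measurableEmbedding (homeomorphUnitSphereProd R3)
  have h2 := h.integral_comp he fun z => F ((z.2 : ℝ) • (z.1 : R3))
  have h3 := h.integrable_comp_emb he (g := fun z => F ((z.2 : ℝ) • (z.1 : R3)))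
  have e : ∀ x : ({0}ᶜ : Set R3), ((homeomorphUnitSphereProd R3 x).2 : ℝ) •
      ((homeomorphUnitSphereProd R3 x).1 : R3) = x := fun x => by
    have := congrArg Subtype.val ((homeomorphUnitSphereProd R3).symm_apply_apply x)
    rwa [homeomorphUnitSphereProd_symm_apply_coe] at this
  simp only [Function.comp_def, e] at h2 h3
  have hint : Integrable (fun x : ({0}ᶜ : Set R3) => F x) (volume.comap Subtype.val) :=
    (MeasurableEmbedding.subtype_coe (measurableSet_singleton (0 : R3)).compl
      ).integrable_map_iff.1 (by
        rw [map_comap_subtype_coe (measurableSet_singleton _).compl]; exact hF.restrict)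
  rw [← restrict_compl_singleton (μ := (volume : Measure R3)) 0,
    ← integral_subtype_comap (measurableSet_singleton _).compl, h2, integral_prod _ (h3.1 hint)]
  refine integral_congr_ae (Filter.Eventually.of_forall fun θ => ?_)
  dsimp only
  rw [Measure.volumeIoiPow, integral_withDensity_eq_integral_toReal_smul (by fun_prop)
    (Filter.Eventually.of_forall fun r => ENNReal.ofReal_lt_top),
    ← integral_subtype_comap measurableSet_Ioi]
  refine integral_congr_ae (Filter.Eventually.of_forall fun r => ?_)
  dsimp only
  rw [ENNReal.toReal_ofReal (by positivity), Complex.real_smul]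

theorem enorm_integral_polar_le (F : R3 → ℂ) : ‖∫ x, F x‖ₑ ≤
    ∫⁻ θ, ‖∫ r in Ioi (0 : ℝ), ((r ^ 2 : ℝ) : ℂ) * F (r • (θ : R3))‖ₑ ∂sphereMeas := by
  by_cases hF : Integrable F
  · rw [integral_polar hF]
    exact enorm_integral_le_lintegral_enorm _
  · rw [integral_undef hF, enorm_zero]
    exact zero_le

/-- The ball lies in the cube `(-1, 1)³`, on which the function is a product and `|t|^(-1/2)` is
integrable. -/
theorem lintegral_coordinate_lt_top :
    ∫⁻ x : R3, (ball (0 : R3) 1).indicator (fun x => ‖x 0‖ₑ ^ (-(1 / 2) : ℝ)) x < ⊤ := by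
  let φ : ℝ → ℝ := (Iio 1).indicator fun t => t ^ (-(1 / 2) : ℝ)
  have h1 : Integrable fun t : ℝ => φ ‖t‖ := by
    rw [integrable_fun_norm_addHaar (volume : Measure ℝ)]
    simp only [Module.finrank_self, Nat.sub_self, pow_zero, one_smul]
    rw [← integrable_indicator_iff measurableSet_Ioi]
    have e : (Ioi (0 : ℝ)).indicator φ = (Ioo (0 : ℝ) 1).indicator fun t => t ^ (-(1 / 2) : ℝ) := by
      rw [indicator_indicator]; rfl
    rw [e, integrable_indicator_iff measurableSet_Ioo]
    have := (intervalIntegral.intervalIntegrable_rpow' (a := 0) (b := 1)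
      (show (-1 : ℝ) < -(1 / 2) by norm_num)).1
    exact this.mono_set Ioo_subset_Ioc_self
  have h2 : Integrable ((Ioo (-1 : ℝ) 1).indicator fun _ => (1 : ℝ)) :=
    (integrable_indicator_iff measurableSet_Ioo).2 (integrableOn_const (by simp))
  have h3 : Integrable fun x : Fin 3 → ℝ => ∏ i, (![fun t => φ ‖t‖,
      (Ioo (-1 : ℝ) 1).indicator fun _ => (1 : ℝ),
      (Ioo (-1 : ℝ) 1).indicator fun _ => (1 : ℝ)] : Fin 3 → ℝ → ℝ) i (x i) := by
    refine Integrable.fintype_prod (μ := fun _ => volume) fun i => ?_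
    fin_cases i
    exacts [h1, h2, h2]
  have h4 := (PiLp.volume_preserving_ofLp (Fin 3)).lintegral_comp_emb
    (MeasurableEquiv.toLp 2 (Fin 3 → ℝ)).symm.measurableEmbedding fun x : Fin 3 → ℝ =>
      ‖∏ i, (![fun t => φ ‖t‖, (Ioo (-1 : ℝ) 1).indicator fun _ => (1 : ℝ),
      (Ioo (-1 : ℝ) 1).indicator fun _ => (1 : ℝ)] : Fin 3 → ℝ → ℝ) i (x i)‖ₑ
  refine lt_of_le_of_lt ?_ (h4.trans_lt h3.2)
  refine lintegral_mono_ae ?_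
  -- On the plane `x 0 = 0` the extended power is `⊤`, while the real power is `0` by convention;
  -- the plane is a null set.
  have h5 : ∀ᵐ x : R3, x 0 ≠ 0 := (PiLp.volume_preserving_ofLp (Fin 3)).quasiMeasurePreserving.ae
    (Measure.ae_eval_ne (μ := fun _ => volume) (0 : Fin 3) (0 : ℝ))
  filter_upwards [h5] with x hx
  by_cases hb : x ∈ ball (0 : R3) 1
  · rw [indicator_of_mem hb]
    have hlt : ∀ i, |x i| < 1 := fun i => by
      have := PiLp.norm_apply_le x i
      rw [mem_ball_zero_iff] at hb
      exact this.trans_lt hb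
    have h6 : ∀ i, (Ioo (-1 : ℝ) 1).indicator (fun _ => (1 : ℝ)) (x i) = 1 := fun i =>
      indicator_of_mem (show x i ∈ Ioo (-1 : ℝ) 1 from abs_lt.1 (hlt i)) _
    rw [Fin.prod_univ_three]
    simp only [Matrix.cons_val_zero, Matrix.cons_val_one, Matrix.cons_val]
    rw [h6, h6, mul_one, mul_one]
    have h7 : φ ‖x 0‖ = |x 0| ^ (-(1 / 2) : ℝ) := indicator_of_mem (s := Iio (1 : ℝ)) (hlt 0) _
    rw [h7, ← ofReal_norm, ← ofReal_norm, Real.norm_eq_abs, Real.norm_eq_abs,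
      ENNReal.ofReal_rpow_of_pos (abs_pos.2 hx),
      abs_of_nonneg (Real.rpow_nonneg (abs_nonneg (x 0)) _)]
  · rw [indicator_of_notMem hb]
    exact zero_le

/-- Invariance of the ball under the reflection that exchanges `e` with the first coordinate vector.
-/
theorem lintegral_ball_inner_eq {e : R3} (he : ‖e‖ = 1) :
    ∫⁻ x : R3, (ball (0 : R3) 1).indicator (fun x => ‖(inner ℝ e x : ℝ)‖ₑ ^ (-(1 / 2) : ℝ)) x =
      ∫⁻ x : R3, (ball (0 : R3) 1).indicator (fun x => ‖x 0‖ₑ ^ (-(1 / 2) : ℝ)) x := by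
  let v : R3 := EuclideanSpace.single 0 1
  have hv : ‖e‖ = ‖v‖ := by simp [he, v]
  let U := (ℝ ∙ (e - v))ᗮ.reflection
  have hU : U e = v := Submodule.reflection_sub hv
  have h := U.measurePreserving.lintegral_comp_emb U.toHomeomorph.measurableEmbedding
    ((ball (0 : R3) 1).indicator fun x => ‖x 0‖ₑ ^ (-(1 / 2) : ℝ))
  rw [← h]
  refine lintegral_congr fun x => ?_
  have e1 : (inner ℝ e x : ℝ) = (U x) 0 := by
    rw [← U.inner_map_map, hU]
    simp [v, EuclideanSpace.inner_single_left]
  have e2 : U x ∈ ball (0 : R3) 1 ↔ x ∈ ball (0 : R3) 1 := by simp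
  by_cases hb : x ∈ ball (0 : R3) 1
  · rw [indicator_of_mem hb, indicator_of_mem (e2.2 hb), e1]
  · rw [indicator_of_notMem hb, indicator_of_notMem (mt e2.1 hb)]

/-- Being homogeneous of degree `-1/2`, the integrand at `θ` is at most its value at `r θ` for `0 <
r < 1`. Integrating `r² dr` over `(0, 1)` gives `1/3`, hence the factor `3`. -/
theorem lintegral_sphere_inner_le {e : R3} (he : ‖e‖ = 1) :
    ∫⁻ θ, ‖(inner ℝ e (θ : R3) : ℝ)‖ₑ ^ (-(1 / 2) : ℝ) ∂sphereMeas ≤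
      3 * ∫⁻ x : R3, (ball (0 : R3) 1).indicator (fun x => ‖x 0‖ₑ ^ (-(1 / 2) : ℝ)) x := by
  rw [← lintegral_ball_inner_eq he, lintegral_polar]
  let r1 : Ioi (0 : ℝ) := ⟨1, mem_Ioi.2 one_pos⟩
  have h1 : ∫⁻ z : sphere (0 : R3) 1 × Ioi (0 : ℝ),
      ‖(inner ℝ e (z.1 : R3) : ℝ)‖ₑ ^ (-(1 / 2) : ℝ) * (Iio r1).indicator 1 z.2
        ∂sphereMeas.prod (Measure.volumeIoiPow 2) =
      (∫⁻ θ, ‖(inner ℝ e (θ : R3) : ℝ)‖ₑ ^ (-(1 / 2) : ℝ) ∂sphereMeas) * (1 / 3) := by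
    rw [lintegral_prod_mul (f := fun θ : sphere (0 : R3) 1 =>
      ‖(inner ℝ e (θ : R3) : ℝ)‖ₑ ^ (-(1 / 2) : ℝ)) (by fun_prop)
      ((measurable_one.indicator measurableSet_Iio).aemeasurable),
      lintegral_indicator_one measurableSet_Iio, Measure.volumeIoiPow_apply_Iio]
    congr 1
    norm_num [r1, ENNReal.ofReal_div_of_pos]
  have h2 : ∀ X : ℝ≥0∞, X = 3 * (X * (1 / 3)) := fun X => by
    rw [mul_left_comm, one_div, ENNReal.mul_inv_cancel (by norm_num) (by norm_num), mul_one]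
  rw [h2 (∫⁻ θ, ‖(inner ℝ e (θ : R3) : ℝ)‖ₑ ^ (-(1 / 2) : ℝ) ∂sphereMeas), ← h1]
  refine mul_le_mul' le_rfl (lintegral_mono fun z => ?_)
  obtain ⟨θ, r⟩ := z
  have hr : (0 : ℝ) < r := r.2
  have hθ : ‖(θ : R3)‖ = 1 := by simp
  by_cases hb : r < r1
  · have hb' : (r : ℝ) < 1 := hb
    have hm : (r : ℝ) • (θ : R3) ∈ ball (0 : R3) 1 := by
      rw [mem_ball_zero_iff, norm_smul, hθ, mul_one, Real.norm_of_nonneg hr.le]; exact hb'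
    dsimp only
    rw [indicator_of_mem (show r ∈ Iio r1 from hb), indicator_of_mem hm, Pi.one_apply, mul_one,
      inner_smul_right]
    rw [ENNReal.rpow_neg, ENNReal.rpow_neg]
    refine ENNReal.inv_le_inv.2 (ENNReal.rpow_le_rpow ?_ (by norm_num))
    rw [enorm_mul]
    refine mul_le_of_le_one_left' ?_
    rw [← ofReal_norm, Real.norm_of_nonneg hr.le]
    exact ENNReal.ofReal_le_one.2 hb'.le
  · dsimp only
    rw [indicator_of_notMem (show r ∉ Iio r1 from hb), mul_zero]
    exact zero_le

/-- Averages over the sphere of a decaying function of one component. -/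
theorem exists_lintegral_sphere_min_le : ∃ C : ℝ, 0 ≤ C ∧ ∀ k : R3,
    ENNReal.ofReal ((1 + ‖k‖ ^ 2) ^ (1 / 4 : ℝ)) *
      ∫⁻ θ, min 1 (‖(inner ℝ k (θ : R3) : ℝ)‖ₑ ^ (-(1 / 2) : ℝ)) ∂sphereMeas ≤
        ENNReal.ofReal C := by
  set S := 3 * ∫⁻ x : R3, (ball (0 : R3) 1).indicator (fun x => ‖x 0‖ₑ ^ (-(1 / 2) : ℝ)) x
  have hS : S < ⊤ := ENNReal.mul_lt_top (by norm_num) lintegral_coordinate_lt_top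
  refine ⟨(ENNReal.ofReal 2 * (sphereMeas univ + S)).toReal, ENNReal.toReal_nonneg, fun k => ?_⟩
  rw [ENNReal.ofReal_toReal (ENNReal.mul_lt_top (by norm_num)
    (ENNReal.add_lt_top.2 ⟨measure_lt_top _ _, hS⟩)).ne]
  -- For `|k| ≤ 1` the minimum is bounded by `1`; for `|k| ≥ 1` homogeneity extracts `|k|^(-1/2)`,
  -- which cancels `(1 + |k|²)^(1/4) ≤ 2 |k|^(1/2)`.
  rcases le_total ‖k‖ 1 with hk | hk
  · refine mul_le_mul' (ENNReal.ofReal_le_ofReal ?_) ?_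
    · calc _ ≤ (2 : ℝ) ^ (1 / 4 : ℝ) := by
            refine Real.rpow_le_rpow (by positivity) ?_ (by norm_num)
            nlinarith [norm_nonneg k]
        _ ≤ (2 : ℝ) ^ (1 : ℝ) := Real.rpow_le_rpow_of_exponent_le (by norm_num) (by norm_num)
        _ = 2 := Real.rpow_one 2
    · refine le_add_right ?_
      calc _ ≤ ∫⁻ _, 1 ∂sphereMeas := lintegral_mono fun _ => min_le_left _ _
        _ = _ := by rw [lintegral_one]
  · have hk0 : 0 < ‖k‖ := by linarith
    have he : ‖‖k‖⁻¹ • k‖ = 1 := norm_smul_inv_norm (norm_pos_iff.1 hk0)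
    have h1 : ∀ θ : R3, ‖(inner ℝ k θ : ℝ)‖ₑ ^ (-(1 / 2) : ℝ) =
        ENNReal.ofReal (‖k‖ ^ (-(1 / 2) : ℝ)) *
          ‖(inner ℝ (‖k‖⁻¹ • k) θ : ℝ)‖ₑ ^ (-(1 / 2) : ℝ) := fun θ => by
      have e : (inner ℝ k θ : ℝ) = ‖k‖ * inner ℝ (‖k‖⁻¹ • k) θ := by
        rw [inner_smul_left]; simp [hk0.ne']
      rw [e, enorm_mul, ENNReal.mul_rpow_of_ne_top (by simp) (by simp), ← ofReal_norm, norm_norm,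
        ENNReal.ofReal_rpow_of_pos hk0]
    have h2 : ∫⁻ θ, min 1 (‖(inner ℝ k (θ : R3) : ℝ)‖ₑ ^ (-(1 / 2) : ℝ)) ∂sphereMeas ≤
        ENNReal.ofReal (‖k‖ ^ (-(1 / 2) : ℝ)) * S := by
      refine (lintegral_mono (g := fun θ : sphere (0 : R3) 1 =>
        ENNReal.ofReal (‖k‖ ^ (-(1 / 2) : ℝ)) *
          ‖(inner ℝ (‖k‖⁻¹ • k) (θ : R3) : ℝ)‖ₑ ^ (-(1 / 2) : ℝ))
        fun θ => (min_le_right _ _).trans_eq (h1 θ)).trans ?_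
      rw [lintegral_const_mul' _ _ (by simp)]
      exact mul_le_mul' le_rfl (lintegral_sphere_inner_le he)
    refine (mul_le_mul' le_rfl h2).trans ?_
    rw [← mul_assoc, ← ENNReal.ofReal_mul (by positivity)]
    refine mul_le_mul' (ENNReal.ofReal_le_ofReal ?_) le_add_self
    have h3 : (1 + ‖k‖ ^ 2) ^ (1 / 4 : ℝ) ≤ (2 : ℝ) * ‖k‖ ^ (1 / 2 : ℝ) := by
      calc _ ≤ (2 * ‖k‖ ^ 2) ^ (1 / 4 : ℝ) :=
            Real.rpow_le_rpow (by positivity) (by nlinarith) (by norm_num)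
        _ = (2 : ℝ) ^ (1 / 4 : ℝ) * ‖k‖ ^ (1 / 2 : ℝ) := by
            rw [Real.mul_rpow (by norm_num) (by positivity), ← Real.rpow_natCast,
              ← Real.rpow_mul hk0.le]
            norm_num
        _ ≤ _ := by
            gcongr
            calc (2 : ℝ) ^ (1 / 4 : ℝ) ≤ (2 : ℝ) ^ (1 : ℝ) :=
                  Real.rpow_le_rpow_of_exponent_le (by norm_num) (by norm_num)
              _ = 2 := Real.rpow_one 2
    calc _ ≤ 2 * ‖k‖ ^ (1 / 2 : ℝ) * ‖k‖ ^ (-(1 / 2) : ℝ) := by gcongr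
      _ = 2 := by
        rw [mul_assoc, ← Real.rpow_add hk0]; norm_num

end Polar

/-! ## Oscillatory integrals over space in polar coordinates -/

section Coupling

/-- The integrals in the definition of the coupling functions. -/
def couplingInt (f : ℝ → ℝ) (M : Fin 2 ⊕ Fin 2 → Fin 2 ⊕ Fin 2 → ℂ) (k : R3)
    (ψ χ : R3 → Spinor) : ℂ :=
  ∫ x : R3, (f ‖x‖ : ℂ) * (∑ a, ∑ b, M a b * (conj (ψ x a) * χ x b)) *
    Complex.exp (((inner ℝ k x : ℝ) : ℂ) * Complex.I)

/-- The integrands of the radial integrals. -/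
def radialFun (f : ℝ → ℝ) (U V : ℝ → Spinor) (a b : Fin 2 ⊕ Fin 2) (r : ℝ) : ℂ :=
  (f r : ℂ) * (conj (U r a) * V r b)

variable {f : ℝ → ℝ} {U V : ℝ → Spinor}

/-- The Jacobian `r²` is shared by the two spinors, each being `1/r` times a radial function times
an angular part that is constant along the ray. -/
theorem radial_integral_eq {M : Fin 2 ⊕ Fin 2 → Fin 2 ⊕ Fin 2 → ℂ} {k θ : R3} {ψ χ S T : R3 → Spinor}
    (hθ : ‖θ‖ = 1)
    (hψ : ∀ x, x ≠ 0 → ∀ a, (‖x‖ : ℂ) * ψ x a = U ‖x‖ a * S x a)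
    (hχ : ∀ x, x ≠ 0 → ∀ a, (‖x‖ : ℂ) * χ x a = V ‖x‖ a * T x a)
    (hS : ∀ r : ℝ, 0 < r → ∀ x, S (r • x) = S x) (hT : ∀ r : ℝ, 0 < r → ∀ x, T (r • x) = T x)
    (hint : ∀ a b (κ : ℝ), IntegrableOn
      (fun r => radialFun f U V a b r * Complex.exp ((κ * r : ℝ) * Complex.I)) (Ioi 0)) :
    ∫ r in Ioi (0 : ℝ), ((r ^ 2 : ℝ) : ℂ) * ((f ‖r • θ‖ : ℂ) *
      (∑ a, ∑ b, M a b * (conj (ψ (r • θ) a) * χ (r • θ) b)) *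
        Complex.exp (((inner ℝ k (r • θ) : ℝ) : ℂ) * Complex.I)) =
    ∑ a, ∑ b, M a b * (conj (S θ a) * T θ b) *
      ∫ r in Ioi (0 : ℝ), radialFun f U V a b r *
        Complex.exp ((inner ℝ k θ * r : ℝ) * Complex.I) := by
  have h1 : ∀ a, ∑ b, M a b * (conj (S θ a) * T θ b) * (∫ r in Ioi (0 : ℝ), radialFun f U V a b r *
        Complex.exp ((inner ℝ k θ * r : ℝ) * Complex.I)) =
      ∫ r in Ioi (0 : ℝ), ∑ b, M a b * (conj (S θ a) * T θ b) * (radialFun f U V a b r *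
        Complex.exp ((inner ℝ k θ * r : ℝ) * Complex.I)) := fun a => by
    rw [integral_finsetSum _ fun b _ => (hint a b _).const_mul _]
    exact Finset.sum_congr rfl fun b _ => (integral_const_mul _ _).symm
  rw [Finset.sum_congr rfl fun a _ => h1 a, ← integral_finsetSum _ fun a _ =>
    integrable_finsetSum _ fun b _ => (hint a b _).const_mul _]
  refine setIntegral_congr_fun measurableSet_Ioi fun r hr => ?_
  have hr0 : (0 : ℝ) < r := hr
  have hn : ‖r • θ‖ = r := by rw [norm_smul, hθ, mul_one, Real.norm_of_nonneg hr0.le]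
  have hne : r • θ ≠ 0 := by rw [← norm_pos_iff, hn]; exact hr0
  have e1 : ∀ a, (r : ℂ) * ψ (r • θ) a = U r a * S θ a := fun a => by
    have := hψ _ hne a
    rwa [hn, hS r hr0] at this
  have e2 : ∀ a, (r : ℂ) * χ (r • θ) a = V r a * T θ a := fun a => by
    have := hχ _ hne a
    rwa [hn, hT r hr0] at this
  have e3 : ∀ a, (r : ℂ) * conj (ψ (r • θ) a) = conj (U r a) * conj (S θ a) := fun a => by
    have := congrArg conj (e1 a)
    rwa [map_mul, map_mul, Complex.conj_ofReal] at this
  rw [hn, inner_smul_right, mul_comm r]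
  simp only [Finset.mul_sum, Finset.sum_mul]
  refine Finset.sum_congr rfl fun a _ => Finset.sum_congr rfl fun b _ => ?_
  unfold radialFun
  rw [Complex.ofReal_pow]
  linear_combination ((f r : ℂ) * M a b * Complex.exp ((inner ℝ k θ * r : ℝ) * Complex.I)) *
    ((r : ℂ) * χ (r • θ) b * e3 a + conj (U r a) * conj (S θ a) * e2 b)

/-- `16` counts the pairs of spinor components. The bound `β` on the radial integrals at frequency
`k · θ` is left open: it will be taken constant in one estimate and decaying in the other. -/
theorem enorm_couplingInt_le {M : Fin 2 ⊕ Fin 2 → Fin 2 ⊕ Fin 2 → ℂ} {k : R3}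
    {ψ χ S T : R3 → Spinor} {ℓ Y Y' : ℝ} (hℓ : 0 ≤ ℓ)
    (hψ : ∀ x, x ≠ 0 → ∀ a, (‖x‖ : ℂ) * ψ x a = U ‖x‖ a * S x a)
    (hχ : ∀ x, x ≠ 0 → ∀ a, (‖x‖ : ℂ) * χ x a = V ‖x‖ a * T x a)
    (hS : ∀ r : ℝ, 0 < r → ∀ x, S (r • x) = S x) (hT : ∀ r : ℝ, 0 < r → ∀ x, T (r • x) = T x)
    (hY : ∀ x, x ≠ 0 → ∀ a, ‖S x a‖ ≤ Y) (hY' : ∀ x, x ≠ 0 → ∀ a, ‖T x a‖ ≤ Y')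
    (hM : ∀ a b, ‖M a b‖ ≤ ℓ)
    (hint : ∀ a b (κ : ℝ), IntegrableOn
      (fun r => radialFun f U V a b r * Complex.exp ((κ * r : ℝ) * Complex.I)) (Ioi 0))
    {β : ℝ → ℝ≥0∞} (hβ : ∀ a b (κ : ℝ), ‖∫ r in Ioi (0 : ℝ), radialFun f U V a b r *
      Complex.exp ((κ * r : ℝ) * Complex.I)‖ₑ ≤ β κ) :
    ‖couplingInt f M k ψ χ‖ₑ ≤
      ENNReal.ofReal (16 * (ℓ * (Y * Y'))) * ∫⁻ θ, β (inner ℝ k (θ : R3)) ∂sphereMeas := by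
  refine (enorm_integral_polar_le _).trans ?_
  rw [← lintegral_const_mul' _ _ ENNReal.ofReal_ne_top]
  refine lintegral_mono fun θ => ?_
  have hθ : ‖(θ : R3)‖ = 1 := by simp
  have hne : (θ : R3) ≠ 0 := by rw [← norm_pos_iff, hθ]; exact one_pos
  have hY0 : 0 ≤ Y := (norm_nonneg _).trans (hY _ hne (Sum.inl 0))
  dsimp only
  rw [radial_integral_eq hθ hψ hχ hS hT hint]
  have h1 : ∀ a b, ‖M a b * (conj (S θ a) * T θ b) * ∫ r in Ioi (0 : ℝ), radialFun f U V a b r *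
        Complex.exp ((inner ℝ k (θ : R3) * r : ℝ) * Complex.I)‖ₑ ≤
      ENNReal.ofReal (ℓ * (Y * Y')) * β (inner ℝ k (θ : R3)) := fun a b => by
    rw [enorm_mul]
    refine mul_le_mul' ?_ (hβ a b _)
    rw [← ofReal_norm, norm_mul, norm_mul, RCLike.norm_conj]
    exact ENNReal.ofReal_le_ofReal (mul_le_mul (hM a b) (mul_le_mul (hY _ hne a) (hY' _ hne b)
      (norm_nonneg _) hY0) (by positivity) hℓ)
  refine (enorm_sum_le _ _).trans ((Finset.sum_le_sum fun a _ => (enorm_sum_le _ _).trans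
    (Finset.sum_le_sum fun b _ => h1 a b)).trans_eq ?_)
  simp only [Finset.sum_const, Finset.card_univ, Fintype.card_sum, Fintype.card_fin, nsmul_eq_mul]
  rw [ENNReal.ofReal_mul (p := 16) (by norm_num), ← mul_assoc, ← mul_assoc]
  congr 2
  norm_num

/-! ### Cutoff functions and estimates of the radial integrals. -/

/-- A cutoff function: Lipschitz on the half-line, with bounded support. -/
structure CutoffBound (f : ℝ → ℝ) (R K : ℝ) : Prop where
  one_le : 1 ≤ R
  nonneg : 0 ≤ K
  zero : ∀ r, R ≤ r → f r = 0
  bound : ∀ r, 0 ≤ r → |f r| ≤ K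
  lip : ∀ r r', 0 ≤ r → 0 ≤ r' → |f r - f r'| ≤ K * |r - r'|

theorem exists_cutoffBound (hf : ContDiffOn ℝ ∞ f (Ici 0))
    (hf_supp : ∃ R : ℝ, ∀ r, R < r → f r = 0) : ∃ R K, CutoffBound f R K := by
  obtain ⟨R₀, hR₀⟩ := hf_supp
  set R := max R₀ 0 + 1
  have hR1 : 1 ≤ R := by have := le_max_right R₀ 0; linarith
  have hz : ∀ r, R ≤ r → f r = 0 := fun r hr => hR₀ r (by have := le_max_left R₀ 0; linarith)
  have hd := hf.continuousOn_derivWithin (uniqueDiffOn_Ici 0) (by simp)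
  obtain ⟨K₁, hK₁⟩ := (isCompact_Icc (a := (0 : ℝ)) (b := R)).exists_bound_of_continuousOn
    (hf.continuousOn.mono Icc_subset_Ici_self)
  obtain ⟨K₂, hK₂⟩ := (isCompact_Icc (a := (0 : ℝ)) (b := R)).exists_bound_of_continuousOn
    (hd.mono Icc_subset_Ici_self)
  have hR0 : (0 : ℝ) ≤ R := by linarith
  have h1 : 0 ≤ K₁ := (norm_nonneg _).trans (hK₁ 0 ⟨le_rfl, hR0⟩)
  have h2 : 0 ≤ K₂ := (norm_nonneg _).trans (hK₂ 0 ⟨le_rfl, hR0⟩)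
  refine ⟨R, K₁ + K₂, hR1, by positivity, hz, fun r hr => ?_, fun r r' hr hr' => ?_⟩
  · rcases le_total R r with h | h
    · rw [hz r h, abs_zero]; positivity
    · have := hK₁ r ⟨hr, h⟩
      rw [Real.norm_eq_abs] at this
      linarith
  · have hb : ∀ x ∈ Ici (0 : ℝ), ‖derivWithin f (Ici 0) x‖ ≤ K₂ := by
      intro x hx
      rcases lt_or_ge R x with h | h
      · have hev : f =ᶠ[nhdsWithin x (Ici 0)] fun _ => 0 := by
          refine nhdsWithin_le_nhds ?_
          filter_upwards [lt_mem_nhds h] with y hy using hz y hy.le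
        rw [hev.derivWithin_eq (hz x h.le)]
        simpa using h2
      · exact hK₂ x ⟨hx, h⟩
    have := (convex_Ici (0 : ℝ)).norm_image_sub_le_of_norm_derivWithin_le
      (hf.differentiableOn (by simp)) hb hr' hr
    rw [Real.norm_eq_abs, Real.norm_eq_abs] at this
    exact this.trans (by gcongr; linarith)

theorem CutoffBound.continuousOn {R K : ℝ} (h : CutoffBound f R K) : ContinuousOn f (Ici 0) := by
  have : LipschitzOnWith K.toNNReal f (Ici 0) := LipschitzOnWith.of_dist_le_mul fun x hx y hy => by
    rw [Real.dist_eq, Real.dist_eq, Real.coe_toNNReal _ h.nonneg]; exact h.lip x y hx hy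
  exact this.continuousOn

/-- The product rule for three Lipschitz factors. `U` and `V` vanish at `0`, so they are at most `B
R` and `B' R` on `[0, R]`; terms with a single power of `R` are absorbed by `R ≤ R²`. -/
theorem CutoffBound.radial_lipschitz {R K B B' : ℝ} (h : CutoffBound f R K) {a b : Fin 2 ⊕ Fin 2}
    (hB : 0 ≤ B) (hB' : 0 ≤ B') (hU0 : U 0 a = 0) (hV0 : V 0 b = 0)
    (hU : ∀ r r', ‖U r a - U r' a‖ ≤ B * |r - r'|) (hV : ∀ r r', ‖V r b - V r' b‖ ≤ B' * |r - r'|)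
    {r r' : ℝ} (hr : r ∈ Icc 0 R) (hr' : r' ∈ Icc 0 R) :
    ‖radialFun f U V a b r - radialFun f U V a b r'‖ ≤ 3 * K * (B * B') * R ^ 2 * |r - r'| := by
  have hR := h.one_le
  have hR0 : 0 ≤ R := by linarith
  have hK := h.nonneg
  have bU : ∀ s ∈ Icc 0 R, ‖U s a‖ ≤ B * R := fun s hs => by
    have := hU s 0
    rw [hU0, sub_zero, sub_zero, abs_of_nonneg hs.1] at this
    exact this.trans (mul_le_mul_of_nonneg_left hs.2 hB)
  have bV : ∀ s ∈ Icc 0 R, ‖V s b‖ ≤ B' * R := fun s hs => by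
    have := hV s 0
    rw [hV0, sub_zero, sub_zero, abs_of_nonneg hs.1] at this
    exact this.trans (mul_le_mul_of_nonneg_left hs.2 hB')
  have e : radialFun f U V a b r - radialFun f U V a b r' =
      ((f r - f r' : ℝ) : ℂ) * (conj (U r a) * V r b) +
      (f r' : ℂ) * (conj (U r a - U r' a) * V r b) +
      (f r' : ℂ) * (conj (U r' a) * (V r b - V r' b)) := by
    unfold radialFun
    push_cast [map_sub]
    ring
  have d := abs_nonneg (r - r')
  have n1 : ‖((f r - f r' : ℝ) : ℂ) * (conj (U r a) * V r b)‖ ≤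
      K * |r - r'| * (B * R * (B' * R)) := by
    rw [norm_mul, norm_mul, RCLike.norm_conj, Complex.norm_real, Real.norm_eq_abs]
    exact mul_le_mul (h.lip _ _ hr.1 hr'.1) (mul_le_mul (bU r hr) (bV r hr) (norm_nonneg _)
      (by positivity)) (by positivity) (by positivity)
  have n2 : ‖(f r' : ℂ) * (conj (U r a - U r' a) * V r b)‖ ≤ K * (B * |r - r'| * (B' * R)) := by
    rw [norm_mul, norm_mul, RCLike.norm_conj, Complex.norm_real, Real.norm_eq_abs]
    exact mul_le_mul (h.bound _ hr'.1) (mul_le_mul (hU r r') (bV r hr) (norm_nonneg _)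
      (by positivity)) (by positivity) (by positivity)
  have n3 : ‖(f r' : ℂ) * (conj (U r' a) * (V r b - V r' b))‖ ≤
      K * (B * R * (B' * |r - r'|)) := by
    rw [norm_mul, norm_mul, RCLike.norm_conj, Complex.norm_real, Real.norm_eq_abs]
    exact mul_le_mul (h.bound _ hr'.1) (mul_le_mul (bU r' hr') (hV r r') (norm_nonneg _)
      (by positivity)) (by positivity) (by positivity)
  rw [e]
  refine (norm_add_le _ _).trans ((add_le_add ((norm_add_le _ _).trans (add_le_add n1 n2)) n3
    ).trans ?_)
  have hR2 : R ≤ R ^ 2 := by nlinarith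
  have hq : 0 ≤ K * (B * B') * |r - r'| := by positivity
  nlinarith

theorem CutoffBound.radial_integral {R K B B' : ℝ} (h : CutoffBound f R K) {a b : Fin 2 ⊕ Fin 2}
    (hB : 0 ≤ B) (hB' : 0 ≤ B') (hU0 : U 0 a = 0) (hV0 : V 0 b = 0)
    (hU : ∀ r r', ‖U r a - U r' a‖ ≤ B * |r - r'|) (hV : ∀ r r', ‖V r b - V r' b‖ ≤ B' * |r - r'|)
    (κ : ℝ) :
    IntegrableOn (fun r => radialFun f U V a b r * Complex.exp ((κ * r : ℝ) * Complex.I)) (Ioi 0) ∧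
    ‖∫ r in Ioi (0 : ℝ), radialFun f U V a b r * Complex.exp ((κ * r : ℝ) * Complex.I)‖ₑ ≤
      ENNReal.ofReal (9 * K * R ^ 4 * (B * B')) * min 1 (‖κ‖ₑ ^ (-(1 / 2) : ℝ)) := by
  have hR := h.one_le
  have hR0 : 0 ≤ R := by linarith
  have hK := h.nonneg
  set L := 3 * K * (B * B') * R ^ 2 with hLdef
  have hL : 0 ≤ L := by positivity
  -- Clamping the argument to `[0, R]` gives a Lipschitz function on the whole line: it vanishes at
  -- `0` because `U 0` does and at `R` because `f` does. The values of `f` on the negative axis,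
  -- where nothing is known, play no role.
  let w : ℝ → ℂ := fun r => radialFun f U V a b (max 0 (min r R))
  have hmem : ∀ r : ℝ, max 0 (min r R) ∈ Icc 0 R := fun r =>
    ⟨le_max_left _ _, max_le hR0 (min_le_right _ _)⟩
  have hw : ∀ r r', ‖w r - w r'‖ ≤ L * |r - r'| := fun r r' => by
    refine (h.radial_lipschitz hB hB' hU0 hV0 hU hV (hmem r) (hmem r')).trans ?_
    refine mul_le_mul_of_nonneg_left ?_ hL
    have h1 := abs_max_sub_max_le_abs (min r R) (min r' R) 0
    rw [max_comm _ 0, max_comm _ 0] at h1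
    refine h1.trans ?_
    have h2 := abs_min_sub_min_le_max r R r' R
    rw [sub_self, abs_zero, max_eq_left (abs_nonneg _)] at h2
    exact h2
  have w0 : ∀ r ≤ 0, w r = 0 := fun r hr => by
    have : max 0 (min r R) = 0 := max_eq_left ((min_le_left _ _).trans hr)
    simp only [w, this, radialFun, hU0, map_zero, zero_mul, mul_zero]
  have wR : ∀ r, R ≤ r → w r = 0 := fun r hr => by
    have : max 0 (min r R) = R := by rw [min_eq_right hr, max_eq_right hR0]
    simp only [w, this, radialFun, h.zero R le_rfl, Complex.ofReal_zero, zero_mul]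
  have weq : ∀ r ∈ Ioi (0 : ℝ), w r * Complex.exp ((κ * r : ℝ) * Complex.I) =
      radialFun f U V a b r * Complex.exp ((κ * r : ℝ) * Complex.I) := fun r hr => by
    congr 1
    rcases le_total R r with hc | hc
    · rw [wR r hc]; simp only [radialFun, h.zero r hc, Complex.ofReal_zero, zero_mul]
    · have : max 0 (min r R) = r := by rw [min_eq_left hc, max_eq_right (le_of_lt hr)]
      simp only [w, this]
  have hlip : LipschitzWith L.toNNReal w := LipschitzWith.of_dist_le_mul fun r r' => by
    rw [dist_eq_norm, dist_eq_norm, Real.norm_eq_abs, Real.coe_toNNReal _ hL]; exact hw r r'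
  have hint : Integrable fun r => w r * Complex.exp ((κ * r : ℝ) * Complex.I) := by
    refine Continuous.integrable_of_hasCompactSupport
      (hlip.continuous.mul (by fun_prop)) ?_
    refine HasCompactSupport.intro (isCompact_Icc (a := (0 : ℝ)) (b := R)) fun r hr => ?_
    rcases lt_or_ge r 0 with h | h
    · rw [w0 r h.le, zero_mul]
    · rw [wR r (not_lt.1 fun hlt => hr ⟨h, hlt.le⟩), zero_mul]
  refine ⟨hint.integrableOn.congr_fun weq measurableSet_Ioi, ?_⟩
  rw [← setIntegral_congr_fun measurableSet_Ioi weq, setIntegral_eq_integral_of_forall_compl_eq_zero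
    fun r hr => by rw [w0 r (not_lt.1 hr), zero_mul]]
  refine (enorm_integral_exp_le hL hw w0 wR hR κ).trans_eq ?_
  congr 2
  rw [hLdef]
  ring

theorem CutoffBound.integrableOn_weight {R K : ℝ} (h : CutoffBound f R K) (n : ℕ) :
    IntegrableOn (fun r => |f r| * r ^ n * (1 + r ^ 2)) (Ioi 0) := by
  have hc : ContinuousOn (fun r => |f r| * r ^ n * (1 + r ^ 2)) (Icc 0 R) :=
    ((h.continuousOn.abs.mono Icc_subset_Ici_self).mul (by fun_prop)).mul (by fun_prop)
  have h1 : IntegrableOn (fun r => |f r| * r ^ n * (1 + r ^ 2)) (Icc 0 R) :=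
    hc.integrableOn_compact isCompact_Icc
  refine h1.of_forall_sdiff_eq_zero measurableSet_Ioi fun r hr => ?_
  have : R ≤ r := not_lt.1 fun hlt => hr.2 ⟨le_of_lt hr.1, hlt.le⟩
  rw [h.zero r this]
  simp

/-- The integral in the weight `A`. -/
def cutoffInt (f : ℝ → ℝ) (n : ℕ) : ℝ := ∫ r in Ioi (0 : ℝ), |f r| * r ^ (2 * n) * (1 + r ^ 2)

theorem CutoffBound.lintegral_le {R K : ℝ} (h : CutoffBound f R K) (n : ℕ) :
    ∫⁻ r in Ioi (0 : ℝ), ENNReal.ofReal (|f r| * r ^ (2 * n)) ≤ ENNReal.ofReal (cutoffInt f n) := by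
  unfold cutoffInt
  rw [ofReal_integral_eq_lintegral_ofReal (h.integrableOn_weight _)]
  · refine lintegral_mono fun r => ENNReal.ofReal_le_ofReal ?_
    have : 0 ≤ |f r| * r ^ (2 * n) := by rw [pow_mul]; positivity
    exact le_mul_of_one_le_right this (by nlinarith [sq_nonneg r])
  · refine Filter.Eventually.of_forall fun r => ?_
    change 0 ≤ |f r| * r ^ (2 * n) * (1 + r ^ 2)
    rw [pow_mul]
    positivity

/-- Cauchy–Schwarz with respect to `|f| dr` separates the two angular momenta and produces the
square roots that occur in the weights `A`. -/
theorem CutoffBound.lintegral_mul_le {R K : ℝ} (h : CutoffBound f R K) (n m : ℕ) :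
    ∫⁻ r in Ioi (0 : ℝ), ENNReal.ofReal (|f r| * (r ^ n * r ^ m)) ≤
      ENNReal.ofReal (Real.sqrt (cutoffInt f n) * Real.sqrt (cutoffInt f m)) := by
  -- The argument `max r 0` is there because `f` is continuous on the half-line only.
  have hm : ∀ n, Measurable fun r : ℝ => ENNReal.ofReal (|f (max r 0)| * (max r 0) ^ (2 * n)) :=
    fun n => by
      have : Continuous fun r : ℝ => f (max r 0) :=
        h.continuousOn.comp_continuous (by fun_prop) fun r => mem_Ici.2 (le_max_right _ _)
      exact ENNReal.measurable_ofReal.comp (this.abs.mul (by fun_prop)).measurable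
  have h1 := lintegral_sqrt_mul_sq_le (μ := volume.restrict (Ioi (0 : ℝ))) (hm n) (hm m)
  have e : ∀ n, ∫⁻ r in Ioi (0 : ℝ), ENNReal.ofReal (|f (max r 0)| * (max r 0) ^ (2 * n)) =
      ∫⁻ r in Ioi (0 : ℝ), ENNReal.ofReal (|f r| * r ^ (2 * n)) := fun n =>
    setLIntegral_congr_fun measurableSet_Ioi fun r hr => by
      have : max r 0 = r := max_eq_left (le_of_lt hr)
      simp only [this]
  have e2 : ∫⁻ r in Ioi (0 : ℝ), (ENNReal.ofReal (|f (max r 0)| * (max r 0) ^ (2 * n)) *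
      ENNReal.ofReal (|f (max r 0)| * (max r 0) ^ (2 * m))) ^ (1 / 2 : ℝ) =
      ∫⁻ r in Ioi (0 : ℝ), ENNReal.ofReal (|f r| * (r ^ n * r ^ m)) :=
    setLIntegral_congr_fun measurableSet_Ioi fun r hr => by
      have hr0 : (0 : ℝ) < r := hr
      have : max r 0 = r := max_eq_left hr0.le
      simp only [this]
      rw [← ENNReal.ofReal_mul (by positivity), ENNReal.ofReal_rpow_of_nonneg (by positivity)
        (by norm_num), ← Real.sqrt_eq_rpow]
      congr 1
      rw [← Real.sqrt_sq (show 0 ≤ |f r| * (r ^ n * r ^ m) by positivity)]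
      congr 1
      ring
  rw [e, e, e2] at h1
  have h2 := h1.trans (mul_le_mul' (h.lintegral_le n) (h.lintegral_le m))
  have hc : ∀ n, 0 ≤ cutoffInt f n := fun n => setIntegral_nonneg measurableSet_Ioi fun r _ => by
    rw [pow_mul]; positivity
  rw [← ENNReal.ofReal_mul (hc n), ← Real.sq_sqrt (mul_nonneg (hc n) (hc m)),
    ENNReal.ofReal_pow (Real.sqrt_nonneg _), Real.sqrt_mul (hc n)] at h2
  exact (ENNReal.pow_le_pow_left_iff (by norm_num)).1 h2

/-- The estimate that ignores the oscillation, for radial functions of power growth. -/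
theorem CutoffBound.radial_integral_le {R K : ℝ} (h : CutoffBound f R K) {a b : Fin 2 ⊕ Fin 2}
    {c c' : ℝ} {n m : ℕ} (hc : 0 ≤ c) (hc' : 0 ≤ c') (hU : ∀ r, 0 ≤ r → ‖U r a‖ ≤ c * r ^ n)
    (hV : ∀ r, 0 ≤ r → ‖V r b‖ ≤ c' * r ^ m) (κ : ℝ) :
    ‖∫ r in Ioi (0 : ℝ), radialFun f U V a b r * Complex.exp ((κ * r : ℝ) * Complex.I)‖ₑ ≤
      ENNReal.ofReal (c * Real.sqrt (cutoffInt f n) * (c' * Real.sqrt (cutoffInt f m))) := by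
  refine (enorm_integral_le_lintegral_enorm _).trans ?_
  have e : c * Real.sqrt (cutoffInt f n) * (c' * Real.sqrt (cutoffInt f m)) =
      (c * c') * (Real.sqrt (cutoffInt f n) * Real.sqrt (cutoffInt f m)) := by ring
  rw [e, ENNReal.ofReal_mul (by positivity)]
  refine le_trans ?_ (mul_le_mul' le_rfl (h.lintegral_mul_le n m))
  rw [← lintegral_const_mul' _ _ (by simp)]
  refine setLIntegral_mono' measurableSet_Ioi fun r hr => ?_
  have hr0 : (0 : ℝ) < r := hr
  rw [← ENNReal.ofReal_mul (by positivity), ← ofReal_norm]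
  refine ENNReal.ofReal_le_ofReal ?_
  rw [norm_mul, Complex.norm_exp_ofReal_mul_I, mul_one]
  unfold radialFun
  rw [norm_mul, norm_mul, RCLike.norm_conj, Complex.norm_real, Real.norm_eq_abs]
  calc _ ≤ |f r| * (c * r ^ n * (c' * r ^ m)) := by
        gcongr
        · exact hU r hr0.le
        · exact hV r hr0.le
    _ = _ := by ring

end Coupling

/-! ## Pointwise bounds on the coupling functions -/

section CouplingBounds

/-- The matrix `∑_μ γ^0 γ^μ (g'_V - γ_5) c_μ`. -/
def couplingMatrix (gV : ℝ) (c : Fin 4 → ℂ) (a b : Fin 2 ⊕ Fin 2) : ℂ :=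
  ∑ μ, (diracGamma 0 * (diracGamma μ * ((gV : ℂ) • (1 : Matrix _ _ ℂ) - diracGamma5)) :
    Matrix (Fin 2 ⊕ Fin 2) (Fin 2 ⊕ Fin 2) ℂ) a b * c μ

theorem sum_current_mul (gV : ℝ) (c : Fin 4 → ℂ) (ψ χ : Spinor) :
    ∑ μ, current gV μ ψ χ * c μ = ∑ a, ∑ b, couplingMatrix gV c a b * (conj (ψ a) * χ b) := by
  unfold couplingMatrix current
  simp only [dotProduct, Matrix.mulVec, Finset.sum_mul, Finset.mul_sum, Pi.star_apply]
  rw [Finset.sum_comm]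
  refine Finset.sum_congr rfl fun a _ => ?_
  rw [Finset.sum_comm]
  refine Finset.sum_congr rfl fun b _ => Finset.sum_congr rfl fun μ _ => ?_
  rw [starRingEnd_apply]
  ring

theorem exists_norm_couplingMatrix_le (gV : ℝ) : ∃ K : ℝ, 0 ≤ K ∧ ∀ (c : Fin 4 → ℂ) (t : ℝ),
    (∀ μ, ‖c μ‖ ≤ t) → ∀ a b, ‖couplingMatrix gV c a b‖ ≤ K * t := by
  let N : Fin 2 ⊕ Fin 2 → Fin 2 ⊕ Fin 2 → Fin 4 → ℝ := fun a b μ =>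
    ‖(diracGamma 0 * (diracGamma μ * ((gV : ℂ) • (1 : Matrix _ _ ℂ) - diracGamma5)) :
      Matrix (Fin 2 ⊕ Fin 2) (Fin 2 ⊕ Fin 2) ℂ) a b‖
  have hN : ∀ a b μ, 0 ≤ N a b μ := fun _ _ _ => norm_nonneg _
  have h1 : ∀ a b, 0 ≤ ∑ μ, N a b μ := fun a b => Finset.sum_nonneg fun μ _ => hN a b μ
  have h2 : ∀ a, 0 ≤ ∑ b, ∑ μ, N a b μ := fun a => Finset.sum_nonneg fun b _ => h1 a b
  refine ⟨∑ a, ∑ b, ∑ μ, N a b μ, Finset.sum_nonneg fun a _ => h2 a, fun c t hc a b => ?_⟩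
  have ht : 0 ≤ t := (norm_nonneg _).trans (hc 0)
  calc ‖couplingMatrix gV c a b‖ ≤ ∑ μ, N a b μ * t := by
        refine (norm_sum_le _ _).trans (Finset.sum_le_sum fun μ _ => ?_)
        rw [norm_mul]
        exact mul_le_mul_of_nonneg_left (hc μ) (hN a b μ)
    _ = (∑ μ, N a b μ) * t := by rw [Finset.sum_mul]
    _ ≤ _ := mul_le_mul_of_nonneg_right
      ((Finset.single_le_sum (f := fun b => ∑ μ, N a b μ) (fun b _ => h1 a b)
        (Finset.mem_univ b)).trans (Finset.single_le_sum (f := fun a => ∑ b, ∑ μ, N a b μ)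
          (fun a _ => h2 a) (Finset.mem_univ a))) ht

theorem hOne_eq_couplingInt (me mZ gV : ℝ) (f : ℝ → ℝ) (ξ₁ ξ₂ : Fermion) (ξ₃ : Boson) :
    hOne me mZ gV f ξ₁ ξ₂ ξ₃ = couplingInt f
      (couplingMatrix gV fun μ => polVec mZ μ ξ₃ / (Real.sqrt (2 * omega3 mZ ξ₃.1) : ℂ)) ξ₃.1
      (psi me true ξ₁) (psi me false (ξ₂.1, ξ₂.2.flip)) := by
  unfold hOne couplingInt psiTilde
  simp only [← sum_current_mul]

/-- Conjugated polarization and `-k` bring `h⁽²⁾` into the form of `h⁽¹⁾`; the later bounds see only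
`|c μ|` and `|k|`. -/
theorem hTwo_eq_couplingInt (me mZ gV : ℝ) (f : ℝ → ℝ) (ξ₁ ξ₂ : Fermion) (ξ₃ : Boson) :
    hTwo me mZ gV f ξ₁ ξ₂ ξ₃ = couplingInt f
      (couplingMatrix gV fun μ => conj (polVec mZ μ ξ₃) / (Real.sqrt (2 * omega3 mZ ξ₃.1) : ℂ))
      (-ξ₃.1) (psi me true ξ₁) (psi me false (ξ₂.1, ξ₂.2.flip)) := by
  unfold hTwo couplingInt psiTilde
  simp only [← sum_current_mul, inner_neg_left, Complex.ofReal_neg]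

/-! ### Constants of the radial and angular factors, and the two estimates of the coupling integral.
-/

variable {me p : ℝ}

theorem omega_pos (hme : 0 < me) (p : ℝ) : 0 < omega me p := Real.sqrt_pos.2 (by positivity)

theorem le_omega (hme : 0 < me) (p : ℝ) : me ≤ omega me p :=
  Real.le_sqrt_of_sq_le (by nlinarith [sq_nonneg p])

theorem norm_radCoef_le (hme : 0 < me) {c : ℝ} (hc : |c| ≤ Real.sqrt (omega me p + me)) :
    ‖radCoef me p c‖ ≤ Real.sqrt ((omega me p + me) / omega me p) / 2 := by
  unfold radCoef
  have hπ : 1 ≤ Real.sqrt Real.pi := by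
    rw [Real.one_le_sqrt]; linarith [Real.pi_gt_three]
  have hω := Real.sqrt_pos.2 (omega_pos hme p)
  rw [norm_mul, norm_mul, Complex.norm_I, one_mul, Complex.norm_real, Complex.norm_real,
    Real.norm_eq_abs, Real.norm_of_nonneg (by positivity),
    Real.sqrt_div (by linarith [omega_pos hme p])]
  have : (1 : ℝ) / (2 * Real.sqrt Real.pi) ≤ 1 / 2 := by
    apply one_div_le_one_div_of_le <;> linarith
  calc |c| * (1 / Real.sqrt (omega me p) * (1 / (2 * Real.sqrt Real.pi)))
      ≤ Real.sqrt (omega me p + me) * (1 / Real.sqrt (omega me p) * (1 / 2)) := by gcongr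
    _ = _ := by ring

theorem sqrt_energy_quotient_le (hme : 0 < me) (p : ℝ) :
    Real.sqrt ((omega me p + me) / omega me p) ≤ 2 := by
  rw [Real.sqrt_le_left (by norm_num), div_le_iff₀ (omega_pos hme p)]
  linarith [le_omega hme p]

/-- Upper and lower components, for both signs of the energy, are treated alike: each coefficient is
dominated by the factor `√((ω + m_e)/ω)` of the weight `A`. -/
theorem exists_radialPart_eq (hme : 0 < me) (pos : Bool) (ξ : Fermion) (a : Fin 2 ⊕ Fin 2) :
    ∃ c τ : ℂ, ‖c‖ ≤ Real.sqrt ((omega me ξ.1 + me) / omega me ξ.1) / 2 ∧ ‖τ‖ = 1 ∧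
      ∀ r, radialPart me pos ξ r a = radU c τ ξ.2 ξ.1 r := by
  have h1 : Real.sqrt (omega me ξ.1 - me) ≤ Real.sqrt (omega me ξ.1 + me) :=
    Real.sqrt_le_sqrt (by linarith)
  rcases a with a | a
  · refine ⟨_, 1, norm_radCoef_le hme ?_, by simp, fun r => rfl⟩
    cases pos
    · simpa [abs_of_nonneg (Real.sqrt_nonneg _)] using h1
    · simp [abs_of_nonneg (Real.sqrt_nonneg _)]
  · refine ⟨_, -1, norm_radCoef_le hme ?_, by simp, fun r => rfl⟩
    cases pos
    · simp [abs_of_nonneg (Real.sqrt_nonneg _)]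
    · simpa [abs_of_nonneg (Real.sqrt_nonneg _)] using h1

theorem radialPart_zero (me : ℝ) (pos : Bool) (ξ : Fermion) (a : Fin 2 ⊕ Fin 2) :
    radialPart me pos ξ 0 a = 0 := by
  rcases a with a | a <;> exact radU_zero _ _ _ _

/-- The factor in the Lipschitz constants of the radial functions. -/
def lipCoef (n : ℕ) : ℝ := (2 * n + 3) * (3 / 2) ^ (n + 1)

theorem lipCoef_nonneg (n : ℕ) : 0 ≤ lipCoef n := by unfold lipCoef; positivity

theorem norm_radialPart_sub_le (hme : 0 < me) (pos : Bool) {ξ : Fermion} (hp : 0 ≤ ξ.1)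
    (a : Fin 2 ⊕ Fin 2) (r r' : ℝ) :
    ‖radialPart me pos ξ r a - radialPart me pos ξ r' a‖ ≤
      2 * lipCoef ξ.2.1 * ξ.1 * |r - r'| := by
  obtain ⟨c, τ, hc, hτ, h⟩ := exists_radialPart_eq hme pos ξ a
  have hc1 : ‖c‖ ≤ 1 := hc.trans (by linarith [sqrt_energy_quotient_le hme ξ.1])
  rw [h, h]
  refine (norm_radU_sub_le c hτ ξ.2 hp r r').trans ?_
  have : 0 ≤ 2 * (lipCoef ξ.2.1 * (ξ.1 * |r - r'|)) := by
    have := lipCoef_nonneg ξ.2.1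
    positivity
  calc _ ≤ 1 * (2 * (lipCoef ξ.2.1 * (ξ.1 * |r - r'|))) := mul_le_mul_of_nonneg_right hc1 this
    _ = _ := by ring

/-- The factor in the growth of the radial functions at the origin. -/
def growthCoef (me : ℝ) (ξ : Fermion) : ℝ :=
  Real.sqrt ((omega me ξ.1 + me) / omega me ξ.1) *
    ((2 * ξ.1) ^ (ξ.2.1 + 1) / ξ.2.1.factorial * (1 / 4) ^ ξ.2.1)

theorem growthCoef_nonneg (me : ℝ) {ξ : Fermion} (hp : 0 ≤ ξ.1) : 0 ≤ growthCoef me ξ := by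
  unfold growthCoef; positivity

theorem norm_radialPart_le (hme : 0 < me) (pos : Bool) {ξ : Fermion} (hp : 0 ≤ ξ.1)
    (a : Fin 2 ⊕ Fin 2) {r : ℝ} (hr : 0 ≤ r) :
    ‖radialPart me pos ξ r a‖ ≤ growthCoef me ξ * r ^ (ξ.2.1 + 1) := by
  obtain ⟨c, τ, hc, hτ, h⟩ := exists_radialPart_eq hme pos ξ a
  rw [h]
  refine (norm_radU_le c hτ ξ.2 hp hr).trans ((mul_le_mul_of_nonneg_right hc ?_).trans_eq ?_)
  · positivity
  · unfold growthCoef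
    rw [← mul_assoc 2 ξ.1 r, mul_pow _ r]
    ring

/-- `A` contains `(2p)^(γ_j + 1)`, one power of `2p` more than the radial functions provide; hence
the division by `2p`, which is harmful at small momenta. -/
theorem growthCoef_mul_sqrt (me : ℝ) (f : ℝ → ℝ) {ξ : Fermion} (hp : 0 < ξ.1) :
    growthCoef me ξ * Real.sqrt (cutoffInt f (ξ.2.1 + 1)) =
      weightA me f ξ * (1 / 4) ^ ξ.2.1 / (2 * ξ.1) := by
  have hG : Real.Gamma ξ.2.gam = ξ.2.1.factorial := by
    unfold QNum.gam
    push_cast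
    exact Real.Gamma_nat_eq_factorial _
  unfold growthCoef weightA
  rw [hG]
  unfold QNum.gam cutoffInt
  rw [eq_div_iff (by positivity), pow_succ _ (ξ.2.1 + 1)]
  ring

theorem weightA_nonneg (me : ℝ) (f : ℝ → ℝ) {ξ : Fermion} (hp : 0 ≤ ξ.1) :
    0 ≤ weightA me f ξ := by
  have : 0 ≤ Real.Gamma ξ.2.gam := Real.Gamma_nonneg_of_nonneg (by positivity)
  unfold weightA
  positivity

/-- The first two values are `9` and `75/8`, and the sequence decreases from `n = 1` on. -/
theorem sq_mul_pow_le (n : ℕ) : (2 * n + 3 : ℝ) ^ 2 * (3 / 8) ^ n ≤ 10 := by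
  induction n with
  | zero => norm_num
  | succ n ih =>
    rcases n with _ | n
    · norm_num
    · refine le_trans ?_ ih
      rw [pow_succ _ (n + 1), mul_comm (_ ^ (n + 1)), ← mul_assoc]
      refine mul_le_mul_of_nonneg_right ?_ (by positivity)
      push_cast
      nlinarith [(n.cast_nonneg : (0 : ℝ) ≤ n)]

/-- Uniformity in the angular momentum: two angular factors `√(2n+3)`, the gain `4^(-n)` of the
direct estimate and the Lipschitz constant combine to `(3/2) (2n+3)² (3/8)^n`. -/
theorem angular_mul_lipCoef_le (n : ℕ) :
    (Real.sqrt (2 * n + 3) * (1 / 4) ^ n) * (Real.sqrt (2 * n + 3) * lipCoef n) ≤ 15 := by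
  have e : (Real.sqrt (2 * n + 3) * (1 / 4 : ℝ) ^ n) * (Real.sqrt (2 * n + 3) * lipCoef n) =
      3 / 2 * ((2 * n + 3 : ℝ) ^ 2 * (3 / 8) ^ n) := by
    have h1 : Real.sqrt (2 * n + 3) * Real.sqrt (2 * n + 3) = 2 * n + 3 :=
      Real.mul_self_sqrt (by positivity)
    have h2 : (3 / 8 : ℝ) ^ n = (1 / 4) ^ n * (3 / 2) ^ n := by rw [← mul_pow]; norm_num
    unfold lipCoef
    rw [h2, pow_succ]
    linear_combination (1 / 4 : ℝ) ^ n * ((2 * n + 3) * ((3 / 2) ^ n * (3 / 2))) * h1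
  rw [e]
  linarith [sq_mul_pow_le n]

theorem norm_angularPart_le (γ : QNum) {x : R3} (hx : x ≠ 0) (a : Fin 2 ⊕ Fin 2) :
    ‖angularPart γ x a‖ ≤ Real.sqrt (2 * γ.1 + 3) := by
  have e : (2 * γ.gam + 1 : ℝ) = 2 * γ.1 + 3 := by unfold QNum.gam; push_cast; ring
  rw [← e]
  rcases a with a | a <;> exact norm_spinorY_le _ _ hx _

theorem angularPart_smul (γ : QNum) {r : ℝ} (hr : 0 < r) (x : R3) :
    angularPart γ (r • x) = angularPart γ x := by
  unfold angularPart
  rw [spinorY_smul _ _ hr, spinorY_smul _ _ hr]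

variable {f : ℝ → ℝ} {R K : ℝ}

theorem enorm_couplingInt_psi_le (hme : 0 < me) (hf : CutoffBound f R K) {ξ₁ ξ₂ : Fermion}
    (h1 : 0 < ξ₁.1) (h2 : 0 < ξ₂.1) {k : R3} {M : Fin 2 ⊕ Fin 2 → Fin 2 ⊕ Fin 2 → ℂ} {ℓ : ℝ}
    (hℓ : 0 ≤ ℓ) (hM : ∀ a b, ‖M a b‖ ≤ ℓ) {β : ℝ → ℝ≥0∞}
    (hβ : ∀ a b (κ : ℝ), ‖∫ r in Ioi (0 : ℝ),
      radialFun f (radialPart me true ξ₁) (radialPart me false ξ₂) a b r *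
        Complex.exp ((κ * r : ℝ) * Complex.I)‖ₑ ≤ β κ) :
    ‖couplingInt f M k (psi me true ξ₁) (psi me false ξ₂)‖ₑ ≤
      ENNReal.ofReal (16 * (ℓ * (Real.sqrt (2 * ξ₁.2.1 + 3) * Real.sqrt (2 * ξ₂.2.1 + 3)))) *
        ∫⁻ θ, β (inner ℝ k (θ : R3)) ∂sphereMeas := by
  have b1 := lipCoef_nonneg ξ₁.2.1
  have b2 := lipCoef_nonneg ξ₂.2.1
  exact enorm_couplingInt_le hℓ (fun x hx a => psi_eq me true ξ₁ hx a)
    (fun x hx a => psi_eq me false ξ₂ hx a) (fun r hr x => angularPart_smul _ hr x)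
    (fun r hr x => angularPart_smul _ hr x) (fun x hx a => norm_angularPart_le _ hx a)
    (fun x hx a => norm_angularPart_le _ hx a) hM
    (fun a b κ => (hf.radial_integral (B := 2 * lipCoef ξ₁.2.1 * ξ₁.1)
      (B' := 2 * lipCoef ξ₂.2.1 * ξ₂.1) (by positivity) (by positivity)
      (radialPart_zero _ _ _ _) (radialPart_zero _ _ _ _)
      (fun r r' => norm_radialPart_sub_le hme _ h1.le _ r r')
      (fun r r' => norm_radialPart_sub_le hme _ h2.le _ r r') κ).1) hβ

/-- The oscillation is ignored, so the sphere contributes only its area. Useful when `p₁ p₂` is not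
small. -/
theorem norm_couplingInt_le_weight (hme : 0 < me) (hf : CutoffBound f R K) {ξ₁ ξ₂ : Fermion}
    (h1 : 0 < ξ₁.1) (h2 : 0 < ξ₂.1) {k : R3} {M : Fin 2 ⊕ Fin 2 → Fin 2 ⊕ Fin 2 → ℂ} {ℓ : ℝ}
    (hℓ : 0 ≤ ℓ) (hM : ∀ a b, ‖M a b‖ ≤ ℓ) :
    ‖couplingInt f M k (psi me true ξ₁) (psi me false ξ₂)‖ ≤
      16 * (ℓ * (Real.sqrt (2 * ξ₁.2.1 + 3) * Real.sqrt (2 * ξ₂.2.1 + 3))) *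
        (weightA me f ξ₁ * (1 / 4) ^ ξ₁.2.1 / (2 * ξ₁.1) *
          (weightA me f ξ₂ * (1 / 4) ^ ξ₂.2.1 / (2 * ξ₂.1)) * (sphereMeas univ).toReal) := by
  have w1 := weightA_nonneg me f h1.le
  have w2 := weightA_nonneg me f h2.le
  have h := enorm_couplingInt_psi_le hme hf h1 h2 (k := k) hℓ hM fun a b κ =>
    hf.radial_integral_le (a := a) (b := b) (growthCoef_nonneg me h1.le)
      (growthCoef_nonneg me h2.le) (fun r hr => norm_radialPart_le hme true h1.le a hr)
      (fun r hr => norm_radialPart_le hme false h2.le b hr) κ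
  rw [growthCoef_mul_sqrt me f h1, growthCoef_mul_sqrt me f h2, lintegral_const,
    ← ENNReal.ofReal_toReal (measure_ne_top sphereMeas univ), ← ENNReal.ofReal_mul (by positivity),
    ← ENNReal.ofReal_mul (by positivity), ← ofReal_norm] at h
  exact (ENNReal.ofReal_le_ofReal_iff (by positivity)).1 h

/-- The spherical average of the decaying radial bound cancels the growth in `k` allowed for `M`,
and the Lipschitz constants supply `p₁ p₂`. Useful when `p₁ p₂` is small. -/
theorem exists_norm_couplingInt_le_decay (hme : 0 < me) (hf : CutoffBound f R K) :
    ∃ D : ℝ, 0 ≤ D ∧ ∀ (ξ₁ ξ₂ : Fermion), 0 < ξ₁.1 → 0 < ξ₂.1 → ∀ (k : R3)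
      (M : Fin 2 ⊕ Fin 2 → Fin 2 ⊕ Fin 2 → ℂ) (t : ℝ), 0 ≤ t →
      (∀ a b, ‖M a b‖ ≤ t * (1 + ‖k‖ ^ 2) ^ (1 / 4 : ℝ)) →
      ‖couplingInt f M k (psi me true ξ₁) (psi me false ξ₂)‖ ≤
        D * t * ((Real.sqrt (2 * ξ₁.2.1 + 3) * lipCoef ξ₁.2.1 * ξ₁.1) *
          (Real.sqrt (2 * ξ₂.2.1 + 3) * lipCoef ξ₂.2.1 * ξ₂.1)) := by
  obtain ⟨D, hD, h⟩ := exists_lintegral_sphere_min_le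
  have hK := hf.nonneg
  have hR : 0 ≤ R := zero_le_one.trans hf.one_le
  refine ⟨16 * 9 * K * R ^ 4 * 4 * D, by positivity, fun ξ₁ ξ₂ h1 h2 k M t ht hM => ?_⟩
  have b1 := lipCoef_nonneg ξ₁.2.1
  have b2 := lipCoef_nonneg ξ₂.2.1
  have hh := enorm_couplingInt_psi_le hme hf h1 h2 (k := k)
    (mul_nonneg ht (by positivity)) hM fun a b κ =>
    (hf.radial_integral (B := 2 * lipCoef ξ₁.2.1 * ξ₁.1)
      (B' := 2 * lipCoef ξ₂.2.1 * ξ₂.1) (by positivity) (by positivity)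
      (radialPart_zero me true ξ₁ a) (radialPart_zero me false ξ₂ b)
      (fun r r' => norm_radialPart_sub_le hme _ h1.le _ r r')
      (fun r r' => norm_radialPart_sub_le hme _ h2.le _ r r') κ).2
  rw [lintegral_const_mul' _ _ ENNReal.ofReal_ne_top] at hh
  set w : ℝ := (1 + ‖k‖ ^ 2) ^ (1 / 4 : ℝ)
  have hw : 0 ≤ w := by positivity
  set Y₁ := Real.sqrt (2 * ξ₁.2.1 + 3)
  set Y₂ := Real.sqrt (2 * ξ₂.2.1 + 3)
  set X : ℝ := 16 * (t * (Y₁ * Y₂)) *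
    (9 * K * R ^ 4 * (2 * lipCoef ξ₁.2.1 * ξ₁.1 * (2 * lipCoef ξ₂.2.1 * ξ₂.1)))
  have hX : 0 ≤ X := by positivity
  have e : ENNReal.ofReal (16 * (t * w * (Y₁ * Y₂))) * ENNReal.ofReal
      (9 * K * R ^ 4 * (2 * lipCoef ξ₁.2.1 * ξ₁.1 * (2 * lipCoef ξ₂.2.1 * ξ₂.1))) =
      ENNReal.ofReal X * ENNReal.ofReal w := by
    rw [← ENNReal.ofReal_mul (by positivity), ← ENNReal.ofReal_mul hX]
    congr 1
    ring
  rw [← mul_assoc, e, mul_assoc] at hh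
  have h3 := hh.trans (mul_le_mul' le_rfl (h k))
  rw [← ENNReal.ofReal_mul hX, ← ofReal_norm] at h3
  refine ((ENNReal.ofReal_le_ofReal_iff (by positivity)).1 h3).trans_eq ?_
  ring

/-- The form of the bound fits the hypotheses on `G`: the term `1` is paired with plain square
integrability, the other with the weighted integral. -/
theorem exists_norm_couplingInt_le (hme : 0 < me) (hf : CutoffBound f R K) :
    ∃ D : ℝ, 0 ≤ D ∧ ∀ (ξ₁ ξ₂ : Fermion), 0 < ξ₁.1 → 0 < ξ₂.1 → ∀ (k : R3)
      (M : Fin 2 ⊕ Fin 2 → Fin 2 ⊕ Fin 2 → ℂ) (t : ℝ), 0 ≤ t →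
      (∀ a b, ‖M a b‖ ≤ t * (1 + ‖k‖ ^ 2) ^ (1 / 4 : ℝ)) →
      ‖couplingInt f M k (psi me true ξ₁) (psi me false ξ₂)‖ ≤
        D * t * (1 + weightA me f ξ₁ * weightA me f ξ₂ * (1 + ‖k‖ ^ 2) ^ (1 / 4 : ℝ)) := by
  obtain ⟨D, hD, h⟩ := exists_norm_couplingInt_le_decay hme hf
  set σ := (sphereMeas univ).toReal
  have hσ : 0 ≤ σ := ENNReal.toReal_nonneg
  refine ⟨4 * σ + 225 * D, by positivity, fun ξ₁ ξ₂ h1 h2 k M t ht hM => ?_⟩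
  set w : ℝ := (1 + ‖k‖ ^ 2) ^ (1 / 4 : ℝ)
  have hw : 0 ≤ w := by positivity
  have w1 := weightA_nonneg me f h1.le
  have w2 := weightA_nonneg me f h2.le
  have b1 := lipCoef_nonneg ξ₁.2.1
  have b2 := lipCoef_nonneg ξ₂.2.1
  set a : ℝ := (Real.sqrt (2 * ξ₁.2.1 + 3) * (1 / 4) ^ ξ₁.2.1) *
    (Real.sqrt (2 * ξ₂.2.1 + 3) * (1 / 4) ^ ξ₂.2.1) with ha_def
  set b : ℝ := (Real.sqrt (2 * ξ₁.2.1 + 3) * lipCoef ξ₁.2.1) *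
    (Real.sqrt (2 * ξ₂.2.1 + 3) * lipCoef ξ₂.2.1) with hb_def
  have ha : 0 ≤ a := by positivity
  have hb : 0 ≤ b := by positivity
  have hab : b * a ≤ 225 := by
    calc b * a = (Real.sqrt (2 * ξ₁.2.1 + 3) * (1 / 4) ^ ξ₁.2.1 *
          (Real.sqrt (2 * ξ₁.2.1 + 3) * lipCoef ξ₁.2.1)) *
          (Real.sqrt (2 * ξ₂.2.1 + 3) * (1 / 4) ^ ξ₂.2.1 *
          (Real.sqrt (2 * ξ₂.2.1 + 3) * lipCoef ξ₂.2.1)) := by rw [ha_def, hb_def]; ring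
      _ ≤ 15 * 15 := mul_le_mul (angular_mul_lipCoef_le ξ₁.2.1) (angular_mul_lipCoef_le ξ₂.2.1)
        (by positivity) (by norm_num)
      _ = 225 := by norm_num
  have hx : 0 < ξ₁.1 * ξ₂.1 := by positivity
  -- Above the threshold `a` the division by `p₁ p₂` in the weighted bound is harmless, with
  -- constant `4 = 16/(2·2)`; below it the oscillatory bound gives `b p₁ p₂ ≤ b a ≤ 225 = 15²`.
  rcases le_total a (ξ₁.1 * ξ₂.1) with hc | hc
  · refine (norm_couplingInt_le_weight hme hf h1 h2 (by positivity) hM).trans ?_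
    calc _ = 4 * σ * t * (weightA me f ξ₁ * weightA me f ξ₂ * w) * (a / (ξ₁.1 * ξ₂.1)) := by
          rw [ha_def]; field_simp; ring
      _ ≤ 4 * σ * t * (weightA me f ξ₁ * weightA me f ξ₂ * w) * 1 :=
          mul_le_mul_of_nonneg_left ((div_le_one hx).2 hc) (by positivity)
      _ ≤ _ := by
          have : 0 ≤ t * (weightA me f ξ₁ * weightA me f ξ₂ * w) := by positivity
          nlinarith [mul_nonneg hσ ht, mul_nonneg hD ht, mul_nonneg hD this]
  · refine (h ξ₁ ξ₂ h1 h2 k M t ht hM).trans ?_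
    calc _ = D * t * (b * (ξ₁.1 * ξ₂.1)) := by rw [hb_def]; ring
      _ ≤ D * t * 225 := mul_le_mul_of_nonneg_left
          ((mul_le_mul_of_nonneg_left hc hb).trans hab) (by positivity)
      _ ≤ _ := by
          have : 0 ≤ t * (weightA me f ξ₁ * weightA me f ξ₂ * w) := by positivity
          nlinarith [mul_nonneg hσ ht, mul_nonneg hσ this, mul_nonneg hD this]

end CouplingBounds

/-! ## Measurability of the coupling functions -/

section CouplingMeasurability

theorem measurable_omega (me : ℝ) : Measurable (omega me) := by unfold omega; fun_prop

theorem continuous_confluentF (n : ℕ) : Continuous (confluentF n) := by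
  unfold confluentF
  refine continuous_const.mul
    (intervalIntegral.continuous_parametric_intervalIntegral_of_continuous' ?_ 0 1)
  unfold Function.uncurry
  fun_prop

theorem measurable_radialTerm (s : ℝ) (γ : QNum) :
    Measurable fun z : ℝ × ℝ => radialTerm s γ z.1 z.2 := by
  unfold radialTerm
  have := (continuous_confluentF γ.gam).measurable
  fun_prop

theorem measurable_radialPrefactor (me : ℝ) (γ : QNum) :
    Measurable fun z : ℝ × ℝ => radialPrefactor me γ z.1 z.2 := by
  unfold radialPrefactor
  have := measurable_omega me
  fun_prop

theorem measurable_gRadial (me : ℝ) (pos : Bool) (γ : QNum) :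
    Measurable fun z : ℝ × ℝ => gRadial me pos γ z.1 z.2 := by
  unfold gRadial
  have h1 := measurable_omega me
  have h2 := measurable_radialTerm 1 γ
  have h3 := measurable_radialTerm (-1) γ
  have h4 := measurable_radialPrefactor me γ
  cases pos <;> simp only [if_true, Bool.false_eq_true, if_false] <;> fun_prop

theorem measurable_fRadial (me : ℝ) (pos : Bool) (γ : QNum) :
    Measurable fun z : ℝ × ℝ => fRadial me pos γ z.1 z.2 := by
  unfold fRadial
  have h1 := measurable_omega me
  have h2 := measurable_radialTerm 1 γ
  have h3 := measurable_radialTerm (-1) γ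
  have h4 := measurable_radialPrefactor me γ
  cases pos <;> simp only [if_true, Bool.false_eq_true, if_false] <;> fun_prop

theorem measurable_psi (me : ℝ) (pos : Bool) (a : Fin 2 ⊕ Fin 2) :
    Measurable fun z : Fermion × R3 => psi me pos z.1 z.2 a := by
  have h : ∀ γ : QNum, Measurable fun z : ℝ × R3 => psi me pos (z.1, γ) z.2 a := fun γ => by
    unfold psi
    have hn : Measurable fun z : ℝ × R3 => (z.1, ‖z.2‖) := by fun_prop
    rcases a with a | a
    · exact (((measurable_gRadial me pos γ).comp hn).const_mul _).mul
        ((measurable_spinorY γ.2.2 γ a).comp measurable_snd)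
    · exact ((measurable_fRadial me pos γ).comp hn).neg.mul
        ((measurable_spinorY (!γ.2.2) γ a).comp measurable_snd)
  have h2 : Measurable fun z : QNum × (ℝ × R3) => psi me pos (z.2.1, z.1) z.2.2 a :=
    measurable_from_prod_countable_right h
  exact h2.comp (f := fun z : Fermion × R3 => (z.1.2, (z.1.1, z.2))) (by fun_prop)

theorem measurable_polVec (mZ : ℝ) (μ : Fin 4) : Measurable (polVec mZ μ) := by
  have h : ∀ l : Fin 3, Measurable fun k : R3 => polVec mZ μ (k, l) := fun l => by
    unfold polVec omega3
    refine Fin.cases ?_ (fun i => ?_) μ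
    · simp only [Fin.cons_zero]
      fun_prop
    · simp only [Fin.cons_succ]
      fun_prop
  exact measurable_from_prod_countable_left h

theorem measurable_omega3 (mZ : ℝ) : Measurable (omega3 mZ) := by unfold omega3; fun_prop

theorem measurable_current (gV : ℝ) (μ : Fin 4) {α : Type*} [MeasurableSpace α] {ψ χ : α → Spinor}
    (hψ : ∀ a, Measurable fun z => ψ z a) (hχ : ∀ a, Measurable fun z => χ z a) :
    Measurable fun z => current gV μ (ψ z) (χ z) := by
  unfold current
  simp only [dotProduct, Matrix.mulVec, Pi.star_apply, ← starRingEnd_apply]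
  refine Finset.measurable_sum _ fun a _ => ((Complex.continuous_conj.measurable.comp (hψ a))).mul
    (Finset.measurable_sum _ fun b _ => (hχ b).const_mul _)

theorem measurable_couplingInt_aux {me gV : ℝ} {f : ℝ → ℝ} (hf : ContinuousOn f (Ici 0))
    {c : Fin 4 → Boson → ℂ} (hc : ∀ μ, Measurable (c μ)) {e : Boson → R3 → ℂ}
    (he : Measurable fun z : Boson × R3 => e z.1 z.2) :
    StronglyMeasurable fun ξ : Fermion × Fermion × Boson => ∫ x : R3, (f ‖x‖ : ℂ) *
      (∑ μ : Fin 4, current gV μ (psi me true ξ.1 x) (psiTilde me ξ.2.1 x) * c μ ξ.2.2) *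
        e ξ.2.2 x := by
  have hcont : Continuous fun x : R3 => f ‖x‖ :=
    hf.comp_continuous continuous_norm fun x => norm_nonneg x
  have hflip : Measurable fun ξ : Fermion => ((ξ.1, ξ.2.flip) : Fermion) :=
    measurable_fst.prodMk ((measurable_of_countable QNum.flip).comp measurable_snd)
  have hm : Measurable fun z : (Fermion × Fermion × Boson) × R3 => (f ‖z.2‖ : ℂ) *
      (∑ μ : Fin 4, current gV μ (psi me true z.1.1 z.2) (psiTilde me z.1.2.1 z.2) * c μ z.1.2.2) *
        e z.1.2.2 z.2 := by
    refine ((Complex.measurable_ofReal.comp (hcont.measurable.comp measurable_snd)).mul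
      (Finset.measurable_sum _ fun μ _ => (measurable_current gV μ (fun a => ?_) fun a => ?_).mul
        ((hc μ).comp (by fun_prop)))).mul (he.comp (f := fun z : (Fermion × Fermion × Boson) × R3 =>
          (z.1.2.2, z.2)) (by fun_prop))
    · exact (measurable_psi me true a).comp
        (f := fun z : (Fermion × Fermion × Boson) × R3 => (z.1.1, z.2)) (by fun_prop)
    · unfold psiTilde
      exact (measurable_psi me false a).comp
        (f := fun z : (Fermion × Fermion × Boson) × R3 => ((z.1.2.1.1, z.1.2.1.2.flip), z.2))
        ((hflip.comp (by fun_prop : Measurable fun z : (Fermion × Fermion × Boson) × R3 =>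
          z.1.2.1)).prodMk measurable_snd)
  exact hm.stronglyMeasurable.integral_prod_right'

theorem stronglyMeasurable_hOne (me mZ gV : ℝ) {f : ℝ → ℝ} (hf : ContinuousOn f (Ici 0)) :
    StronglyMeasurable (kernelFun (hOne me mZ gV f)) := by
  have h1 := measurable_omega3 mZ
  have hc : ∀ μ, Measurable fun ξ : Boson =>
      polVec mZ μ ξ / (Real.sqrt (2 * omega3 mZ ξ.1) : ℂ) := fun μ =>
    (measurable_polVec mZ μ).div (by fun_prop)
  have he : Measurable fun z : Boson × R3 =>
      Complex.exp (((inner ℝ z.1.1 z.2 : ℝ) : ℂ) * Complex.I) := by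
    have : Continuous fun z : Boson × R3 => (inner ℝ z.1.1 z.2 : ℝ) := by fun_prop
    fun_prop
  have := measurable_couplingInt_aux (me := me) (gV := gV) hf hc
    (e := fun ξ x => Complex.exp (((inner ℝ ξ.1 x : ℝ) : ℂ) * Complex.I)) he
  unfold kernelFun hOne
  exact this

theorem stronglyMeasurable_hTwo (me mZ gV : ℝ) {f : ℝ → ℝ} (hf : ContinuousOn f (Ici 0)) :
    StronglyMeasurable (kernelFun (hTwo me mZ gV f)) := by
  have h1 := measurable_omega3 mZ
  have hc : ∀ μ, Measurable fun ξ : Boson =>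
      conj (polVec mZ μ ξ) / (Real.sqrt (2 * omega3 mZ ξ.1) : ℂ) := fun μ =>
    (Complex.continuous_conj.measurable.comp (measurable_polVec mZ μ)).div (by fun_prop)
  have he : Measurable fun z : Boson × R3 =>
      Complex.exp (-((inner ℝ z.1.1 z.2 : ℝ) : ℂ) * Complex.I) := by
    have : Continuous fun z : Boson × R3 => (inner ℝ z.1.1 z.2 : ℝ) := by fun_prop
    fun_prop
  have := measurable_couplingInt_aux (me := me) (gV := gV) hf hc
    (e := fun ξ x => Complex.exp (-((inner ℝ ξ.1 x : ℝ) : ℂ) * Complex.I)) he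
  unfold kernelFun hTwo
  exact this

end CouplingMeasurability

/-! ## Square integrability of the interaction kernels -/

section KernelIntegrability

theorem ae_muF_pos : ∀ᵐ ξ ∂muF, 0 < ξ.1 :=
  Measure.quasiMeasurePreserving_fst.ae (ae_restrict_mem measurableSet_Ioi)

theorem ae_muFFB_pos : ∀ᵐ ξ ∂muFFB, 0 < ξ.1.1 ∧ 0 < ξ.2.1.1 :=
  (Measure.quasiMeasurePreserving_fst.ae ae_muF_pos).and
    (Measure.quasiMeasurePreserving_snd.ae (Measure.quasiMeasurePreserving_fst.ae ae_muF_pos))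

theorem sqrt_one_add_sq_le {mZ : ℝ} (hmZ : 0 < mZ) (x : ℝ) :
    Real.sqrt (1 + x ^ 2) ≤ (1 + 1 / mZ) * Real.sqrt (x ^ 2 + mZ ^ 2) := by
  rw [← Real.sqrt_sq (show 0 ≤ 1 + 1 / mZ by positivity), ← Real.sqrt_mul (by positivity)]
  apply Real.sqrt_le_sqrt
  have h : (1 / mZ) ^ 2 * mZ ^ 2 = 1 := by field_simp
  have : 0 < 1 / mZ := by positivity
  nlinarith [mul_nonneg (by positivity : 0 ≤ (1 / mZ) ^ 2 + 2 * (1 / mZ)) (sq_nonneg x),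
    mul_nonneg this.le (sq_nonneg mZ), sq_nonneg mZ]

/-- `|h G|` is dominated almost everywhere by `D (|G| + √u)`, with `u` a multiple of the weighted
integrand: the square of `(1+|k|²)^(1/4)` is at most a constant times `ω₃(k)`, as `m_Z > 0`. Almost
every momentum is positive, where the weights are nonnegative. -/
theorem memLp_kernel_of_norm_le {me mZ D : ℝ} (hmZ : 0 < mZ) {f : ℝ → ℝ} {h G : Kernel3}
    (hh : StronglyMeasurable (kernelFun h))
    (hb : ∀ ξ : Fermion × Fermion × Boson, 0 < ξ.1.1 → 0 < ξ.2.1.1 → ‖kernelFun h ξ‖ ≤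
      D * (1 + weightA me f ξ.1 * weightA me f ξ.2.1 * (1 + ‖ξ.2.2.1‖ ^ 2) ^ (1 / 4 : ℝ)))
    (hD : 0 ≤ D) (hG : AdmissibleKernel me mZ f G) :
    MemLp (kernelFun fun ξ₁ ξ₂ ξ₃ => h ξ₁ ξ₂ ξ₃ * G ξ₁ ξ₂ ξ₃) 2 muFFB := by
  set u : Fermion × Fermion × Boson → ℝ := fun ξ => (1 + 1 / mZ) *
    (weightA me f ξ.1 ^ 2 * weightA me f ξ.2.1 ^ 2 * Real.sqrt (‖ξ.2.2.1‖ ^ 2 + mZ ^ 2) *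
      ‖G ξ.1 ξ.2.1 ξ.2.2‖ ^ 2) with hu_def
  have hu : Integrable u muFFB := hG.weighted.const_mul _
  have hu0 : ∀ ξ, 0 ≤ u ξ := fun ξ => by simp only [hu_def]; positivity
  have h1 : MemLp (fun ξ => Real.sqrt (u ξ)) 2 muFFB := by
    rw [memLp_two_iff_integrable_sq (Real.continuous_sqrt.comp_aestronglyMeasurable hu.1)]
    simpa only [Real.sq_sqrt (hu0 _)] using hu
  have h2 := (hG.memLp.norm.add h1).const_mul D
  refine h2.mono' (hh.aestronglyMeasurable.mul hG.memLp.1) ?_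
  filter_upwards [ae_muFFB_pos] with ξ hξ
  have hA : 0 ≤ weightA me f ξ.1 := weightA_nonneg me f hξ.1.le
  have hA' : 0 ≤ weightA me f ξ.2.1 := weightA_nonneg me f hξ.2.le
  have hg := norm_nonneg (G ξ.1 ξ.2.1 ξ.2.2)
  have hq : ((1 + ‖ξ.2.2.1‖ ^ 2) ^ (1 / 4 : ℝ)) ^ 2 = Real.sqrt (1 + ‖ξ.2.2.1‖ ^ 2) := by
    rw [← Real.rpow_natCast, ← Real.rpow_mul (by positivity), Real.sqrt_eq_rpow]
    norm_num
  have h3 : weightA me f ξ.1 * weightA me f ξ.2.1 * (1 + ‖ξ.2.2.1‖ ^ 2) ^ (1 / 4 : ℝ) *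
      ‖G ξ.1 ξ.2.1 ξ.2.2‖ ≤ Real.sqrt (u ξ) := by
    refine Real.le_sqrt_of_sq_le ?_
    rw [mul_pow, mul_pow _ ((1 + ‖ξ.2.2.1‖ ^ 2) ^ (1 / 4 : ℝ)), hq, mul_pow]
    have := mul_le_mul_of_nonneg_left (sqrt_one_add_sq_le hmZ ‖ξ.2.2.1‖)
      (show 0 ≤ weightA me f ξ.1 ^ 2 * weightA me f ξ.2.1 ^ 2 * ‖G ξ.1 ξ.2.1 ξ.2.2‖ ^ 2 by
        positivity)
    simp only [hu_def]
    linarith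
  change ‖kernelFun h ξ * G ξ.1 ξ.2.1 ξ.2.2‖ ≤ D * (‖G ξ.1 ξ.2.1 ξ.2.2‖ + Real.sqrt (u ξ))
  rw [norm_mul]
  calc _ ≤ D * (1 + weightA me f ξ.1 * weightA me f ξ.2.1 *
        (1 + ‖ξ.2.2.1‖ ^ 2) ^ (1 / 4 : ℝ)) * ‖G ξ.1 ξ.2.1 ξ.2.2‖ :=
        mul_le_mul_of_nonneg_right (hb ξ hξ.1 hξ.2) hg
    _ = D * (‖G ξ.1 ξ.2.1 ξ.2.2‖ + weightA me f ξ.1 * weightA me f ξ.2.1 *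
        (1 + ‖ξ.2.2.1‖ ^ 2) ^ (1 / 4 : ℝ) * ‖G ξ.1 ξ.2.1 ξ.2.2‖) := by ring
    _ ≤ _ := mul_le_mul_of_nonneg_left (by linarith) hD

variable {me mZ gV C : ℝ} {f : ℝ → ℝ}

theorem exists_norm_couplingMatrix_psi_le (gV : ℝ) (hme : 0 < me) (hf : ContDiffOn ℝ ∞ f (Ici 0))
    (hf_supp : ∃ R : ℝ, ∀ r, R < r → f r = 0) (hC : 0 ≤ C) :
    ∃ D : ℝ, 0 ≤ D ∧ ∀ (ξ₁ ξ₂ : Fermion), 0 < ξ₁.1 → 0 < ξ₂.1 → ∀ (k : R3) (c : Fin 4 → ℂ),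
      (∀ μ, ‖c μ‖ ≤ C * (1 + ‖k‖ ^ 2) ^ (1 / 4 : ℝ)) →
      ‖couplingInt f (couplingMatrix gV c) k (psi me true ξ₁) (psi me false (ξ₂.1, ξ₂.2.flip))‖ ≤
        D * (1 + weightA me f ξ₁ * weightA me f ξ₂ * (1 + ‖k‖ ^ 2) ^ (1 / 4 : ℝ)) := by
  obtain ⟨R, K, hfc⟩ := exists_cutoffBound hf hf_supp
  obtain ⟨D, hD, hb⟩ := exists_norm_couplingInt_le hme hfc
  obtain ⟨N, hN, hn⟩ := exists_norm_couplingMatrix_le gV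
  refine ⟨D * (N * C), by positivity, fun ξ₁ ξ₂ h1 h2 k c hc => ?_⟩
  exact hb ξ₁ (ξ₂.1, ξ₂.2.flip) h1 h2 k _ (N * C) (by positivity) fun a b =>
    (hn c _ hc a b).trans_eq (mul_assoc _ _ _).symm

theorem nonneg_of_polVec_le
    (hC : ∀ (μ : Fin 4) (ξ : Boson), ‖polVec mZ μ ξ / (Real.sqrt (2 * omega3 mZ ξ.1) : ℂ)‖ ≤
      C * (1 + ‖ξ.1‖ ^ 2) ^ (1 / 4 : ℝ)) : 0 ≤ C := by
  simpa using (norm_nonneg _).trans (hC 0 (0, 0))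

theorem memLp_kernel_hOne (hme : 0 < me) (hmZ : 0 < mZ) (hf : ContDiffOn ℝ ∞ f (Ici 0))
    (hf_supp : ∃ R : ℝ, ∀ r, R < r → f r = 0)
    (hC : ∀ (μ : Fin 4) (ξ : Boson), ‖polVec mZ μ ξ / (Real.sqrt (2 * omega3 mZ ξ.1) : ℂ)‖ ≤
      C * (1 + ‖ξ.1‖ ^ 2) ^ (1 / 4 : ℝ))
    {G : Kernel3} (hG : AdmissibleKernel me mZ f G) :
    MemLp (kernelFun fun ξ₁ ξ₂ ξ₃ => hOne me mZ gV f ξ₁ ξ₂ ξ₃ * G ξ₁ ξ₂ ξ₃) 2 muFFB := by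
  obtain ⟨D, hD, hb⟩ :=
    exists_norm_couplingMatrix_psi_le gV hme hf hf_supp (nonneg_of_polVec_le hC)
  refine memLp_kernel_of_norm_le hmZ (stronglyMeasurable_hOne me mZ gV hf.continuousOn)
    (fun ξ h1 h2 => ?_) hD hG
  unfold kernelFun
  rw [hOne_eq_couplingInt]
  exact hb ξ.1 ξ.2.1 h1 h2 ξ.2.2.1 _ fun μ => hC μ ξ.2.2

theorem memLp_kernel_hTwo (hme : 0 < me) (hmZ : 0 < mZ) (hf : ContDiffOn ℝ ∞ f (Ici 0))
    (hf_supp : ∃ R : ℝ, ∀ r, R < r → f r = 0)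
    (hC : ∀ (μ : Fin 4) (ξ : Boson), ‖polVec mZ μ ξ / (Real.sqrt (2 * omega3 mZ ξ.1) : ℂ)‖ ≤
      C * (1 + ‖ξ.1‖ ^ 2) ^ (1 / 4 : ℝ))
    {G : Kernel3} (hG : AdmissibleKernel me mZ f G) :
    MemLp (kernelFun fun ξ₁ ξ₂ ξ₃ => hTwo me mZ gV f ξ₁ ξ₂ ξ₃ * G ξ₁ ξ₂ ξ₃) 2 muFFB := by
  obtain ⟨D, hD, hb⟩ :=
    exists_norm_couplingMatrix_psi_le gV hme hf hf_supp (nonneg_of_polVec_le hC)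
  refine memLp_kernel_of_norm_le hmZ (stronglyMeasurable_hTwo me mZ gV hf.continuousOn)
    (fun ξ h1 h2 => ?_) hD hG
  unfold kernelFun
  rw [hTwo_eq_couplingInt]
  have := hb ξ.1 ξ.2.1 h1 h2 (-ξ.2.2.1)
    (fun μ => conj (polVec mZ μ ξ.2.2) / (Real.sqrt (2 * omega3 mZ ξ.2.2.1) : ℂ)) fun μ => by
      have := hC μ ξ.2.2
      rwa [norm_div, ← RCLike.norm_conj (polVec mZ μ ξ.2.2), ← norm_div,
        ← norm_neg ξ.2.2.1] at this
  rwa [norm_neg] at this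

end KernelIntegrability

end ZDecay

end

/-! ## Self-adjointness

The interaction is bounded relative to the free Hamiltonian with relative bound zero, so the
conclusion holds for every real coupling constant; the smallness of `g₀` is not used. -/

theorem mainTheorem5 (me mZ gV : ℝ) (hme : 0 < me) (hmZ : 0 < mZ)
    (f : ℝ → ℝ) (hf : ContDiffOn ℝ ∞ f (Ici 0)) (hf_supp : ∃ R : ℝ, ∀ r, R < r → f r = 0)
    (C : ℝ)
    (hC : ∀ (μ : Fin 4) (ξ : ZDecay.Boson),
      ‖ZDecay.polVec mZ μ ξ / (Real.sqrt (2 * ZDecay.omega3 mZ ξ.1) : ℂ)‖ ≤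
        C * (1 + ‖ξ.1‖ ^ 2) ^ (1 / 4 : ℝ))
    (G₁ G₂ : ZDecay.Kernel3)
    (hG₁ : ZDecay.AdmissibleKernel me mZ f G₁) (hG₂ : ZDecay.AdmissibleKernel me mZ f G₂)
    (g₀ : ℝ) (hg₀ : 0 < g₀)
    (hsmall : g₀ ^ 2 * (ZDecay.K1sq me f C G₁ + ZDecay.K1sq me f C G₂) * (1 / me ^ 2 + 1) < 1)
    (g : ℝ) (hg : |g| ≤ g₀) :
    IsSelfAdjoint (ZDecay.totalHam me mZ gV f G₁ G₂ g) ∧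
      (ZDecay.totalHam me mZ gV f G₁ G₂ g).domain = (ZDecay.freeHam me mZ).domain ∧
      ∀ D : Submodule ℂ ZDecay.Fock, (ZDecay.freeHam me mZ).HasCore D →
        (ZDecay.totalHam me mZ gV f G₁ G₂ g).HasCore D :=
  ZDecay.selfAdjoint_of_memLp hme hmZ (ZDecay.memLp_kernel_hOne hme hmZ hf hf_supp hC hG₁)
    (ZDecay.memLp_kernel_hTwo hme hmZ hf hf_supp hC hG₂) g
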